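/- **Setting.** Let $n\ge 1$ and let $\mathbb H_n=\mathbb R^{2n}\times\mathbb R$ be the Heisenberg group with points $x=(x_1,\dots,x_{2n},t)$, horizontal vector fields $X_i=\partial_{x_i}-\tfrac{x_{n+i}}2\partial_t$, $X_{n+i}=\partial_{x_{n+i}}+\tfrac{x_i}2\partial_t$ ($1\le i\le n$), homogeneous dimension $Q=2n+2$, and Lebesgue measure. Write $\mathfrak X u=(X_1u,\dots,X_{2n}u)$ for the weak horizontal gradient and $\operatorname{div}_{\mathbb H}G=\sum_{j=1}^{2n}X_jG_j$. Balls $B_R$ are balls of the Carnot–Carathéodory distance $d_{CC}$ (the infimum of lengths of horizontal curves), $B_{R/2}$ is concentric with $B_R$, and $A\subset\subset B$ means that $\overline A$ is compact and contained in $B$. Let $\Omega\subset\mathbb H_n$ be open and bounded and let $\tilde\Omega\subset\subset\Omega$ be open. Let $1<\gamma_1\le\gamma_2<\infty$, $L\ge 0$, and let $p:\Omega\to[\gamma_1,\gamma_2]$ have modulus of continuity $$\omega_p(r)=\sup\{|p(x)-p(y)|:x,y\in\Omega,\ d_{CC}(x,y)\le r\}\le\omega(r)\quad(r>0),$$ where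 $\omega$ is a function on $(0,\infty)$ with $\lim_{r\to0^+}\omega(r)\log(1/r)=L$ (for example $\omega=\omega_p$, if this limit exists). $L^{p(\cdot)}(U)$ is the set of measurable $f$ with $\int_U|f|^{p(x)}\,dx<\infty$, with the Luxemburg norm. $HW^{1,p(\cdot)}(U)$ is the set of $u\in L^{p(\cdot)}(U)$ with $\mathfrak Xu\in L^{p(\cdot)}(U;\mathbb R^{2n})$, normed by $\|u\|_{L^{p(\cdot)}(U)}+\|\mathfrak Xu\|_{L^{p(\cdot)}(U)}$; $HW^{1,p(\cdot)}_0(U)$ is the closure of $C_c^\infty(U)$ in it. A *local weak solution* of $$\operatorname{div}_{\mathbb H}\big(a(x)|\mathfrak Xu|^{p(x)-2}\mathfrak Xu\big)=\operatorname{div}_{\mathbb H}F\quad\text{in }\Omega$$ is a $u\in HW^{1,p(\cdot)}_{\rm loc}(\Omega)$ such that, for every open $U\subset\subset\Omega$ and every $\phi\in HW^{1,p(\cdot)}_0(U)$, $$\int_U\langle a|\mathfrak Xu|^{p(x)-2}\mathfrak Xu,\mathfrak X\phi\rangle=\int_U\langle F,\mathfrak X\phi\rangle.$$ **(1)** Let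 $0<\nu\le\Lambda<\infty$, let $a:\Omega\to[\nu,\Lambda]$ be measurable, let $q>1$ and $F\in L^{q\gamma_1/(\gamma_1-1)}(\Omega;\mathbb R^{2n})$. Let $u$ be a local weak solution of $\operatorname{div}_{\mathbb H}(a|\mathfrak Xu|^{p(x)-2}\mathfrak Xu)=\operatorname{div}_{\mathbb H}F$ in $\Omega$, and put $K_0=\int_{\tilde\Omega}|\mathfrak Xu|^{p(x)}dx+1$. Then there exist a constant $c>0$ depending only on $Q,\gamma_1,\gamma_2,\nu,\Lambda,L$, an exponent $\sigma_0\in(0,1)$ with $1+\sigma_0<q$ depending only on $Q,\gamma_1,\gamma_2,\nu,\Lambda,L,q$, and a radius $0<R_0<1/K_0$ depending only on $Q,\gamma_1,\gamma_2,\nu,\Lambda,L,K_0$ and on the function $\omega$, such that for every ball $B_R\subset\subset\tilde\Omega$ with $0<R\le R_0$, every $\xi\in\mathbb R^{2n}$ and every $0\le\sigma\le\sigma_0$, $$\Big(\fint_{B_{R/2}}|\mathfrak Xu|^{p(x)(1+\sigma)}dx\Big)^{\frac1{1+\sigma}}\le c\Big(\fint_{B_R}|\mathfrak Xu|^{p(x)}dx+1\Big)+c\Big(1+\fint_{B_R}|F-\xi|^{\frac{\gamma_1(1+\sigma)}{\gamma_1-1}}dx\Big)^{\frac1{1+\sigma}}.$$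 **(2)** Let $\gamma=\min\{\gamma_1,\ \gamma_2/(\gamma_2-1),\ 2Q/(Q-1)\}$. Let $w$ be a local weak solution of $\operatorname{div}_{\mathbb H}(|\mathfrak Xw|^{p(x)-2}\mathfrak Xw)=0$ in $\Omega$, and put $K_0=\int_{\tilde\Omega}|\mathfrak Xw|^{p(x)}dx+1$. Then there exist a constant $c_h>0$ and an exponent $\sigma_0\in(0,1)$, both depending only on $Q,\gamma_1,\gamma_2,L$, and a radius $0<R_0<1/K_0$ depending only on $Q,\gamma_1,\gamma_2,L,K_0$ and on the function $\omega$, such that for every ball $B_R\subset\subset\tilde\Omega$ with $0<R\le R_0$, every $0<\sigma\le\sigma_0$ and every $\bar x\in B_R$, $$\max\Big\{\Big(\fint_{B_{R/2}}|\mathfrak Xw|^{p(x)(1+\sigma)}dx\Big)^{\frac1{p(\bar x)(1+\sigma)}},\ \Big(\fint_{B_{R/2}}|\mathfrak Xw|^{p(\bar x)(1+\sigma)}dx\Big)^{\frac1{p(\bar x)(1+\sigma)}}\Big\}\le c_h\Big[1+\Big(\fint_{B_R}|\mathfrak Xw|^{\gamma}dx\Big)^{\frac1\gamma}\Big].$$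 In both parts the left-hand sides are in particular finite. -/

import Mathlib

open MeasureTheory Set Filter Topology
open scoped ENNReal RealInnerProductSpace

noncomputable section

namespace Heisenberg

/-- The horizontal layer `ℝ²ⁿ` with its Euclidean norm. The index `Sum.inl i` is the coordinate `i`
and `Sum.inr i` is the coordinate `n + i`. -/
abbrev Hor (n : ℕ) : Type := EuclideanSpace ℝ (Fin n ⊕ Fin n)

/-- The Heisenberg group, identified with `ℝ²ⁿ × ℝ`; a point is `(z, t)`. The Haar measure is the
Lebesgue measure `volume`. -/
abbrev Heis (n : ℕ) : Type := Hor n × ℝ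

/-- The homogeneous dimension `Q = 2n + 2`. -/
def homDim (n : ℕ) : ℝ := 2 * n + 2

variable {n : ℕ}

/-- The value at `x` of the left invariant horizontal vector field `∑ⱼ vⱼ Xⱼ`, namely
`(v, ½ ∑ᵢ (xᵢ vₙ₊ᵢ - xₙ₊ᵢ vᵢ))`. -/
def lift (x : Heis n) (v : Hor n) : Heis n :=
  (v, (1 / 2) * ∑ i : Fin n, (x.1 (Sum.inl i) * v (Sum.inr i) - x.1 (Sum.inr i) * v (Sum.inl i)))

/-- The horizontal vector fields `Xᵢ = ∂ᵢ - (xₙ₊ᵢ / 2) ∂ₜ` (index `Sum.inl i`) and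
`Xₙ₊ᵢ = ∂ₙ₊ᵢ + (xᵢ / 2) ∂ₜ` (index `Sum.inr i`). -/
def X (j : Fin n ⊕ Fin n) (x : Heis n) : Heis n := lift x (EuclideanSpace.single j 1)

/-- The classical horizontal gradient `(X₁ ψ, …, X₂ₙ ψ)` of a smooth function. -/
def hgrad (ψ : Heis n → ℝ) (x : Heis n) : Hor n := WithLp.toLp 2 fun j => fderiv ℝ ψ x (X j x)

/-- Horizontal curves on `[0, 1]`: absolutely continuous, with almost every velocity horizontal. -/
def IsHorizontalCurve (c : ℝ → Heis n) : Prop :=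
  AbsolutelyContinuousOnInterval c 0 1 ∧
    ∀ᵐ s ∂(volume.restrict (Icc (0 : ℝ) 1)), HasDerivAt c (lift (c s) (deriv c s).1) s

/-- The length of a horizontal curve, for the left invariant metric making `X₁, …, X₂ₙ`
orthonormal. -/
def curveLength (c : ℝ → Heis n) : ℝ≥0∞ := ∫⁻ s in Icc (0 : ℝ) 1, ‖(deriv c s).1‖ₑ

/-- The Carnot-Carathéodory distance. -/
def dCC (x y : Heis n) : ℝ≥0∞ :=
  sInf {l | ∃ c : ℝ → Heis n, IsHorizontalCurve c ∧ c 0 = x ∧ c 1 = y ∧ l = curveLength c}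

/-- Open metric balls of the Carnot-Carathéodory distance. -/
def ball (x : Heis n) (r : ℝ) : Set (Heis n) := {y | dCC x y < ENNReal.ofReal r}

/-- Boundedness in the Carnot-Carathéodory distance. -/
def IsCCBounded (Ω : Set (Heis n)) : Prop :=
  ∃ M : ℝ, ∀ x ∈ Ω, ∀ y ∈ Ω, dCC x y ≤ ENNReal.ofReal M

/-- `U ⊂⊂ Ω`. -/
def CompactlyIn (U Ω : Set (Heis n)) : Prop := IsCompact (closure U) ∧ closure U ⊆ Ω

/-- The modulus of continuity `ω_{p,Ω}(r) = sup {|p x - p y| : x, y ∈ Ω, d(x, y) ≤ r}` of a bounded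
function. -/
def modulus (p : Heis n → ℝ) (Ω : Set (Heis n)) (r : ℝ) : ℝ :=
  sSup {s | ∃ x ∈ Ω, ∃ y ∈ Ω, dCC x y ≤ ENNReal.ofReal r ∧ s = |p x - p y|}

/-- `C_c^∞(U)`. -/
def IsTest (U : Set (Heis n)) (ψ : Heis n → ℝ) : Prop :=
  ContDiff ℝ ((⊤ : ℕ∞) : WithTop ℕ∞) ψ ∧ HasCompactSupport ψ ∧ tsupport ψ ⊆ U

/-- The variable exponent space `L^{p(·)}(U; E)`. -/
def MemLpx {E : Type*} [NormedAddCommGroup E] (U : Set (Heis n)) (p : Heis n → ℝ)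
    (f : Heis n → E) : Prop :=
  AEStronglyMeasurable f (volume.restrict U) ∧ ∫⁻ x in U, ‖f x‖ₑ ^ p x < ∞

/-- The Luxemburg norm of `L^{p(·)}(U; E)`; it is `∞` if no positive number is admissible. -/
def luxNorm {E : Type*} [NormedAddCommGroup E] (U : Set (Heis n)) (p : Heis n → ℝ)
    (f : Heis n → E) : ℝ≥0∞ :=
  sInf {l | 0 < l ∧ l < ∞ ∧ ∫⁻ x in U, (‖f x‖ₑ / l) ^ p x ≤ 1}

/-- `G` is the weak (distributional) horizontal gradient of `u` in `U`. The fields `Xⱼ` are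
divergence free, so the formal adjoint of `Xⱼ` is `-Xⱼ`. -/
def IsWeakHGrad (U : Set (Heis n)) (u : Heis n → ℝ) (G : Heis n → Hor n) : Prop :=
  ∀ ψ, IsTest U ψ → ∀ j, ∫ x in U, u x * hgrad ψ x j = - ∫ x in U, G x j * ψ x

/-- `u ∈ HW^{1,p(·)}(U)` with weak horizontal gradient `G`, for a bounded open set `U`. -/
def MemHW (U : Set (Heis n)) (p u : Heis n → ℝ) (G : Heis n → Hor n) : Prop :=
  MemLpx U p u ∧ MemLpx U p G ∧ IsWeakHGrad U u G

/-- `u ∈ HW^{1,p(·)}_loc(Ω)` with weak horizontal gradient `G`. -/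
def MemHWloc (Ω : Set (Heis n)) (p u : Heis n → ℝ) (G : Heis n → Hor n) : Prop :=
  ∀ U, IsOpen U → CompactlyIn U Ω → MemHW U p u G

/-- `φ ∈ HW^{1,p(·)}_0(U)` with weak horizontal gradient `G`: the closure of `C_c^∞(U)` in
`HW^{1,p(·)}(U)`. -/
def MemHW0 (U : Set (Heis n)) (p φ : Heis n → ℝ) (G : Heis n → Hor n) : Prop :=
  MemHW U p φ G ∧ ∃ ψ : ℕ → Heis n → ℝ, (∀ k, IsTest U (ψ k)) ∧
    Tendsto (fun k => luxNorm U p (fun x => ψ k x - φ x) +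
      luxNorm U p (fun x => hgrad (ψ k) x - G x)) atTop (𝓝 0)

/-- `u`, with weak horizontal gradient `Xu`, is a local weak solution in `Ω` of
`div_ℍ (a(x) |𝔛u|^{p(x)-2} 𝔛u) = div_ℍ F`: it lies in `HW^{1,p(·)}_loc(Ω)` and the weak formulation
holds in every open `U ⊂⊂ Ω`. -/
def IsLocalWeakSolution (Ω : Set (Heis n)) (p a : Heis n → ℝ) (F : Heis n → Hor n)
    (u : Heis n → ℝ) (Xu : Heis n → Hor n) : Prop :=
  MemHWloc Ω p u Xu ∧ ∀ U, IsOpen U → CompactlyIn U Ω → ∀ φ G, MemHW0 U p φ G →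
    ∫ x in U, ⟪(a x * ‖Xu x‖ ^ (p x - 2)) • Xu x, G x⟫ = ∫ x in U, ⟪F x, G x⟫

end Heisenberg

end

/-!
The gradient of a local weak solution satisfies a reverse Hölder inequality on small balls, and
Gehring's lemma turns it into higher integrability.

*Geometry.* All analysis is done with the left invariant distance of the box norm
`max ‖z‖ √|t|`, whose closed balls of radius `r` have measure exactly `κ r ^ Q`. It is comparable to
the Carnot-Carathéodory distance (`boxDist_le_dCC`, `dCC_le_boxDist`): a horizontal curve controls
the box norm directly, and conversely every element is a product of five horizontal ones of
comparable size. The same factorization yields the `L¹` Poincaré inequality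
(`poincareOn_of_isWeakHGrad`), and telescoping along shrinking balls improves it to a Sobolev-Poincaré
inequality with a small gain of integrability (`exists_sobolevPoincare_const`).

*The equation.* The test function is `η ^ m (u - c)` with a cutoff `η`. It is admissible because
mollification converges in variable exponent Sobolev spaces when the exponent is log-Hölder
continuous (`memHW0_of_isWeakHGrad`). Its horizontal gradient has integral zero, which allows one to
replace `F` by `F - ξ`. Young's inequality gives the Caccioppoli inequality
(`exists_caccioppoli_const`). In the Sobolev-Poincaré inequality the exponent is frozen at its supremum
`P` over the ball. Returning to `p` costs a power `N ^ (P - inf p)`, where `N` bounds the average of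
`‖Xu‖ ^ p`; the condition `R < 1 / K₀` makes `N` at most a negative power of the radius, so that the
log-Hölder condition bounds the factor (`exists_variable_sobolevPoincare_const`). The two inequalities
combine to `exists_reverseHolder_const`.

*Gehring's lemma.* It is proved for any metric space whose balls have measure `κ r ^ Q`, on a set `D`
instead of a ball (`gehring`, `gehring_interior`). The weight `dist(x, Dᶜ) ^ Q` makes every stopping
ball lie well inside `D`, and removes the usual iteration over concentric balls. For the homogeneous
equation a weighted supremum of averages is absorbed by interpolation, which allows an arbitrarily
small power of the integrand on the right-hand side (`gehring_lower_exponent`). This reaches the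
exponent `γ ≤ γ₁`; only `1 ≤ γ ≤ γ₁` matters for the argument. The value `p x₁` replaces `p x` at the
price of a slightly larger `σ` and of another factor `R ^ (-δ)`, where `δ` bounds the oscillation.
-/

noncomputable section

namespace Heisenberg

variable {n : ℕ}

/-! ### The group law, the box norm and Lebesgue measure -/

/-- The complex structure `(x, y) ↦ (-y, x)` of the horizontal layer. -/
def rot (n : ℕ) : Hor n →L[ℝ] Hor n :=
  LinearMap.toContinuousLinearMap
    { toFun := fun z => WithLp.toLp 2
        (Sum.elim (fun i => -z (Sum.inr i)) (fun i => z (Sum.inl i)))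
      map_add' := by
        intro x y
        ext (i | i)
        · simp; ring
        · simp
      map_smul' := by
        intro c x
        ext (i | i) <;> simp }

/-- The standard symplectic form of the horizontal layer. -/
def sympl (z v : Hor n) : ℝ := ⟪rot n z, v⟫

theorem sympl_eq_sum (z v : Hor n) :
    sympl z v = ∑ i : Fin n, (z (Sum.inl i) * v (Sum.inr i) - z (Sum.inr i) * v (Sum.inl i)) := by
  simp only [sympl, rot, PiLp.inner_apply, Fintype.sum_sum_type, ← Finset.sum_add_distrib]
  refine Finset.sum_congr rfl fun i _ => ?_
  simp
  ring

theorem norm_rot (z : Hor n) : ‖rot n z‖ = ‖z‖ := by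
  simp only [EuclideanSpace.norm_eq, Fintype.sum_sum_type]
  congr 1
  simp [rot, add_comm]

theorem abs_sympl_le (z v : Hor n) : |sympl z v| ≤ ‖z‖ * ‖v‖ := by
  have := abs_real_inner_le_norm (rot n z) v
  rwa [norm_rot] at this

@[simp] theorem sympl_self (z : Hor n) : sympl z z = 0 := by
  rw [sympl_eq_sum]; refine Finset.sum_eq_zero fun i _ => by ring

theorem sympl_swap (z v : Hor n) : sympl v z = -sympl z v := by
  rw [sympl_eq_sum, sympl_eq_sum, ← Finset.sum_neg_distrib]
  refine Finset.sum_congr rfl fun i _ => by ring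

@[simp] theorem sympl_add_left (z w v : Hor n) : sympl (z + w) v = sympl z v + sympl w v := by
  simp [sympl, inner_add_left]
@[simp] theorem sympl_add_right (z w v : Hor n) : sympl z (w + v) = sympl z w + sympl z v := by
  simp [sympl, inner_add_right]
@[simp] theorem sympl_neg_left (z v : Hor n) : sympl (-z) v = -sympl z v := by simp [sympl]
@[simp] theorem sympl_neg_right (z v : Hor n) : sympl z (-v) = -sympl z v := by simp [sympl]
@[simp] theorem sympl_sub_left (z w v : Hor n) : sympl (z - w) v = sympl z v - sympl w v := by
  simp [sympl, inner_sub_left]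
@[simp] theorem sympl_smul_left (c : ℝ) (z v : Hor n) : sympl (c • z) v = c * sympl z v := by
  simp [sympl, inner_smul_left]
@[simp] theorem sympl_smul_right (c : ℝ) (z v : Hor n) : sympl z (c • v) = c * sympl z v := by
  simp [sympl, inner_smul_right]
@[simp] theorem sympl_zero_left (v : Hor n) : sympl 0 v = 0 := by simp [sympl]
@[simp] theorem sympl_zero_right (v : Hor n) : sympl v 0 = 0 := by simp [sympl]

theorem lift_eq (x : Heis n) (v : Hor n) : lift x v = (v, (1 / 2) * sympl x.1 v) := by
  rw [lift, sympl_eq_sum]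

/-- The group law of the Heisenberg group. The inverse of `x` is `-x`. -/
def op (x y : Heis n) : Heis n := (x.1 + y.1, x.2 + y.2 + (1 / 2) * sympl x.1 y.1)

theorem op_assoc (x y z : Heis n) : op (op x y) z = op x (op y z) := by
  ext1
  · simp [op, add_assoc]
  · simp only [op, sympl_add_left, sympl_add_right]; ring

@[simp] theorem op_zero (x : Heis n) : op x 0 = x := by simp [op]
@[simp] theorem zero_op (x : Heis n) : op 0 x = x := by simp [op]
@[simp] theorem op_neg_self (x : Heis n) : op x (-x) = 0 := by
  ext1 <;> simp [op]
@[simp] theorem neg_op_self (x : Heis n) : op (-x) x = 0 := by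
  ext1 <;> simp [op]
@[simp] theorem op_neg_op (x y : Heis n) : op x (op (-x) y) = y := by simp [← op_assoc]
@[simp] theorem neg_op_op (x y : Heis n) : op (-x) (op x y) = y := by simp [← op_assoc]
theorem neg_op (x y : Heis n) : -op x y = op (-y) (-x) := by
  ext1
  · simp [op, add_comm]
  · simp only [op, Prod.snd_neg, Prod.fst_neg, sympl_neg_left, sympl_neg_right, neg_neg]
    rw [sympl_swap x.1 y.1]; ring

theorem contDiff_sympl {E : Type*} [NormedAddCommGroup E] [NormedSpace ℝ E] {f g : E → Hor n}
    {k : WithTop ℕ∞} (hf : ContDiff ℝ k f) (hg : ContDiff ℝ k g) :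
    ContDiff ℝ k fun x => sympl (f x) (g x) :=
  ContDiff.inner ℝ ((rot n).contDiff.comp hf) hg

theorem contDiff_op {E : Type*} [NormedAddCommGroup E] [NormedSpace ℝ E] {f g : E → Heis n}
    {k : WithTop ℕ∞} (hf : ContDiff ℝ k f) (hg : ContDiff ℝ k g) :
    ContDiff ℝ k fun x => op (f x) (g x) :=
  (hf.fst.add hg.fst).prodMk
    ((hf.snd.add hg.snd).add (contDiff_const.mul (contDiff_sympl hf.fst hg.fst)))

theorem continuous_op : Continuous fun p : Heis n × Heis n => op p.1 p.2 :=
  (contDiff_op (k := 0) contDiff_fst contDiff_snd).continuous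

theorem continuous_op_left (a : Heis n) : Continuous (op a) :=
  continuous_op.comp (continuous_const.prodMk continuous_id)

theorem continuous_op_right (a : Heis n) : Continuous fun y => op y a :=
  continuous_op.comp (continuous_id.prodMk continuous_const)

theorem measurePreserving_op_left (a : Heis n) :
    MeasurePreserving (op a) (volume : Measure (Heis n)) volume := by
  have h := (measurePreserving_add_left (volume : Measure (Hor n)) a.1).skew_product
    (μc := (volume : Measure ℝ)) (μd := volume)
    (g := fun z t => a.2 + t + (1 / 2) * sympl a.1 z)
    (((continuous_const.add continuous_snd).add (continuous_const.mul
      (contDiff_sympl (k := 0) contDiff_const contDiff_fst).continuous)).measurable)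
    (Eventually.of_forall fun z => by
      have : (fun t => a.2 + t + (1 / 2) * sympl a.1 z) =
        fun t => (a.2 + (1 / 2) * sympl a.1 z) + t := by ext; ring
      simpa only [this] using map_add_left_eq_self (volume : Measure ℝ) _)
  exact h

theorem measurePreserving_op_right (a : Heis n) :
    MeasurePreserving (fun y => op y a) (volume : Measure (Heis n)) volume := by
  have h := (measurePreserving_add_right (volume : Measure (Hor n)) a.1).skew_product
    (μc := (volume : Measure ℝ)) (μd := volume)
    (g := fun z t => t + a.2 + (1 / 2) * sympl z a.1)
    (((continuous_snd.add continuous_const).add (continuous_const.mul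
      (contDiff_sympl (k := 0) contDiff_fst contDiff_const).continuous)).measurable)
    (Eventually.of_forall fun z => by
      have : (fun t => t + a.2 + (1 / 2) * sympl z a.1) =
        fun t => (a.2 + (1 / 2) * sympl z a.1) + t := by ext; ring
      simpa only [this] using map_add_left_eq_self (volume : Measure ℝ) _)
  exact h

/-- The box norm `max (|z|, |t|^{1/2})`. It is homogeneous, symmetric and satisfies the triangle
inequality for the group law. -/
def boxNorm (x : Heis n) : ℝ := max ‖x.1‖ (Real.sqrt |x.2|)

theorem boxNorm_nonneg (x : Heis n) : 0 ≤ boxNorm x := le_max_of_le_left (norm_nonneg _)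

theorem boxNorm_le_iff {x : Heis n} {r : ℝ} (hr : 0 ≤ r) :
    boxNorm x ≤ r ↔ ‖x.1‖ ≤ r ∧ |x.2| ≤ r ^ 2 := by
  rw [boxNorm, max_le_iff, Real.sqrt_le_left hr]

theorem norm_fst_le_boxNorm (x : Heis n) : ‖x.1‖ ≤ boxNorm x := le_max_left _ _

theorem abs_snd_le_boxNorm_sq (x : Heis n) : |x.2| ≤ boxNorm x ^ 2 :=
  ((boxNorm_le_iff (boxNorm_nonneg x)).1 le_rfl).2

@[simp] theorem boxNorm_neg (x : Heis n) : boxNorm (-x) = boxNorm x := by simp [boxNorm]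

@[simp] theorem boxNorm_zero : boxNorm (0 : Heis n) = 0 := by simp [boxNorm]

theorem eq_zero_of_boxNorm_eq_zero {x : Heis n} (h : boxNorm x = 0) : x = 0 := by
  have := (boxNorm_le_iff le_rfl).1 h.le
  ext1
  · simpa using this.1
  · simpa using this.2

theorem boxNorm_op_le (x y : Heis n) : boxNorm (op x y) ≤ boxNorm x + boxNorm y := by
  have hx := boxNorm_nonneg x
  have hy := boxNorm_nonneg y
  rw [boxNorm_le_iff (by positivity)]
  have h1 := norm_fst_le_boxNorm x
  have h2 := norm_fst_le_boxNorm y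
  refine ⟨(norm_add_le _ _).trans (add_le_add h1 h2), ?_⟩
  have h3 := abs_snd_le_boxNorm_sq x
  have h4 := abs_snd_le_boxNorm_sq y
  have h5 : |sympl x.1 y.1| ≤ boxNorm x * boxNorm y :=
    (abs_sympl_le _ _).trans (mul_le_mul h1 h2 (norm_nonneg _) hx)
  calc |(op x y).2| ≤ |x.2| + |y.2| + (1 / 2) * |sympl x.1 y.1| := by
        refine (abs_add_le _ _).trans (add_le_add (abs_add_le _ _) ?_)
        rw [abs_mul]; norm_num
    _ ≤ (boxNorm x + boxNorm y) ^ 2 := by nlinarith [mul_nonneg hx hy]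

theorem continuous_boxNorm : Continuous (boxNorm : Heis n → ℝ) := by
  unfold boxNorm; fun_prop

/-- The Heisenberg group as a metric space, with the left invariant distance
`boxNorm (x⁻¹ y)`. -/
def BoxHeis (n : ℕ) : Type := Heis n

instance : TopologicalSpace (BoxHeis n) := inferInstanceAs (TopologicalSpace (Heis n))
instance : MeasureSpace (BoxHeis n) := inferInstanceAs (MeasureSpace (Heis n))
instance : BorelSpace (BoxHeis n) := inferInstanceAs (BorelSpace (Heis n))
instance : SecondCountableTopology (BoxHeis n) :=
  inferInstanceAs (SecondCountableTopology (Heis n))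
instance : SFinite (volume : Measure (BoxHeis n)) :=
  inferInstanceAs (SFinite (volume : Measure (Heis n)))

theorem norm_le_of_boxNorm_le {x : Heis n} {r : ℝ} (hr : 0 ≤ r) (hr1 : r ≤ 1)
    (h : boxNorm x ≤ r) : ‖x‖ ≤ r := by
  obtain ⟨h1, h2⟩ := (boxNorm_le_iff hr).1 h
  refine max_le h1 (h2.trans ?_)
  nlinarith

/-- The left invariant distance associated with the box norm. -/
def boxDist (x y : Heis n) : ℝ := boxNorm (op (-x) y)

@[simp] theorem boxDist_self (x : Heis n) : boxDist x x = 0 := by simp [boxDist]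

theorem boxDist_nonneg (x y : Heis n) : 0 ≤ boxDist x y := boxNorm_nonneg _

theorem eq_of_boxDist_eq_zero (x y : Heis n) (h : boxDist x y = 0) : x = y := by
  have h2 : op x (op (-x) y) = x := by rw [eq_zero_of_boxNorm_eq_zero h, op_zero]
  simpa using h2.symm

theorem boxDist_comm (x y : Heis n) : boxDist x y = boxDist y x := by
  rw [boxDist, ← boxNorm_neg, neg_op, neg_neg]; rfl

theorem boxDist_triangle (x y z : Heis n) : boxDist x z ≤ boxDist x y + boxDist y z := by
  have : op (-x) z = op (op (-x) y) (op (-y) z) := by rw [op_assoc, op_neg_op]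
  rw [boxDist, this]; exact boxNorm_op_le _ _

theorem isOpen_iff_boxDist (s : Set (Heis n)) :
    IsOpen s ↔ ∀ x ∈ s, ∃ ε > 0, ∀ y, boxDist x y < ε → y ∈ s := by
  constructor
  · intro hs x hx
    have h0 : op x ⁻¹' s ∈ 𝓝 (0 : Heis n) :=
      (hs.preimage (continuous_op_left x)).mem_nhds (by simpa using hx)
    obtain ⟨δ, hδ, h⟩ := Metric.mem_nhds_iff.1 h0
    refine ⟨min (δ / 2) 1, by positivity, fun y hy => ?_⟩
    have h1 : ‖op (-x) y‖ ≤ min (δ / 2) 1 :=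
      norm_le_of_boxNorm_le (by positivity) (min_le_right _ _) hy.le
    have h2 : op (-x) y ∈ op x ⁻¹' s := h (by
      rw [mem_ball_zero_iff]
      exact lt_of_le_of_lt (h1.trans (min_le_left _ _)) (by linarith))
    simpa using h2
  · intro H
    refine isOpen_iff_mem_nhds.2 fun x hx => ?_
    obtain ⟨ε, hε, h⟩ := H x hx
    have hc : Continuous (boxDist x) := continuous_boxNorm.comp (continuous_op_left _)
    have : {y | boxDist x y < ε} ∈ 𝓝 x :=
      (isOpen_lt hc continuous_const).mem_nhds (by simpa [boxDist] using hε)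
    exact mem_of_superset this h

instance : MetricSpace (BoxHeis n) :=
  MetricSpace.ofDistTopology (α := BoxHeis n) (fun x y => boxDist (n := n) x y)
    (boxDist_self (n := n)) boxDist_comm boxDist_triangle isOpen_iff_boxDist
    (eq_of_boxDist_eq_zero (n := n))

theorem dist_boxHeis (x y : BoxHeis n) : dist x y = boxDist (n := n) x y := rfl

/-- Closed balls of the box distance. -/
def cball (x : Heis n) (r : ℝ) : Set (Heis n) := {y | boxDist x y ≤ r}

theorem closedBall_boxHeis (x : BoxHeis n) (r : ℝ) :
    Metric.closedBall x r = (cball (n := n) x r) := by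
  ext y
  rw [Metric.mem_closedBall, dist_comm]; rfl

theorem mem_cball_iff {x y : Heis n} {r : ℝ} : y ∈ cball x r ↔ boxDist x y ≤ r := Iff.rfl

theorem cball_mono {x : Heis n} {r s : ℝ} (h : r ≤ s) : cball x r ⊆ cball x s :=
  fun _ hz => le_trans hz h

theorem mem_cball_self {x : Heis n} {r : ℝ} (h : 0 ≤ r) : x ∈ cball x r := by
  simpa [cball, boxDist] using h

/-- The volume of the unit ball of the box norm. -/
def unitVol (n : ℕ) : ℝ := (volume (Metric.ball (0 : Hor n) 1)).toReal * 2

theorem unitVol_pos (n : ℕ) : 0 < unitVol n := by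
  refine mul_pos (ENNReal.toReal_pos ?_ ?_) two_pos
  · exact (Metric.measure_ball_pos volume _ one_pos).ne'
  · exact measure_ball_lt_top.ne

theorem isClosed_cball (x : Heis n) (r : ℝ) : IsClosed (cball x r) :=
  isClosed_le (continuous_boxNorm.comp (continuous_op_left (-x))) continuous_const

theorem cball_zero_eq {r : ℝ} (hr : 0 ≤ r) :
    cball (0 : Heis n) r = Metric.closedBall 0 r ×ˢ Metric.closedBall 0 (r ^ 2) := by
  ext y
  simp [cball, boxDist, boxNorm_le_iff hr]

theorem cball_eq_preimage (x : Heis n) (r : ℝ) : cball x r = op (-x) ⁻¹' cball 0 r := by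
  ext y
  simp [cball, boxDist]

theorem isCompact_cball (x : Heis n) (r : ℝ) : IsCompact (cball x r) := by
  rcases lt_or_ge r 0 with hr | hr
  · convert isCompact_empty
    ext y
    simpa [cball] using hr.trans_le (boxDist_nonneg x y)
  have : cball x r = op x '' cball 0 r := by
    rw [cball_eq_preimage]
    ext y
    constructor
    · intro h; exact ⟨_, h, by simp⟩
    · rintro ⟨z, hz, rfl⟩; simpa using hz
  rw [this, cball_zero_eq hr]
  exact ((isCompact_closedBall _ _).prod (isCompact_closedBall _ _)).image (continuous_op_left x)

theorem homDim_pos (n : ℕ) : 0 < homDim n := by unfold homDim; positivity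

theorem volume_cball (x : Heis n) {r : ℝ} (hr : 0 < r) :
    volume (cball x r) = ENNReal.ofReal (unitVol n * r ^ homDim n) := by
  rw [cball_eq_preimage, (measurePreserving_op_left (-x)).measure_preimage
    (isClosed_cball _ _).measurableSet.nullMeasurableSet, cball_zero_eq hr.le]
  rw [Measure.volume_eq_prod, Measure.prod_prod, Real.volume_closedBall,
    Measure.addHaar_closedBall _ _ hr.le, unitVol, ← ENNReal.ofReal_toReal (a := volume
      (Metric.ball (0 : Hor n) 1)) measure_ball_lt_top.ne, ← ENNReal.ofReal_mul (by positivity),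
    ← ENNReal.ofReal_mul (by positivity)]
  congr 1
  have : r ^ homDim n = r ^ (2 * n) * r ^ 2 := by
    rw [homDim, ← pow_add, ← Real.rpow_natCast]; push_cast; rfl
  rw [this]
  have h2 : Module.finrank ℝ (Hor n) = 2 * n := by simp; ring
  rw [h2, ENNReal.toReal_ofReal ENNReal.toReal_nonneg]; ring

theorem volume_closedBall_boxHeis (x : BoxHeis n) {r : ℝ} (hr : 0 < r) :
    volume (Metric.closedBall x r) = ENNReal.ofReal (unitVol n * r ^ homDim n) := by
  rw [closedBall_boxHeis]; exact volume_cball x hr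

variable {n : ℕ}

/-! ### Comparison of the Carnot-Carathéodory and the box distance -/

theorem _root_.LipschitzWith.comp_absolutelyContinuousOnInterval {X Y : Type*}
    [PseudoMetricSpace X] [PseudoMetricSpace Y] {K : NNReal} {g : X → Y} (hg : LipschitzWith K g)
    {f : ℝ → X} {a b : ℝ} (hf : AbsolutelyContinuousOnInterval f a b) :
    AbsolutelyContinuousOnInterval (fun s => g (f s)) a b := by
  have h := (Tendsto.const_mul (K : ℝ) hf)
  rw [mul_zero] at h
  refine squeeze_zero (fun E => Finset.sum_nonneg fun _ _ => dist_nonneg) (fun E => ?_) h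
  rw [Finset.mul_sum]
  exact Finset.sum_le_sum fun i _ => hg.dist_le_mul _ _

/-- Precomposition of an absolutely continuous function with a monotone Lipschitz map. -/
theorem _root_.AbsolutelyContinuousOnInterval.comp_monotone {X : Type*} [PseudoMetricSpace X]
    {f : ℝ → X} {a b c d : ℝ} (hf : AbsolutelyContinuousOnInterval f a b) {θ : ℝ → ℝ}
    {K : NNReal} (hθ : LipschitzWith K θ) (hm : Monotone θ)
    (hmap : ∀ s ∈ uIcc c d, θ s ∈ uIcc a b) :
    AbsolutelyContinuousOnInterval (fun s => f (θ s)) c d := by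
  rw [absolutelyContinuousOnInterval_iff] at hf ⊢
  intro ε hε
  obtain ⟨δ, hδ, h⟩ := hf ε hε
  refine ⟨δ / (K + 1), by positivity, fun E hE hE' => ?_⟩
  refine h (E.1, fun i => (θ (E.2 i).1, θ (E.2 i).2)) ⟨fun i hi => ?_, ?_⟩ ?_
  · exact ⟨hmap _ (hE.1 i hi).1, hmap _ (hE.1 i hi).2⟩
  · intro i hi j hj hij
    have hd := hE.2 hi hj hij
    simp only [Function.onFun, uIoc, ← hm.map_min, ← hm.map_max] at hd ⊢
    rw [Set.disjoint_left]
    intro u hu hu'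
    rw [Set.mem_Ioc] at hu hu'
    have h1 : min (E.2 i).1 (E.2 i).2 < max (E.2 i).1 (E.2 i).2 :=
      hm.reflect_lt (hu.1.trans_le hu.2)
    have h2 : min (E.2 j).1 (E.2 j).2 < max (E.2 j).1 (E.2 j).2 :=
      hm.reflect_lt (hu'.1.trans_le hu'.2)
    have h3 : min (E.2 i).1 (E.2 i).2 < max (E.2 j).1 (E.2 j).2 :=
      hm.reflect_lt (hu.1.trans_le hu'.2)
    have h4 : min (E.2 j).1 (E.2 j).2 < max (E.2 i).1 (E.2 i).2 :=
      hm.reflect_lt (hu'.1.trans_le hu.2)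
    rw [Set.disjoint_left] at hd
    exact hd (a := min (max (E.2 i).1 (E.2 i).2) (max (E.2 j).1 (E.2 j).2))
      ⟨lt_min h1 h3, min_le_left _ _⟩ ⟨lt_min h4 h2, min_le_right _ _⟩
  · calc ∑ i ∈ Finset.range E.1, dist (θ (E.2 i).1) (θ (E.2 i).2)
        ≤ ∑ i ∈ Finset.range E.1, K * dist (E.2 i).1 (E.2 i).2 :=
          Finset.sum_le_sum fun i _ => hθ.dist_le_mul _ _
      _ = K * ∑ i ∈ Finset.range E.1, dist (E.2 i).1 (E.2 i).2 := by rw [Finset.mul_sum]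
      _ ≤ (K + 1) * ∑ i ∈ Finset.range E.1, dist (E.2 i).1 (E.2 i).2 := by
          refine mul_le_mul_of_nonneg_right (by linarith)
            (Finset.sum_nonneg fun _ _ => dist_nonneg)
      _ < δ := by rwa [lt_div_iff₀' (by positivity)] at hE'

theorem abs_sub_le_of_deriv_le_speed {c : ℝ → Heis n} (hfin : curveLength c ≠ ∞)
    {f : ℝ → ℝ} (hf : AbsolutelyContinuousOnInterval f 0 1) {M : ℝ} (hM : 0 ≤ M)
    (h : ∀ᵐ s ∂(volume.restrict (Icc (0 : ℝ) 1)), |deriv f s| ≤ M * ‖(deriv c s).1‖)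
    {b : ℝ} (hb : b ∈ Icc (0 : ℝ) 1) : |f b - f 0| ≤ M * (curveLength c).toReal := by
  have hf' : AbsolutelyContinuousOnInterval f 0 b := hf.mono (by
    rw [uIcc_of_le hb.1, uIcc_of_le zero_le_one]; exact Icc_subset_Icc_right hb.2)
  have h1 : ‖f b - f 0‖ₑ ≤ ENNReal.ofReal M * curveLength c := by
    rw [← hf'.integral_deriv_eq_sub, intervalIntegral.integral_of_le hb.1]
    refine (enorm_integral_le_lintegral_enorm _).trans ?_
    calc ∫⁻ s in Ioc 0 b, ‖deriv f s‖ₑ ≤ ∫⁻ s in Icc 0 1, ‖deriv f s‖ₑ :=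
          lintegral_mono_set (Ioc_subset_Icc_self.trans (Icc_subset_Icc_right hb.2))
      _ ≤ ∫⁻ s in Icc (0 : ℝ) 1, ENNReal.ofReal M * ‖(deriv c s).1‖ₑ := by
          refine lintegral_mono_ae (h.mono fun s hs => ?_)
          rw [← ofReal_norm, ← ofReal_norm, ← ENNReal.ofReal_mul hM]
          exact ENNReal.ofReal_le_ofReal hs
      _ = ENNReal.ofReal M * curveLength c := lintegral_const_mul' _ _ ENNReal.ofReal_ne_top
  have h2 := ENNReal.toReal_mono (ENNReal.mul_ne_top ENNReal.ofReal_ne_top hfin) h1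
  rwa [ENNReal.toReal_mul, ENNReal.toReal_ofReal hM, toReal_enorm, Real.norm_eq_abs] at h2

/-- A horizontal curve of length `l` stays horizontally within `l` of its starting point, and the
vertical coordinate of the translated curve then grows at speed at most `l / 2`. -/
theorem boxDist_le_curveLength {c : ℝ → Heis n} (hc : IsHorizontalCurve c) :
    ENNReal.ofReal (boxDist (c 0) (c 1)) ≤ curveLength c := by
  by_cases hfin : curveLength c = ∞
  · simp [hfin]
  set l := (curveLength c).toReal with hl
  have hl0 : 0 ≤ l := ENNReal.toReal_nonneg
  have hz : ∀ b ∈ Icc (0 : ℝ) 1, ‖(c b).1 - (c 0).1‖ ≤ l := by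
    intro b hb
    set e := (c b).1 - (c 0).1 with he
    set Lf : Heis n →L[ℝ] ℝ := (innerSL ℝ e).comp (ContinuousLinearMap.fst ℝ (Hor n) ℝ) with hLf
    have hLa : ∀ x, Lf x = ⟪e, x.1⟫ := fun x => by simp [hLf]
    have h1 := abs_sub_le_of_deriv_le_speed hfin
      (Lf.lipschitz.comp_absolutelyContinuousOnInterval hc.1) (norm_nonneg e)
      (hc.2.mono fun s hs => by
        have h2 : HasDerivAt (fun s => Lf (c s)) (Lf (lift (c s) (deriv c s).1)) s :=
          Lf.hasFDerivAt.comp_hasDerivAt s hs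
        rw [h2.deriv, hLa]
        exact abs_real_inner_le_norm _ _) hb
    rw [hLa, hLa, ← inner_sub_right, ← he, real_inner_self_eq_norm_sq, abs_of_nonneg (sq_nonneg _),
      sq, ← hl] at h1
    rcases (norm_nonneg e).eq_or_lt with h0 | h0
    · rw [← h0]; exact hl0
    · exact le_of_mul_le_mul_left h1 h0
  have ht : |(op (-c 0) (c 1)).2| ≤ l ^ 2 := by
    set Lf : Heis n →L[ℝ] ℝ := ContinuousLinearMap.snd ℝ (Hor n) ℝ -
      (1 / 2 : ℝ) • (innerSL ℝ (rot n (c 0).1)).comp (ContinuousLinearMap.fst ℝ (Hor n) ℝ) with hLf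
    have hLa : ∀ x, Lf x = x.2 - (1 / 2) * sympl (c 0).1 x.1 := fun x => by simp [hLf, sympl]
    have h1 := abs_sub_le_of_deriv_le_speed hfin
      (Lf.lipschitz.comp_absolutelyContinuousOnInterval hc.1) (M := l) hl0
      ((hc.2.and (ae_restrict_mem measurableSet_Icc)).mono fun s hs => by
        have h2 : HasDerivAt (fun s => Lf (c s)) (Lf (lift (c s) (deriv c s).1)) s :=
          Lf.hasFDerivAt.comp_hasDerivAt s hs.1
        rw [h2.deriv, hLa, lift_eq]
        have h3 := abs_sympl_le ((c s).1 - (c 0).1) (deriv c s).1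
        have h4 : (1 / 2) * sympl (c s).1 (deriv c s).1 - (1 / 2) * sympl (c 0).1 (deriv c s).1 =
          (1 / 2) * sympl ((c s).1 - (c 0).1) (deriv c s).1 := by simp; ring
        have h5 := mul_le_mul_of_nonneg_right (hz s hs.2) (norm_nonneg (deriv c s).1)
        dsimp only
        rw [h4, abs_mul, abs_of_pos (by norm_num : (0 : ℝ) < 1 / 2)]
        have h6 := abs_nonneg (sympl ((c s).1 - (c 0).1) (deriv c s).1)
        linarith) (right_mem_Icc.2 zero_le_one)
    have h2 : (op (-c 0) (c 1)).2 = Lf (c 1) - Lf (c 0) := by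
      rw [hLa, hLa]; simp [op]; ring
    rw [h2, sq]; exact h1
  refine ENNReal.ofReal_le_of_le_toReal ((boxNorm_le_iff hl0).2 ⟨?_, ht⟩)
  have := hz 1 (right_mem_Icc.2 zero_le_one)
  rwa [sub_eq_neg_add] at this

theorem boxDist_le_dCC (x y : Heis n) : ENNReal.ofReal (boxDist x y) ≤ dCC x y := by
  refine le_sInf ?_
  rintro l ⟨c, hc, rfl, rfl, rfl⟩
  exact boxDist_le_curveLength hc

theorem op_horizontal (x : Heis n) (s : ℝ) (v : Hor n) : op x (s • v, 0) = x + s • lift x v := by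
  rw [lift_eq]
  ext1
  · simp [op]
  · simp [op]; ring

theorem lift_op_horizontal (x : Heis n) (s : ℝ) (v : Hor n) :
    lift (op x (s • v, 0)) v = lift x v := by
  simp [lift_eq, op]

theorem dCC_op_horizontal_le (x : Heis n) (v : Hor n) : dCC x (op x (v, 0)) ≤ ‖v‖ₑ := by
  have hd : ∀ s : ℝ, HasDerivAt (fun s : ℝ => x + s • lift x v) (lift x v) s := fun s => by
    simpa using ((hasDerivAt_id s).smul_const (lift x v)).const_add x
  refine sInf_le ⟨fun s => x + s • lift x v, ⟨?_, ?_⟩, by simp, ?_, ?_⟩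
  · refine ContDiffOn.absolutelyContinuousOnInterval (ContDiff.contDiffOn ?_)
    fun_prop
  · refine Eventually.of_forall fun s => ?_
    rw [(hd s).deriv]
    have h1 : (lift x v).1 = v := rfl
    have h2 : lift (x + s • lift x v) v = lift x v := by
      rw [← op_horizontal, lift_op_horizontal]
    rw [h1, h2]
    exact hd s
  · simpa using (op_horizontal x 1 v).symm
  · have : ∀ s, (deriv (fun s : ℝ => x + s • lift x v) s).1 = v := fun s => by
      rw [(hd s).deriv]; rfl
    simp only [curveLength, this]
    simp

theorem quasiMeasurePreserving_affine {a : ℝ} (ha : a ≠ 0) (b : ℝ) :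
    Measure.QuasiMeasurePreserving (fun s : ℝ => a * s + b) volume volume := by
  refine ⟨by fun_prop, Measure.AbsolutelyContinuous.mk fun N hN h0 => ?_⟩
  rw [Measure.map_apply (by fun_prop) hN]
  have : (fun s : ℝ => a * s + b) ⁻¹' N = (a * ·) ⁻¹' ((· + b) ⁻¹' N) := rfl
  rw [this, Real.volume_preimage_mul_left ha, measure_preimage_add_right, h0, mul_zero]

/-- A piece of a concatenation of curves: on an interval mapped affinely to `[0, 1]`, with speed
doubled. -/
theorem horizontal_piece {c d : ℝ → Heis n} (hc : IsHorizontalCurve c) {b : ℝ}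
    {u v : ℝ} (hmap : ∀ s ∈ Ioo u v, 2 * s + b ∈ Icc (0 : ℝ) 1)
    (hd : ∀ s ∈ Ioo u v, d s = c (2 * s + b)) :
    (∀ᵐ s ∂(volume.restrict (Ioo u v)), HasDerivAt d (lift (d s) (deriv d s).1) s) ∧
      ∫⁻ s in Ioo u v, ‖(deriv d s).1‖ₑ ≤ curveLength c := by
  have h1 : ∀ᵐ s ∂(volume : Measure ℝ), 2 * s + b ∈ Icc (0 : ℝ) 1 →
      HasDerivAt c (lift (c (2 * s + b)) (deriv c (2 * s + b)).1) (2 * s + b) :=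
    (quasiMeasurePreserving_affine two_ne_zero b).ae
      (p := fun t => t ∈ Icc (0 : ℝ) 1 → HasDerivAt c (lift (c t) (deriv c t).1) t)
      ((ae_restrict_iff' measurableSet_Icc).1 hc.2)
  have h2 : ∀ᵐ s ∂(volume : Measure ℝ), s ∈ Ioo u v →
      HasDerivAt d ((2 : ℝ) • lift (c (2 * s + b)) (deriv c (2 * s + b)).1) s := by
    filter_upwards [h1] with s hs hsuv
    have h3 : HasDerivAt (fun s : ℝ => 2 * s + b) 2 s := by
      simpa using ((hasDerivAt_id s).const_mul 2).add_const b
    have h4 := HasDerivAt.scomp s (hs (hmap s hsuv)) h3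
    refine h4.congr_of_eventuallyEq ?_
    filter_upwards [isOpen_Ioo.mem_nhds hsuv] with s' hs' using hd s' hs'
  constructor
  · rw [ae_restrict_iff' measurableSet_Ioo]
    filter_upwards [h2] with s hs hsuv
    convert hs hsuv using 1
    rw [(hs hsuv).deriv, hd s hsuv]
    simp [lift_eq]
  · calc ∫⁻ s in Ioo u v, ‖(deriv d s).1‖ₑ
        = ∫⁻ s in Ioo u v, ENNReal.ofReal |2| * ‖(deriv c (2 * s + b)).1‖ₑ := by
          refine setLIntegral_congr_fun_ae measurableSet_Ioo ?_
          filter_upwards [h2] with s hs hsuv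
          rw [(hs hsuv).deriv]
          simp [lift_eq, enorm_smul, ← ofReal_norm (2 : ℝ)]
      _ = ∫⁻ s in (fun s : ℝ => 2 * s + b) '' Ioo u v, ‖(deriv c s).1‖ₑ := by
          rw [lintegral_image_eq_lintegral_abs_deriv_mul measurableSet_Ioo (f' := fun _ => 2)]
          · intro s _
            simpa using (((hasDerivAt_id s).const_mul 2).add_const b).hasDerivWithinAt
          · intro s _ t _ h
            simpa using h
      _ ≤ curveLength c := lintegral_mono_set (by rintro _ ⟨s, hs, rfl⟩; exact hmap s hs)

/-- Near-optimal curves are concatenated after reparametrization on `[0, 1/2]` and `[1/2, 1]`. The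
concatenation is written as `c₁ (min (2 s) 1) + c₂ (max (2 s - 1) 0) - y`, whose absolute continuity
needs no gluing. -/
theorem dCC_triangle (x y z : Heis n) : dCC x z ≤ dCC x y + dCC y z := by
  refine ENNReal.le_of_forall_pos_le_add fun ε hε hfin => ?_
  have hx : dCC x y < dCC x y + ε / 2 :=
    ENNReal.lt_add_right (ne_top_of_le_ne_top hfin.ne le_self_add) (by simpa using hε.ne')
  have hy : dCC y z < dCC y z + ε / 2 :=
    ENNReal.lt_add_right (ne_top_of_le_ne_top hfin.ne le_add_self) (by simpa using hε.ne')
  obtain ⟨_, ⟨c₁, h₁, rfl, hc₁, rfl⟩, hl₁⟩ := sInf_lt_iff.1 hx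
  obtain ⟨_, ⟨c₂, h₂, hc₂, rfl, rfl⟩, hl₂⟩ := sInf_lt_iff.1 hy
  set d : ℝ → Heis n := fun s => c₁ (min (2 * s + 0) 1) + c₂ (max (2 * s + (-1)) 0) - y with hd
  have hd1 : ∀ s ∈ Ioo (0 : ℝ) (1 / 2), d s = c₁ (2 * s + 0) := fun s hs => by
    simp only [hd]
    rw [min_eq_left (by linarith [hs.2]), max_eq_right (by linarith [hs.2]), hc₂]; abel
  have hd2 : ∀ s ∈ Ioo (1 / 2 : ℝ) 1, d s = c₂ (2 * s + (-1)) := fun s hs => by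
    simp only [hd]
    rw [min_eq_right (by linarith [hs.1]), max_eq_left (by linarith [hs.1]), hc₁]; abel
  have p1 := horizontal_piece h₁
    (fun s hs => ⟨by linarith [hs.1], by linarith [hs.2]⟩) hd1
  have p2 := horizontal_piece h₂
    (fun s hs => ⟨by linarith [hs.1], by linarith [hs.2]⟩) hd2
  -- the endpoints and the gluing point are negligible
  have hae : Icc (0 : ℝ) 1 =ᵐ[volume] (Ioo 0 (1 / 2) ∪ Ioo (1 / 2) 1 : Set ℝ) := by
    refine (ae_eq_set).2 ⟨measure_mono_null (t := {0, 1 / 2, 1}) ?_ ?_, ?_⟩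
    · intro s hs
      simp only [Set.mem_sdiff, mem_Icc, mem_union, mem_Ioo, not_or, not_and, not_lt] at hs
      obtain ⟨⟨h0, h1⟩, h2, h3⟩ := hs
      simp only [mem_insert_iff, mem_singleton_iff]
      by_contra! hne
      have h4 := h2 (lt_of_le_of_ne h0 (Ne.symm hne.1))
      have h5 := h3 (lt_of_le_of_ne h4 (Ne.symm hne.2.1))
      exact hne.2.2 (le_antisymm h1 h5)
    · exact (Set.toFinite _).measure_zero _
    · rw [Set.sdiff_eq_empty.2]
      · simp
      · rintro s (hs | hs)
        · exact ⟨hs.1.le, by linarith [hs.2]⟩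
        · exact ⟨by linarith [hs.1], hs.2.le⟩
  have hdisj : Disjoint (Ioo (0 : ℝ) (1 / 2)) (Ioo (1 / 2) 1) := by
    rw [Set.disjoint_left]; intro s hs hs'; linarith [hs.2, hs'.1]
  have hhor : IsHorizontalCurve d := by
    constructor
    · have l1 : LipschitzWith 2 (fun s : ℝ => min (2 * s + 0) 1) := by
        refine LipschitzWith.min_const (LipschitzWith.of_dist_le_mul fun s t => ?_) 1
        simp [Real.dist_eq, ← mul_sub, abs_mul]
      have l2 : LipschitzWith 2 (fun s : ℝ => max (2 * s + (-1)) 0) := by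
        refine LipschitzWith.max_const (LipschitzWith.of_dist_le_mul fun s t => ?_) 0
        simp [Real.dist_eq, ← mul_sub, abs_mul]
      have a1 := h₁.1.comp_monotone (c := 0) (d := 1) l1
        (fun s t hst => min_le_min_right _ (by linarith)) (fun s hs => by
          rw [uIcc_of_le zero_le_one] at hs ⊢
          exact ⟨le_min (by linarith [hs.1]) zero_le_one, min_le_right _ _⟩)
      have a2 := h₂.1.comp_monotone (c := 0) (d := 1) l2
        (fun s t hst => max_le_max_right _ (by linarith)) (fun s hs => by
          rw [uIcc_of_le zero_le_one] at hs ⊢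
          exact ⟨le_max_right _ _, max_le (by linarith [hs.2]) zero_le_one⟩)
      refine (a1.add a2).sub ?_
      exact ContDiffOn.absolutelyContinuousOnInterval (contDiff_const (c := y)).contDiffOn
    · rw [Measure.restrict_congr_set hae, ae_restrict_union_eq]
      exact ⟨p1.1, p2.1⟩
  calc dCC (c₁ 0) (c₂ 1) ≤ curveLength d := by
        refine sInf_le ⟨d, hhor, ?_, ?_, rfl⟩
        · simp [hd, hc₂]
        · simp only [hd]
          rw [min_eq_right (by norm_num), max_eq_left (by norm_num), hc₁]
          norm_num
    _ ≤ curveLength c₁ + curveLength c₂ := by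
        rw [curveLength, Measure.restrict_congr_set hae,
          lintegral_union measurableSet_Ioo hdisj]
        exact add_le_add p1.2 p2.2
    _ ≤ (dCC (c₁ 0) y + ε / 2) + (dCC y (c₂ 1) + ε / 2) := add_le_add hl₁.le hl₂.le
    _ = dCC (c₁ 0) y + dCC y (c₂ 1) + ε := by
        rw [add_add_add_comm, ENNReal.add_halves]

/-- Every element is a product of five horizontal ones of comparable size: the central direction
is reached by a commutator. -/
theorem exists_horizontal_factors (hn : 1 ≤ n) (h : Heis n) :
    ∃ v₀ v₁ v₂ v₃ v₄ : Hor n, ‖v₀‖ ≤ boxNorm h ∧ ‖v₁‖ ≤ boxNorm h ∧ ‖v₂‖ ≤ boxNorm h ∧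
      ‖v₃‖ ≤ boxNorm h ∧ ‖v₄‖ ≤ boxNorm h ∧
      h = op (op (op (op (v₀, 0) (v₁, 0)) (v₂, 0)) (v₃, 0)) (v₄, 0) := by
  obtain ⟨a, b, ha, hb, hab⟩ : ∃ a b : ℝ, |a| ≤ boxNorm h ∧ |b| ≤ boxNorm h ∧ a * b = h.2 := by
    have hs : Real.sqrt |h.2| ≤ boxNorm h := le_max_right _ _
    rcases le_total 0 h.2 with h0 | h0
    · refine ⟨Real.sqrt |h.2|, Real.sqrt |h.2|, ?_, ?_, ?_⟩
      · rwa [abs_of_nonneg (Real.sqrt_nonneg _)]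
      · rwa [abs_of_nonneg (Real.sqrt_nonneg _)]
      · rw [Real.mul_self_sqrt (abs_nonneg _), abs_of_nonneg h0]
    · refine ⟨-Real.sqrt |h.2|, Real.sqrt |h.2|, ?_, ?_, ?_⟩
      · rwa [abs_neg, abs_of_nonneg (Real.sqrt_nonneg _)]
      · rwa [abs_of_nonneg (Real.sqrt_nonneg _)]
      · rw [neg_mul, Real.mul_self_sqrt (abs_nonneg _), abs_of_nonpos h0, neg_neg]
  set e : Hor n := EuclideanSpace.single (Sum.inl ⟨0, hn⟩) 1 with he
  set f : Hor n := EuclideanSpace.single (Sum.inr ⟨0, hn⟩) 1 with hf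
  have hef : sympl e f = 1 := by
    rw [sympl_eq_sum, he, hf]
    simp
  have hfe : sympl f e = -1 := by rw [sympl_swap, hef]
  have hne : ‖e‖ = 1 := by simp [he]
  have hnf : ‖f‖ = 1 := by simp [hf]
  refine ⟨h.1, a • e, b • f, -(a • e), -(b • f), norm_fst_le_boxNorm h, ?_, ?_, ?_, ?_, ?_⟩
  · simpa [norm_smul, hne] using ha
  · simpa [norm_smul, hnf] using hb
  · simpa [norm_smul, hne] using ha
  · simpa [norm_smul, hnf] using hb
  · ext1
    · simp only [op]; abel
    · simp [op, hef, hfe, ← hab]; ring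

theorem dCC_op_le (hn : 1 ≤ n) (x h : Heis n) :
    dCC x (op x h) ≤ ENNReal.ofReal (5 * boxNorm h) := by
  obtain ⟨v₀, v₁, v₂, v₃, v₄, h0, h1, h2, h3, h4, e⟩ := exists_horizontal_factors hn h
  have key : ∀ (y : Heis n) (v : Hor n), ‖v‖ ≤ boxNorm h →
      dCC x (op x (op y (v, 0))) ≤ dCC x (op x y) + ENNReal.ofReal (boxNorm h) := by
    intro y v hv
    refine (dCC_triangle x (op x y) _).trans (add_le_add le_rfl ?_)
    rw [← op_assoc]
    refine (dCC_op_horizontal_le _ _).trans ?_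
    rw [← ofReal_norm]
    exact ENNReal.ofReal_le_ofReal hv
  have k0 : dCC x (op x (v₀, 0)) ≤ ENNReal.ofReal (boxNorm h) := by
    refine (dCC_op_horizontal_le _ _).trans ?_
    rw [← ofReal_norm]
    exact ENNReal.ofReal_le_ofReal h0
  have hb := boxNorm_nonneg h
  calc dCC x (op x h) = dCC x (op x (op (op (op (op (v₀, 0) (v₁, 0)) (v₂, 0)) (v₃, 0)) (v₄, 0))) := by
        rw [← e]
    _ ≤ ENNReal.ofReal (boxNorm h) + ENNReal.ofReal (boxNorm h) + ENNReal.ofReal (boxNorm h) +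
          ENNReal.ofReal (boxNorm h) + ENNReal.ofReal (boxNorm h) := by
        refine (key _ _ h4).trans (add_le_add ?_ le_rfl)
        refine (key _ _ h3).trans (add_le_add ?_ le_rfl)
        refine (key _ _ h2).trans (add_le_add ?_ le_rfl)
        exact (key _ _ h1).trans (add_le_add k0 le_rfl)
    _ = ENNReal.ofReal (5 * boxNorm h) := by
        rw [← ENNReal.ofReal_add hb hb, ← ENNReal.ofReal_add (by positivity) hb,
          ← ENNReal.ofReal_add (by positivity) hb, ← ENNReal.ofReal_add (by positivity) hb]
        congr 1; ring

theorem dCC_le_boxDist (hn : 1 ≤ n) (x y : Heis n) :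
    dCC x y ≤ ENNReal.ofReal (5 * boxDist x y) := by
  have := dCC_op_le hn x (op (-x) y)
  rwa [op_neg_op] at this

/-! ### From level set inequalities to higher integrability -/

theorem ennreal_le_two_mul_of_le_half_add {a b : ℝ≥0∞} (ha : a ≠ ∞) (h : a ≤ a / 2 + b) :
    a ≤ 2 * b := by
  have h1 : a / 2 + a / 2 ≤ a / 2 + b := by rwa [ENNReal.add_halves]
  have h2 : a / 2 ≤ b := (ENNReal.add_le_add_iff_left (ENNReal.div_ne_top ha two_ne_zero)).1 h1
  calc a = 2 * (a / 2) := by rw [ENNReal.mul_div_cancel two_ne_zero ENNReal.ofNat_ne_top]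
    _ ≤ 2 * b := by gcongr

theorem lintegral_Ioo_rpow {b : ℝ} (hb : 0 < b) {m : ℝ} (hm : 0 ≤ m) :
    ∫⁻ t in Ioo 0 m, ENNReal.ofReal (b * t ^ (b - 1)) = ENNReal.ofReal m ^ b := by
  rw [ENNReal.ofReal_rpow_of_nonneg hm hb.le, restrict_Ioo_eq_restrict_Ioc]
  have hint : IntervalIntegrable (fun t : ℝ => b * t ^ (b - 1)) volume 0 m :=
    (intervalIntegral.intervalIntegrable_rpow' (by linarith)).const_mul b
  rw [← ofReal_integral_eq_lintegral_ofReal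
    ((intervalIntegrable_iff_integrableOn_Ioc_of_le hm).1 hint)]
  · rw [← intervalIntegral.integral_of_le hm, intervalIntegral.integral_const_mul,
      integral_rpow (Or.inl (by linarith))]
    congr 1
    rw [sub_add_cancel, Real.zero_rpow hb.ne']
    field_simp
    simp
  · filter_upwards [ae_restrict_mem measurableSet_Ioc] with t ht
    exact mul_nonneg hb.le (Real.rpow_nonneg ht.1.le _)

theorem lintegral_rpow_sublevel_le {b c : ℝ} (hb : 0 < b) (hc : 0 < c) {S : Set ℝ}
    (hS : S ⊆ Ioi 0) (y : ℝ≥0∞) :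
    ∫⁻ t in S ∩ {t | ENNReal.ofReal (c * t) < y}, ENNReal.ofReal (b * t ^ (b - 1)) ≤
      (y / ENNReal.ofReal c) ^ b := by
  by_cases hy : y = ∞
  · rw [hy, ENNReal.top_div_of_ne_top ENNReal.ofReal_ne_top, ENNReal.top_rpow_of_pos hb]
    exact le_top
  have hsub : S ∩ {t | ENNReal.ofReal (c * t) < y} ⊆ Ioo 0 (y.toReal / c) := by
    rintro t ⟨ht, ht'⟩
    have h0 : 0 < t := hS ht
    refine ⟨h0, ?_⟩
    rw [lt_div_iff₀ hc, mul_comm]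
    exact (ENNReal.ofReal_lt_iff_lt_toReal (by positivity) hy).1 ht'
  refine (lintegral_mono_set hsub).trans_eq ?_
  rw [lintegral_Ioo_rpow hb (by positivity), ENNReal.ofReal_div_of_pos hc, ENNReal.ofReal_toReal hy]

/-- A power of a truncation, split at the level `t₀` below which no level set inequality is known. -/
theorem rpow_min_le_add_lintegral {σ : ℝ} (hσ : 0 < σ) {t₀ T : ℝ} (ht₀ : 0 ≤ t₀) (hT : 0 ≤ T)
    (y : ℝ≥0∞) :
    (min y (ENNReal.ofReal T)) ^ σ ≤ ENNReal.ofReal t₀ ^ σ +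
      ∫⁻ t in Ioo t₀ T ∩ {t | ENNReal.ofReal (1 * t) < y}, ENNReal.ofReal (σ * t ^ (σ - 1)) := by
  set m := (min y (ENNReal.ofReal T)).toReal with hm
  have hfin : min y (ENNReal.ofReal T) ≠ ∞ :=
    ne_top_of_le_ne_top ENNReal.ofReal_ne_top (min_le_right _ _)
  have hmy : ENNReal.ofReal m = min y (ENNReal.ofReal T) := ENNReal.ofReal_toReal hfin
  have hm0 : 0 ≤ m := ENNReal.toReal_nonneg
  have hmT : m ≤ T := by
    have : ENNReal.ofReal m ≤ ENNReal.ofReal T := hmy ▸ min_le_right _ _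
    exact (ENNReal.ofReal_le_ofReal_iff hT).1 this
  rw [← hmy, ← lintegral_Ioo_rpow hσ hm0, ← lintegral_Ioo_rpow hσ ht₀,
    restrict_Ioo_eq_restrict_Ioc (a := 0) (b := t₀)]
  refine (lintegral_mono_set (t := Ioc 0 t₀ ∪ (Ioo t₀ T ∩ {t | ENNReal.ofReal (1 * t) < y})) ?_).trans
    (lintegral_union_le _ _ _)
  intro t ht
  rcases le_or_gt t t₀ with h | h
  · exact Or.inl ⟨ht.1, h⟩
  · refine Or.inr ⟨⟨h, ht.2.trans_le hmT⟩, ?_⟩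
    have h1 : ENNReal.ofReal t < ENNReal.ofReal m :=
      (ENNReal.ofReal_lt_ofReal_iff (ht.1.trans ht.2)).2 ht.2
    rw [hmy] at h1
    simpa using h1.trans_le (min_le_left _ _)

/-- The layer cake identity: Tonelli for `F` integrated over the superlevel sets of `H`. -/
theorem lintegral_superlevel_swap {X : Type*} [MeasurableSpace X] {μ : Measure X} [SFinite μ]
    {F H : X → ℝ≥0∞} (hF : Measurable F) (hH : Measurable H) {φ : ℝ → ℝ≥0∞} (hφ : Measurable φ)
    (S : Set ℝ) (c : ℝ) :
    ∫⁻ t in S, φ t * ∫⁻ x in {x | ENNReal.ofReal (c * t) < H x}, F x ∂μ =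
      ∫⁻ x, (F x * ∫⁻ t in S ∩ {t | ENNReal.ofReal (c * t) < H x}, φ t) ∂μ := by
  have hm : MeasurableSet {p : ℝ × X | ENNReal.ofReal (c * p.1) < H p.2} :=
    measurableSet_lt (by fun_prop) (by fun_prop)
  have e1 : ∀ t, φ t * ∫⁻ x in {x | ENNReal.ofReal (c * t) < H x}, F x ∂μ =
      ∫⁻ x, {p : ℝ × X | ENNReal.ofReal (c * p.1) < H p.2}.indicator
        (fun p => φ p.1 * F p.2) (t, x) ∂μ := fun t => by
    rw [← lintegral_const_mul _ hF, ← lintegral_indicator (measurableSet_lt measurable_const hH)]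
    rfl
  have e2 : ∀ x, F x * ∫⁻ t in S ∩ {t | ENNReal.ofReal (c * t) < H x}, φ t =
      ∫⁻ t in S, {p : ℝ × X | ENNReal.ofReal (c * p.1) < H p.2}.indicator
        (fun p => φ p.1 * F p.2) (t, x) := fun x => by
    have hm' : MeasurableSet {t : ℝ | ENNReal.ofReal (c * t) < H x} :=
      measurableSet_lt (by fun_prop) measurable_const
    rw [inter_comm, ← Measure.restrict_restrict hm', ← lintegral_const_mul _ hφ,
      ← lintegral_indicator hm']
    refine lintegral_congr fun t => ?_
    simp only [indicator, mem_ofPred_eq, mul_comm]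
  simp_rw [e1, e2]
  exact lintegral_lintegral_swap
    ((hφ.comp measurable_fst).mul (hF.comp measurable_snd) |>.indicator hm).aemeasurable

/-- A reverse Hölder inequality on superlevel sets self-improves the integrability. The proof
integrates the hypothesis against `σ t^{σ-1}` over `(t₀, T)`; truncating at `T` makes the term to be
absorbed finite. -/
theorem lintegral_rpow_le_of_superlevel {X : Type*} [MeasurableSpace X] {μ : Measure X} [SFinite μ]
    {H K : X → ℝ≥0∞} (hH : Measurable H) (hK : Measurable K) (hfin : ∫⁻ x, H x ∂μ ≠ ∞)
    {θ c C σ t₀ : ℝ} (hθ : 1 < θ) (hc : 0 < c) (hc1 : c ≤ 1) (hC : 0 ≤ C) (hσ : 0 < σ) (hσ1 : σ ≤ 1)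
    (ht₀ : 0 ≤ t₀) (hsmall : C * (c⁻¹ ^ 2 * (σ / (1 - 1 / θ))) ≤ 1 / 2)
    (hlevel : ∀ t, t₀ < t → ∫⁻ x in {x | ENNReal.ofReal t < H x}, H x ∂μ ≤
      ENNReal.ofReal C * (ENNReal.ofReal (t ^ (1 - 1 / θ)) *
        ∫⁻ x in {x | ENNReal.ofReal (c * t) < H x}, H x ^ (1 / θ) ∂μ +
        ∫⁻ x in {x | ENNReal.ofReal (c * t) < K x}, K x ∂μ)) :
    ∫⁻ x, H x ^ (1 + σ) ∂μ ≤ 2 * (ENNReal.ofReal t₀ ^ σ * ∫⁻ x, H x ∂μ +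
      ENNReal.ofReal (C * c⁻¹) * ∫⁻ x, K x ^ (1 + σ) ∂μ) := by
  have hθ1 : 0 < 1 - 1 / θ := by
    rw [sub_pos, div_lt_one (by linarith)]; exact hθ
  set b := σ + (1 - 1 / θ) with hb
  have hb0 : 0 < b := by positivity
  have hci : ENNReal.ofReal c⁻¹ = (ENNReal.ofReal c)⁻¹ := ENNReal.ofReal_inv_of_pos hc
  have hc0 : ENNReal.ofReal c ≠ 0 := by simpa using hc
  have h1ci : 1 ≤ ENNReal.ofReal c⁻¹ := by
    rw [ENNReal.one_le_ofReal]; exact (one_le_inv₀ hc).2 hc1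
  have hmeasφ : ∀ a e : ℝ, Measurable fun t : ℝ => ENNReal.ofReal (a * t ^ e) := fun a e => by
    fun_prop
  set Z : ℝ → ℝ≥0∞ := fun T => ∫⁻ x, H x * (min (H x) (ENNReal.ofReal T)) ^ σ ∂μ with hZ
  have hZfin : ∀ T, Z T ≠ ∞ := fun T => by
    refine ne_top_of_le_ne_top (b := ENNReal.ofReal T ^ σ * ∫⁻ x, H x ∂μ)
      (ENNReal.mul_ne_top (ENNReal.rpow_ne_top_of_nonneg hσ.le ENNReal.ofReal_ne_top) hfin) ?_
    rw [← lintegral_const_mul _ hH]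
    refine lintegral_mono fun x => ?_
    rw [mul_comm]
    gcongr
    exact min_le_right _ _
  set RHS := ENNReal.ofReal t₀ ^ σ * ∫⁻ x, H x ∂μ +
      ENNReal.ofReal (C * c⁻¹) * ∫⁻ x, K x ^ (1 + σ) ∂μ with hRHS
  have hZle : ∀ T, 0 ≤ T → Z T ≤ 2 * RHS := by
    intro T hT
    refine ennreal_le_two_mul_of_le_half_add (hZfin T) ?_
    -- the layer cake formula for `Z T`; the levels below `t₀` give the first term
    have s1 : Z T ≤ ENNReal.ofReal t₀ ^ σ * ∫⁻ x, H x ∂μ +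
        ∫⁻ t in Ioo t₀ T, ENNReal.ofReal (σ * t ^ (σ - 1)) *
          ∫⁻ x in {x | ENNReal.ofReal (1 * t) < H x}, H x ∂μ := by
      rw [lintegral_superlevel_swap hH hH (hmeasφ _ _) _,
        ← lintegral_const_mul _ hH, ← lintegral_add_left (hH.const_mul _)]
      refine lintegral_mono fun x => ?_
      rw [mul_comm (ENNReal.ofReal t₀ ^ σ), ← mul_add]
      gcongr
      exact rpow_min_le_add_lintegral hσ ht₀ hT _
    have s2 : ∫⁻ t in Ioo t₀ T, ENNReal.ofReal (σ * t ^ (σ - 1)) *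
          ∫⁻ x in {x | ENNReal.ofReal (1 * t) < H x}, H x ∂μ ≤
        ENNReal.ofReal C * (∫⁻ t in Ioo t₀ T, ENNReal.ofReal (σ / b * (b * t ^ (b - 1))) *
          ∫⁻ x in {x | ENNReal.ofReal (c * t) < H x}, H x ^ (1 / θ) ∂μ) +
        ENNReal.ofReal C * (∫⁻ t in Ioo t₀ T, ENNReal.ofReal (σ * t ^ (σ - 1)) *
          ∫⁻ x in {x | ENNReal.ofReal (c * t) < K x}, K x ∂μ) := by
      rw [← mul_add, ← lintegral_add_left', ← lintegral_const_mul']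
      · refine lintegral_mono_ae ?_
        filter_upwards [ae_restrict_mem measurableSet_Ioo] with t ht
        have ht0 : 0 < t := ht₀.trans_lt ht.1
        rw [one_mul]
        calc ENNReal.ofReal (σ * t ^ (σ - 1)) * ∫⁻ x in {x | ENNReal.ofReal t < H x}, H x ∂μ
            ≤ ENNReal.ofReal (σ * t ^ (σ - 1)) * (ENNReal.ofReal C * (ENNReal.ofReal (t ^ (1 - 1 / θ)) *
              ∫⁻ x in {x | ENNReal.ofReal (c * t) < H x}, H x ^ (1 / θ) ∂μ +
              ∫⁻ x in {x | ENNReal.ofReal (c * t) < K x}, K x ∂μ)) := by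
              gcongr; exact hlevel t ht.1
          _ = _ := by
              have : σ / b * (b * t ^ (b - 1)) = σ * t ^ (σ - 1) * t ^ (1 - 1 / θ) := by
                rw [mul_assoc σ, ← Real.rpow_add ht0, ← mul_assoc, div_mul_cancel₀ _ hb0.ne', hb]
                congr 2; ring
              rw [this, ENNReal.ofReal_mul (p := σ * t ^ (σ - 1)) (by positivity)]
              ring
      · exact ENNReal.ofReal_ne_top
      · refine AEMeasurable.mul (by fun_prop) ?_
        have : Antitone fun t : ℝ => ∫⁻ x in {x | ENNReal.ofReal (c * t) < H x}, H x ^ (1 / θ) ∂μ := by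
          intro s t hst
          refine lintegral_mono_set fun x hx => ?_
          exact lt_of_le_of_lt (ENNReal.ofReal_le_ofReal (by gcongr)) hx
        exact this.measurable.aemeasurable
    have s3 : ∫⁻ t in Ioo t₀ T, ENNReal.ofReal (σ * t ^ (σ - 1)) *
          ∫⁻ x in {x | ENNReal.ofReal (c * t) < K x}, K x ∂μ ≤
        ENNReal.ofReal c⁻¹ * ∫⁻ x, K x ^ (1 + σ) ∂μ := by
      rw [lintegral_superlevel_swap hK hK (hmeasφ _ _) _,
        ← lintegral_const_mul _ (by fun_prop)]
      refine lintegral_mono fun x => ?_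
      calc K x * _ ≤ K x * (K x / ENNReal.ofReal c) ^ σ := by
            gcongr
            exact lintegral_rpow_sublevel_le hσ hc (fun t ht => ht₀.trans_lt ht.1) _
        _ = ENNReal.ofReal c⁻¹ ^ σ * K x ^ (1 + σ) := by
            rw [div_eq_mul_inv, ← hci, ENNReal.mul_rpow_of_nonneg _ _ hσ.le,
              ENNReal.rpow_add_of_nonneg _ _ zero_le_one hσ.le, ENNReal.rpow_one]
            ring
        _ ≤ ENNReal.ofReal c⁻¹ * K x ^ (1 + σ) := by
            gcongr
            calc ENNReal.ofReal c⁻¹ ^ σ ≤ ENNReal.ofReal c⁻¹ ^ (1 : ℝ) :=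
                  ENNReal.rpow_le_rpow_of_exponent_le h1ci hσ1
              _ = _ := ENNReal.rpow_one _
    -- the factor `t ^ (1 - 1 / θ)` restores the missing power of `H`; since `t < T` and `c ≤ 1`, only
    -- the truncation `mn` enters
    have s4 : ∫⁻ t in Ioo t₀ T, ENNReal.ofReal (σ / b * (b * t ^ (b - 1))) *
          ∫⁻ x in {x | ENNReal.ofReal (c * t) < H x}, H x ^ (1 / θ) ∂μ ≤
        ENNReal.ofReal (c⁻¹ ^ 2 * (σ / (1 - 1 / θ))) * Z T := by
      rw [lintegral_superlevel_swap (by fun_prop) hH (by fun_prop) _, hZ]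
      dsimp only
      rw [← lintegral_const_mul _ (by fun_prop)]
      refine lintegral_mono fun x => ?_
      set y := H x
      set mn := min y (ENNReal.ofReal T) with hmn
      have u1 : ∫⁻ t in Ioo t₀ T ∩ {t | ENNReal.ofReal (c * t) < y},
          ENNReal.ofReal (σ / b * (b * t ^ (b - 1))) ≤
          ENNReal.ofReal (σ / b) * (mn / ENNReal.ofReal c) ^ b := by
        simp_rw [ENNReal.ofReal_mul (show (0 : ℝ) ≤ σ / b by positivity)]
        rw [lintegral_const_mul' _ _ ENNReal.ofReal_ne_top]
        gcongr
        refine le_trans (lintegral_mono_set ?_)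
          (lintegral_rpow_sublevel_le hb0 hc (S := Ioo t₀ T) (fun t ht => ht₀.trans_lt ht.1) mn)
        rintro t ⟨ht, ht'⟩
        refine ⟨ht, (lt_min ht' ?_ : ENNReal.ofReal (c * t) < min y (ENNReal.ofReal T))⟩
        have ht0 : 0 < t := ht₀.trans_lt ht.1
        refine (ENNReal.ofReal_lt_ofReal_iff (ht0.trans ht.2)).2 (lt_of_le_of_lt ?_ ht.2)
        exact mul_le_of_le_one_left ht0.le hc1
      calc y ^ (1 / θ) * _ ≤ y ^ (1 / θ) * (ENNReal.ofReal (σ / b) * (mn / ENNReal.ofReal c) ^ b) := by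
            gcongr
        _ = ENNReal.ofReal (σ / b) * (y ^ (1 / θ) * (ENNReal.ofReal c⁻¹ ^ b *
              (mn ^ σ * mn ^ (1 - 1 / θ)))) := by
            rw [div_eq_mul_inv mn, ← hci, ENNReal.mul_rpow_of_nonneg _ _ hb0.le, hb,
              ENNReal.rpow_add_of_nonneg (x := mn) _ _ hσ.le hθ1.le]
            ring
        _ ≤ ENNReal.ofReal (σ / (1 - 1 / θ)) * (y ^ (1 / θ) * (ENNReal.ofReal c⁻¹ ^ (2 : ℝ) *
              (mn ^ σ * y ^ (1 - 1 / θ)))) := by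
            gcongr
            · linarith
            · have : 0 < 1 / θ := by positivity
              linarith
            · exact min_le_left _ _
        _ = ENNReal.ofReal (c⁻¹ ^ 2 * (σ / (1 - 1 / θ))) * (y * mn ^ σ) := by
            have : y = y ^ (1 / θ) * y ^ (1 - 1 / θ) := by
              rw [← ENNReal.rpow_add_of_nonneg _ _ (by positivity) hθ1.le]; simp
            rw [ENNReal.ofReal_mul (by positivity), ENNReal.ofReal_pow (by positivity)]
            conv_rhs => rw [this]
            norm_cast
            ring
    calc Z T ≤ _ := s1
      _ ≤ ENNReal.ofReal t₀ ^ σ * ∫⁻ x, H x ∂μ + (ENNReal.ofReal C *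
          (ENNReal.ofReal (c⁻¹ ^ 2 * (σ / (1 - 1 / θ))) * Z T) +
          ENNReal.ofReal C * (ENNReal.ofReal c⁻¹ * ∫⁻ x, K x ^ (1 + σ) ∂μ)) := by
          refine add_le_add le_rfl (s2.trans ?_)
          gcongr
      _ ≤ Z T / 2 + RHS := by
          rw [hRHS, ENNReal.ofReal_mul hC, ← mul_assoc, ← ENNReal.ofReal_mul hC]
          have : ENNReal.ofReal (C * (c⁻¹ ^ 2 * (σ / (1 - 1 / θ)))) * Z T ≤ Z T / 2 := by
            rw [div_eq_mul_inv (Z T), mul_comm (Z T)]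
            refine mul_le_mul' ?_ le_rfl
            refine (ENNReal.ofReal_le_ofReal hsmall).trans_eq ?_
            rw [one_div, ENNReal.ofReal_inv_of_pos two_pos]; simp
          calc _ = ENNReal.ofReal (C * (c⁻¹ ^ 2 * (σ / (1 - 1 / θ)))) * Z T +
                (ENNReal.ofReal t₀ ^ σ * ∫⁻ x, H x ∂μ +
                ENNReal.ofReal C * ENNReal.ofReal c⁻¹ * ∫⁻ x, K x ^ (1 + σ) ∂μ) := by ring
            _ ≤ _ := add_le_add this le_rfl
  -- monotone convergence removes the truncation
  have hsup : ∫⁻ x, H x ^ (1 + σ) ∂μ = ⨆ N : ℕ, Z N := by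
    rw [hZ]
    dsimp only
    rw [← lintegral_iSup (fun N => by fun_prop)]
    · refine lintegral_congr fun x => ?_
      apply le_antisymm
      · rw [ENNReal.rpow_add_of_nonneg _ _ zero_le_one hσ.le, ENNReal.rpow_one]
        have hmono : Monotone fun N : ℕ => min (H x) (ENNReal.ofReal N) := fun a b hab =>
          min_le_min_left _ (ENNReal.ofReal_le_ofReal (by exact_mod_cast hab))
        have ht1 : Tendsto (fun N : ℕ => min (H x) (ENNReal.ofReal N)) atTop (𝓝 (min (H x) ∞)) :=
          tendsto_const_nhds.min (by
            simpa using ENNReal.tendsto_nat_nhds_top)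
        have ht2 : Tendsto (fun N : ℕ => H x * min (H x) (ENNReal.ofReal N) ^ σ) atTop
            (𝓝 (H x * H x ^ σ)) := by
          refine ENNReal.Tendsto.const_mul ?_ ?_
          · rw [min_top_right] at ht1
            exact ((ENNReal.continuous_rpow_const (y := σ)).tendsto _).comp ht1
          · by_cases h0 : H x = 0
            · right; simp [h0]
            · left
              intro h
              rcases ENNReal.rpow_eq_zero_iff.1 h with h | h
              · exact h0 h.1
              · linarith [h.2]
        exact le_of_tendsto' ht2 fun N => le_iSup (fun N : ℕ => H x * min (H x) (ENNReal.ofReal N) ^ σ) N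
      · refine iSup_le fun N => ?_
        rw [ENNReal.rpow_add_of_nonneg _ _ zero_le_one hσ.le, ENNReal.rpow_one]
        gcongr
        exact min_le_left _ _
    · intro a b hab x
      dsimp only
      gcongr
  rw [hsup]
  exact iSup_le fun N => hZle N (by positivity)

/-! ### Gehring's lemma in a metric space with a homogeneous measure -/

/-- The measure of closed balls is `κ r^Q`. -/
structure IsHomogeneousMeasure {X : Type*} [MetricSpace X] [MeasurableSpace X] (μ : Measure X)
    (κ Q : ℝ) : Prop where
  pos : 0 < κ
  dim_pos : 0 < Q
  closedBall : ∀ x r, 0 < r → μ (Metric.closedBall x r) = ENNReal.ofReal (κ * r ^ Q)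

/-- A reverse Hölder inequality, with right-hand side `k` and enlarged balls, on all balls whose
enlargement lies in `D`. -/
def ReverseHolderOn {X : Type*} [MetricSpace X] [MeasurableSpace X] (μ : Measure X) (D : Set X)
    (θ A lam : ℝ) (h k : X → ℝ≥0∞) : Prop :=
  ∀ x r, 0 < r → Metric.closedBall x (lam * r) ⊆ D →
    ⨍⁻ y in Metric.closedBall x r, h y ∂μ ≤ ENNReal.ofReal A *
      ((⨍⁻ y in Metric.closedBall x (lam * r), h y ^ (1 / θ) ∂μ) ^ θ +
        ⨍⁻ y in Metric.closedBall x (lam * r), k y ∂μ)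

section

variable {X : Type*} [MetricSpace X] [MeasurableSpace X] {μ : Measure X} {κ Q : ℝ}

namespace IsHomogeneousMeasure

theorem closedBall_mul (hμ : IsHomogeneousMeasure μ κ Q) (x : X) {M r : ℝ} (hM : 0 < M)
    (hr : 0 < r) :
    μ (Metric.closedBall x (M * r)) = ENNReal.ofReal (M ^ Q) * μ (Metric.closedBall x r) := by
  rw [hμ.closedBall x _ (by positivity), hμ.closedBall x r hr,
    ← ENNReal.ofReal_mul (by positivity), Real.mul_rpow hM.le hr.le]
  congr 1; ring

theorem closedBall_ne_zero (hμ : IsHomogeneousMeasure μ κ Q) (x : X) {r : ℝ} (hr : 0 < r) :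
    μ (Metric.closedBall x r) ≠ 0 := by
  rw [hμ.closedBall x r hr]
  have := hμ.pos
  simp only [ne_eq, ENNReal.ofReal_eq_zero, not_le]
  positivity

theorem closedBall_ne_top (hμ : IsHomogeneousMeasure μ κ Q) (x : X) {r : ℝ} (hr : 0 < r) :
    μ (Metric.closedBall x r) ≠ ∞ := by
  rw [hμ.closedBall x r hr]; exact ENNReal.ofReal_ne_top

theorem isUnifLocDoublingMeasure (hμ : IsHomogeneousMeasure μ κ Q) :
    IsUnifLocDoublingMeasure μ := by
  refine ⟨⟨Real.toNNReal (2 ^ Q), ?_⟩⟩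
  filter_upwards [self_mem_nhdsWithin] with ε hε x
  exact (hμ.closedBall_mul x two_pos hε).le

theorem isLocallyFiniteMeasure (hμ : IsHomogeneousMeasure μ κ Q) : IsLocallyFiniteMeasure μ :=
  ⟨fun x => ⟨Metric.closedBall x 1, Metric.closedBall_mem_nhds x one_pos,
    (hμ.closedBall_ne_top x one_pos).lt_top⟩⟩

end IsHomogeneousMeasure

/-- Discrete stopping time: among the radii `r₀ M⁻ʲ`, the first one at which `f` exceeds `τ`. At the
preceding radius `f` is still at most `τ`. -/
theorem exists_stopping_radius {f : ℝ → ℝ≥0∞} {L τ : ℝ≥0∞} {r₀ M : ℝ} (hr₀ : 0 < r₀) (hM : 1 < M)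
    (hlim : Tendsto f (𝓝[>] 0) (𝓝 L)) (hL : τ < L) (h0 : f r₀ ≤ τ) :
    ∃ r, 0 < r ∧ M * r ≤ r₀ ∧ f (M * r) ≤ τ ∧ τ < f r := by
  have hM0 : 0 < M := by linarith
  have hseq : Tendsto (fun j : ℕ => r₀ * M⁻¹ ^ j) atTop (𝓝[>] 0) := by
    refine tendsto_nhdsWithin_iff.2 ⟨?_, Eventually.of_forall fun j => ?_⟩
    · have := (tendsto_pow_atTop_nhds_zero_of_lt_one (inv_nonneg.2 hM0.le)
        (inv_lt_one_of_one_lt₀ hM)).const_mul r₀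
      rwa [mul_zero] at this
    · exact mem_Ioi.2 (by positivity)
  have hex : ∃ j : ℕ, τ < f (r₀ * M⁻¹ ^ j) :=
    ((hlim.comp hseq).eventually (lt_mem_nhds hL)).exists
  classical
  have hspec := Nat.find_spec hex
  set j := Nat.find hex with hj
  have hj0 : j ≠ 0 := by
    intro h
    rw [h] at hspec
    simp only [pow_zero, mul_one] at hspec
    exact absurd hspec (not_lt.2 h0)
  obtain ⟨i, hi⟩ := Nat.exists_eq_succ_of_ne_zero hj0
  have hmin := Nat.find_min hex (m := i) (by omega)
  have he : M * (r₀ * M⁻¹ ^ j) = r₀ * M⁻¹ ^ i := by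
    rw [hi, Nat.succ_eq_add_one, pow_succ]; field_simp
  refine ⟨r₀ * M⁻¹ ^ j, by positivity, ?_, ?_, hspec⟩
  · rw [he]
    exact mul_le_of_le_one_right hr₀.le (pow_le_one₀ (inv_nonneg.2 hM0.le)
      (inv_le_one_of_one_le₀ hM.le))
  · rw [he]; exact not_lt.1 hmin

/-- Splitting an integral at the level `s`. -/
theorem lintegral_le_mul_add_superlevel {Y : Type*} [MeasurableSpace Y] {ν : Measure Y}
    {f : Y → ℝ≥0∞} (s : ℝ≥0∞) (B : Set Y) :
    ∫⁻ y in B, f y ∂ν ≤ s * ν B + ∫⁻ y in B ∩ {y | s < f y}, f y ∂ν := by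
  have : B ⊆ (B ∩ {y | f y ≤ s}) ∪ (B ∩ {y | s < f y}) := fun y hy => by
    rcases le_or_gt (f y) s with h | h
    · exact Or.inl ⟨hy, h⟩
    · exact Or.inr ⟨hy, h⟩
  refine (lintegral_mono_set this).trans ((lintegral_union_le _ _ _).trans (add_le_add ?_ le_rfl))
  calc ∫⁻ y in B ∩ {y | f y ≤ s}, f y ∂ν ≤ ∫⁻ _ in B ∩ {y | f y ≤ s}, s ∂ν :=
        setLIntegral_mono measurable_const fun y hy => hy.2
    _ = s * ν (B ∩ {y | f y ≤ s}) := by simp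
    _ ≤ s * ν B := by gcongr; exact inter_subset_left

/-- If the right-hand side of a reverse Hölder inequality exceeds `τ`, then a fixed proportion of it
comes from the points where the integrands exceed a multiple of `τ`. -/
theorem mul_measure_le_of_le_reverseHolder {Y : Type*} [MeasurableSpace Y] {ν : Measure Y}
    {h k : Y → ℝ≥0∞} {B : Set Y} (hB0 : ν B ≠ 0) (hB : ν B ≠ ∞) {θ A : ℝ} (hθ : 1 < θ) (hA : 1 ≤ A)
    {τ : ℝ≥0∞} (hτ : τ ≠ ∞)
    (hle : τ ≤ ENNReal.ofReal A * ((⨍⁻ y in B, h y ^ (1 / θ) ∂ν) ^ θ + ⨍⁻ y in B, k y ∂ν)) :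
    τ * ν B ≤ ENNReal.ofReal (4 * A) *
      (τ ^ (1 - 1 / θ) * ∫⁻ y in B ∩ {y | ENNReal.ofReal (2 ^ (-θ) / (2 * A)) * τ < h y},
          h y ^ (1 / θ) ∂ν +
        ∫⁻ y in B ∩ {y | ENNReal.ofReal (2 ^ (-θ) / (2 * A)) * τ < k y}, k y ∂ν) := by
  have hθ0 : 0 < θ := by linarith
  have hθi : 0 < 1 / θ := by positivity
  set c : ℝ := 2 ^ (-θ) / (2 * A) with hc
  set a := ENNReal.ofReal (2 * A) with ha
  have ha0 : a ≠ 0 := by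
    simp only [ha, ne_eq, ENNReal.ofReal_eq_zero, not_le]; linarith
  have hat : a ≠ ∞ := ENNReal.ofReal_ne_top
  have ha1 : 1 ≤ a := by rw [ha, ENNReal.one_le_ofReal]; linarith
  have h4 : ENNReal.ofReal (4 * A) = 2 * a := by
    rw [ha, show 4 * A = 2 * (2 * A) by ring, ENNReal.ofReal_mul two_pos.le]; simp
  have hac : a * ENNReal.ofReal c = ENNReal.ofReal (2 ^ (-θ)) := by
    rw [ha, ← ENNReal.ofReal_mul (by linarith), hc]; congr 1; field_simp
  have h2θ : (2 : ℝ) ^ (-θ) ≤ 1 / 2 := by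
    rw [one_div, ← Real.rpow_neg_one]
    exact Real.rpow_le_rpow_of_exponent_le one_le_two (by linarith)
  have hhalf : ENNReal.ofReal (1 / 2) = 2⁻¹ := by
    rw [one_div, ENNReal.ofReal_inv_of_pos two_pos]; simp
  have hτB : τ * ν B ≠ ∞ := ENNReal.mul_ne_top hτ hB
  rw [h4]
  have hcases : τ ≤ a * (⨍⁻ y in B, h y ^ (1 / θ) ∂ν) ^ θ ∨ τ ≤ a * ⨍⁻ y in B, k y ∂ν := by
    rcases le_total (⨍⁻ y in B, k y ∂ν) ((⨍⁻ y in B, h y ^ (1 / θ) ∂ν) ^ θ) with h | h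
    · left
      refine hle.trans ?_
      rw [ha, ENNReal.ofReal_mul two_pos.le, mul_comm (ENNReal.ofReal 2), mul_assoc]
      gcongr
      simp only [ENNReal.ofReal_ofNat, two_mul]
      gcongr
    · right
      refine hle.trans ?_
      rw [ha, ENNReal.ofReal_mul two_pos.le, mul_comm (ENNReal.ofReal 2), mul_assoc]
      gcongr
      simp only [ENNReal.ofReal_ofNat, two_mul]
      gcongr
  rcases hcases with hg | hk
  · have e1 : τ ^ (1 / θ) * ν B ≤ a ^ (1 / θ) * ∫⁻ y in B, h y ^ (1 / θ) ∂ν := by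
      have := ENNReal.rpow_le_rpow hg hθi.le
      rw [ENNReal.mul_rpow_of_nonneg _ _ hθi.le, ← ENNReal.rpow_mul, mul_one_div_cancel hθ0.ne',
        ENNReal.rpow_one, setLAverage_eq, ENNReal.div_eq_inv_mul] at this
      calc τ ^ (1 / θ) * ν B
          ≤ a ^ (1 / θ) * ((ν B)⁻¹ * ∫⁻ y in B, h y ^ (1 / θ) ∂ν) * ν B := by gcongr
        _ = a ^ (1 / θ) * (∫⁻ y in B, h y ^ (1 / θ) ∂ν) * ((ν B)⁻¹ * ν B) := by ring
        _ = _ := by rw [ENNReal.inv_mul_cancel hB0 hB, mul_one]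
    have hset : {y | (ENNReal.ofReal c * τ) ^ (1 / θ) < h y ^ (1 / θ)} =
        {y | ENNReal.ofReal c * τ < h y} := by
      ext y
      exact ENNReal.rpow_lt_rpow_iff hθi
    have e2 := lintegral_le_mul_add_superlevel (ν := ν) (f := fun y => h y ^ (1 / θ))
      ((ENNReal.ofReal c * τ) ^ (1 / θ)) B
    rw [hset] at e2
    set S := ∫⁻ y in B ∩ {y | ENNReal.ofReal c * τ < h y}, h y ^ (1 / θ) ∂ν
    have e3 : τ ^ (1 / θ) * ν B ≤ τ ^ (1 / θ) * ν B / 2 + a ^ (1 / θ) * S := by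
      refine e1.trans ((mul_le_mul' le_rfl e2).trans_eq ?_)
      rw [mul_add, ← mul_assoc, ← ENNReal.mul_rpow_of_nonneg _ _ hθi.le, ← mul_assoc, hac,
        ENNReal.mul_rpow_of_nonneg _ _ hθi.le, ENNReal.ofReal_rpow_of_nonneg (by positivity) hθi.le,
        ← Real.rpow_mul two_pos.le, show -θ * (1 / θ) = -1 by field_simp, Real.rpow_neg_one,
        ← one_div, hhalf, div_eq_mul_inv (τ ^ (1 / θ) * ν B)]
      ring
    have e4 := ennreal_le_two_mul_of_le_half_add
      (ENNReal.mul_ne_top (ENNReal.rpow_ne_top_of_nonneg hθi.le hτ) hB) e3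
    have hθ1 : 0 ≤ 1 - 1 / θ := by
      rw [sub_nonneg, div_le_one hθ0]; exact hθ.le
    calc τ * ν B = τ ^ (1 - 1 / θ) * (τ ^ (1 / θ) * ν B) := by
          rw [← mul_assoc, ← ENNReal.rpow_add_of_nonneg _ _ hθ1 hθi.le]; simp
      _ ≤ τ ^ (1 - 1 / θ) * (2 * (a ^ (1 / θ) * S)) := by gcongr
      _ ≤ τ ^ (1 - 1 / θ) * (2 * (a * S)) := by
          gcongr
          calc a ^ (1 / θ) ≤ a ^ (1 : ℝ) := ENNReal.rpow_le_rpow_of_exponent_le ha1 (by linarith)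
            _ = a := ENNReal.rpow_one a
      _ = 2 * a * (τ ^ (1 - 1 / θ) * S) := by ring
      _ ≤ _ := by gcongr; exact le_self_add
  · have e1 : τ * ν B ≤ a * ∫⁻ y in B, k y ∂ν := by
      rw [setLAverage_eq, ENNReal.div_eq_inv_mul] at hk
      calc τ * ν B ≤ a * ((ν B)⁻¹ * ∫⁻ y in B, k y ∂ν) * ν B := by gcongr
        _ = a * (∫⁻ y in B, k y ∂ν) * ((ν B)⁻¹ * ν B) := by ring
        _ = _ := by rw [ENNReal.inv_mul_cancel hB0 hB, mul_one]
    have e2 := lintegral_le_mul_add_superlevel (ν := ν) (f := k) (ENNReal.ofReal c * τ) B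
    set S := ∫⁻ y in B ∩ {y | ENNReal.ofReal c * τ < k y}, k y ∂ν
    have e3 : τ * ν B ≤ τ * ν B / 2 + a * S := by
      refine e1.trans ((mul_le_mul' le_rfl e2).trans ?_)
      rw [mul_add, ← mul_assoc, ← mul_assoc, hac, div_eq_mul_inv, ← hhalf,
        mul_comm (τ * ν B), mul_assoc]
      gcongr
    calc τ * ν B ≤ 2 * (a * S) := ennreal_le_two_mul_of_le_half_add hτB e3
      _ = 2 * a * S := by ring
      _ ≤ _ := by gcongr; exact le_add_self

end

theorem closedBall_subset_of_lt_infDist {X : Type*} [MetricSpace X] {D : Set X} {x : X} {r : ℝ}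
    (h : r < Metric.infDist x Dᶜ) : Metric.closedBall x r ⊆ D :=
  (Metric.closedBall_subset_ball h).trans Metric.ball_infDist_compl_subset

/-- The weight `dist(x, Dᶜ)^Q`, which vanishes outside `D`. -/
def bdryWeight {X : Type*} [MetricSpace X] (Q : ℝ) (D : Set X) (x : X) : ℝ≥0∞ := ENNReal.ofReal (Metric.infDist x Dᶜ ^ Q)

theorem measurable_bdryWeight {X : Type*} [MetricSpace X] [MeasurableSpace X] [BorelSpace X]
    (Q : ℝ) (D : Set X) : Measurable (bdryWeight Q D) :=
  ENNReal.measurable_ofReal.comp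
    ((Metric.continuous_infDist_pt Dᶜ).measurable.pow_const Q)

section

variable {X : Type*} [MetricSpace X] [MeasurableSpace X] [BorelSpace X]
  {μ : Measure X} {κ Q : ℝ}

theorem ae_tendsto_laverage_closedBall [SecondCountableTopology X] (hμ : IsHomogeneousMeasure μ κ Q) {f : X → ℝ≥0∞}
    (hf : AEMeasurable f μ) (hfin : ∫⁻ x, f x ∂μ ≠ ∞) :
    ∀ᵐ x ∂μ, Tendsto (fun r => ⨍⁻ y in Metric.closedBall x r, f y ∂μ) (𝓝[>] 0) (𝓝 (f x)) := by
  have := hμ.isUnifLocDoublingMeasure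
  have := hμ.isLocallyFiniteMeasure
  filter_upwards [(IsUnifLocDoublingMeasure.vitaliFamily μ 1).ae_tendsto_lintegral_div hf hfin]
    with x hx
  simp_rw [setLAverage_eq]
  refine hx.comp ?_
  refine IsUnifLocDoublingMeasure.tendsto_closedBall_filterAt μ (fun _ => x) id tendsto_id ?_
  filter_upwards [self_mem_nhdsWithin] with r hr
  exact Metric.mem_closedBall_self (by rw [one_mul]; exact (mem_Ioi.1 hr).le)

/-- The contribution of one stopping ball. The weight is comparable to a constant on the enlarged
ball, so the reverse Hölder inequality for `h` becomes an inequality between integrals of the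
weighted functions over superlevel sets in the unenlarged ball. -/
theorem superlevel_ball_estimate (hμ : IsHomogeneousMeasure μ κ Q) {D : Set X}
    {h k : X → ℝ≥0∞} {θ A lam : ℝ} (hθ : 1 < θ) (hA : 1 ≤ A)
    (hlam : 1 ≤ lam) (hrev : ReverseHolderOn μ D θ A lam h k)
    {t : ℝ} (ht : 0 < t) {x : X} {r : ℝ} (hr : 0 < r)
    (hrd : 5 * lam * r ≤ Metric.infDist x Dᶜ / 2)
    (h1 : ⨍⁻ y in Metric.closedBall x (5 * lam * r), h y ∂μ ≤ ENNReal.ofReal t / bdryWeight Q D x)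
    (h2 : ENNReal.ofReal t / bdryWeight Q D x < ⨍⁻ y in Metric.closedBall x r, h y ∂μ) :
    ∫⁻ y in Metric.closedBall x (5 * (lam * r)), bdryWeight Q D y * h y ∂μ ≤
      ENNReal.ofReal (20 ^ Q * (4 * A)) * (ENNReal.ofReal (t ^ (1 - 1 / θ)) *
        ∫⁻ y in Metric.closedBall x (lam * r) ∩
          {y | ENNReal.ofReal (2 ^ (-θ) / (2 * A) * 2⁻¹ ^ Q * t) < bdryWeight Q D y * h y},
            (bdryWeight Q D y * h y) ^ (1 / θ) ∂μ +
        ∫⁻ y in Metric.closedBall x (lam * r) ∩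
          {y | ENNReal.ofReal (2 ^ (-θ) / (2 * A) * 2⁻¹ ^ Q * t) < bdryWeight Q D y * k y},
            bdryWeight Q D y * k y ∂μ) := by
  have hQ := hμ.dim_pos
  have hlr : 0 < lam * r := by positivity
  have hθi : 0 < 1 / θ := by have : 0 < θ := by linarith
                             positivity
  have hθ1 : 0 ≤ 1 - 1 / θ := by
    rw [sub_nonneg, div_le_one (by linarith)]; exact hθ.le
  set d := Metric.infDist x Dᶜ with hd
  have hd0 : 0 < d := by nlinarith
  set w := bdryWeight Q D x with hw
  have hw' : w = ENNReal.ofReal (d ^ Q) := rfl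
  have hw0 : w ≠ 0 := by
    rw [hw', ne_eq, ENNReal.ofReal_eq_zero, not_le]; positivity
  have hwt : w ≠ ∞ := ENNReal.ofReal_ne_top
  set τ := ENNReal.ofReal t / w with hτ
  have hτt : τ ≠ ∞ := ENNReal.div_ne_top ENNReal.ofReal_ne_top hw0
  have hwτ : w * τ = ENNReal.ofReal t := ENNReal.mul_div_cancel hw0 hwt
  have hdist : ∀ y ∈ Metric.closedBall x (5 * (lam * r)),
      Metric.infDist y Dᶜ ≤ 2 * d ∧ d ≤ 2 * Metric.infDist y Dᶜ := by
    intro y hy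
    have e1 := Metric.infDist_le_infDist_add_dist (s := Dᶜ) (x := y) (y := x)
    have e2 := Metric.infDist_le_infDist_add_dist (s := Dᶜ) (x := x) (y := y)
    rw [Metric.mem_closedBall] at hy
    rw [dist_comm] at e2
    constructor <;> linarith
  have hwle : ∀ y ∈ Metric.closedBall x (5 * (lam * r)),
      bdryWeight Q D y ≤ ENNReal.ofReal (2 ^ Q) * w ∧
        w ≤ ENNReal.ofReal (2 ^ Q) * bdryWeight Q D y := by
    intro y hy
    obtain ⟨e1, e2⟩ := hdist y hy
    have e3 : 0 ≤ Metric.infDist y Dᶜ := Metric.infDist_nonneg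
    rw [hw', bdryWeight, ← ENNReal.ofReal_mul (by positivity), ← ENNReal.ofReal_mul (by positivity),
      ← Real.mul_rpow two_pos.le hd0.le, ← Real.mul_rpow two_pos.le e3]
    exact ⟨ENNReal.ofReal_le_ofReal (Real.rpow_le_rpow e3 e1 hQ.le),
      ENNReal.ofReal_le_ofReal (Real.rpow_le_rpow hd0.le e2 hQ.le)⟩
  have hsub : Metric.closedBall x (lam * r) ⊆ Metric.closedBall x (5 * (lam * r)) :=
    Metric.closedBall_subset_closedBall (by linarith)
  have hD : Metric.closedBall x (lam * r) ⊆ D := closedBall_subset_of_lt_infDist (by nlinarith)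
  have key := mul_measure_le_of_le_reverseHolder (hμ.closedBall_ne_zero x hlr)
    (hμ.closedBall_ne_top x hlr) hθ hA hτt (h2.le.trans (hrev x r hr hD))
  set c := (2 : ℝ) ^ (-θ) / (2 * A) with hc
  have hc0 : 0 ≤ c := by positivity
  have hlev : ∀ f : X → ℝ≥0∞, Metric.closedBall x (lam * r) ∩ {y | ENNReal.ofReal c * τ < f y} ⊆
      Metric.closedBall x (lam * r) ∩
        {y | ENNReal.ofReal (c * 2⁻¹ ^ Q * t) < bdryWeight Q D y * f y} := by
    rintro f y ⟨hy, hy'⟩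
    refine ⟨hy, ?_⟩
    have e1 := (hwle y (hsub hy)).2
    have h2Q : ENNReal.ofReal (2⁻¹ ^ Q) * ENNReal.ofReal (2 ^ Q) = 1 := by
      rw [← ENNReal.ofReal_mul (by positivity), ← Real.mul_rpow (by positivity) (by positivity)]
      norm_num
    have e2 : ENNReal.ofReal (2⁻¹ ^ Q) * w ≤ bdryWeight Q D y := by
      calc _ ≤ ENNReal.ofReal (2⁻¹ ^ Q) * (ENNReal.ofReal (2 ^ Q) * bdryWeight Q D y) := by gcongr
        _ = _ := by rw [← mul_assoc, h2Q, one_mul]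
    have hpos : ENNReal.ofReal (2⁻¹ ^ Q) ≠ 0 := by
      rw [ne_eq, ENNReal.ofReal_eq_zero, not_le]; positivity
    calc ENNReal.ofReal (c * 2⁻¹ ^ Q * t)
        = ENNReal.ofReal (2⁻¹ ^ Q) * w * (ENNReal.ofReal c * τ) := by
          rw [ENNReal.ofReal_mul (by positivity), ENNReal.ofReal_mul hc0, ← hwτ]; ring
      _ < ENNReal.ofReal (2⁻¹ ^ Q) * w * f y :=
          ENNReal.mul_lt_mul_right (mul_ne_zero hpos hw0)
            (ENNReal.mul_ne_top ENNReal.ofReal_ne_top hwt) hy'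
      _ ≤ bdryWeight Q D y * f y := by gcongr
  have hQ1 : (1 : ℝ≥0∞) ≤ ENNReal.ofReal (2 ^ Q) := by
    rw [ENNReal.one_le_ofReal]; exact Real.one_le_rpow one_le_two hQ.le
  have i1 : ∫⁻ y in Metric.closedBall x (5 * (lam * r)), bdryWeight Q D y * h y ∂μ ≤
      ENNReal.ofReal (2 ^ Q) * w * ∫⁻ y in Metric.closedBall x (5 * (lam * r)), h y ∂μ := by
    rw [← lintegral_const_mul' _ _ (ENNReal.mul_ne_top ENNReal.ofReal_ne_top hwt)]
    refine setLIntegral_mono' measurableSet_closedBall fun y hy => ?_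
    gcongr
    exact (hwle y hy).1
  -- on the enlarged ball the average does not exceed `τ`, by the choice of the radius
  have i2 : ∫⁻ y in Metric.closedBall x (5 * (lam * r)), h y ∂μ ≤
      ENNReal.ofReal (5 ^ Q) * (τ * μ (Metric.closedBall x (lam * r))) := by
    rw [setLAverage_eq, mul_assoc] at h1
    have h5 : (0 : ℝ) < 5 * (lam * r) := by positivity
    rw [ENNReal.div_le_iff (hμ.closedBall_ne_zero x h5) (hμ.closedBall_ne_top x h5),
      hμ.closedBall_mul x (by norm_num) hlr] at h1
    exact h1.trans_eq (by ring)
  -- `w τ = t`, so the weight is distributed as `w τ^(1-1/θ) = t^(1-1/θ) w^(1/θ)`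
  have j1 : w * (τ ^ (1 - 1 / θ) * ∫⁻ y in Metric.closedBall x (lam * r) ∩
        {y | ENNReal.ofReal c * τ < h y}, h y ^ (1 / θ) ∂μ) ≤
      ENNReal.ofReal (2 ^ Q) * (ENNReal.ofReal (t ^ (1 - 1 / θ)) *
        ∫⁻ y in Metric.closedBall x (lam * r) ∩
          {y | ENNReal.ofReal (c * 2⁻¹ ^ Q * t) < bdryWeight Q D y * h y},
            (bdryWeight Q D y * h y) ^ (1 / θ) ∂μ) := by
    have e0 : w * τ ^ (1 - 1 / θ) = ENNReal.ofReal (t ^ (1 - 1 / θ)) * w ^ (1 / θ) := by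
      rw [← ENNReal.ofReal_rpow_of_nonneg ht.le hθ1, ← hwτ, ENNReal.mul_rpow_of_nonneg _ _ hθ1,
        mul_right_comm, ← ENNReal.rpow_add_of_nonneg _ _ hθ1 hθi.le]
      simp
    have hwi : w ^ (1 / θ) ≠ ∞ := ENNReal.rpow_ne_top_of_nonneg hθi.le hwt
    rw [← mul_assoc, e0, mul_assoc, mul_left_comm (ENNReal.ofReal (2 ^ Q))]
    refine mul_le_mul' le_rfl ?_
    rw [← lintegral_const_mul' _ _ hwi, ← lintegral_const_mul' _ _ ENNReal.ofReal_ne_top]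
    refine (lintegral_mono_set (hlev h)).trans ?_
    refine lintegral_mono_ae ((ae_restrict_of_ae_restrict_of_subset inter_subset_left
      (ae_restrict_mem measurableSet_closedBall)).mono fun y hy => ?_)
    rw [ENNReal.mul_rpow_of_nonneg _ _ hθi.le, ← mul_assoc]
    gcongr
    calc w ^ (1 / θ) ≤ (ENNReal.ofReal (2 ^ Q) * bdryWeight Q D y) ^ (1 / θ) := by
          gcongr; exact (hwle y (hsub hy)).2
      _ = ENNReal.ofReal (2 ^ Q) ^ (1 / θ) * bdryWeight Q D y ^ (1 / θ) :=
          ENNReal.mul_rpow_of_nonneg _ _ hθi.le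
      _ ≤ ENNReal.ofReal (2 ^ Q) * bdryWeight Q D y ^ (1 / θ) := by
          gcongr
          calc _ ≤ ENNReal.ofReal (2 ^ Q) ^ (1 : ℝ) :=
                ENNReal.rpow_le_rpow_of_exponent_le hQ1 (by linarith)
            _ = _ := ENNReal.rpow_one _
  have j2 : w * (∫⁻ y in Metric.closedBall x (lam * r) ∩
        {y | ENNReal.ofReal c * τ < k y}, k y ∂μ) ≤
      ENNReal.ofReal (2 ^ Q) *
        ∫⁻ y in Metric.closedBall x (lam * r) ∩
          {y | ENNReal.ofReal (c * 2⁻¹ ^ Q * t) < bdryWeight Q D y * k y},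
            bdryWeight Q D y * k y ∂μ := by
    rw [← lintegral_const_mul' _ _ hwt, ← lintegral_const_mul' _ _ ENNReal.ofReal_ne_top]
    refine (lintegral_mono_set (hlev k)).trans ?_
    refine lintegral_mono_ae ((ae_restrict_of_ae_restrict_of_subset inter_subset_left
      (ae_restrict_mem measurableSet_closedBall)).mono fun y hy => ?_)
    rw [← mul_assoc]
    gcongr
    exact (hwle y (hsub hy)).2
  have hconst : ENNReal.ofReal (20 ^ Q * (4 * A)) = ENNReal.ofReal (2 ^ Q) * ENNReal.ofReal (5 ^ Q) *
      ENNReal.ofReal (2 ^ Q) * ENNReal.ofReal (4 * A) := by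
    rw [← ENNReal.ofReal_mul (by positivity), ← ENNReal.ofReal_mul (by positivity),
      ← ENNReal.ofReal_mul (by positivity), ← Real.mul_rpow (by positivity) (by positivity),
      ← Real.mul_rpow (by positivity) (by positivity)]
    norm_num
  calc _ ≤ _ := i1
    _ ≤ ENNReal.ofReal (2 ^ Q) * w * (ENNReal.ofReal (5 ^ Q) *
          (τ * μ (Metric.closedBall x (lam * r)))) := by gcongr
    _ ≤ ENNReal.ofReal (2 ^ Q) * w * (ENNReal.ofReal (5 ^ Q) * _) :=
        mul_le_mul' le_rfl (mul_le_mul' le_rfl key)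
    _ = ENNReal.ofReal (2 ^ Q) * ENNReal.ofReal (5 ^ Q) * ENNReal.ofReal (4 * A) *
        (w * (τ ^ (1 - 1 / θ) * ∫⁻ y in Metric.closedBall x (lam * r) ∩
          {y | ENNReal.ofReal c * τ < h y}, h y ^ (1 / θ) ∂μ) +
          w * ∫⁻ y in Metric.closedBall x (lam * r) ∩
            {y | ENNReal.ofReal c * τ < k y}, k y ∂μ) := by ring
    _ ≤ ENNReal.ofReal (2 ^ Q) * ENNReal.ofReal (5 ^ Q) * ENNReal.ofReal (4 * A) *
        (ENNReal.ofReal (2 ^ Q) * _ + ENNReal.ofReal (2 ^ Q) * _) :=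
        mul_le_mul' le_rfl (add_le_add j1 j2)
    _ = _ := by rw [hconst]; ring

end

theorem infDist_pos_of_bdryWeight_ne_zero {X : Type*} [MetricSpace X] {Q : ℝ} (hQ : 0 < Q) {D : Set X} {x : X}
    (h : bdryWeight Q D x ≠ 0) : 0 < Metric.infDist x Dᶜ := by
  refine lt_of_le_of_ne Metric.infDist_nonneg fun h0 => h ?_
  rw [bdryWeight, ← h0, Real.zero_rpow hQ.ne', ENNReal.ofReal_zero]

theorem mem_of_infDist_compl_pos {X : Type*} [MetricSpace X] {D : Set X} {x : X} (h : 0 < Metric.infDist x Dᶜ) : x ∈ D :=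
  closedBall_subset_of_lt_infDist h (Metric.mem_closedBall_self le_rfl)

section

variable {X : Type*} [MetricSpace X] [MeasurableSpace X] [BorelSpace X] {μ : Measure X} {κ Q : ℝ}

theorem measurableSet_infDist_pos (D : Set X) : MeasurableSet {x | 0 < Metric.infDist x Dᶜ} :=
  measurableSet_lt measurable_const (Metric.continuous_infDist_pt Dᶜ).measurable

theorem lintegral_comp_bdryWeight_le (hQ : 0 < Q) {D : Set X} {R : ℝ}
    (hR : ∀ x, Metric.infDist x Dᶜ ≤ R) (f : X → ℝ≥0∞) {a : ℝ} (ha : 0 < a) :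
    ∫⁻ x, (bdryWeight Q D x * f x) ^ a ∂μ ≤ ENNReal.ofReal (R ^ Q) ^ a * ∫⁻ x in D, f x ^ a ∂μ := by
  rw [← lintegral_const_mul' _ _ (ENNReal.rpow_ne_top_of_nonneg ha.le ENNReal.ofReal_ne_top)]
  calc ∫⁻ x, (bdryWeight Q D x * f x) ^ a ∂μ
      = ∫⁻ x in {x | 0 < Metric.infDist x Dᶜ}, (bdryWeight Q D x * f x) ^ a ∂μ := by
        rw [← lintegral_indicator (measurableSet_infDist_pos D)]
        refine lintegral_congr fun x => ?_
        by_cases hx : 0 < Metric.infDist x Dᶜ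
        · rw [indicator_of_mem (s := {x | 0 < Metric.infDist x Dᶜ}) hx]
        · rw [indicator_of_notMem (s := {x | 0 < Metric.infDist x Dᶜ}) hx]
          have : bdryWeight Q D x = 0 := by
            by_contra h0; exact hx (infDist_pos_of_bdryWeight_ne_zero hQ h0)
          rw [this, zero_mul, ENNReal.zero_rpow_of_pos ha]
    _ ≤ ∫⁻ x in {x | 0 < Metric.infDist x Dᶜ}, ENNReal.ofReal (R ^ Q) ^ a * f x ^ a ∂μ := by
        refine lintegral_mono fun x => ?_
        rw [ENNReal.mul_rpow_of_nonneg _ _ ha.le]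
        gcongr
        exact ENNReal.ofReal_le_ofReal (Real.rpow_le_rpow Metric.infDist_nonneg (hR x) hQ.le)
    _ ≤ _ := lintegral_mono_set fun x hx => mem_of_infDist_compl_pos hx

/-- The reverse Hölder inequality on the superlevel sets of the weighted function: stopping balls
around almost every point of `{t < w h}`, a Vitali covering, and summation over the disjoint family.
For `t` above the given threshold, the ball of radius `dist(x, Dᶜ) / 2` does not stop. -/
theorem superlevel_estimate [SecondCountableTopology X] (hμ : IsHomogeneousMeasure μ κ Q)
    {D : Set X} {R : ℝ} (hR : ∀ x, Metric.infDist x Dᶜ ≤ R)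
    {h k : X → ℝ≥0∞} (hh : Measurable h) (hk : Measurable k) (hfin : ∫⁻ x in D, h x ∂μ ≠ ∞)
    {θ A lam : ℝ} (hθ : 1 < θ) (hA : 1 ≤ A) (hlam : 1 ≤ lam)
    (hrev : ReverseHolderOn μ D θ A lam h k) {t : ℝ}
    (ht : 2 ^ Q / κ * (∫⁻ x in D, h x ∂μ).toReal < t) :
    ∫⁻ x in {x | ENNReal.ofReal t < bdryWeight Q D x * h x}, bdryWeight Q D x * h x ∂μ ≤
      ENNReal.ofReal (20 ^ Q * (4 * A)) * (ENNReal.ofReal (t ^ (1 - 1 / θ)) *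
        ∫⁻ x in {x | ENNReal.ofReal (2 ^ (-θ) / (2 * A) * 2⁻¹ ^ Q * t) < bdryWeight Q D x * h x},
            (bdryWeight Q D x * h x) ^ (1 / θ) ∂μ +
        ∫⁻ x in {x | ENNReal.ofReal (2 ^ (-θ) / (2 * A) * 2⁻¹ ^ Q * t) < bdryWeight Q D x * k x},
            bdryWeight Q D x * k x ∂μ) := by
  have hQ := hμ.dim_pos
  have hκ := hμ.pos
  have ht0 : 0 < t := lt_of_le_of_lt (by positivity) ht
  have hwm := measurable_bdryWeight Q D
  have hwh : Measurable fun x => bdryWeight Q D x * h x := hwm.mul hh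
  have hwk : Measurable fun x => bdryWeight Q D x * k x := hwm.mul hk
  set P : Set X := {x | 0 < Metric.infDist x Dᶜ} with hP
  have hPm : MeasurableSet P := measurableSet_infDist_pos D
  -- `h` need not be integrable outside `D`; the averages of `f` and `h` agree on the balls in use
  set f := P.indicator h with hf
  have hffin : ∫⁻ x, f x ∂μ ≠ ∞ := by
    rw [hf, lintegral_indicator hPm]
    exact ne_top_of_le_ne_top hfin (lintegral_mono_set fun x hx => mem_of_infDist_compl_pos hx)
  have hleb := ae_tendsto_laverage_closedBall hμ (hh.indicator hPm).aemeasurable hffin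
  set G : Set X := {x | ENNReal.ofReal t < bdryWeight Q D x * h x} ∩
    {x | Tendsto (fun r => ⨍⁻ y in Metric.closedBall x r, f y ∂μ) (𝓝[>] 0) (𝓝 (f x))} with hG
  have hexit : ∀ x ∈ G, ∃ r, 0 < r ∧ 5 * lam * r ≤ Metric.infDist x Dᶜ / 2 ∧
      ⨍⁻ y in Metric.closedBall x (5 * lam * r), h y ∂μ ≤ ENNReal.ofReal t / bdryWeight Q D x ∧
      ENNReal.ofReal t / bdryWeight Q D x < ⨍⁻ y in Metric.closedBall x r, h y ∂μ := by
    rintro x ⟨hx, hx'⟩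
    have hw0 : bdryWeight Q D x ≠ 0 := by
      intro h0
      simp [h0] at hx
    have hwt : bdryWeight Q D x ≠ ∞ := ENNReal.ofReal_ne_top
    have hd : 0 < Metric.infDist x Dᶜ := infDist_pos_of_bdryWeight_ne_zero hQ hw0
    set d := Metric.infDist x Dᶜ with hdd
    have hfh : ∀ r ≤ d / 2, ⨍⁻ y in Metric.closedBall x r, f y ∂μ =
        ⨍⁻ y in Metric.closedBall x r, h y ∂μ := by
      intro r hr
      rw [setLAverage_eq, setLAverage_eq]
      congr 1
      refine setLIntegral_congr_fun measurableSet_closedBall fun y hy => ?_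
      have : y ∈ P := by
        have e2 := Metric.infDist_le_infDist_add_dist (s := Dᶜ) (x := x) (y := y)
        rw [Metric.mem_closedBall, dist_comm] at hy
        have e3 : 0 < Metric.infDist y Dᶜ := by linarith
        exact e3
      exact indicator_of_mem this _
    have hfx : f x = h x := indicator_of_mem (show x ∈ P from hd) _
    have hL : ENNReal.ofReal t / bdryWeight Q D x < f x := by
      rw [hfx, ENNReal.div_lt_iff (Or.inl hw0) (Or.inl hwt), mul_comm]
      exact hx
    have h0 : ⨍⁻ y in Metric.closedBall x (d / 2), f y ∂μ ≤
        ENNReal.ofReal t / bdryWeight Q D x := by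
      have hd2 : 0 < d / 2 := by positivity
      rw [hfh _ le_rfl, setLAverage_eq, ENNReal.div_le_iff (hμ.closedBall_ne_zero x hd2)
        (hμ.closedBall_ne_top x hd2), hμ.closedBall x _ hd2, bdryWeight, ← hdd,
        ← ENNReal.ofReal_div_of_pos (by positivity), ← ENNReal.ofReal_mul (by positivity)]
      calc ∫⁻ y in Metric.closedBall x (d / 2), h y ∂μ ≤ ∫⁻ y in D, h y ∂μ :=
            lintegral_mono_set (closedBall_subset_of_lt_infDist (by linarith))
        _ = ENNReal.ofReal (∫⁻ y in D, h y ∂μ).toReal := (ENNReal.ofReal_toReal hfin).symm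
        _ ≤ _ := by
          refine ENNReal.ofReal_le_ofReal ?_
          rw [div_mul_eq_mul_div, div_lt_iff₀ hκ] at ht
          rw [Real.div_rpow hd.le two_pos.le]
          have e : t / d ^ Q * (κ * (d ^ Q / 2 ^ Q)) = t * κ / 2 ^ Q := by
            have : d ^ Q ≠ 0 := by positivity
            field_simp
          rw [e, le_div_iff₀ (by positivity)]
          linarith
    obtain ⟨r, hr, hr1, hr2, hr3⟩ := exists_stopping_radius (M := 5 * lam)
      (by positivity : 0 < d / 2) (by linarith) hx' hL h0
    have hrle : r ≤ d / 2 := by nlinarith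
    refine ⟨r, hr, hr1, ?_, ?_⟩
    · rwa [hfh _ hr1] at hr2
    · rwa [hfh _ hrle] at hr3
  choose! r hr hrd hr1 hr2 using hexit
  -- the balls `B(x, lam r)` are disjointed, their `5`-fold enlargements cover
  obtain ⟨u, huG, hdisj, hcov⟩ := Vitali.exists_disjoint_subfamily_covering_enlargement_closedBall
    G id (fun x => lam * r x) R (fun x hx => by
      have e1 := hrd x hx
      have e2 := hR x
      have e3 := hr x hx
      nlinarith [Metric.infDist_nonneg (x := x) (s := Dᶜ)]) 5 (by norm_num)
  simp only [id] at hdisj hcov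
  have hlr : ∀ x ∈ G, 0 < lam * r x := fun x hx => mul_pos (by linarith) (hr x hx)
  have hucount : u.Countable := by
    refine hdisj.countable_of_nonempty_interior fun x hx => ⟨x, ?_⟩
    exact mem_interior_iff_mem_nhds.2 (Metric.closedBall_mem_nhds x (hlr x (huG hx)))
  have : Countable u := hucount.to_subtype
  have hpd : ∀ S : Set X, Pairwise (Function.onFun Disjoint
      fun b : u => Metric.closedBall b.1 (lam * r b.1) ∩ S) := fun S a b hab =>
    (hdisj a.2 b.2 (fun e => hab (Subtype.ext e))).mono inter_subset_left inter_subset_left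
  have hsum : ∀ (S : Set X) (hS : MeasurableSet S) (F : X → ℝ≥0∞),
      ∑' b : u, ∫⁻ y in Metric.closedBall b.1 (lam * r b.1) ∩ S, F y ∂μ ≤ ∫⁻ y in S, F y ∂μ := by
    intro S hS F
    rw [← lintegral_iUnion (fun b => measurableSet_closedBall.inter hS) (hpd S)]
    exact lintegral_mono_set (iUnion_subset fun b => inter_subset_right)
  set L := {x | ENNReal.ofReal (2 ^ (-θ) / (2 * A) * 2⁻¹ ^ Q * t) < bdryWeight Q D x * h x} with hL
  set L' := {x | ENNReal.ofReal (2 ^ (-θ) / (2 * A) * 2⁻¹ ^ Q * t) < bdryWeight Q D x * k x}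
    with hL'
  have hLm : MeasurableSet L := measurableSet_lt measurable_const hwh
  have hLm' : MeasurableSet L' := measurableSet_lt measurable_const hwk
  have hae : ({x | ENNReal.ofReal t < bdryWeight Q D x * h x} : Set X) ≤ᵐ[μ]
      (⋃ b : u, Metric.closedBall b.1 (5 * (lam * r b.1)) : Set X) := by
    filter_upwards [hleb] with x hx hxt
    have hxG : x ∈ G := ⟨hxt, hx⟩
    obtain ⟨b, hb, hsub⟩ := hcov x hxG
    exact mem_iUnion.2 ⟨⟨b, hb⟩, hsub (Metric.mem_closedBall_self (hlr x hxG).le)⟩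
  calc ∫⁻ x in {x | ENNReal.ofReal t < bdryWeight Q D x * h x}, bdryWeight Q D x * h x ∂μ
      ≤ ∫⁻ x in ⋃ b : u, Metric.closedBall b.1 (5 * (lam * r b.1)), bdryWeight Q D x * h x ∂μ :=
        lintegral_mono' (Measure.restrict_mono_ae hae) le_rfl
    _ ≤ ∑' b : u, ∫⁻ x in Metric.closedBall b.1 (5 * (lam * r b.1)), bdryWeight Q D x * h x ∂μ :=
        lintegral_iUnion_le _ _
    _ ≤ ∑' b : u, ENNReal.ofReal (20 ^ Q * (4 * A)) * (ENNReal.ofReal (t ^ (1 - 1 / θ)) *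
        ∫⁻ y in Metric.closedBall b.1 (lam * r b.1) ∩ L, (bdryWeight Q D y * h y) ^ (1 / θ) ∂μ +
        ∫⁻ y in Metric.closedBall b.1 (lam * r b.1) ∩ L', bdryWeight Q D y * k y ∂μ) :=
        ENNReal.tsum_le_tsum fun b => superlevel_ball_estimate hμ hθ hA hlam hrev ht0
          (hr _ (huG b.2)) (hrd _ (huG b.2)) (hr1 _ (huG b.2)) (hr2 _ (huG b.2))
    _ ≤ _ := by
        rw [ENNReal.tsum_mul_left, ENNReal.tsum_add, ENNReal.tsum_mul_left]
        gcongr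
        · exact hsum L hLm _
        · exact hsum L' hLm' _

/-- **Gehring's lemma** with a boundary weight: a reverse Hölder inequality on the balls in `D`
improves the integrability. -/
theorem gehring [SecondCountableTopology X] [SFinite μ] (hμ : IsHomogeneousMeasure μ κ Q)
    {θ A lam : ℝ} (hθ : 1 < θ) (hA : 1 ≤ A) (hlam : 1 ≤ lam) :
    ∃ σ₁ C : ℝ, 0 < σ₁ ∧ σ₁ ≤ 1 ∧ 0 < C ∧ ∀ (D : Set X) (R : ℝ),
      (∀ x, Metric.infDist x Dᶜ ≤ R) → ∀ h k : X → ℝ≥0∞, Measurable h → Measurable k →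
      ∫⁻ x in D, h x ∂μ ≠ ∞ → ReverseHolderOn μ D θ A lam h k → ∀ σ, 0 < σ → σ ≤ σ₁ →
      ∫⁻ x, (bdryWeight Q D x * h x) ^ (1 + σ) ∂μ ≤ ENNReal.ofReal C *
        ((∫⁻ x in D, h x ∂μ) ^ σ * (ENNReal.ofReal (R ^ Q) * ∫⁻ x in D, h x ∂μ) +
          ENNReal.ofReal (R ^ Q) ^ (1 + σ) * ∫⁻ x in D, k x ^ (1 + σ) ∂μ) := by
  have hQ := hμ.dim_pos
  have hκ := hμ.pos
  have hθ1 : 0 < 1 - 1 / θ := by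
    rw [sub_pos, div_lt_one (by linarith)]; exact hθ
  set c : ℝ := 2 ^ (-θ) / (2 * A) * 2⁻¹ ^ Q with hc
  set C₀ : ℝ := 20 ^ Q * (4 * A) with hC₀
  have hc0 : 0 < c := by positivity
  have hC₀0 : 0 < C₀ := by positivity
  have hc1 : c ≤ 1 := by
    have e1 : (2 : ℝ) ^ (-θ) ≤ 1 := Real.rpow_le_one_of_one_le_of_nonpos one_le_two (by linarith)
    have e2 : (2⁻¹ : ℝ) ^ Q ≤ 1 := Real.rpow_le_one (by norm_num) (by norm_num) hQ.le
    have e3 : (2 : ℝ) ^ (-θ) / (2 * A) ≤ 1 := by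
      rw [div_le_one (by linarith)]; linarith
    exact mul_le_one₀ e3 (by positivity) e2
  set B₀ := C₀ * c⁻¹ ^ 2 / (1 - 1 / θ) with hB₀
  have hB₀0 : 0 < B₀ := by positivity
  set M : ℝ := max 1 (2 ^ Q / κ) with hM
  have hM1 : 1 ≤ M := le_max_left _ _
  refine ⟨min 1 (1 / (2 * B₀)), 2 * (M + C₀ * c⁻¹), by positivity, min_le_left _ _, by positivity,
    fun D R hR h k hh hk hfin hrev σ hσ hσ1 => ?_⟩
  have hσ1' : σ ≤ 1 := hσ1.trans (min_le_left _ _)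
  have hsmall : C₀ * (c⁻¹ ^ 2 * (σ / (1 - 1 / θ))) ≤ 1 / 2 := by
    have e1 : C₀ * (c⁻¹ ^ 2 * (σ / (1 - 1 / θ))) = B₀ * σ := by rw [hB₀]; ring
    rw [e1]
    calc B₀ * σ ≤ B₀ * (1 / (2 * B₀)) := by
          gcongr; exact hσ1.trans (min_le_right _ _)
      _ = 1 / 2 := by field_simp
  have hwm := measurable_bdryWeight Q D
  set I := ∫⁻ x in D, h x ∂μ with hI
  have hone : ∀ f : X → ℝ≥0∞, ∫⁻ x, bdryWeight Q D x * f x ∂μ ≤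
      ENNReal.ofReal (R ^ Q) * ∫⁻ x in D, f x ∂μ := fun f => by
    simpa using lintegral_comp_bdryWeight_le (μ := μ) hQ hR f one_pos
  have key := lintegral_rpow_le_of_superlevel (μ := μ) (hwm.mul hh) (hwm.mul hk)
    (ne_top_of_le_ne_top (ENNReal.mul_ne_top ENNReal.ofReal_ne_top hfin) (hone h)) hθ hc0 hc1 hC₀0.le
    hσ hσ1' (t₀ := 2 ^ Q / κ * I.toReal) (by positivity) hsmall
    (fun t ht => superlevel_estimate hμ hR hh hk hfin hθ hA hlam hrev ht)
  refine key.trans ?_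
  have ht₀ : ENNReal.ofReal (2 ^ Q / κ * I.toReal) ^ σ ≤ ENNReal.ofReal M * I ^ σ := by
    rw [ENNReal.ofReal_mul (by positivity), ENNReal.ofReal_toReal hfin,
      ENNReal.mul_rpow_of_nonneg _ _ hσ.le]
    gcongr
    calc ENNReal.ofReal (2 ^ Q / κ) ^ σ ≤ ENNReal.ofReal M ^ σ := by
          gcongr; exact le_max_right _ _
      _ ≤ ENNReal.ofReal M ^ (1 : ℝ) :=
          ENNReal.rpow_le_rpow_of_exponent_le (by rwa [ENNReal.one_le_ofReal]) hσ1'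
      _ = _ := ENNReal.rpow_one _
  have hKle := lintegral_comp_bdryWeight_le (μ := μ) hQ hR k (a := 1 + σ) (by linarith)
  have e2 : ENNReal.ofReal (2 * (M + C₀ * c⁻¹)) = 2 * ENNReal.ofReal (M + C₀ * c⁻¹) := by
    rw [ENNReal.ofReal_mul two_pos.le, ENNReal.ofReal_ofNat]
  rw [e2, mul_assoc (2 : ℝ≥0∞)]
  refine mul_le_mul' le_rfl ?_
  rw [mul_add]
  refine add_le_add ?_ ?_
  · calc ENNReal.ofReal (2 ^ Q / κ * I.toReal) ^ σ * ∫⁻ x, bdryWeight Q D x * h x ∂μ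
        ≤ (ENNReal.ofReal M * I ^ σ) * (ENNReal.ofReal (R ^ Q) * I) := mul_le_mul' ht₀ (hone h)
      _ = ENNReal.ofReal M * (I ^ σ * (ENNReal.ofReal (R ^ Q) * I)) := by ring
      _ ≤ _ := by gcongr; exact le_add_of_nonneg_right (by positivity)
  · refine mul_le_mul' (ENNReal.ofReal_le_ofReal ?_) hKle
    linarith

end

/-! ### Lowering the exponent in a reverse Hölder inequality -/

/-- Absorption of an interpolated term. Finiteness of `S` is essential. -/
theorem le_of_le_interpolation {S N M c : ℝ≥0∞} (hS : S ≠ ∞) {e : ℝ} (he0 : 0 ≤ e)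
    (he : e < 1) (h : S ≤ c * (S ^ e * N ^ (1 - e)) + M) :
    S ≤ (2 * c) ^ (1 / (1 - e)) * N + 2 * M := by
  have he' : 0 < 1 - e := by linarith
  by_cases hM : S ≤ 2 * M
  · exact hM.trans le_add_self
  rw [not_le] at hM
  have hS0 : S ≠ 0 := ne_bot_of_gt hM
  have h1 : S ≤ S / 2 + c * (S ^ e * N ^ (1 - e)) := by
    refine h.trans ?_
    rw [add_comm]
    gcongr
    rw [ENNReal.le_div_iff_mul_le (Or.inl two_ne_zero) (Or.inl ENNReal.ofNat_ne_top), mul_comm]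
    exact hM.le
  have h2 := ennreal_le_two_mul_of_le_half_add hS h1
  have hSe0 : S ^ e ≠ 0 := (ENNReal.rpow_pos (pos_iff_ne_zero.2 hS0) hS).ne'
  have hSet : S ^ e ≠ ∞ := ENNReal.rpow_ne_top_of_nonneg he0 hS
  have h3 : S ^ (1 - e) ≤ 2 * c * N ^ (1 - e) := by
    have e1 : S ^ e * S ^ (1 - e) ≤ S ^ e * (2 * c * N ^ (1 - e)) := by
      rw [← ENNReal.rpow_add_of_nonneg _ _ he0 he'.le]
      calc S ^ (e + (1 - e)) = S := by simp
        _ ≤ _ := h2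
        _ = _ := by ring
    exact (ENNReal.mul_le_mul_iff_right hSe0 hSet).1 e1
  have h4 := ENNReal.rpow_le_rpow h3 (one_div_nonneg.2 he'.le)
  rw [ENNReal.mul_rpow_of_nonneg _ _ (one_div_nonneg.2 he'.le), ← ENNReal.rpow_mul,
    ← ENNReal.rpow_mul, mul_one_div_cancel he'.ne', ENNReal.rpow_one, ENNReal.rpow_one] at h4
  exact h4.trans le_self_add

/-- Interpolation of the exponent `1 / θ` between `s` and `1`. -/
theorem lintegral_rpow_interpolation {Y : Type*} [MeasurableSpace Y] {ν : Measure Y}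
    {h : Y → ℝ≥0∞} (hh : AEMeasurable h ν) {θ s : ℝ} (hθ : 1 < θ) (hs : 0 < s) (hsθ : s < 1 / θ) :
    (∫⁻ y, h y ^ (1 / θ) ∂ν) ^ θ ≤
      (∫⁻ y, h y ∂ν) ^ ((1 - θ * s) / (1 - s)) *
        ((∫⁻ y, h y ^ s ∂ν) ^ (1 / s)) ^ (1 - (1 - θ * s) / (1 - s)) := by
  have hθ0 : 0 < θ := by linarith
  have hs1 : s < 1 := hsθ.trans ((div_lt_one hθ0).2 hθ)
  have h1s : 0 < 1 - s := by linarith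
  have hθs : θ * s < 1 := by rwa [lt_div_iff₀ hθ0, mul_comm] at hsθ
  set a := (1 / θ - s) / (1 - s) with ha
  set b := (1 - 1 / θ) / (1 - s) with hb
  have ha0 : 0 ≤ a := div_nonneg (by linarith) h1s.le
  have hb0 : 0 ≤ b := by
    refine div_nonneg ?_ h1s.le
    rw [sub_nonneg, div_le_one hθ0]; exact hθ.le
  have hab : a + b = 1 := by rw [ha, hb]; field_simp; ring
  have habs : a + s * b = 1 / θ := by rw [ha, hb]; field_simp; ring
  have key := ENNReal.lintegral_mul_norm_pow_le hh (hh.pow_const s) ha0 hb0 hab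
  have e1 : ∀ y, h y ^ a * (h y ^ s) ^ b = h y ^ (1 / θ) := fun y => by
    rw [← ENNReal.rpow_mul, ← ENNReal.rpow_add_of_nonneg _ _ ha0 (by positivity), habs]
  simp_rw [e1] at key
  refine (ENNReal.rpow_le_rpow key hθ0.le).trans_eq ?_
  rw [ENNReal.mul_rpow_of_nonneg _ _ hθ0.le, ← ENNReal.rpow_mul, ← ENNReal.rpow_mul,
    ← ENNReal.rpow_mul]
  congr 2
  · rw [ha]; field_simp
  · rw [hb]; field_simp; ring

theorem laverage_le_of_lintegral_le {X : Type*} [MetricSpace X] [MeasurableSpace X]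
    {μ : Measure X} {κ Q : ℝ} (hμ : IsHomogeneousMeasure μ κ Q) {f : X → ℝ≥0∞} {x : X} {r : ℝ}
    (hr : 0 < r) {D : Set X} (hD : Metric.closedBall x r ⊆ D) :
    ⨍⁻ y in Metric.closedBall x r, f y ∂μ ≤
      ENNReal.ofReal (κ⁻¹ * r ^ (-Q)) * ∫⁻ y in D, f y ∂μ := by
  have hκ := hμ.pos
  have e : ENNReal.ofReal (κ⁻¹ * r ^ (-Q)) = (ENNReal.ofReal (κ * r ^ Q))⁻¹ := by
    rw [← ENNReal.ofReal_inv_of_pos (by positivity), mul_inv, Real.rpow_neg hr.le]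
  rw [setLAverage_eq, ENNReal.div_eq_inv_mul, hμ.closedBall x r hr, e]
  gcongr

section

variable {X : Type*} [MetricSpace X] [MeasurableSpace X] [BorelSpace X] {μ : Measure X} {κ Q : ℝ}

/-- An integral is controlled by integrals over balls of a fixed radius, by averaging over the
centers. -/
theorem lintegral_le_of_lintegral_closedBall_le [SecondCountableTopology X] [SFinite μ]
    (hμ : IsHomogeneousMeasure μ κ Q) {h : X → ℝ≥0∞} (hh : Measurable h) {E F : Set X}
    (hE : MeasurableSet E) {r : ℝ} (hr : 0 < r) (hEF : ∀ z ∈ E, Metric.closedBall z r ⊆ F)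
    {I : ℝ≥0∞} (hI : ∀ y ∈ F, ∫⁻ z in Metric.closedBall y r, h z ∂μ ≤ I) :
    ENNReal.ofReal (κ * r ^ Q) * ∫⁻ z in E, h z ∂μ ≤ I * μ F := by
  have hm : MeasurableSet {p : X × X | dist p.1 p.2 ≤ r} :=
    measurableSet_le measurable_dist measurable_const
  have e1 : ENNReal.ofReal (κ * r ^ Q) * ∫⁻ z in E, h z ∂μ =
      ∫⁻ z in E, ∫⁻ y, {p : X × X | dist p.1 p.2 ≤ r}.indicator (fun p => h p.1) (z, y) ∂μ ∂μ := by
    rw [← lintegral_const_mul _ hh]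
    refine lintegral_congr fun z => ?_
    have : ∀ y, {p : X × X | dist p.1 p.2 ≤ r}.indicator (fun p => h p.1) (z, y) =
        (Metric.closedBall z r).indicator (fun _ => h z) y := fun y => by
      simp only [indicator, mem_ofPred_eq, Metric.mem_closedBall, dist_comm y z]
    simp_rw [this]
    rw [lintegral_indicator_const measurableSet_closedBall, hμ.closedBall z r hr, mul_comm]
  have e2 : ∫⁻ z in E, ∫⁻ y, {p : X × X | dist p.1 p.2 ≤ r}.indicator (fun p => h p.1) (z, y) ∂μ ∂μ =
      ∫⁻ y, ∫⁻ z in E, {p : X × X | dist p.1 p.2 ≤ r}.indicator (fun p => h p.1) (z, y) ∂μ ∂μ :=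
    lintegral_lintegral_swap ((hh.comp measurable_fst).indicator hm).aemeasurable
  rw [e1, e2]
  refine le_trans (lintegral_mono fun y => ?_) (lintegral_indicator_const_le F I)
  by_cases hy : y ∈ F
  · rw [indicator_of_mem hy]
    refine le_trans ?_ (hI y hy)
    rw [← lintegral_indicator measurableSet_closedBall]
    refine (lintegral_mono' Measure.restrict_le_self le_rfl).trans (lintegral_mono fun z => ?_)
    simp only [indicator, mem_ofPred_eq, Metric.mem_closedBall]
    exact le_rfl
  · rw [indicator_of_notMem hy, nonpos_iff_eq_zero, ← lintegral_zero (μ := μ.restrict E)]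
    refine setLIntegral_congr_fun hE fun z hz => ?_
    refine indicator_of_notMem (fun hd => hy (hEF z hz ?_)) _
    have hd' : dist z y ≤ r := hd
    rwa [Metric.mem_closedBall, dist_comm]

/-- The power `1 / θ` on the right-hand side of a reverse Hölder inequality may be lowered to `s`.
The supremum `S` over `x` of `dist(x, Dᶜ)^(Q/s)` times the average over a ball of radius comparable
to the distance is finite; interpolation and the reverse Hölder inequality bound `S` by `S ^ e` with
`e < 1`, which is absorbed. -/
theorem laverage_le_lower_exponent [SecondCountableTopology X] [SFinite μ]
    (hμ : IsHomogeneousMeasure μ κ Q) {θ A lam s : ℝ} (hθ : 1 < θ) (hA : 1 ≤ A) (hlam : 1 ≤ lam)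
    (hs : 0 < s) (hsθ : s < 1 / θ) :
    ∃ C : ℝ, 0 < C ∧ ∀ (D : Set X) (R : ℝ), (∀ x, Metric.infDist x Dᶜ ≤ R) →
      ∀ h : X → ℝ≥0∞, Measurable h → ∫⁻ x in D, h x ∂μ ≠ ∞ →
      ReverseHolderOn μ D θ A lam h (fun _ => 1) → ∀ x, 0 < Metric.infDist x Dᶜ →
      ENNReal.ofReal (Metric.infDist x Dᶜ ^ (Q / s)) *
          ⨍⁻ y in Metric.closedBall x (Metric.infDist x Dᶜ / (4 * lam)), h y ∂μ ≤
        ENNReal.ofReal C * ((∫⁻ x in D, h x ^ s ∂μ) ^ (1 / s) + ENNReal.ofReal (R ^ (Q / s))) := by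
  have hQ := hμ.dim_pos
  have hκ := hμ.pos
  have hθ0 : 0 < θ := by linarith
  have hs1 : s < 1 := hsθ.trans ((div_lt_one hθ0).2 hθ)
  have hθs : θ * s < 1 := by rwa [lt_div_iff₀ hθ0, mul_comm] at hsθ
  set α := Q / s with hα
  have hα0 : 0 < α := by positivity
  set e := (1 - θ * s) / (1 - s) with he
  have he0 : 0 < e := div_pos (by linarith) (by linarith)
  have he1 : e < 1 := by rw [he, div_lt_one (by linarith)]; nlinarith
  set C₂ : ℝ := 8 ^ Q * 2 ^ α with hC₂
  set C₃ : ℝ := (κ⁻¹ * 4 ^ Q) ^ (1 / s) with hC₃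
  set C₄ : ℝ := A * C₂ ^ e * C₃ ^ (1 - e) with hC₄
  have hC₂0 : 0 < C₂ := by positivity
  have hC₃0 : 0 < C₃ := by positivity
  have hC₄0 : 0 < C₄ := by positivity
  refine ⟨(2 * C₄) ^ (1 / (1 - e)) + 2 * A, by positivity, fun D R hR h hh hfin hrev x hx => ?_⟩
  set J := ∫⁻ x in D, h x ^ s ∂μ with hJ
  set a : X → ℝ≥0∞ := fun x => ENNReal.ofReal (Metric.infDist x Dᶜ ^ α) *
    ⨍⁻ y in Metric.closedBall x (Metric.infDist x Dᶜ / (4 * lam)), h y ∂μ with ha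
  set S := ⨆ (x) (_ : 0 < Metric.infDist x Dᶜ), a x with hS
  have hl4 : 0 < 4 * lam := by linarith
  have hαQ : Q ≤ α := by rw [hα, le_div_iff₀ hs]; nlinarith
  -- crude bound: each average is at most the total mass divided by the volume of the ball
  have hSfin : S ≠ ∞ := by
    refine ne_top_of_le_ne_top (b := ENNReal.ofReal (R ^ (α - Q) * (κ⁻¹ * (4 * lam) ^ Q)) *
      ∫⁻ y in D, h y ∂μ) (ENNReal.mul_ne_top ENNReal.ofReal_ne_top hfin) ?_
    refine iSup₂_le fun z hz => ?_
    set d := Metric.infDist z Dᶜ with hd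
    have hr : 0 < d / (4 * lam) := by positivity
    have e1 := laverage_le_of_lintegral_le hμ (f := h) hr (D := D)
      (closedBall_subset_of_lt_infDist (div_lt_self hz (by linarith)))
    calc a z ≤ ENNReal.ofReal (d ^ α) * (ENNReal.ofReal (κ⁻¹ * (d / (4 * lam)) ^ (-Q)) *
          ∫⁻ y in D, h y ∂μ) := mul_le_mul' le_rfl e1
      _ = ENNReal.ofReal (d ^ (α - Q) * (κ⁻¹ * (4 * lam) ^ Q)) * ∫⁻ y in D, h y ∂μ := by
          rw [← mul_assoc, ← ENNReal.ofReal_mul (by positivity), Real.div_rpow hz.le hl4.le,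
            Real.rpow_neg hz.le, Real.rpow_neg hl4.le, Real.rpow_sub hz]
          congr 2
          field_simp
      _ ≤ _ := by
          gcongr
          exact hR z
  have hmain : S ≤ ENNReal.ofReal C₄ * (S ^ e * (J ^ (1 / s)) ^ (1 - e)) +
      ENNReal.ofReal A * ENNReal.ofReal (R ^ α) := by
    refine iSup₂_le fun z hz => ?_
    set d := Metric.infDist z Dᶜ with hd
    have hr : 0 < d / (4 * lam) := by positivity
    have hle : lam * (d / (4 * lam)) = d / 4 := by field_simp
    have hd4 : 0 < d / 4 := by positivity
    have hsub : Metric.closedBall z (d / 4) ⊆ D := closedBall_subset_of_lt_infDist (by linarith)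
    have e1 := hrev z _ hr (by rw [hle]; exact hsub)
    rw [hle] at e1
    have e2 : (⨍⁻ y in Metric.closedBall z (d / 4), h y ^ (1 / θ) ∂μ) ^ θ ≤ _ :=
      lintegral_rpow_interpolation hh.aemeasurable hθ hs hsθ
    -- the mass of the ball of radius `d / 4` is an average of masses of balls of radius `ρ`, which `S`
    -- bounds
    have e3 : ⨍⁻ y in Metric.closedBall z (d / 4), h y ∂μ ≤ ENNReal.ofReal (C₂ * d ^ (-α)) * S := by
      set ρ := d / (8 * lam) with hρ
      have hρ0 : 0 < ρ := by positivity
      have hρd : ρ ≤ d / 8 := by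
        rw [hρ]; exact div_le_div_of_nonneg_left hz.le (by norm_num) (by linarith)
      have hI : ∀ y ∈ Metric.closedBall z (d / 2), ∫⁻ w in Metric.closedBall y ρ, h w ∂μ ≤
          S * ENNReal.ofReal ((d / 2) ^ (-α) * (κ * (4 * ρ) ^ Q)) := by
        intro y hy
        rw [Metric.mem_closedBall] at hy
        have i1 := Metric.infDist_le_infDist_add_dist (s := Dᶜ) (x := z) (y := y)
        have i2 := Metric.infDist_le_infDist_add_dist (s := Dᶜ) (x := y) (y := z)
        rw [dist_comm z y] at i1
        set d' := Metric.infDist y Dᶜ with hd'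
        have hd'0 : d / 2 ≤ d' := by linarith
        have hd'1 : d' ≤ 2 * d := by linarith
        have hd'p : 0 < d' := by linarith
        have hr' : 0 < d' / (4 * lam) := by positivity
        have hρr : ρ ≤ d' / (4 * lam) := by
          rw [hρ, div_le_div_iff₀ (by positivity) hl4]; nlinarith
        have hrρ : d' / (4 * lam) ≤ 4 * ρ := by
          rw [hρ, div_le_iff₀ hl4]
          have : 4 * (d / (8 * lam)) * (4 * lam) = 2 * d := by field_simp; ring
          linarith
        have haS : a y ≤ S := le_iSup₂_of_le y hd'p le_rfl
        have hμr := hμ.closedBall_ne_zero y hr'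
        have hμt := hμ.closedBall_ne_top y hr'
        have hdα : ENNReal.ofReal (d' ^ (-α)) * ENNReal.ofReal (d' ^ α) = 1 := by
          rw [← ENNReal.ofReal_mul (by positivity), ← Real.rpow_add hd'p]; simp
        calc ∫⁻ w in Metric.closedBall y ρ, h w ∂μ
            ≤ ∫⁻ w in Metric.closedBall y (d' / (4 * lam)), h w ∂μ :=
              lintegral_mono_set (Metric.closedBall_subset_closedBall hρr)
          _ = (⨍⁻ w in Metric.closedBall y (d' / (4 * lam)), h w ∂μ) *
                μ (Metric.closedBall y (d' / (4 * lam))) := by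
              rw [setLAverage_eq, ENNReal.div_mul_cancel hμr hμt]
          _ = ENNReal.ofReal (d' ^ (-α)) * a y * μ (Metric.closedBall y (d' / (4 * lam))) := by
              rw [ha]; dsimp only; rw [← hd', ← mul_assoc, hdα, one_mul]
          _ ≤ ENNReal.ofReal ((d / 2) ^ (-α)) * S * ENNReal.ofReal (κ * (4 * ρ) ^ Q) := by
              rw [hμ.closedBall y _ hr']
              refine mul_le_mul' (mul_le_mul' (ENNReal.ofReal_le_ofReal ?_) haS)
                (ENNReal.ofReal_le_ofReal ?_)
              · exact Real.rpow_le_rpow_of_nonpos (by positivity) hd'0 (by linarith)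
              · gcongr
          _ = _ := by rw [ENNReal.ofReal_mul (p := (d / 2) ^ (-α)) (by positivity)]; ring
      have havg := lintegral_le_of_lintegral_closedBall_le hμ hh
        (E := Metric.closedBall z (d / 4)) (F := Metric.closedBall z (d / 2))
        measurableSet_closedBall hρ0 (fun w hw => Metric.closedBall_subset_closedBall' (by
          rw [Metric.mem_closedBall] at hw; linarith)) hI
      have hd2 : 0 < d / 2 := by positivity
      rw [hμ.closedBall z _ hd2] at havg
      have hκρ : ENNReal.ofReal (κ * ρ ^ Q) ≠ 0 := by
        rw [ne_eq, ENNReal.ofReal_eq_zero, not_le]; positivity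
      rw [setLAverage_eq, ENNReal.div_le_iff (hμ.closedBall_ne_zero z hd4)
        (hμ.closedBall_ne_top z hd4), hμ.closedBall z _ hd4,
        ← ENNReal.mul_le_mul_iff_right hκρ ENNReal.ofReal_ne_top]
      refine havg.trans_eq ?_
      have hreal : (d / 2) ^ (-α) * (κ * (4 * ρ) ^ Q) * (κ * (d / 2) ^ Q) =
          κ * ρ ^ Q * (C₂ * d ^ (-α) * (κ * (d / 4) ^ Q)) := by
        have p1 : (d / 2) ^ (-α) = d ^ (-α) * 2 ^ α := by
          rw [Real.div_rpow hz.le two_pos.le, Real.rpow_neg two_pos.le, div_inv_eq_mul]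
        have p2 : (4 * ρ) ^ Q = 4 ^ Q * ρ ^ Q := Real.mul_rpow (by norm_num) hρ0.le
        have p3 : (d / 2) ^ Q = 2 ^ Q * (d / 4) ^ Q := by
          rw [← Real.mul_rpow two_pos.le hd4.le]; congr 1; ring
        have p4 : (8 : ℝ) ^ Q = 4 ^ Q * 2 ^ Q := by
          rw [← Real.mul_rpow (by norm_num) two_pos.le]; norm_num
        rw [p1, p2, p3, hC₂, p4]; ring
      rw [mul_assoc S, ← ENNReal.ofReal_mul (by positivity), hreal,
        ENNReal.ofReal_mul (by positivity), ENNReal.ofReal_mul (p := C₂ * d ^ (-α)) (by positivity)]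
      ring
    have e4 : (⨍⁻ y in Metric.closedBall z (d / 4), h y ^ s ∂μ) ^ (1 / s) ≤
        ENNReal.ofReal (C₃ * d ^ (-α)) * J ^ (1 / s) := by
      have i1 := laverage_le_of_lintegral_le hμ (f := fun y => h y ^ s) hd4 hsub
      refine (ENNReal.rpow_le_rpow i1 (by positivity)).trans_eq ?_
      rw [ENNReal.mul_rpow_of_nonneg _ _ (by positivity),
        ENNReal.ofReal_rpow_of_nonneg (by positivity) (by positivity)]
      congr 2
      rw [hC₃, Real.div_rpow hz.le (by norm_num), Real.rpow_neg (by norm_num : (0 : ℝ) ≤ 4),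
        div_inv_eq_mul, mul_comm (d ^ (-Q)), ← mul_assoc, Real.mul_rpow (by positivity) (by positivity),
        ← Real.rpow_mul hz.le]
      congr 2
      rw [hα]; ring
    have e5 : (⨍⁻ y in Metric.closedBall z (d / 4), h y ^ (1 / θ) ∂μ) ^ θ ≤
        (ENNReal.ofReal (C₂ * d ^ (-α)) * S) ^ e *
          (ENNReal.ofReal (C₃ * d ^ (-α)) * J ^ (1 / s)) ^ (1 - e) := by
      refine e2.trans (mul_le_mul' (ENNReal.rpow_le_rpow e3 he0.le)
        (ENNReal.rpow_le_rpow e4 (by linarith)))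
    have e6 : ⨍⁻ y in Metric.closedBall z (d / 4), (1 : ℝ≥0∞) ∂μ = 1 := by
      rw [setLAverage_eq]
      simp only [lintegral_const, MeasurableSet.univ, Measure.restrict_apply, univ_inter, one_mul]
      exact ENNReal.div_self (hμ.closedBall_ne_zero z hd4) (hμ.closedBall_ne_top z hd4)
    rw [e6] at e1
    calc a z ≤ ENNReal.ofReal (d ^ α) * (ENNReal.ofReal A *
          ((ENNReal.ofReal (C₂ * d ^ (-α)) * S) ^ e *
          (ENNReal.ofReal (C₃ * d ^ (-α)) * J ^ (1 / s)) ^ (1 - e) + 1)) :=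
          mul_le_mul' le_rfl (e1.trans (by gcongr))
      _ = ENNReal.ofReal C₄ * (S ^ e * (J ^ (1 / s)) ^ (1 - e)) +
          ENNReal.ofReal A * ENNReal.ofReal (d ^ α) := by
          have hreal : C₄ = d ^ α * A * (C₂ * d ^ (-α)) ^ e * (C₃ * d ^ (-α)) ^ (1 - e) := by
            rw [Real.mul_rpow hC₂0.le (by positivity), Real.mul_rpow hC₃0.le (by positivity),
              ← Real.rpow_mul hz.le, ← Real.rpow_mul hz.le, hC₄]
            have : d ^ α * d ^ (-α * e) * d ^ (-α * (1 - e)) = 1 := by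
              rw [← Real.rpow_add hz, ← Real.rpow_add hz,
                show α + -α * e + -α * (1 - e) = 0 by ring, Real.rpow_zero]
            calc A * C₂ ^ e * C₃ ^ (1 - e) = A * C₂ ^ e * C₃ ^ (1 - e) *
                (d ^ α * d ^ (-α * e) * d ^ (-α * (1 - e))) := by rw [this, mul_one]
              _ = _ := by ring
          rw [ENNReal.mul_rpow_of_nonneg _ _ he0.le, ENNReal.mul_rpow_of_nonneg _ _ (by linarith),
            ENNReal.ofReal_rpow_of_nonneg (by positivity) he0.le,
            ENNReal.ofReal_rpow_of_nonneg (by positivity) (by linarith), hreal,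
            ENNReal.ofReal_mul (by positivity), ENNReal.ofReal_mul (by positivity),
            ENNReal.ofReal_mul (by positivity)]
          ring
      _ ≤ _ := by
          gcongr
          exact hR z
  have hfinal := le_of_le_interpolation hSfin he0.le he1 hmain
  refine (le_iSup₂_of_le (f := fun x (_ : 0 < Metric.infDist x Dᶜ) => a x) x hx le_rfl).trans
    (hfinal.trans ?_)
  have h1e : 0 ≤ 1 / (1 - e) := one_div_nonneg.2 (by linarith)
  have e7 : (2 * ENNReal.ofReal C₄) ^ (1 / (1 - e)) = ENNReal.ofReal ((2 * C₄) ^ (1 / (1 - e))) := by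
    rw [← ENNReal.ofReal_rpow_of_nonneg (by positivity) h1e, ENNReal.ofReal_mul two_pos.le,
      ENNReal.ofReal_ofNat]
  have e8 : 2 * (ENNReal.ofReal A * ENNReal.ofReal (R ^ α)) =
      ENNReal.ofReal (2 * A) * ENNReal.ofReal (R ^ α) := by
    rw [ENNReal.ofReal_mul two_pos.le, ENNReal.ofReal_ofNat, mul_assoc]
  rw [e7, e8, mul_add]
  have hp : (0 : ℝ) ≤ (2 * C₄) ^ (1 / (1 - e)) := by positivity
  gcongr
  · linarith
  · linarith

end

theorem rpow_mul_lintegral_le_lintegral_bdryWeight {X : Type*} [MetricSpace X] [MeasurableSpace X]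
    [BorelSpace X] {μ : Measure X} {D : Set X} {h : X → ℝ≥0∞}
    {δ Q t : ℝ} (hδ : 0 ≤ δ) (hQ : 0 ≤ Q) (ht : 0 ≤ t) :
    ENNReal.ofReal (δ ^ Q) ^ t * ∫⁻ x in {x | δ ≤ Metric.infDist x Dᶜ}, h x ^ t ∂μ ≤
      ∫⁻ x, (bdryWeight Q D x * h x) ^ t ∂μ := by
  have hm : MeasurableSet {x | δ ≤ Metric.infDist x Dᶜ} :=
    (isClosed_le continuous_const (Metric.continuous_infDist_pt _)).measurableSet
  rw [← lintegral_const_mul' _ _ (ENNReal.rpow_ne_top_of_nonneg ht ENNReal.ofReal_ne_top)]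
  refine (setLIntegral_mono' hm fun x hx => ?_).trans
    (setLIntegral_le_lintegral {x | δ ≤ Metric.infDist x Dᶜ} _)
  rw [← ENNReal.mul_rpow_of_nonneg _ _ ht]
  have hx' : δ ≤ Metric.infDist x Dᶜ := hx
  unfold bdryWeight
  gcongr

/-- Interior form of Gehring's lemma, at distance comparable to `R` from the complement. -/
theorem gehring_interior {X : Type*} [MetricSpace X] [MeasurableSpace X] [BorelSpace X]
    [SecondCountableTopology X] {μ : Measure X} [SFinite μ] {κ Q : ℝ} (hμ : IsHomogeneousMeasure μ κ Q) {θ A lam : ℝ} (hθ : 1 < θ)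
    (hA : 1 ≤ A) (hlam : 1 ≤ lam) {c : ℝ} (hc : 0 < c) (hc1 : c ≤ 1) :
    ∃ σ₁ C : ℝ, 0 < σ₁ ∧ σ₁ ≤ 1 ∧ 0 < C ∧ ∀ (D : Set X) (R : ℝ), 0 < R →
      (∀ x, Metric.infDist x Dᶜ ≤ R) → ∀ h k : X → ℝ≥0∞, Measurable h → Measurable k →
      ∫⁻ x in D, h x ∂μ ≠ ∞ → ReverseHolderOn μ D θ A lam h k → ∀ σ, 0 < σ → σ ≤ σ₁ →
      ∫⁻ x in {x | c * R ≤ Metric.infDist x Dᶜ}, h x ^ (1 + σ) ∂μ ≤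
        ENNReal.ofReal C * ((ENNReal.ofReal (R ^ (-Q)) * ∫⁻ x in D, h x ∂μ) ^ σ *
          (∫⁻ x in D, h x ∂μ) + ∫⁻ x in D, k x ^ (1 + σ) ∂μ) := by
  obtain ⟨σ₁, C, hσ₁, hσ₁', hC, H⟩ := gehring hμ hθ hA hlam
  have hQ := hμ.dim_pos
  refine ⟨σ₁, C * c ^ (-(2 * Q)), hσ₁, hσ₁', by positivity,
    fun D R hR hdR h k hh hk hfin hrev σ hσ hσ' => ?_⟩
  have h1 := (rpow_mul_lintegral_le_lintegral_bdryWeight (μ := μ) (D := D) (h := h)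
    (δ := c * R) (Q := Q) (t := 1 + σ) (by positivity) hQ.le (by linarith)).trans
      (H D R hdR h k hh hk hfin hrev σ hσ hσ')
  set I := ∫⁻ x in {x | c * R ≤ Metric.infDist x Dᶜ}, h x ^ (1 + σ) ∂μ
  set H₀ := ∫⁻ x in D, h x ∂μ
  set K := ∫⁻ x in D, k x ^ (1 + σ) ∂μ
  have hRQ : 0 < R ^ Q := by positivity
  set b : ℝ := (c ^ Q * R ^ Q) ^ (1 + σ) with hb
  have hb0 : 0 < b := by positivity
  rw [Real.mul_rpow hc.le hR.le, ENNReal.ofReal_rpow_of_nonneg (by positivity) (by linarith),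
    ← hb] at h1
  have hbne : ENNReal.ofReal b ≠ 0 := by rw [ne_eq, ENNReal.ofReal_eq_zero, not_le]; exact hb0
  rw [← ENNReal.mul_le_mul_iff_right hbne ENNReal.ofReal_ne_top]
  refine h1.trans ?_
  have e1 : R ^ Q ≤ b * c ^ (-(2 * Q)) * (R ^ (-Q)) ^ σ := by
    have p1 : (R ^ Q) ^ (1 + σ) * (R ^ (-Q)) ^ σ = R ^ Q := by
      rw [← Real.rpow_mul hR.le, ← Real.rpow_mul hR.le, ← Real.rpow_add hR]; congr 1; ring
    have p2 : 1 ≤ (c ^ Q) ^ (1 + σ) * c ^ (-(2 * Q)) := by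
      rw [← Real.rpow_mul hc.le, ← Real.rpow_add hc]
      exact Real.one_le_rpow_of_pos_of_le_one_of_nonpos hc hc1 (by nlinarith)
    rw [hb, Real.mul_rpow (by positivity) hRQ.le]
    calc R ^ Q = 1 * R ^ Q := by ring
      _ ≤ ((c ^ Q) ^ (1 + σ) * c ^ (-(2 * Q))) * R ^ Q := by gcongr
      _ = _ := by nth_rewrite 1 [← p1]; ring
  have e2 : (R ^ Q) ^ (1 + σ) ≤ b * c ^ (-(2 * Q)) := by
    have p2 : 1 ≤ (c ^ Q) ^ (1 + σ) * c ^ (-(2 * Q)) := by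
      rw [← Real.rpow_mul hc.le, ← Real.rpow_add hc]
      exact Real.one_le_rpow_of_pos_of_le_one_of_nonpos hc hc1 (by nlinarith)
    rw [hb, Real.mul_rpow (by positivity) hRQ.le]
    calc (R ^ Q) ^ (1 + σ) = 1 * (R ^ Q) ^ (1 + σ) := by ring
      _ ≤ ((c ^ Q) ^ (1 + σ) * c ^ (-(2 * Q))) * (R ^ Q) ^ (1 + σ) := by gcongr
      _ = _ := by ring
  rw [ENNReal.ofReal_rpow_of_nonneg hRQ.le (by linarith)]
  calc ENNReal.ofReal C * (H₀ ^ σ * (ENNReal.ofReal (R ^ Q) * H₀) +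
        ENNReal.ofReal ((R ^ Q) ^ (1 + σ)) * K)
      ≤ ENNReal.ofReal C * (H₀ ^ σ * (ENNReal.ofReal (b * c ^ (-(2 * Q)) * (R ^ (-Q)) ^ σ) * H₀) +
        ENNReal.ofReal (b * c ^ (-(2 * Q))) * K) := by gcongr
    _ = _ := by
        rw [ENNReal.mul_rpow_of_nonneg _ _ hσ.le,
          ENNReal.ofReal_rpow_of_nonneg (by positivity) hσ.le,
          ENNReal.ofReal_mul (p := b * c ^ (-(2 * Q))) (by positivity),
          ENNReal.ofReal_mul hb0.le, ENNReal.ofReal_mul hC.le]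
        ring

/-- Higher integrability with a low power of `h` on the right-hand side, the right-hand side of the
reverse Hölder inequality being constant. -/
theorem gehring_lower_exponent {X : Type*} [MetricSpace X] [MeasurableSpace X] [BorelSpace X]
    [SecondCountableTopology X] {μ : Measure X} [SFinite μ] {κ Q : ℝ}
    (hμ : IsHomogeneousMeasure μ κ Q) {θ A lam : ℝ} (hθ : 1 < θ)
    (hA : 1 ≤ A) (hlam : 1 ≤ lam) {c : ℝ} (hc : 0 < c) (hc1 : c ≤ 1) {s : ℝ} (hs : 0 < s)
    (hsθ : s < 1 / θ) :
    ∃ σ₁ C : ℝ, 0 < σ₁ ∧ σ₁ ≤ 1 ∧ 0 < C ∧ ∀ (D : Set X) (R : ℝ), 0 < R →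
      (∀ x, Metric.infDist x Dᶜ ≤ R) → μ D ≤ ENNReal.ofReal (κ * R ^ Q) →
      ∀ h : X → ℝ≥0∞, Measurable h →
      ∫⁻ x in D, h x ∂μ ≠ ∞ → ReverseHolderOn μ D θ A lam h (fun _ => 1) → ∀ σ, 0 < σ → σ ≤ σ₁ →
      ∫⁻ x in {x | c * R ≤ Metric.infDist x Dᶜ}, h x ^ (1 + σ) ∂μ ≤
        ENNReal.ofReal C * ENNReal.ofReal (R ^ Q) *
          ((ENNReal.ofReal (R ^ (-Q)) * ∫⁻ x in D, h x ^ s ∂μ) ^ (1 / s) + 1) ^ (1 + σ) := by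
  obtain ⟨σ₁, C, hσ₁, hσ₁', hC, H⟩ := gehring_interior hμ hθ hA hlam (half_pos hc) (by linarith)
  obtain ⟨C₁, hC₁, H₁⟩ := laverage_le_lower_exponent hμ hθ hA hlam hs hsθ
  have hQ := hμ.dim_pos
  have hκ := hμ.pos
  set M : ℝ := (c / (16 * lam)) ^ (-Q) * κ * (C₁ * (c / 4) ^ (-(Q / s))) with hM
  have hM0 : 0 < M := by positivity
  set M₁ := max M 1 with hM₁
  have hM₁0 : 0 < M₁ := by positivity
  refine ⟨σ₁, C * (M₁ ^ (2 : ℝ) + κ), hσ₁, hσ₁', by positivity,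
    fun D R hR hdR hμD h hh hfin hrev σ hσ hσ' => ?_⟩
  set J := ∫⁻ x in D, h x ^ s ∂μ with hJ
  set T := (ENNReal.ofReal (R ^ (-Q)) * J) ^ (1 / s) + 1 with hT
  have hRQ : 0 < R ^ Q := by positivity
  rcases eq_empty_or_nonempty Dᶜ with hDe | hDne
  · have : {x | c * R ≤ Metric.infDist x Dᶜ} = ∅ := by
      ext x
      simp only [hDe, Metric.infDist_empty, mem_ofPred_eq, mem_empty_iff_false, iff_false, not_le]
      positivity
    rw [this]; simp
  set D' := {x | c * R / 2 < Metric.infDist x Dᶜ} with hD'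
  have hD'm : MeasurableSet D' :=
    (isOpen_lt continuous_const (Metric.continuous_infDist_pt _)).measurableSet
  have hD'D : D' ⊆ D := fun x hx => mem_of_infDist_compl_pos (lt_trans (by positivity) hx)
  have hDc : Dᶜ ⊆ D'ᶜ := compl_subset_compl.2 hD'D
  have hcl : ∀ x, Metric.infDist x D'ᶜ ≤ R := fun x =>
    (Metric.infDist_le_infDist_of_subset hDc hDne).trans (hdR x)
  have hsub : {x | c * R ≤ Metric.infDist x Dᶜ} ⊆ {x | c / 2 * R ≤ Metric.infDist x D'ᶜ} := by
    intro x hx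
    refine (Metric.le_infDist (hDne.mono hDc)).2 fun y hy => ?_
    have hy' : Metric.infDist y Dᶜ ≤ c * R / 2 := not_lt.1 hy
    have := Metric.infDist_le_infDist_add_dist (s := Dᶜ) (x := x) (y := y)
    have hx' : c * R ≤ Metric.infDist x Dᶜ := hx
    linarith
  -- the mass of `h` in `D'`
  set r := c * R / (16 * lam) with hr
  have hr0 : 0 < r := by positivity
  have hrle : r ≤ c * R / 16 := by
    rw [hr]; exact div_le_div_of_nonneg_left (by positivity) (by norm_num) (by linarith)
  have hmass : ∫⁻ x in D', h x ∂μ ≤ ENNReal.ofReal (M * R ^ Q) * T := by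
    set F := {x | c * R / 4 < Metric.infDist x Dᶜ} with hF
    have hFD : F ⊆ D := fun x hx => mem_of_infDist_compl_pos (lt_trans (by positivity) hx)
    have hI : ∀ y ∈ F, ∫⁻ z in Metric.closedBall y r, h z ∂μ ≤
        ENNReal.ofReal (C₁ * (c / 4) ^ (-(Q / s)) * (κ * R ^ Q)) * T := by
      intro y hy
      have hy' : c * R / 4 < Metric.infDist y Dᶜ := hy
      have hdRy := hdR y
      have hH₁ := H₁ D R hdR h hh hfin hrev y (lt_trans (by positivity) hy')
      set d := Metric.infDist y Dᶜ with hd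
      have hd0 : 0 < d := lt_trans (by positivity) hy'
      have hl4 : 0 < 4 * lam := by linarith
      have hr' : 0 < d / (4 * lam) := by positivity
      have hrr : r ≤ d / (4 * lam) := by
        rw [hr, div_le_div_iff₀ (by positivity) hl4]; nlinarith
      have hdα : ENNReal.ofReal (d ^ (-(Q / s))) * ENNReal.ofReal (d ^ (Q / s)) = 1 := by
        rw [← ENNReal.ofReal_mul (by positivity), ← Real.rpow_add hd0]; simp
      have hTJ : ENNReal.ofReal (R ^ (-(Q / s))) *
          (J ^ (1 / s) + ENNReal.ofReal (R ^ (Q / s))) = T := by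
        rw [hT, mul_add, ← ENNReal.ofReal_mul (by positivity), ← Real.rpow_add hR, neg_add_cancel,
          Real.rpow_zero, ENNReal.ofReal_one, ENNReal.mul_rpow_of_nonneg _ _ (by positivity),
          ENNReal.ofReal_rpow_of_nonneg (by positivity) (by positivity), ← Real.rpow_mul hR.le]
        congr 4; ring
      set Av := ⨍⁻ w in Metric.closedBall y (d / (4 * lam)), h w ∂μ with hAv
      calc ∫⁻ w in Metric.closedBall y r, h w ∂μ
          ≤ ∫⁻ w in Metric.closedBall y (d / (4 * lam)), h w ∂μ :=
            lintegral_mono_set (Metric.closedBall_subset_closedBall hrr)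
        _ = Av * μ (Metric.closedBall y (d / (4 * lam))) := by
            rw [hAv, setLAverage_eq, ENNReal.div_mul_cancel (hμ.closedBall_ne_zero y hr')
              (hμ.closedBall_ne_top y hr')]
        _ = ENNReal.ofReal (d ^ (-(Q / s))) * (ENNReal.ofReal (d ^ (Q / s)) * Av) *
              ENNReal.ofReal (κ * (d / (4 * lam)) ^ Q) := by
            rw [← mul_assoc, hdα, one_mul, hμ.closedBall y _ hr']
        _ ≤ ENNReal.ofReal ((c * R / 4) ^ (-(Q / s))) * (ENNReal.ofReal C₁ *
              (J ^ (1 / s) + ENNReal.ofReal (R ^ (Q / s)))) * ENNReal.ofReal (κ * R ^ Q) := by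
            refine mul_le_mul' (mul_le_mul' (ENNReal.ofReal_le_ofReal ?_) hH₁)
              (ENNReal.ofReal_le_ofReal ?_)
            · exact Real.rpow_le_rpow_of_nonpos (by positivity) hy'.le (by
                rw [neg_nonpos]; positivity)
            · have : d / (4 * lam) ≤ R := (div_le_self hd0.le (by linarith)).trans hdRy
              gcongr
        _ = _ := by
            rw [← hTJ, show c * R / 4 = c / 4 * R by ring,
              Real.mul_rpow (by positivity) hR.le, ENNReal.ofReal_mul (by positivity),
              ENNReal.ofReal_mul (p := C₁ * _) (by positivity), ENNReal.ofReal_mul hC₁.le]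
            ring
    have havg := lintegral_le_of_lintegral_closedBall_le hμ hh hD'm hr0 (F := F) (fun z hz w hw => by
      have h1 := Metric.infDist_le_infDist_add_dist (s := Dᶜ) (x := z) (y := w)
      rw [Metric.mem_closedBall, dist_comm] at hw
      have hz' : c * R / 2 < Metric.infDist z Dᶜ := hz
      have : 0 < c * R := by positivity
      show c * R / 4 < _
      linarith) hI
    have hκr : ENNReal.ofReal (κ * r ^ Q) ≠ 0 := by
      rw [ne_eq, ENNReal.ofReal_eq_zero, not_le]; positivity
    rw [← ENNReal.mul_le_mul_iff_right hκr ENNReal.ofReal_ne_top]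
    refine havg.trans ((mul_le_mul' le_rfl ((measure_mono hFD).trans hμD)).trans_eq ?_)
    have hreal : C₁ * (c / 4) ^ (-(Q / s)) * (κ * R ^ Q) * (κ * R ^ Q) =
        κ * r ^ Q * (M * R ^ Q) := by
      have p1 : r ^ Q = (c / (16 * lam)) ^ Q * R ^ Q := by
        rw [← Real.mul_rpow (by positivity) hR.le]; congr 1; rw [hr]; ring
      have p2 : (c / (16 * lam)) ^ Q * (c / (16 * lam)) ^ (-Q) = 1 := by
        rw [← Real.rpow_add (by positivity)]; simp
      rw [p1, hM]
      linear_combination (-(κ ^ 2 * R ^ Q * R ^ Q * (C₁ * (c / 4) ^ (-(Q / s))))) * p2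
    rw [mul_right_comm, ← ENNReal.ofReal_mul (by positivity), hreal,
      ENNReal.ofReal_mul (p := κ * r ^ Q) (by positivity), mul_assoc]
  have hT1 : 1 ≤ T := le_add_self
  have hmain := H D' R hR hcl h (fun _ => 1) hh measurable_const
    (ne_top_of_le_ne_top hfin (lintegral_mono_set hD'D))
    (fun x ρ hρ hx => hrev x ρ hρ (hx.trans hD'D)) σ hσ hσ'
  refine ((lintegral_mono_set hsub).trans hmain).trans ?_
  have hM1 : M ≤ M₁ := le_max_left _ _
  have hM11 : 1 ≤ M₁ := le_max_right _ _
  have e1 : ENNReal.ofReal (R ^ (-Q)) * ∫⁻ x in D', h x ∂μ ≤ ENNReal.ofReal M₁ * T := by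
    refine (mul_le_mul' le_rfl hmass).trans ?_
    rw [← mul_assoc, ← ENNReal.ofReal_mul (by positivity)]
    gcongr
    rw [mul_comm M, ← mul_assoc, ← Real.rpow_add hR, neg_add_cancel, Real.rpow_zero, one_mul]
    exact hM1
  have e2 : ∫⁻ x in D', h x ∂μ ≤ ENNReal.ofReal M₁ * ENNReal.ofReal (R ^ Q) * T := by
    refine hmass.trans ?_
    rw [← ENNReal.ofReal_mul hM₁0.le]
    gcongr
  have e3 : ∫⁻ x in D', (1 : ℝ≥0∞) ^ (1 + σ) ∂μ ≤ ENNReal.ofReal κ * ENNReal.ofReal (R ^ Q) := by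
    simp only [ENNReal.one_rpow, lintegral_const, MeasurableSet.univ, Measure.restrict_apply,
      univ_inter, one_mul]
    rw [← ENNReal.ofReal_mul hκ.le]
    exact (measure_mono hD'D).trans hμD
  have e4 : (ENNReal.ofReal M₁ * T) ^ σ * (ENNReal.ofReal M₁ * ENNReal.ofReal (R ^ Q) * T) ≤
      ENNReal.ofReal (M₁ ^ (2 : ℝ)) * ENNReal.ofReal (R ^ Q) * T ^ (1 + σ) := by
    have : (ENNReal.ofReal M₁ * T) ^ σ * (ENNReal.ofReal M₁ * ENNReal.ofReal (R ^ Q) * T) =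
        ENNReal.ofReal M₁ ^ (1 + σ) * ENNReal.ofReal (R ^ Q) * T ^ (1 + σ) := by
      rw [ENNReal.mul_rpow_of_nonneg _ _ hσ.le, ENNReal.rpow_add_of_nonneg _ _ zero_le_one hσ.le,
        ENNReal.rpow_add_of_nonneg _ _ zero_le_one hσ.le, ENNReal.rpow_one, ENNReal.rpow_one]
      ring
    rw [this, ENNReal.ofReal_rpow_of_nonneg hM₁0.le (by linarith)]
    gcongr
    linarith
  calc _ ≤ ENNReal.ofReal C * ((ENNReal.ofReal M₁ * T) ^ σ *
        (ENNReal.ofReal M₁ * ENNReal.ofReal (R ^ Q) * T) +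
          ENNReal.ofReal κ * ENNReal.ofReal (R ^ Q)) := by gcongr
    _ ≤ ENNReal.ofReal C * (ENNReal.ofReal (M₁ ^ (2 : ℝ)) * ENNReal.ofReal (R ^ Q) * T ^ (1 + σ) +
          ENNReal.ofReal κ * ENNReal.ofReal (R ^ Q) * T ^ (1 + σ)) := by
        refine mul_le_mul' le_rfl (add_le_add e4 ?_)
        exact le_mul_of_one_le_right zero_le (ENNReal.one_le_rpow hT1 (by linarith))
    _ = _ := by
        rw [ENNReal.ofReal_mul hC.le, ENNReal.ofReal_add (by positivity) hκ.le]
        ring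

/-! ### From an `L¹` Poincaré inequality to a Sobolev-Poincaré inequality -/

/-- Jensen for a measure of mass at most one. -/
theorem rpow_lintegral_le {Y : Type*} [MeasurableSpace Y] {ν : Measure Y} {f : Y → ℝ≥0∞}
    (hf : AEMeasurable f ν) (hν : ν univ ≤ 1) {P : ℝ} (hP : 1 ≤ P) :
    (∫⁻ y, f y ∂ν) ^ P ≤ ∫⁻ y, f y ^ P ∂ν := by
  have hP0 : 0 < P := by linarith
  have h := ENNReal.lintegral_mul_norm_pow_le (hf.pow_const P)
    (aemeasurable_const (b := (1 : ℝ≥0∞))) (p := 1 / P) (q := 1 - 1 / P)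
    (by positivity) (by rw [sub_nonneg, div_le_one hP0]; exact hP) (by ring)
  have e1 : ∀ y, (f y ^ P) ^ (1 / P) * (1 : ℝ≥0∞) ^ (1 - 1 / P) = f y := fun y => by
    rw [← ENNReal.rpow_mul, mul_one_div_cancel hP0.ne', ENNReal.rpow_one, ENNReal.one_rpow, mul_one]
  simp_rw [e1, lintegral_one] at h
  have h2 : ∫⁻ y, f y ∂ν ≤ (∫⁻ y, f y ^ P ∂ν) ^ (1 / P) :=
    h.trans (mul_le_of_le_one_right zero_le (ENNReal.rpow_le_one hν
      (by rw [sub_nonneg, div_le_one hP0]; exact hP)))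
  refine (ENNReal.rpow_le_rpow h2 hP0.le).trans_eq ?_
  rw [← ENNReal.rpow_mul, one_div_mul_cancel hP0.ne', ENNReal.rpow_one]

theorem rpow_laverage_le {Y : Type*} [MeasurableSpace Y] {ν : Measure Y} {f : Y → ℝ≥0∞}
    (hf : AEMeasurable f ν) {P : ℝ} (hP : 1 ≤ P) :
    (⨍⁻ y, f y ∂ν) ^ P ≤ ⨍⁻ y, f y ^ P ∂ν :=
  rpow_lintegral_le (hf.smul_measure _) (by simp [ENNReal.inv_mul_le_one]) hP

theorem rpow_tsum_mul_le {w a : ℕ → ℝ≥0∞} (hw : ∑' k, w k ≤ 1) {P : ℝ} (hP : 1 ≤ P) :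
    (∑' k, w k * a k) ^ P ≤ ∑' k, w k * a k ^ P := by
  have h := rpow_lintegral_le (ν := Measure.count.withDensity w) (f := a)
    (measurable_of_countable a).aemeasurable (by
      rw [withDensity_apply _ MeasurableSet.univ, Measure.restrict_univ, lintegral_count]
      exact hw) hP
  rw [lintegral_withDensity_eq_lintegral_mul _ (measurable_of_countable w)
    (measurable_of_countable a), lintegral_withDensity_eq_lintegral_mul _
    (measurable_of_countable w) (measurable_of_countable _), lintegral_count, lintegral_count] at h
  exact h

/-- The `L¹` Poincaré inequality, with enlarged balls on the right-hand side, on all balls whose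
enlargement lies in `D`. -/
def PoincareOn {X : Type*} [MetricSpace X] [MeasurableSpace X] (μ : Measure X) (D : Set X)
    (C lam : ℝ) (u : X → ℝ) (g : X → ℝ≥0∞) : Prop :=
  ∀ x r, 0 < r → Metric.closedBall x (lam * r) ⊆ D →
    ⨍⁻ y in Metric.closedBall x r, ‖u y - ⨍ z in Metric.closedBall x r, u z ∂μ‖ₑ ∂μ ≤
      ENNReal.ofReal (C * r) * ⨍⁻ y in Metric.closedBall x (lam * r), g y ∂μ

theorem enorm_setAverage_sub_le {Y : Type*} [MeasurableSpace Y] {ν : Measure Y} {s : Set Y}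
    {u : Y → ℝ} (hu : IntegrableOn u s ν) (hs0 : ν s ≠ 0) (hs : ν s ≠ ∞) (c : ℝ) :
    ‖(⨍ y in s, u y ∂ν) - c‖ₑ ≤ ⨍⁻ y in s, ‖u y - c‖ₑ ∂ν := by
  have : IsFiniteMeasure (ν.restrict s) := ⟨by simpa using hs.lt_top⟩
  have : NeZero (ν.restrict s) := ⟨by rwa [ne_eq, Measure.restrict_eq_zero]⟩
  have e : (⨍ y in s, u y ∂ν) - c = ⨍ y in s, (u y - c) ∂ν := by
    have h1 : IsFiniteMeasure (((ν.restrict s) univ)⁻¹ • ν.restrict s) := by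
      refine ⟨?_⟩
      simp only [Measure.smul_apply, smul_eq_mul, Measure.restrict_apply_univ]
      exact (ENNReal.inv_mul_le_one _).trans_lt ENNReal.one_lt_top
    unfold average
    rw [integral_sub (hu.smul_measure (by simpa using hs0)) (integrable_const _)]
    congr 1
    exact (average_const (ν.restrict s) c).symm
  rw [e]
  exact enorm_integral_le_lintegral_enorm _

section

variable {X : Type*} [MetricSpace X] [MeasurableSpace X] {μ : Measure X} {κ Q : ℝ}

theorem laverage_closedBall_le_mul (hμ : IsHomogeneousMeasure μ κ Q) {f : X → ℝ≥0∞} {x y : X}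
    {r s : ℝ} (hs : 0 < s) (hrs : r ≤ 2 * s)
    (hsub : Metric.closedBall y s ⊆ Metric.closedBall x r) (hr : 0 < r) :
    ⨍⁻ z in Metric.closedBall y s, f z ∂μ ≤
      ENNReal.ofReal (2 ^ Q) * ⨍⁻ z in Metric.closedBall x r, f z ∂μ := by
  have hQ := hμ.dim_pos
  have hκ := hμ.pos
  rw [setLAverage_eq, ENNReal.div_le_iff (hμ.closedBall_ne_zero y hs) (hμ.closedBall_ne_top y hs)]
  calc ∫⁻ z in Metric.closedBall y s, f z ∂μ ≤ ∫⁻ z in Metric.closedBall x r, f z ∂μ :=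
        lintegral_mono_set hsub
    _ = (⨍⁻ z in Metric.closedBall x r, f z ∂μ) * μ (Metric.closedBall x r) := by
        rw [setLAverage_eq, ENNReal.div_mul_cancel (hμ.closedBall_ne_zero x hr)
          (hμ.closedBall_ne_top x hr)]
    _ ≤ (⨍⁻ z in Metric.closedBall x r, f z ∂μ) *
        (ENNReal.ofReal (2 ^ Q) * μ (Metric.closedBall y s)) := by
        rw [hμ.closedBall x r hr, hμ.closedBall y s hs, ← ENNReal.ofReal_mul (by positivity)]
        refine mul_le_mul' le_rfl (ENNReal.ofReal_le_ofReal ?_)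
        calc κ * r ^ Q ≤ κ * (2 * s) ^ Q := by gcongr
          _ = _ := by rw [Real.mul_rpow two_pos.le hs.le]; ring
    _ = _ := by ring

/-- Averaging over balls of a fixed radius does not increase the integral, because all balls of
that radius have the same measure. -/
theorem lintegral_laverage_closedBall_le [BorelSpace X] [SecondCountableTopology X] [SFinite μ]
    (hμ : IsHomogeneousMeasure μ κ Q) {f : X → ℝ≥0∞} (hf : Measurable f) {E D : Set X}
    (hE : MeasurableSet E) {r : ℝ} (hr : 0 < r)
    (hED : ∀ y ∈ E, Metric.closedBall y r ⊆ D) :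
    ∫⁻ y in E, ⨍⁻ z in Metric.closedBall y r, f z ∂μ ∂μ ≤ ∫⁻ z in D, f z ∂μ := by
  have hκ := hμ.pos
  have hm : MeasurableSet {p : X × X | dist p.1 p.2 ≤ r} :=
    measurableSet_le measurable_dist measurable_const
  set V := ENNReal.ofReal (κ * r ^ Q) with hV
  have hV0 : V ≠ 0 := by rw [hV, ne_eq, ENNReal.ofReal_eq_zero, not_le]; positivity
  have hVt : V ≠ ∞ := ENNReal.ofReal_ne_top
  have e1 : ∫⁻ y in E, ⨍⁻ z in Metric.closedBall y r, f z ∂μ ∂μ =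
      V⁻¹ * ∫⁻ y in E, ∫⁻ z in D, {p : X × X | dist p.1 p.2 ≤ r}.indicator (fun p => f p.2) (y, z)
        ∂μ ∂μ := by
    rw [← lintegral_const_mul' _ _ (ENNReal.inv_ne_top.2 hV0)]
    refine setLIntegral_congr_fun hE fun y hy => ?_
    rw [setLAverage_eq, hμ.closedBall y r hr, ENNReal.div_eq_inv_mul]
    congr 1
    have : ∀ z, {p : X × X | dist p.1 p.2 ≤ r}.indicator (fun p => f p.2) (y, z) =
        (Metric.closedBall y r).indicator f z := fun z => by
      simp only [indicator, mem_ofPred_eq, Metric.mem_closedBall, dist_comm z y]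
    simp_rw [this]
    rw [lintegral_indicator measurableSet_closedBall,
      Measure.restrict_restrict measurableSet_closedBall, inter_eq_left.2 (hED y hy)]
  have e2 : ∫⁻ y in E, ∫⁻ z in D, {p : X × X | dist p.1 p.2 ≤ r}.indicator (fun p => f p.2) (y, z)
        ∂μ ∂μ = ∫⁻ z in D, ∫⁻ y in E,
          {p : X × X | dist p.1 p.2 ≤ r}.indicator (fun p => f p.2) (y, z) ∂μ ∂μ :=
    lintegral_lintegral_swap ((hf.comp measurable_snd).indicator hm).aemeasurable
  rw [e1, e2]
  rw [← ENNReal.mul_le_mul_iff_right hV0 hVt, ← mul_assoc, ENNReal.mul_inv_cancel hV0 hVt, one_mul,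
    ← lintegral_const_mul _ hf]
  refine lintegral_mono fun z => ?_
  have : ∀ y, {p : X × X | dist p.1 p.2 ≤ r}.indicator (fun p => f p.2) (y, z) =
      (Metric.closedBall z r).indicator (fun _ => f z) y := fun y => by
    simp only [indicator, mem_ofPred_eq, Metric.mem_closedBall]
  simp_rw [this]
  refine (lintegral_mono' Measure.restrict_le_self le_rfl).trans ?_
  rw [lintegral_indicator_const measurableSet_closedBall, hμ.closedBall z r hr, mul_comm]

/-- Telescoping along shrinking balls at a Lebesgue point. -/
theorem ae_enorm_sub_le_tsum [BorelSpace X] [SecondCountableTopology X]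
    (hμ : IsHomogeneousMeasure μ κ Q) {u : X → ℝ} (hu : Integrable u μ) {g : X → ℝ≥0∞}
    {D : Set X} {C lam : ℝ} (hlam : 1 ≤ lam) (hP : PoincareOn μ D C lam u g)
    {x : X} {r : ℝ} (hr : 0 < r) (hD : Metric.closedBall x ((4 * lam + 2) * r) ⊆ D) :
    ∀ᵐ y ∂μ.restrict (Metric.closedBall x (2 * r)),
      ‖u y - ⨍ z in Metric.closedBall x (2 * r), u z ∂μ‖ₑ ≤
        ∑' k : ℕ, ENNReal.ofReal (2 * 2 ^ Q * (C * (4 * r * (1 / 2) ^ k))) *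
          ⨍⁻ z in Metric.closedBall y (lam * (4 * r * (1 / 2) ^ k)), g z ∂μ := by
  have := hμ.isUnifLocDoublingMeasure
  have := hμ.isLocallyFiniteMeasure
  have hQ := hμ.dim_pos
  filter_upwards [ae_restrict_of_ae (IsUnifLocDoublingMeasure.ae_tendsto_average μ
    hu.locallyIntegrable 1), ae_restrict_mem measurableSet_closedBall] with y hy hyx
  set ρ : ℕ → ℝ := fun k => 4 * r * (1 / 2) ^ k with hρ
  have hρ0 : ∀ k, 0 < ρ k := fun k => by positivity
  have hρs : ∀ k, ρ k = 2 * ρ (k + 1) := fun k => by simp only [hρ, pow_succ]; ring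
  have hρ4 : ∀ k, ρ k ≤ 4 * r := fun k => by
    have : ((1 : ℝ) / 2) ^ k ≤ 1 := pow_le_one₀ (by norm_num) (by norm_num)
    simp only [hρ]; nlinarith
  have hρt : Tendsto ρ atTop (𝓝[>] 0) := by
    refine tendsto_nhdsWithin_iff.2 ⟨?_, Eventually.of_forall hρ0⟩
    have := (tendsto_pow_atTop_nhds_zero_of_lt_one (r := (1 : ℝ) / 2) (by norm_num)
      (by norm_num)).const_mul (4 * r)
    simpa [hρ] using this
  have hlim := hy (fun _ => y) ρ hρt (Eventually.of_forall fun k =>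
    Metric.mem_closedBall_self (by have := hρ0 k; linarith))
  set m : ℕ → ℝ := fun k => ⨍ z in Metric.closedBall y (ρ k), u z ∂μ with hm
  have hPk : ∀ k, ⨍⁻ z in Metric.closedBall y (ρ k), ‖u z - m k‖ₑ ∂μ ≤
      ENNReal.ofReal (C * ρ k) * ⨍⁻ z in Metric.closedBall y (lam * ρ k), g z ∂μ := fun k => by
    refine hP y (ρ k) (hρ0 k) ((Metric.closedBall_subset_closedBall' ?_).trans hD)
    have h1 := hρ4 k
    rw [Metric.mem_closedBall] at hyx
    nlinarith
  have hstep : ∀ k, edist (m k) (m (k + 1)) ≤ ENNReal.ofReal (2 ^ Q * (C * ρ k)) *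
      ⨍⁻ z in Metric.closedBall y (lam * ρ k), g z ∂μ := fun k => by
    rw [edist_comm, edist_eq_enorm_sub]
    refine (enorm_setAverage_sub_le hu.integrableOn (hμ.closedBall_ne_zero y (hρ0 _))
      (hμ.closedBall_ne_top y (hρ0 _)) (m k)).trans ?_
    refine (laverage_closedBall_le_mul hμ (hρ0 _) (hρs k).le (Metric.closedBall_subset_closedBall
      (by rw [hρs k]; linarith [hρ0 (k + 1)])) (hρ0 k)).trans ?_
    rw [ENNReal.ofReal_mul (by positivity), mul_assoc]
    gcongr
    exact hPk k
  have htele := edist_le_tsum_of_edist_le_of_tendsto₀ _ hstep hlim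
  have hfirst : ‖(⨍ z in Metric.closedBall x (2 * r), u z ∂μ) - m 0‖ₑ ≤
      ENNReal.ofReal (2 ^ Q * (C * ρ 0)) * ⨍⁻ z in Metric.closedBall y (lam * ρ 0), g z ∂μ := by
    have hr2 : 0 < 2 * r := by positivity
    refine (enorm_setAverage_sub_le hu.integrableOn (hμ.closedBall_ne_zero x hr2)
      (hμ.closedBall_ne_top x hr2) (m 0)).trans ?_
    have h40 : ρ 0 = 4 * r := by simp [hρ]
    refine (laverage_closedBall_le_mul hμ hr2 (r := ρ 0) (x := y) (by rw [h40]; linarith)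
      (Metric.closedBall_subset_closedBall' ?_) (hρ0 0)).trans ?_
    · rw [Metric.mem_closedBall, dist_comm] at hyx
      rw [h40]; linarith
    rw [ENNReal.ofReal_mul (by positivity), mul_assoc]
    gcongr
    exact hPk 0
  have hfirst' := hfirst.trans (ENNReal.le_tsum (f := fun k => ENNReal.ofReal (2 ^ Q * (C * ρ k)) *
      ⨍⁻ z in Metric.closedBall y (lam * ρ k), g z ∂μ) 0)
  rw [edist_comm, edist_eq_enorm_sub] at htele
  rw [← edist_eq_enorm_sub, edist_comm, edist_eq_enorm_sub] at hfirst'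
  have e2 : ∀ k, ENNReal.ofReal (2 * 2 ^ Q * (C * ρ k)) *
      ⨍⁻ z in Metric.closedBall y (lam * ρ k), g z ∂μ = 2 * (ENNReal.ofReal (2 ^ Q * (C * ρ k)) *
      ⨍⁻ z in Metric.closedBall y (lam * ρ k), g z ∂μ) := fun k => by
    rw [mul_assoc, ENNReal.ofReal_mul two_pos.le, ENNReal.ofReal_ofNat, mul_assoc]
  rw [tsum_congr e2, ENNReal.tsum_mul_left]
  refine le_of_le_of_eq ?_ (two_mul _).symm
  calc ‖u y - ⨍ z in Metric.closedBall x (2 * r), u z ∂μ‖ₑ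
      = ‖(u y - m 0) + (m 0 - ⨍ z in Metric.closedBall x (2 * r), u z ∂μ)‖ₑ := by
        rw [sub_add_sub_cancel]
    _ ≤ _ := (enorm_add_le _ _).trans (add_le_add htele hfirst')

/-- Part of the power is spent on the crude bound of an average by the total mass. This gains the
integrability exponent `θ` in the Sobolev-Poincaré inequality, at the cost of `r ^ (-Q (θ - 1))`. -/
theorem rpow_laverage_closedBall_le (hμ : IsHomogeneousMeasure μ κ Q) {g : X → ℝ≥0∞}
    (hg : Measurable g) {D : Set X} {y : X} {r : ℝ} (hr : 0 < r)
    (hD : Metric.closedBall y r ⊆ D) {θ P : ℝ} (hθ : 1 ≤ θ) (hP : θ ≤ P) :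
    (⨍⁻ z in Metric.closedBall y r, g z ∂μ) ^ P ≤
      (ENNReal.ofReal (κ⁻¹ * r ^ (-Q)) * ∫⁻ z in D, g z ^ (P / θ) ∂μ) ^ (θ - 1) *
        ⨍⁻ z in Metric.closedBall y r, g z ^ (P / θ) ∂μ := by
  have hθ0 : 0 < θ := by linarith
  have h1 := rpow_laverage_le (ν := μ.restrict (Metric.closedBall y r)) hg.aemeasurable
    (P := P / θ) ((one_le_div hθ0).2 hP)
  have h2 := laverage_le_of_lintegral_le hμ (f := fun z => g z ^ (P / θ)) hr hD
  calc (⨍⁻ z in Metric.closedBall y r, g z ∂μ) ^ P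
      = ((⨍⁻ z in Metric.closedBall y r, g z ∂μ) ^ (P / θ)) ^ (θ - 1 + 1) := by
        rw [← ENNReal.rpow_mul]; congr 1; field_simp; ring
    _ ≤ (⨍⁻ z in Metric.closedBall y r, g z ^ (P / θ) ∂μ) ^ (θ - 1 + 1) := by gcongr
    _ = (⨍⁻ z in Metric.closedBall y r, g z ^ (P / θ) ∂μ) ^ (θ - 1) *
        ⨍⁻ z in Metric.closedBall y r, g z ^ (P / θ) ∂μ := by
        rw [ENNReal.rpow_add_of_nonneg _ _ (by linarith) zero_le_one, ENNReal.rpow_one]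
    _ ≤ _ := by gcongr

/-- Sobolev-Poincaré inequality: the exponent on the right-hand side is smaller by the factor `θ`,
and the constant is uniform for exponents in a bounded interval. -/
theorem exists_sobolevPoincare_const [BorelSpace X] [SecondCountableTopology X] [SFinite μ]
    (hμ : IsHomogeneousMeasure μ κ Q) {C lam θ γ : ℝ} (hlam : 1 ≤ lam)
    (hθ : 1 ≤ θ) (hθQ : Q * (θ - 1) ≤ 1 / 2) :
    ∃ C' : ℝ, 0 < C' ∧ ∀ (u : X → ℝ), Integrable u μ → ∀ g : X → ℝ≥0∞, Measurable g →
      ∀ D : Set X, PoincareOn μ D C lam u g → ∀ x r, 0 < r →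
      Metric.closedBall x ((4 * lam + 2) * r) ⊆ D → ∀ P, θ ≤ P → P ≤ γ →
      ∫⁻ y in Metric.closedBall x (2 * r),
          ‖u y - ⨍ z in Metric.closedBall x (2 * r), u z ∂μ‖ₑ ^ P ∂μ ≤
        ENNReal.ofReal (C' * r ^ P * r ^ (-(Q * (θ - 1)))) *
          (∫⁻ y in Metric.closedBall x ((4 * lam + 2) * r), g y ^ (P / θ) ∂μ) ^ θ := by
  have hQ := hμ.dim_pos
  have hκ := hμ.pos
  set b : ℝ := max (16 * 2 ^ Q * C) 1 with hb
  have hb1 : 1 ≤ b := le_max_right _ _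
  have hb0 : 0 < b := by linarith
  set S : ℝ≥0∞ := ∑' k : ℕ, ENNReal.ofReal ((1 / 2) ^ (k + 1) * (2 ^ (1 / 2 : ℝ)) ^ k) with hS
  have hSt : S ≠ ∞ := by
    have h2 : (2 : ℝ) ^ (1 / 2 : ℝ) < 2 := by
      have := Real.rpow_lt_rpow_of_exponent_lt (x := 2) one_lt_two
        (show (1 / 2 : ℝ) < 1 by norm_num)
      rwa [Real.rpow_one] at this
    have hq0 : 0 < (2 : ℝ) ^ (1 / 2 : ℝ) := by positivity
    have hsum : Summable fun k : ℕ => ((1 : ℝ) / 2) ^ (k + 1) * (2 ^ (1 / 2 : ℝ)) ^ k := by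
      have := (summable_geometric_of_lt_one (r := (2 : ℝ) ^ (1 / 2 : ℝ) / 2) (by positivity)
        ((div_lt_one two_pos).2 h2)).mul_left (1 / 2)
      refine this.congr fun k => ?_
      rw [div_pow, pow_succ, one_div, inv_pow]; ring
    exact hsum.tsum_ofReal_ne_top
  set M : ℝ := (κ⁻¹ * (4 * lam) ^ (-Q)) ^ (θ - 1) with hM
  refine ⟨b ^ γ * M * (S.toReal + 1), by positivity, fun u hu g hg D hP x r hr hD P hθP hPγ => ?_⟩
  have hP1 : 1 ≤ P := hθ.trans hθP
  have hP0 : 0 < P := by linarith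
  have hθ0 : 0 ≤ θ - 1 := by linarith
  set D₀ := Metric.closedBall x ((4 * lam + 2) * r) with hD₀
  set G := ∫⁻ y in D₀, g y ^ (P / θ) ∂μ with hG
  set ρ : ℕ → ℝ := fun k => lam * (4 * r * (1 / 2) ^ k) with hρ
  have hρ0 : ∀ k, 0 < ρ k := fun k => by positivity
  have hsub : ∀ k, ∀ y ∈ Metric.closedBall x (2 * r), Metric.closedBall y (ρ k) ⊆ D₀ :=
    fun k y hy => by
      refine Metric.closedBall_subset_closedBall' ?_
      rw [Metric.mem_closedBall] at hy
      have : ((1 : ℝ) / 2) ^ k ≤ 1 := pow_le_one₀ (by norm_num) (by norm_num)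
      have h3 : ρ k ≤ 4 * lam * r := by
        have : 0 < lam * r := by positivity
        simp only [hρ]; nlinarith
      nlinarith
  set a : ℕ → X → ℝ≥0∞ := fun k y => ⨍⁻ z in Metric.closedBall y (ρ k), g z ∂μ with ha
  set a' : ℕ → X → ℝ≥0∞ := fun k y => ⨍⁻ z in Metric.closedBall y (ρ k), g z ^ (P / θ) ∂μ with ha'
  -- Jensen with the weights `2⁻ᵏ⁻¹` for the telescoping series
  have hpt : ∀ᵐ y ∂μ.restrict (Metric.closedBall x (2 * r)),
      ‖u y - ⨍ z in Metric.closedBall x (2 * r), u z ∂μ‖ₑ ^ P ≤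
        ENNReal.ofReal (b * r) ^ P * ∑' k : ℕ, ENNReal.ofReal ((1 / 2) ^ (k + 1)) *
          ((ENNReal.ofReal (κ⁻¹ * ρ k ^ (-Q)) * G) ^ (θ - 1) * a' k y) := by
    filter_upwards [ae_enorm_sub_le_tsum hμ hu hlam hP hr hD,
      ae_restrict_mem measurableSet_closedBall] with y hy hyx
    have h1 : ‖u y - ⨍ z in Metric.closedBall x (2 * r), u z ∂μ‖ₑ ≤
        ENNReal.ofReal (b * r) * ∑' k : ℕ, ENNReal.ofReal ((1 / 2) ^ (k + 1)) * a k y := by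
      refine hy.trans ?_
      rw [← ENNReal.tsum_mul_left]
      refine ENNReal.tsum_le_tsum fun k => ?_
      rw [← mul_assoc (ENNReal.ofReal (b * r)), ← ENNReal.ofReal_mul (by positivity)]
      refine mul_le_mul' (ENNReal.ofReal_le_ofReal ?_) le_rfl
      have h16 : 16 * 2 ^ Q * C ≤ b := le_max_left _ _
      have : 0 < r * (1 / 2) ^ k := by positivity
      calc 2 * 2 ^ Q * (C * (4 * r * (1 / 2) ^ k)) = 16 * 2 ^ Q * C * (r * (1 / 2) ^ k) / 2 := by ring
        _ ≤ b * (r * (1 / 2) ^ k) / 2 := by gcongr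
        _ = _ := by rw [pow_succ]; ring
    refine (ENNReal.rpow_le_rpow h1 hP0.le).trans ?_
    rw [ENNReal.mul_rpow_of_nonneg _ _ hP0.le]
    gcongr
    refine (rpow_tsum_mul_le ?_ hP1).trans ?_
    · have := ENNReal.ofReal_tsum_of_nonneg (f := fun k : ℕ => ((1 : ℝ) / 2) ^ (k + 1))
        (fun k => by positivity) ((summable_geometric_two).mul_left (1 / 2) |>.congr fun k => by
          rw [pow_succ]; ring)
      rw [← this]
      have h2 : ∑' k : ℕ, ((1 : ℝ) / 2) ^ (k + 1) = 1 := by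
        simp_rw [pow_succ]
        rw [tsum_mul_right, tsum_geometric_two]; norm_num
      rw [h2, ENNReal.ofReal_one]
    · refine ENNReal.tsum_le_tsum fun k => ?_
      gcongr
      exact rpow_laverage_closedBall_le hμ hg (hρ0 k) (hsub k y hyx) hθ hθP
  have hmeas : ∀ k, AEMeasurable (a' k) (μ.restrict (Metric.closedBall x (2 * r))) := fun k => by
    have hm : MeasurableSet {p : X × X | dist p.1 p.2 ≤ ρ k} :=
      measurableSet_le measurable_dist measurable_const
    have e : a' k = fun y => (ENNReal.ofReal (κ * ρ k ^ Q))⁻¹ *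
        ∫⁻ z, {p : X × X | dist p.1 p.2 ≤ ρ k}.indicator (fun p => g p.2 ^ (P / θ)) (y, z) ∂μ := by
      funext y
      simp only [ha']
      rw [setLAverage_eq, hμ.closedBall y _ (hρ0 k), ENNReal.div_eq_inv_mul,
        ← lintegral_indicator measurableSet_closedBall]
      congr 1
      refine lintegral_congr fun z => ?_
      simp only [indicator, mem_ofPred_eq, Metric.mem_closedBall, dist_comm z y]
    rw [e]
    exact ((((hg.pow_const _).comp measurable_snd).indicator hm).lintegral_prod_right'
      |>.const_mul _).aemeasurable
  refine (lintegral_mono_ae hpt).trans ?_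
  rw [lintegral_const_mul' _ _ (ENNReal.rpow_ne_top_of_nonneg hP0.le ENNReal.ofReal_ne_top),
    lintegral_tsum fun k => ((hmeas k).const_mul _).const_mul _]
  -- `ρ k ^ (-Q (θ - 1))` grows at most like `2 ^ (k / 2)`, by `Q (θ - 1) ≤ 1 / 2`
  have hterm : ∀ k, ∫⁻ y in Metric.closedBall x (2 * r), ENNReal.ofReal ((1 / 2) ^ (k + 1)) *
          ((ENNReal.ofReal (κ⁻¹ * ρ k ^ (-Q)) * G) ^ (θ - 1) * a' k y) ∂μ ≤
      ENNReal.ofReal ((1 / 2) ^ (k + 1) * (2 ^ (1 / 2 : ℝ)) ^ k) *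
        (ENNReal.ofReal (M * r ^ (-(Q * (θ - 1)))) * G ^ θ) := fun k => by
    rw [lintegral_const_mul' _ _ ENNReal.ofReal_ne_top,
      lintegral_const_mul'' _ (hmeas k), ENNReal.mul_rpow_of_nonneg _ _ hθ0]
    have h1 := lintegral_laverage_closedBall_le hμ (hg.pow_const (P / θ))
      (E := Metric.closedBall x (2 * r)) measurableSet_closedBall (hρ0 k) (hsub k)
    have hGθ : G ^ θ = G ^ (θ - 1) * G := by
      rw [← ENNReal.rpow_one G, ← ENNReal.rpow_mul, ← ENNReal.rpow_mul,
        ← ENNReal.rpow_add_of_nonneg _ _ (by linarith) (by norm_num)]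
      congr 1; ring
    have h2 : (κ⁻¹ * ρ k ^ (-Q)) ^ (θ - 1) ≤ (2 ^ (1 / 2 : ℝ)) ^ k * (M * r ^ (-(Q * (θ - 1)))) := by
      have p0 : ρ k = 4 * lam * r * (1 / 2) ^ k := by simp only [hρ]; ring
      have p1 : ρ k ^ (-Q) = (4 * lam) ^ (-Q) * r ^ (-Q) * ((2 : ℝ) ^ Q) ^ k := by
        rw [p0, Real.mul_rpow (by positivity) (by positivity),
          Real.mul_rpow (by positivity) hr.le]
        congr 1
        rw [← Real.rpow_natCast, ← Real.rpow_mul (by norm_num), ← Real.rpow_natCast,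
          ← Real.rpow_mul two_pos.le, one_div, Real.inv_rpow (by norm_num),
          ← Real.rpow_neg (by norm_num)]
        congr 1; ring
      have p2 : (((2 : ℝ) ^ Q) ^ k) ^ (θ - 1) ≤ (2 ^ (1 / 2 : ℝ)) ^ k := by
        rw [← Real.rpow_natCast, ← Real.rpow_mul two_pos.le, ← Real.rpow_mul two_pos.le,
          ← Real.rpow_natCast, ← Real.rpow_mul two_pos.le]
        refine Real.rpow_le_rpow_of_exponent_le (by norm_num) ?_
        have : (0 : ℝ) ≤ k := by positivity
        nlinarith
      rw [p1, ← mul_assoc, ← mul_assoc, Real.mul_rpow (by positivity) (by positivity),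
        Real.mul_rpow (by positivity) (by positivity), ← Real.rpow_mul hr.le, hM, neg_mul]
      calc _ ≤ (κ⁻¹ * (4 * lam) ^ (-Q)) ^ (θ - 1) * r ^ (-(Q * (θ - 1))) *
            (2 ^ (1 / 2 : ℝ)) ^ k := by gcongr
        _ = _ := by ring
    calc _ ≤ ENNReal.ofReal ((1 / 2) ^ (k + 1)) * (ENNReal.ofReal (κ⁻¹ * ρ k ^ (-Q)) ^ (θ - 1) *
          G ^ (θ - 1) * G) := by gcongr
      _ = ENNReal.ofReal ((1 / 2) ^ (k + 1)) *
          (ENNReal.ofReal ((κ⁻¹ * ρ k ^ (-Q)) ^ (θ - 1)) * G ^ θ) := by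
          rw [hGθ, ENNReal.ofReal_rpow_of_nonneg (by positivity) hθ0, mul_assoc]
      _ ≤ ENNReal.ofReal ((1 / 2) ^ (k + 1)) *
          (ENNReal.ofReal ((2 ^ (1 / 2 : ℝ)) ^ k * (M * r ^ (-(Q * (θ - 1))))) * G ^ θ) := by
          gcongr
      _ = _ := by
          rw [ENNReal.ofReal_mul (p := (2 ^ (1 / 2 : ℝ)) ^ k) (by positivity),
            ENNReal.ofReal_mul (p := (1 / 2) ^ (k + 1)) (by positivity)]
          ring
  calc _ ≤ ENNReal.ofReal (b * r) ^ P * ∑' k : ℕ,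
        ENNReal.ofReal ((1 / 2) ^ (k + 1) * (2 ^ (1 / 2 : ℝ)) ^ k) *
        (ENNReal.ofReal (M * r ^ (-(Q * (θ - 1)))) * G ^ θ) := by
        gcongr with k
        exact hterm k
    _ = ENNReal.ofReal ((b * r) ^ P) * (S * (ENNReal.ofReal (M * r ^ (-(Q * (θ - 1)))) * G ^ θ)) := by
        rw [ENNReal.tsum_mul_right, ENNReal.ofReal_rpow_of_nonneg (by positivity) hP0.le]
    _ ≤ ENNReal.ofReal (b ^ γ * r ^ P) * (ENNReal.ofReal (S.toReal + 1) *
          (ENNReal.ofReal (M * r ^ (-(Q * (θ - 1)))) * G ^ θ)) := by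
        gcongr
        · rw [Real.mul_rpow hb0.le hr.le]
          gcongr
        · rw [← ENNReal.ofReal_toReal hSt]
          exact ENNReal.ofReal_le_ofReal (by rw [ENNReal.ofReal_toReal hSt]; linarith)
    _ = _ := by
        rw [← mul_assoc, ← mul_assoc, ← ENNReal.ofReal_mul (by positivity),
          ← ENNReal.ofReal_mul (by positivity)]
        congr 2; ring

end

/-! ### Derivatives along horizontal directions -/

theorem hasDerivAt_comp_op_horizontal {n : ℕ} {F : Heis n → ℝ} (hF : Differentiable ℝ F)
    (x : Heis n) (v : Hor n) (s : ℝ) :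
    HasDerivAt (fun s : ℝ => F (op x (s • v, 0)))
      (fderiv ℝ F (op x (s • v, 0)) (lift (op x (s • v, 0)) v)) s := by
  rw [lift_op_horizontal]
  have h1 : HasDerivAt (fun s : ℝ => op x (s • v, 0)) (lift x v) s := by
    simp_rw [op_horizontal]
    simpa using ((hasDerivAt_id s).smul_const (lift x v)).const_add x
  exact (hF _).hasFDerivAt.comp_hasDerivAt s h1

theorem fderiv_lift {n : ℕ} (F : Heis n → ℝ) (x : Heis n) (v : Hor n) :
    fderiv ℝ F x (lift x v) = ⟪hgrad F x, v⟫ := by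
  have h1 : lift x v = ∑ j, v j • X j x := by
    simp only [X, lift_eq]
    have hv : v = ∑ j, v j • EuclideanSpace.single j (1 : ℝ) := by
      have := ((EuclideanSpace.basisFun (Fin n ⊕ Fin n) ℝ).sum_repr v).symm
      simpa only [EuclideanSpace.basisFun_repr, EuclideanSpace.basisFun_apply] using this
    refine Prod.ext ?_ ?_
    · simp only [Prod.fst_sum, Prod.smul_fst]
      exact hv
    · simp only [Prod.snd_sum, Prod.smul_snd, smul_eq_mul]
      conv_lhs => rw [hv]
      simp only [sympl, inner_sum, inner_smul_right, Finset.mul_sum]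
      exact Finset.sum_congr rfl fun i _ => by ring
  rw [h1, map_sum, PiLp.inner_apply]
  refine Finset.sum_congr rfl fun j _ => ?_
  simp [hgrad]

theorem hgrad_apply {n : ℕ} (F : Heis n → ℝ) (x : Heis n) (j : Fin n ⊕ Fin n) :
    hgrad F x j = fderiv ℝ F x (X j x) := rfl

theorem continuous_X {n : ℕ} (j : Fin n ⊕ Fin n) : Continuous (X (n := n) j) := by
  simp only [funext fun x => show X j x = _ from lift_eq x _]
  refine continuous_const.prodMk (continuous_const.mul ?_)
  exact (contDiff_sympl (n := n) (k := 0) contDiff_fst contDiff_const).continuous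

theorem continuous_hgrad {n : ℕ} {F : Heis n → ℝ} (hF : ContDiff ℝ 1 F) :
    Continuous (hgrad F) := by
  refine (PiLp.continuous_toLp 2 _).comp (continuous_pi fun j => ?_)
  exact (hF.continuous_fderiv one_ne_zero).clm_apply (continuous_X j)

theorem hgrad_eq_zero_of_notMem_tsupport {n : ℕ} {F : Heis n → ℝ} {x : Heis n}
    (hx : x ∉ tsupport F) : hgrad F x = 0 := by
  ext j
  have : fderiv ℝ F x = 0 := by
    by_contra h
    exact hx (support_fderiv_subset ℝ h)
  simp [hgrad_apply, this]

/-! ### Mollification on the group -/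

instance isAddHaarMeasure_volume (n : ℕ) : (volume : Measure (Heis n)).IsAddHaarMeasure :=
  inferInstanceAs (Measure.IsAddHaarMeasure
    ((volume : Measure (Hor n)).prod (volume : Measure ℝ)))

/-- A nonnegative smooth kernel of integral one, supported in the Euclidean ball of radius `ε`. -/
structure IsMollifier {n : ℕ} (ρ : Heis n → ℝ) (ε : ℝ) : Prop where
  contDiff : ContDiff ℝ ((⊤ : ℕ∞) : WithTop ℕ∞) ρ
  nonneg : ∀ x, 0 ≤ ρ x
  integral : ∫ x, ρ x = 1
  tsupport_subset : tsupport ρ ⊆ Metric.closedBall 0 ε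

/-- Mollifiers with sup norm of the order of the inverse volume of the Euclidean ball. -/
theorem exists_isMollifier (n : ℕ) : ∃ C : ℝ, 0 < C ∧ ∀ ε, 0 < ε → ∃ ρ : Heis n → ℝ,
    IsMollifier ρ ε ∧ ∀ x, ρ x ≤ C * ε⁻¹ ^ Module.finrank ℝ (Heis n) := by
  set V := (volume (Metric.closedBall (0 : Heis n) 1)).toReal with hV
  have hV0 : 0 < V := ENNReal.toReal_pos
    (Metric.measure_closedBall_pos volume _ one_pos).ne' measure_closedBall_lt_top.ne
  refine ⟨2 ^ Module.finrank ℝ (Heis n) / V, by positivity, fun ε hε => ?_⟩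
  let φ : ContDiffBump (0 : Heis n) := ⟨ε / 2, ε, by positivity, by linarith⟩
  refine ⟨φ.normed volume, ⟨φ.contDiff_normed, φ.nonneg_normed, φ.integral_normed, ?_⟩, fun x => ?_⟩
  · rw [φ.tsupport_normed_eq]
  · refine (φ.normed_le_div_measure_closedBall_rOut volume 2 (by
      change ε ≤ 2 * (ε / 2); linarith) x).trans_eq ?_
    have e1 : volume.real (Metric.closedBall (0 : Heis n) φ.rOut) =
        ε ^ Module.finrank ℝ (Heis n) * V := by
      rw [measureReal_def, Measure.addHaar_closedBall' _ _ hε.le, ENNReal.toReal_mul,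
        ENNReal.toReal_ofReal (by positivity)]
    rw [e1, inv_pow]
    field_simp

namespace IsMollifier

variable {n : ℕ} {ρ : Heis n → ℝ} {ε : ℝ}

theorem hasCompactSupport (h : IsMollifier ρ ε) : HasCompactSupport ρ :=
  (isCompact_closedBall (0 : Heis n) ε).of_isClosed_subset (isClosed_tsupport ρ) h.tsupport_subset

theorem norm_le_of_ne_zero (h : IsMollifier ρ ε) {x : Heis n} (hx : ρ x ≠ 0) : ‖x‖ ≤ ε := by
  simpa using h.tsupport_subset (subset_tsupport ρ hx)

theorem lintegral_enorm (h : IsMollifier ρ ε) : ∫⁻ x, ‖ρ x‖ₑ = 1 := by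
  have h1 := ofReal_integral_eq_lintegral_ofReal
    (h.contDiff.continuous.integrable_of_hasCompactSupport (μ := volume) h.hasCompactSupport)
    (Eventually.of_forall h.nonneg)
  rw [h.integral, ENNReal.ofReal_one] at h1
  rw [h1]
  exact lintegral_congr fun x => by rw [Real.enorm_eq_ofReal (h.nonneg x)]

end IsMollifier

/-- The group convolution `x ↦ ∫ ρ(x y⁻¹) f(y) dy`, which averages left translates of `f` and so
commutes with the left invariant fields. -/
def mollify {n : ℕ} {E : Type*} [NormedAddCommGroup E] [NormedSpace ℝ E] (ρ : Heis n → ℝ)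
    (f : Heis n → E) (x : Heis n) : E :=
  ∫ y, ρ (op x (-y)) • f y

section

variable {n : ℕ} {ρ : Heis n → ℝ} {ε : ℝ}

theorem measurePreserving_op_neg (x : Heis n) :
    MeasurePreserving (fun y : Heis n => op x (-y)) volume volume :=
  (measurePreserving_op_left x).comp (Measure.measurePreserving_neg volume)

theorem continuous_op_neg : Continuous fun p : Heis n × Heis n => op p.1 (-p.2) :=
  continuous_op.comp (continuous_fst.prodMk continuous_snd.neg)

theorem eq_op_of_kernel (x y : Heis n) : x = op (op x (-y)) y := by
  rw [op_assoc, neg_op_self, op_zero]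

theorem kernel_eq_zero_of_notMem (x w : Heis n) (R : ℝ)
    {p : Heis n} (hp : p ∈ Metric.ball x R)
    (hw : w ∉ (fun q : Heis n × Heis n => op (-q.1) q.2) ''
      (Metric.closedBall x R ×ˢ tsupport ρ)) : ρ (op p w) = 0 := by
  by_contra h
  exact hw ⟨(p, op p w), ⟨Metric.ball_subset_closedBall hp, subset_tsupport ρ h⟩, by simp⟩

theorem isCompact_kernelSet (x : Heis n) (R : ℝ) (hρ : HasCompactSupport ρ) :
    IsCompact ((fun q : Heis n × Heis n => op (-q.1) q.2) ''
      (Metric.closedBall x R ×ˢ tsupport ρ)) :=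
  ((isCompact_closedBall x R).prod hρ).image
    (continuous_op.comp (continuous_fst.neg.prodMk continuous_snd))

theorem mollify_eq_convolution (f : Heis n → ℝ) (x : Heis n) :
    mollify ρ f x = convolution f (fun w => ρ (op x w)) (ContinuousLinearMap.mul ℝ ℝ) volume 0 := by
  simp only [mollify, convolution, ContinuousLinearMap.mul_apply', zero_sub, smul_eq_mul, mul_comm]

theorem contDiff_mollify {f : Heis n → ℝ} (hf : LocallyIntegrable f)
    (hρ : ContDiff ℝ ((⊤ : ℕ∞) : WithTop ℕ∞) ρ) (hρc : HasCompactSupport ρ) :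
    ContDiff ℝ ((⊤ : ℕ∞) : WithTop ℕ∞) (mollify ρ f) := by
  rw [contDiff_iff_contDiffAt]
  intro x
  have h := contDiffOn_convolution_right_with_param (n := ⊤) (μ := volume) (f := f)
    (ContinuousLinearMap.mul ℝ ℝ)
    (g := fun p w => ρ (op p w)) Metric.isOpen_ball (isCompact_kernelSet x 1 hρc)
    (fun p w hp hw => kernel_eq_zero_of_notMem x w 1 hp hw) hf
    (hρ.comp (contDiff_op contDiff_fst contDiff_snd)).contDiffOn
  have h2 := (h.contDiffAt (x := (x, 0)) ((Metric.isOpen_ball.prod isOpen_univ).mem_nhds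
    ⟨Metric.mem_ball_self one_pos, mem_univ _⟩))
  have h3 := h2.comp x (contDiffAt_id.prodMk (contDiffAt_const (c := (0 : Heis n))))
  refine h3.congr_of_eventuallyEq (Eventually.of_forall fun y => mollify_eq_convolution f y)

theorem fderiv_mollify {f : Heis n → ℝ} (hf : LocallyIntegrable f)
    (hρ : ContDiff ℝ ((⊤ : ℕ∞) : WithTop ℕ∞) ρ) (hρc : HasCompactSupport ρ) (x v : Heis n) :
    fderiv ℝ (mollify ρ f) x v = ∫ y, f y * fderiv ℝ (fun x => ρ (op x (-y))) x v := by
  set g : Heis n → Heis n → ℝ := fun p w => ρ (op p w) with hg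
  set k := (fun q : Heis n × Heis n => op (-q.1) q.2) ''
      (Metric.closedBall x 1 ×ˢ tsupport ρ) with hk
  have hkc : IsCompact k := isCompact_kernelSet x 1 hρc
  have hgs : ContDiff ℝ ((⊤ : ℕ∞) : WithTop ℕ∞) ↿g := hρ.comp (contDiff_op contDiff_fst contDiff_snd)
  have hg1 : ContDiff ℝ 1 ↿g := hgs.of_le (by exact_mod_cast le_top)
  have hz : ∀ p w, p ∈ Metric.ball x 1 → w ∉ k → g p w = 0 :=
    fun p w hp hw => kernel_eq_zero_of_notMem x w 1 hp hw
  have h := hasFDerivAt_convolution_right_with_param (ContinuousLinearMap.mul ℝ ℝ)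
    Metric.isOpen_ball hkc hz hf hg1.contDiffOn (x, 0) (Metric.mem_ball_self one_pos)
  have h2 := h.comp (f := fun p : Heis n => (p, (0 : Heis n))) x
    ((hasFDerivAt_id x).prodMk (hasFDerivAt_const (0 : Heis n) x))
  have h3 : HasFDerivAt (mollify ρ f) _ x :=
    h2.congr_of_eventuallyEq (Eventually.of_forall fun y => mollify_eq_convolution f y)
  have hcs : HasCompactSupport fun w => fderiv ℝ ↿g (x, w) := by
    refine HasCompactSupport.intro hkc fun w hw => ?_
    have : ↿g =ᶠ[𝓝 (x, w)] fun _ => 0 := by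
      filter_upwards [(Metric.isOpen_ball.prod hkc.isClosed.isOpen_compl).mem_nhds
        (show (x, w) ∈ Metric.ball x 1 ×ˢ kᶜ from ⟨Metric.mem_ball_self one_pos, hw⟩)] with q hq
      exact hz q.1 q.2 hq.1 hq.2
    rw [this.fderiv_eq]; simp
  have hcont : Continuous fun w => fderiv ℝ ↿g (x, w) :=
    (hg1.continuous_fderiv one_ne_zero).comp (continuous_const.prodMk continuous_id)
  rw [h3.fderiv]
  rw [ContinuousLinearMap.comp_apply]
  erw [convolution_precompR_apply (ContinuousLinearMap.mul ℝ ℝ) hf hcs hcont]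
  simp only [convolution, ContinuousLinearMap.mul_apply', zero_sub]
  refine integral_congr_ae (Eventually.of_forall fun y => ?_)
  simp only
  congr 1
  have h4 : HasFDerivAt (fun x => ρ (op x (-y))) _ x :=
    HasFDerivAt.comp (g := ↿g) (f := fun x : Heis n => (x, -y)) x
      (((hg1.differentiable one_ne_zero) (x, -y)).hasFDerivAt) ((hasFDerivAt_id x).prodMk (hasFDerivAt_const (-y) x))
  rw [h4.fderiv]
  rfl

theorem fderiv_kernel_left {F : Heis n → ℝ} (hF : Differentiable ℝ F) (x y : Heis n)
    (j : Fin n ⊕ Fin n) :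
    fderiv ℝ (fun x => F (op x (-y))) x (X j x) = -hgrad (fun y => F (op x (-y))) y j := by
  set v : Hor n := EuclideanSpace.single j 1
  have d1 : Differentiable ℝ (fun x => F (op x (-y))) :=
    hF.comp ((contDiff_op (n := n) contDiff_id contDiff_const).differentiable one_ne_zero)
  have d2 : Differentiable ℝ (fun y => F (op x (-y))) :=
    hF.comp ((contDiff_op (n := n) contDiff_const contDiff_neg).differentiable one_ne_zero)
  have h1 := hasDerivAt_comp_op_horizontal d1 x v 0
  have h2 := hasDerivAt_comp_op_horizontal d2 y v 0
  have e0 : ∀ x : Heis n, op x ((0 : ℝ) • v, 0) = x := fun x => by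
    rw [zero_smul]; exact op_zero x
  rw [e0] at h1 h2
  have h3 : HasDerivAt (fun s : ℝ => F (op (op x ((-s) • v, 0)) (-y))) _ 0 :=
    HasDerivAt.scomp (h := fun s : ℝ => -s) (g₁ := fun s : ℝ => F (op (op x (s • v, 0)) (-y)))
      (0 : ℝ) (by rw [neg_zero]; exact h1) (hasDerivAt_neg 0)
  have e1 : (fun s : ℝ => F (op x (-op y (s • v, 0)))) =
      fun s : ℝ => F (op (op x ((-s) • v, 0)) (-y)) := by
    funext s
    rw [neg_op, op_assoc]
    congr 3
    ext <;> simp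
  simp only [e1] at h2
  have := h2.unique h3
  rw [hgrad_apply]
  change _ = -(fderiv ℝ (fun y => F (op x (-y))) y (lift y v))
  rw [this]
  simp [X, v]

/-- Mollification commutes with the horizontal gradient. -/
theorem hgrad_mollify {f : Heis n → ℝ} {G : Heis n → Hor n} (hf : LocallyIntegrable f)
    (hG : LocallyIntegrable G) (hfG : IsWeakHGrad univ f G)
    (hρ : ContDiff ℝ ((⊤ : ℕ∞) : WithTop ℕ∞) ρ) (hρc : HasCompactSupport ρ) (x : Heis n) :
    hgrad (mollify ρ f) x = mollify ρ G x := by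
  have hker : IsTest univ fun y => ρ (op x (-y)) := by
    refine ⟨hρ.comp (contDiff_op contDiff_const contDiff_neg), ?_, subset_univ _⟩
    refine HasCompactSupport.intro (hρc.image (f := fun z => op (-z) x)
      (continuous_op.comp (continuous_neg.prodMk continuous_const))) fun y hy => ?_
    by_contra h
    exact hy ⟨op x (-y), subset_tsupport ρ h, by simp [neg_op, op_assoc]⟩
  ext j
  have h1 := hfG _ hker j
  rw [setIntegral_univ, setIntegral_univ] at h1
  rw [hgrad_apply, fderiv_mollify hf hρ hρc]
  simp_rw [fderiv_kernel_left (hρ.differentiable (by simp)), mul_neg]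
  rw [integral_neg, h1, neg_neg, mollify]
  have hint : Integrable fun y => ρ (op x (-y)) • G y :=
    hG.integrable_smul_left_of_hasCompactSupport hker.1.continuous hker.2.1
  have := (EuclideanSpace.proj j : Hor n →L[ℝ] ℝ).integral_comp_comm hint
  simp only [PiLp.proj_apply, PiLp.smul_apply, smul_eq_mul] at this
  rw [← this]
  simp_rw [mul_comm]

variable {E : Type*} [NormedAddCommGroup E] [NormedSpace ℝ E]

theorem enorm_mollify_le (f : Heis n → E) (x : Heis n) :
    ‖mollify ρ f x‖ₑ ≤ ∫⁻ y, ‖ρ (op x (-y))‖ₑ * ‖f y‖ₑ :=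
  (enorm_integral_le_lintegral_enorm _).trans_eq (lintegral_congr fun _ => enorm_smul _ _)

theorem lintegral_enorm_mollify_le (h : IsMollifier ρ ε) {f : Heis n → E}
    (hf : AEStronglyMeasurable f) : ∫⁻ x, ‖mollify ρ f x‖ₑ ≤ ∫⁻ x, ‖f x‖ₑ := by
  have hc := h.contDiff.continuous
  have hm : AEMeasurable (Function.uncurry fun x y : Heis n => ‖ρ (op x (-y))‖ₑ * ‖f y‖ₑ)
      (volume.prod volume) :=
    ((hc.comp continuous_op_neg).enorm.measurable.aemeasurable).mul hf.enorm.comp_snd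
  calc ∫⁻ x, ‖mollify ρ f x‖ₑ ≤ ∫⁻ x, ∫⁻ y, ‖ρ (op x (-y))‖ₑ * ‖f y‖ₑ :=
        lintegral_mono fun x => enorm_mollify_le f x
    _ = ∫⁻ y, ∫⁻ x, ‖ρ (op x (-y))‖ₑ * ‖f y‖ₑ := lintegral_lintegral_swap hm
    _ = ∫⁻ y, ‖f y‖ₑ := by
        refine lintegral_congr fun y => ?_
        have hcy : Measurable fun x => ‖ρ (op x (-y))‖ₑ :=
          (hc.comp (continuous_op_right (-y))).enorm.measurable
        rw [lintegral_mul_const _ hcy]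
        have := (measurePreserving_op_right (-y)).lintegral_comp hc.enorm.measurable
        rw [this, h.lintegral_enorm, one_mul]

theorem integrable_kernel_smul (h : IsMollifier ρ ε) {f : Heis n → E} (hf : LocallyIntegrable f)
    (x : Heis n) : Integrable fun y => ρ (op x (-y)) • f y := by
  refine hf.integrable_smul_left_of_hasCompactSupport
    (h.contDiff.continuous.comp (continuous_op_neg.comp (continuous_const.prodMk continuous_id))) ?_
  refine HasCompactSupport.intro (h.hasCompactSupport.image (f := fun z => op (-z) x)
      (continuous_op.comp (continuous_neg.prodMk continuous_const))) fun y hy => ?_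
  by_contra h'
  exact hy ⟨op x (-y), subset_tsupport ρ h', by simp [neg_op, op_assoc]⟩

theorem integral_kernel (h : IsMollifier ρ ε) (x : Heis n) : ∫ y, ρ (op x (-y)) = 1 := by
  have hmp := measurePreserving_op_neg x
  have h1 := integral_map (μ := volume) hmp.measurable.aemeasurable (f := ρ)
    h.contDiff.continuous.aestronglyMeasurable
  rw [hmp.map_eq, h.integral] at h1
  exact h1.symm

theorem enorm_mollify_sub_le (h : IsMollifier ρ ε) {f : Heis n → E} [CompleteSpace E]
    (hf : LocallyIntegrable f) (x : Heis n) :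
    ‖mollify ρ f x - f x‖ₑ ≤ ∫⁻ y, ‖ρ (op x (-y))‖ₑ * ‖f y - f x‖ₑ := by
  have hi : Integrable fun y => ρ (op x (-y)) :=
    integrable_of_integral_eq_one (integral_kernel h x)
  have e1 : mollify ρ f x - f x = ∫ y, ρ (op x (-y)) • (f y - f x) := by
    simp_rw [smul_sub]
    rw [integral_sub (integrable_kernel_smul h hf x) (hi.smul_const _), integral_smul_const,
      integral_kernel h x, one_smul, mollify]
  rw [e1]
  exact (enorm_integral_le_lintegral_enorm _).trans_eq (lintegral_congr fun y => enorm_smul _ _)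

theorem lintegral_enorm_kernel (h : IsMollifier ρ ε) (x : Heis n) :
    ∫⁻ y, ‖ρ (op x (-y))‖ₑ = 1 := by
  rw [(measurePreserving_op_neg x).lintegral_comp h.contDiff.continuous.enorm.measurable,
    h.lintegral_enorm]

theorem mollify_eq_zero (h : IsMollifier ρ ε) {f : Heis n → E} {K : Set (Heis n)}
    (hf : ∀ y ∉ K, f y = 0) {x : Heis n} (hx : ∀ w, ‖w‖ ≤ ε → ∀ y ∈ K, op w y ≠ x) :
    mollify ρ f x = 0 := by
  refine integral_eq_zero_of_ae (Eventually.of_forall fun y => ?_)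
  by_contra hne
  have hne' : ρ (op x (-y)) • f y ≠ 0 := hne
  rw [smul_ne_zero_iff] at hne'
  refine hx _ (h.norm_le_of_ne_zero hne'.1) y ?_ (eq_op_of_kernel x y).symm
  by_contra hy
  exact hne'.2 (hf y hy)

theorem tsupport_mollify_subset (h : IsMollifier ρ ε) {f : Heis n → E} {K : Set (Heis n)}
    (hK : IsCompact K) (hf : ∀ y ∉ K, f y = 0) :
    tsupport (mollify ρ f) ⊆
      (fun p : Heis n × Heis n => op p.1 p.2) '' (Metric.closedBall 0 ε ×ˢ K) := by
  refine closure_minimal (fun x hx => ?_)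
    (((isCompact_closedBall _ _).prod hK).image continuous_op).isClosed
  by_contra hx'
  refine hx (mollify_eq_zero h hf fun w hw y hy he => hx' ⟨(w, y), ⟨by simpa using hw, hy⟩, he⟩)

theorem hasCompactSupport_mollify (h : IsMollifier ρ ε) {f : Heis n → E} {K : Set (Heis n)}
    (hK : IsCompact K) (hf : ∀ y ∉ K, f y = 0) : HasCompactSupport (mollify ρ f) :=
  (((isCompact_closedBall _ _).prod hK).image continuous_op).of_isClosed_subset
    (isClosed_tsupport _) (tsupport_mollify_subset h hK hf)

theorem exists_forall_op_mem {K U : Set (Heis n)} (hK : IsCompact K) (hU : IsOpen U) (hKU : K ⊆ U) :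
    ∃ δ > 0, ∀ w : Heis n, ‖w‖ ≤ δ → ∀ y ∈ K, op w y ∈ U := by
  have h := hK.eventually_forall_of_forall_eventually (x₀ := (0 : Heis n))
    (P := fun w y => op w y ∈ U) fun y hy => by
      refine continuous_op.continuousAt.preimage_mem_nhds (hU.mem_nhds ?_)
      simpa using hKU hy
  obtain ⟨δ, hδ, hδ'⟩ := Metric.eventually_nhds_iff.1 h
  exact ⟨δ / 2, by positivity, fun w hw => hδ' (by rw [dist_zero_right]; linarith)⟩

theorem exists_forall_enorm_op_sub_le {E : Type*} [NormedAddCommGroup E] {g : Heis n → E} (hg : Continuous g) {K : Set (Heis n)}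
    (hK : IsCompact K) {δ : ℝ≥0∞} (hδ : 0 < δ) :
    ∃ η > 0, ∀ w : Heis n, ‖w‖ ≤ η → ∀ x ∈ K, ‖g (op w x) - g x‖ₑ ≤ δ := by
  have hcont : Continuous fun p : Heis n × Heis n => ‖g (op p.1 p.2) - g p.2‖ₑ :=
    ((hg.comp continuous_op).sub (hg.comp continuous_snd)).enorm
  have h := hK.eventually_forall_of_forall_eventually (x₀ := (0 : Heis n))
    (P := fun w x => ‖g (op w x) - g x‖ₑ < δ) fun y hy => by
      refine (isOpen_lt hcont continuous_const).mem_nhds ?_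
      simpa using hδ
  obtain ⟨η, hη, hη'⟩ := Metric.eventually_nhds_iff.1 h
  exact ⟨η / 2, by positivity, fun w hw x hx =>
    (hη' (by rw [dist_zero_right]; linarith) x hx).le⟩

/-- Mollifications converge in `L¹`, uniformly over all kernels supported in a small ball. -/
theorem exists_forall_lintegral_mollify_sub_le [CompleteSpace E] {f : Heis n → E}
    (hf : Integrable f) {δ : ℝ≥0∞} (hδ : δ ≠ 0) :
    ∃ η > 0, ∀ ε ≤ η, ∀ ρ, IsMollifier ρ ε → ∫⁻ x, ‖mollify ρ f x - f x‖ₑ ≤ δ := by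
  have hδ3 : δ / 3 ≠ 0 := (ENNReal.div_pos hδ (by norm_num)).ne'
  obtain ⟨g, hgc, hfg, hgcont, hgi⟩ := hf.exists_hasCompactSupport_lintegral_sub_le hδ3
  set K := tsupport g with hK
  set K' := (fun p : Heis n × Heis n => op p.1 p.2) '' (Metric.closedBall 0 1 ×ˢ K) with hK'
  have hKc : IsCompact K := hgc
  have hK'c : IsCompact K' := ((isCompact_closedBall _ _).prod hKc).image continuous_op
  have hgK : ∀ y ∉ K, g y = 0 := fun y hy => image_eq_zero_of_notMem_tsupport hy
  have hKK' : K ⊆ K' := fun y hy => ⟨(0, y), ⟨by simp, hy⟩, by simp⟩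
  have hvol : volume K' ≠ ∞ := hK'c.measure_lt_top.ne
  set τ : ℝ≥0∞ := δ / 3 / (volume K' + 1) with hτ
  have hτ0 : 0 < τ := ENNReal.div_pos hδ3 (ENNReal.add_ne_top.2 ⟨hvol, ENNReal.one_ne_top⟩)
  obtain ⟨η, hη, hη'⟩ := exists_forall_enorm_op_sub_le hgcont hK'c hτ0
  refine ⟨min η 1, by positivity, fun ε hε ρ h => ?_⟩
  have hεη : ε ≤ η := hε.trans (min_le_left _ _)
  have hε1 : ε ≤ 1 := hε.trans (min_le_right _ _)
  have hpt : ∀ x, ‖mollify ρ g x - g x‖ₑ ≤ K'.indicator (fun _ => τ) x := fun x => by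
    by_cases hx : x ∈ K'
    · rw [indicator_of_mem hx]
      refine (enorm_mollify_sub_le h hgi.locallyIntegrable x).trans ?_
      calc _ ≤ ∫⁻ y, ‖ρ (op x (-y))‖ₑ * τ := lintegral_mono fun y => by
            by_cases hy : ρ (op x (-y)) = 0
            · simp [hy]
            · gcongr
              have hw := h.norm_le_of_ne_zero hy
              have := hη' (-(op x (-y))) (by rw [norm_neg]; exact hw.trans hεη) x hx
              have e : op (-op x (-y)) x = y := by rw [neg_op, neg_neg, op_assoc, neg_op_self, op_zero]
              rwa [e] at this
        _ = τ := by
            have hm : Measurable fun y => ‖ρ (op x (-y))‖ₑ :=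
              (h.contDiff.continuous.comp (continuous_op_neg.comp
                (continuous_const.prodMk continuous_id))).enorm.measurable
            rw [lintegral_mul_const _ hm, lintegral_enorm_kernel h, one_mul]
    · have h1 : g x = 0 := hgK x fun hxK => hx (hKK' hxK)
      have h2 : mollify ρ g x = 0 := mollify_eq_zero h hgK fun w hw y hy he =>
        hx ⟨(w, y), ⟨by simpa using hw.trans hε1, hy⟩, he⟩
      simp [h1, h2]
  have hg1 : ∫⁻ x, K'.indicator (fun _ => τ) x ≤ δ / 3 := by
    refine (lintegral_indicator_const_le _ _).trans ?_
    rw [hτ]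
    calc δ / 3 / (volume K' + 1) * volume K' ≤ δ / 3 / (volume K' + 1) * (volume K' + 1) := by
          gcongr; exact le_self_add
      _ = δ / 3 := ENNReal.div_mul_cancel (by simp) (ENNReal.add_ne_top.2 ⟨hvol, ENNReal.one_ne_top⟩)
  have hsplit : ∀ x, mollify ρ f x - f x =
      mollify ρ (fun y => f y - g y) x + (mollify ρ g x - g x) + (g x - f x) := fun x => by
    have : mollify ρ (fun y => f y - g y) x = mollify ρ f x - mollify ρ g x := by
      simp only [mollify, smul_sub]
      exact integral_sub (integrable_kernel_smul h hf.locallyIntegrable x)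
        (integrable_kernel_smul h hgi.locallyIntegrable x)
    rw [this]; abel
  have hmg : AEMeasurable (fun x => ‖g x - f x‖ₑ) volume := (hgi.sub hf).1.enorm
  have h3 : ∫⁻ x, ‖g x - f x‖ₑ ≤ δ / 3 := by
    simp_rw [← enorm_sub_rev (f _)]; exact hfg
  have h2 : ∫⁻ x, ‖mollify ρ (fun y => f y - g y) x‖ₑ ≤ δ / 3 :=
    (lintegral_enorm_mollify_le h (hf.sub hgi).1).trans hfg
  have hmm : Measurable (K'.indicator fun _ => τ) :=
    measurable_const.indicator hK'c.isClosed.measurableSet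
  calc ∫⁻ x, ‖mollify ρ f x - f x‖ₑ
      ≤ ∫⁻ x, ((‖mollify ρ (fun y => f y - g y) x‖ₑ + K'.indicator (fun _ => τ) x) +
          ‖g x - f x‖ₑ) := lintegral_mono fun x => by
          rw [hsplit x]
          exact (enorm_add_le _ _).trans
            (add_le_add ((enorm_add_le _ _).trans (add_le_add le_rfl (hpt x))) le_rfl)
    _ = (∫⁻ x, ‖mollify ρ (fun y => f y - g y) x‖ₑ) + (∫⁻ x, K'.indicator (fun _ => τ) x) +
          ∫⁻ x, ‖g x - f x‖ₑ := by
        rw [lintegral_add_right' _ hmg, lintegral_add_right _ hmm]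
    _ ≤ δ / 3 + δ / 3 + δ / 3 := by gcongr
    _ = δ := ENNReal.add_thirds δ

end

/-! ### The `L¹` Poincaré inequality -/

section

variable {n : ℕ}

theorem boxDist_op_le (x y b : Heis n) : boxDist x (op y b) ≤ boxDist x y + boxNorm b := by
  have h : boxDist y (op y b) = boxNorm b := by rw [boxDist, neg_op_op]
  exact (boxDist_triangle x y (op y b)).trans_eq (by rw [h])

theorem boxNorm_horizontal (v : Hor n) : boxNorm (v, (0 : ℝ)) = ‖v‖ := by simp [boxNorm]

/-- The fundamental theorem of calculus along a horizontal segment. -/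
theorem enorm_sub_le_lintegral_segment {v : Heis n → ℝ} (hv : ContDiff ℝ 1 v) (b : Heis n)
    (w : Hor n) :
    ‖v (op b (w, 0)) - v b‖ₑ ≤
      ∫⁻ s in Icc (0 : ℝ) 1, ‖hgrad v (op b (s • w, 0))‖ₑ * ‖w‖ₑ := by
  have hcont : Continuous fun s : ℝ => op b (s • w, 0) := by
    exact (continuous_op_left b).comp
      ((continuous_id.smul continuous_const).prodMk continuous_const)
  have hder : ∀ s ∈ uIcc (0 : ℝ) 1, HasDerivAt (fun s : ℝ => v (op b (s • w, 0)))
      ⟪hgrad v (op b (s • w, 0)), w⟫ s := fun s _ => by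
    rw [← fderiv_lift]
    exact hasDerivAt_comp_op_horizontal (hv.differentiable one_ne_zero) b w s
  have hci : Continuous fun s : ℝ => ⟪hgrad v (op b (s • w, 0)), w⟫ :=
    ((continuous_hgrad hv).comp hcont).inner continuous_const
  have h1 := intervalIntegral.integral_eq_sub_of_hasDerivAt hder (hci.intervalIntegrable _ _)
  simp only [one_smul, zero_smul] at h1
  rw [show ((0 : Hor n), (0 : ℝ)) = 0 from rfl, op_zero] at h1
  rw [← h1, intervalIntegral.integral_of_le zero_le_one, ← integral_Icc_eq_integral_Ioc]
  refine (enorm_integral_le_lintegral_enorm _).trans (lintegral_mono fun s => ?_)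
  rw [← enorm_norm (hgrad v _), ← enorm_norm w, ← enorm_mul]
  rw [enorm_le_iff_norm_le, Real.norm_eq_abs, Real.norm_of_nonneg (by positivity)]
  exact abs_real_inner_le_norm _ _

theorem setLIntegral_op_right_le {F : Heis n → ℝ≥0∞} (hF : Measurable F) {E E' : Set (Heis n)}
    (hE : MeasurableSet E) (hE' : MeasurableSet E') {b : Heis n} (h : ∀ y ∈ E, op y b ∈ E') :
    ∫⁻ y in E, F (op y b) ≤ ∫⁻ y in E', F y := by
  rw [← lintegral_indicator hE, ← lintegral_indicator hE',
    ← (measurePreserving_op_right b).lintegral_comp (hF.indicator hE')]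
  refine lintegral_mono fun y => ?_
  by_cases hy : y ∈ E
  · rw [indicator_of_mem hy, indicator_of_mem (h y hy)]
  · rw [indicator_of_notMem hy]; exact zero_le

theorem measurableSet_cball (x : Heis n) (r : ℝ) : MeasurableSet (cball x r) :=
  (isClosed_cball x r).measurableSet

/-- The preceding estimate integrated over the starting points; right translations preserve the
measure. -/
theorem lintegral_cball_segment_le {v : Heis n → ℝ} (hv : ContDiff ℝ 1 v) (x a : Heis n)
    (w : Hor n) {r t : ℝ} (ha : boxNorm a + ‖w‖ ≤ t) :
    ∫⁻ y in cball x r, ‖v (op y (op a (w, 0))) - v (op y a)‖ₑ ≤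
      ‖w‖ₑ * ∫⁻ y in cball x (r + t), ‖hgrad v y‖ₑ := by
  have hc := continuous_hgrad hv
  have hjoint : Continuous fun p : Heis n × ℝ => op (op p.1 a) (p.2 • w, 0) :=
    continuous_op.comp (((continuous_op_right a).comp continuous_fst).prodMk
      ((continuous_snd.smul continuous_const).prodMk continuous_const))
  have hm : AEMeasurable (Function.uncurry fun (y : Heis n) (s : ℝ) =>
      ‖hgrad v (op (op y a) (s • w, 0))‖ₑ * ‖w‖ₑ)
      ((volume.restrict (cball x r)).prod (volume.restrict (Icc 0 1))) :=
    ((hc.comp hjoint).enorm.measurable.mul_const _).aemeasurable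
  calc _ ≤ ∫⁻ y in cball x r, ∫⁻ s in Icc (0 : ℝ) 1,
        ‖hgrad v (op (op y a) (s • w, 0))‖ₑ * ‖w‖ₑ := lintegral_mono fun y => by
        rw [← op_assoc]; exact enorm_sub_le_lintegral_segment hv _ w
    _ = ∫⁻ s in Icc (0 : ℝ) 1, ∫⁻ y in cball x r,
        ‖hgrad v (op (op y a) (s • w, 0))‖ₑ * ‖w‖ₑ := lintegral_lintegral_swap hm
    _ ≤ ∫⁻ s in Icc (0 : ℝ) 1, ‖w‖ₑ * ∫⁻ y in cball x (r + t), ‖hgrad v y‖ₑ := by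
        refine setLIntegral_mono' measurableSet_Icc fun s hs => ?_
        rw [lintegral_mul_const' _ _ enorm_ne_top, mul_comm]
        refine mul_le_mul' le_rfl ?_
        simp_rw [op_assoc]
        refine setLIntegral_op_right_le (F := fun y => ‖hgrad v y‖ₑ) hc.enorm.measurable
          (measurableSet_cball _ _) (measurableSet_cball _ _) fun y hy => ?_
        refine (boxDist_op_le x y _).trans (add_le_add hy ((boxNorm_op_le _ _).trans ?_))
        refine le_trans (add_le_add le_rfl ?_) ha
        rw [boxNorm_horizontal, norm_smul, Real.norm_of_nonneg hs.1]
        exact mul_le_of_le_one_left (norm_nonneg _) hs.2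
    _ = _ := by simp

/-- Right translation by `h` is a chain of five horizontal segments of length at most `boxNorm h`,
each of which stays in the ball of radius `11 r`. -/
theorem lintegral_cball_op_sub_le (hn : 1 ≤ n) {v : Heis n → ℝ} (hv : ContDiff ℝ 1 v) (x h : Heis n)
    {r : ℝ} (hr : boxNorm h ≤ 2 * r) :
    ∫⁻ y in cball x r, ‖v (op y h) - v y‖ₑ ≤
      ENNReal.ofReal (10 * r) * ∫⁻ y in cball x (11 * r), ‖hgrad v y‖ₑ := by
  obtain ⟨w₀, w₁, w₂, w₃, w₄, hw₀, hw₁, hw₂, hw₃, hw₄, he⟩ := exists_horizontal_factors hn h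
  set N := boxNorm h with hN
  set I := ∫⁻ y in cball x (11 * r), ‖hgrad v y‖ₑ with hI
  have hb : ∀ w : Hor n, ‖w‖ ≤ N → boxNorm (w, (0 : ℝ)) ≤ N := fun w hw => by
    rwa [boxNorm_horizontal]
  have step : ∀ (a : Heis n) (w : Hor n), boxNorm a ≤ 4 * N → ‖w‖ ≤ N →
      ∫⁻ y in cball x r, ‖v (op y (op a (w, 0))) - v (op y a)‖ₑ ≤ ENNReal.ofReal (2 * r) * I := by
    intro a w ha hw
    refine (lintegral_cball_segment_le hv x a w (t := 10 * r) (by linarith)).trans ?_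
    rw [show r + 10 * r = 11 * r by ring]
    gcongr
    rw [← ofReal_norm]
    exact ENNReal.ofReal_le_ofReal (hw.trans hr)
  have hN0 : 0 ≤ N := boxNorm_nonneg h
  have b1 : boxNorm (op (w₀, (0 : ℝ)) (w₁, 0)) ≤ 2 * N :=
    (boxNorm_op_le _ _).trans (by linarith [hb _ hw₀, hb _ hw₁])
  have b2 : boxNorm (op (op (w₀, (0 : ℝ)) (w₁, 0)) (w₂, 0)) ≤ 3 * N :=
    (boxNorm_op_le _ _).trans (by linarith [hb _ hw₂])
  have b3 : boxNorm (op (op (op (w₀, (0 : ℝ)) (w₁, 0)) (w₂, 0)) (w₃, 0)) ≤ 4 * N :=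
    (boxNorm_op_le _ _).trans (by linarith [hb _ hw₃])
  have s0 := step 0 w₀ (by rw [boxNorm_zero]; positivity) hw₀
  have s1 := step _ w₁ ((hb _ hw₀).trans (by linarith)) hw₁
  have s2 := step _ w₂ (b1.trans (by linarith)) hw₂
  have s3 := step _ w₃ (b2.trans (by linarith)) hw₃
  have s4 := step _ w₄ b3 hw₄
  rw [← he] at s4
  simp only [zero_op, op_zero] at s0
  have hm : ∀ a b : Heis n, Measurable fun y => ‖v (op y a) - v (op y b)‖ₑ := fun a b =>
    ((hv.continuous.comp (continuous_op_right a)).sub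
      (hv.continuous.comp (continuous_op_right b))).enorm.measurable
  have hm0 : ∀ a : Heis n, Measurable fun y => ‖v (op y a) - v y‖ₑ := fun a => by
    simpa using hm a 0
  have tri : ∀ (a b : Heis n) (y : Heis n), ‖v (op y a) - v y‖ₑ ≤
      ‖v (op y a) - v (op y b)‖ₑ + ‖v (op y b) - v y‖ₑ := fun a b y => by
    rw [← sub_add_sub_cancel (v (op y a)) (v (op y b)) (v y)]; exact enorm_add_le _ _
  have ladd : ∀ (a b : Heis n), ∫⁻ y in cball x r, ‖v (op y a) - v y‖ₑ ≤
      (∫⁻ y in cball x r, ‖v (op y a) - v (op y b)‖ₑ) + ∫⁻ y in cball x r, ‖v (op y b) - v y‖ₑ :=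
    fun a b => (lintegral_mono fun y => tri a b y).trans_eq (lintegral_add_left (hm a b) _)
  have t1 := (ladd _ _).trans (add_le_add s1 s0)
  have t2 := (ladd _ _).trans (add_le_add s2 t1)
  have t3 := (ladd _ _).trans (add_le_add s3 t2)
  have t4 := (ladd _ _).trans (add_le_add s4 t3)
  refine t4.trans_eq ?_
  rw [show 10 * r = 5 * (2 * r) by ring, ENNReal.ofReal_mul (p := 5) (by norm_num), ENNReal.ofReal_ofNat]
  ring

/-- The double integral form of the Poincaré inequality, by the substitution `z = op y h` with `h` in
the ball of radius `2 r`. -/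
theorem lintegral_lintegral_cball_sub_le (hn : 1 ≤ n) {v : Heis n → ℝ} (hv : ContDiff ℝ 1 v)
    (x : Heis n) {r : ℝ} (hr : 0 < r) :
    ∫⁻ y in cball x r, ∫⁻ z in cball x r, ‖v z - v y‖ₑ ≤
      ENNReal.ofReal (unitVol n * (2 * r) ^ homDim n) *
        (ENNReal.ofReal (10 * r) * ∫⁻ y in cball x (11 * r), ‖hgrad v y‖ₑ) := by
  have hjoint : Continuous fun p : Heis n × Heis n => op p.1 p.2 := continuous_op
  have hm : AEMeasurable (Function.uncurry fun (y h : Heis n) => ‖v (op y h) - v y‖ₑ)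
      ((volume.restrict (cball x r)).prod (volume.restrict (cball 0 (2 * r)))) :=
    (((hv.continuous.comp hjoint).sub (hv.continuous.comp continuous_fst)).enorm.measurable
      ).aemeasurable
  calc ∫⁻ y in cball x r, ∫⁻ z in cball x r, ‖v z - v y‖ₑ
      ≤ ∫⁻ y in cball x r, ∫⁻ h in cball 0 (2 * r), ‖v (op y h) - v y‖ₑ := by
        refine setLIntegral_mono' (measurableSet_cball _ _) fun y hy => ?_
        rw [← lintegral_indicator (measurableSet_cball _ _),
          ← lintegral_indicator (measurableSet_cball _ _)]
        have hmz : Measurable ((cball x r).indicator fun z => ‖v z - v y‖ₑ) :=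
          ((hv.continuous.sub continuous_const).enorm.measurable).indicator
            (measurableSet_cball _ _)
        rw [← (measurePreserving_op_left y).lintegral_comp hmz]
        refine lintegral_mono fun h => ?_
        by_cases hh : op y h ∈ cball x r
        · rw [indicator_of_mem hh, indicator_of_mem]
          have h1 := boxDist_triangle y x (op y h)
          rw [boxDist_comm y x] at h1
          have h2 : boxDist y (op y h) = boxNorm h := by rw [boxDist, neg_op_op]
          rw [mem_cball_iff] at hh hy ⊢
          have h3 : boxDist 0 h = boxNorm h := by rw [boxDist, neg_zero, zero_op]
          linarith
        · rw [indicator_of_notMem hh]; exact zero_le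
    _ = ∫⁻ h in cball 0 (2 * r), ∫⁻ y in cball x r, ‖v (op y h) - v y‖ₑ :=
        lintegral_lintegral_swap hm
    _ ≤ ∫⁻ h in cball (0 : Heis n) (2 * r),
        (ENNReal.ofReal (10 * r) * ∫⁻ y in cball x (11 * r), ‖hgrad v y‖ₑ) := by
        refine setLIntegral_mono' (measurableSet_cball _ _) fun h hh => ?_
        refine lintegral_cball_op_sub_le hn hv x h ?_
        rw [mem_cball_iff, boxDist, neg_zero, zero_op] at hh
        exact hh
    _ = _ := by
        rw [lintegral_const, Measure.restrict_apply_univ, volume_cball _ (by positivity), mul_comm]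

theorem isHomogeneousMeasure_boxHeis (n : ℕ) :
    IsHomogeneousMeasure (volume : Measure (BoxHeis n)) (unitVol n) (homDim n) :=
  ⟨unitVol_pos n, homDim_pos n, fun x _ hr => volume_closedBall_boxHeis x hr⟩

/-- The double-integral form of the `L¹` Poincaré inequality, for compactly supported weakly
differentiable functions. -/
theorem lintegral_lintegral_cball_sub_le_of_isWeakHGrad (hn : 1 ≤ n) {f : Heis n → ℝ}
    {G : Heis n → Hor n} (hf : Integrable f) (hG : Integrable G) (hfG : IsWeakHGrad univ f G)
    (x : Heis n) {r : ℝ} (hr : 0 < r) :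
    ∫⁻ y in cball x r, ∫⁻ z in cball x r, ‖f z - f y‖ₑ ≤
      ENNReal.ofReal (unitVol n * (2 * r) ^ homDim n) *
        (ENNReal.ofReal (10 * r) * ∫⁻ y in cball x (11 * r), ‖G y‖ₑ) := by
  set A := ENNReal.ofReal (unitVol n * (2 * r) ^ homDim n) * ENNReal.ofReal (10 * r) with hA
  have hAt : A ≠ ∞ := ENNReal.mul_ne_top ENNReal.ofReal_ne_top ENNReal.ofReal_ne_top
  set V := volume (cball x r) with hV
  have hVt : V ≠ ∞ := (isCompact_cball x r).measure_lt_top.ne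
  obtain ⟨C, hC, hmoll⟩ := exists_isMollifier n
  have key : ∀ δ : ℝ≥0∞, δ ≠ 0 → ∫⁻ y in cball x r, ∫⁻ z in cball x r, ‖f z - f y‖ₑ ≤
      (A * ∫⁻ y in cball x (11 * r), ‖G y‖ₑ) + (2 * V + A) * δ := by
    intro δ hδ
    obtain ⟨η₁, hη₁, h₁⟩ := exists_forall_lintegral_mollify_sub_le hf hδ
    obtain ⟨η₂, hη₂, h₂⟩ := exists_forall_lintegral_mollify_sub_le hG hδ
    obtain ⟨ρ, hρ, -⟩ := hmoll (min η₁ η₂) (by positivity)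
    have i1 := h₁ _ (min_le_left _ _) ρ hρ
    have i2 := h₂ _ (min_le_right _ _) ρ hρ
    set v := mollify ρ f with hv
    have hvs : ContDiff ℝ ((⊤ : ℕ∞) : WithTop ℕ∞) v :=
      contDiff_mollify hf.locallyIntegrable hρ.contDiff hρ.hasCompactSupport
    have hv1 : ContDiff ℝ 1 v := hvs.of_le (by exact_mod_cast le_top)
    have hgv : ∀ y, hgrad v y = mollify ρ G y := fun y => hgrad_mollify hf.locallyIntegrable
      hG.locallyIntegrable hfG hρ.contDiff hρ.hasCompactSupport y
    have h0 := lintegral_lintegral_cball_sub_le hn hv1 x hr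
    rw [← mul_assoc, ← hA] at h0
    have hfm : AEMeasurable (fun z => ‖f z - v z‖ₑ) (volume.restrict (cball x r)) :=
      (hf.1.sub hvs.continuous.aestronglyMeasurable).enorm.restrict
    have hd : ∫⁻ z in cball x r, ‖f z - v z‖ₑ ≤ δ := by
      refine (setLIntegral_le_lintegral _ _).trans ?_
      simp_rw [← enorm_sub_rev (v _)]; exact i1
    have e1 : ∫⁻ y in cball x r, ∫⁻ z in cball x r, ‖f z - f y‖ₑ ≤
        (∫⁻ y in cball x r, ∫⁻ z in cball x r, ‖v z - v y‖ₑ) + 2 * V * δ := by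
      have hvm : Measurable fun y => ∫⁻ z in cball x r, ‖v z - v y‖ₑ := by
        refine Measurable.lintegral_prod_right' (f := fun p : Heis n × Heis n => ‖v p.2 - v p.1‖ₑ) ?_
        exact ((hvs.continuous.comp continuous_snd).sub
          (hvs.continuous.comp continuous_fst)).enorm.measurable
      calc _ ≤ ∫⁻ y in cball x r, ((∫⁻ z in cball x r, ‖v z - v y‖ₑ) + (δ + V * ‖f y - v y‖ₑ)) := by
            refine lintegral_mono fun y => ?_
            calc ∫⁻ z in cball x r, ‖f z - f y‖ₑ
                ≤ ∫⁻ z in cball x r, (‖v z - v y‖ₑ + (‖f z - v z‖ₑ + ‖f y - v y‖ₑ)) := by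
                  refine lintegral_mono fun z => ?_
                  have : f z - f y = (v z - v y) + ((f z - v z) - (f y - v y)) := by ring
                  rw [this]
                  exact (enorm_add_le _ _).trans (add_le_add le_rfl (enorm_sub_le))
              _ = (∫⁻ z in cball x r, ‖v z - v y‖ₑ) + ((∫⁻ z in cball x r, ‖f z - v z‖ₑ) +
                    V * ‖f y - v y‖ₑ) := by
                  have hvy : Measurable fun z => ‖v z - v y‖ₑ :=
                    (hvs.continuous.sub continuous_const).enorm.measurable
                  rw [lintegral_add_left hvy,
                    lintegral_add_right _ measurable_const, lintegral_const,
                    Measure.restrict_apply_univ, mul_comm V]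
              _ ≤ _ := by gcongr
        _ = (∫⁻ y in cball x r, ∫⁻ z in cball x r, ‖v z - v y‖ₑ) +
              (δ * V + V * ∫⁻ z in cball x r, ‖f z - v z‖ₑ) := by
            rw [lintegral_add_left hvm, lintegral_add_left measurable_const, lintegral_const,
              Measure.restrict_apply_univ, lintegral_const_mul' _ _ hVt]
        _ ≤ (∫⁻ y in cball x r, ∫⁻ z in cball x r, ‖v z - v y‖ₑ) + (δ * V + V * δ) := by gcongr
        _ = _ := by ring
    have e2 : ∫⁻ y in cball x (11 * r), ‖hgrad v y‖ₑ ≤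
        (∫⁻ y in cball x (11 * r), ‖G y‖ₑ) + δ := by
      calc _ ≤ ∫⁻ y in cball x (11 * r), (‖G y‖ₑ + ‖mollify ρ G y - G y‖ₑ) := by
            refine lintegral_mono fun y => ?_
            rw [hgv]
            calc ‖mollify ρ G y‖ₑ = ‖G y + (mollify ρ G y - G y)‖ₑ := by rw [add_sub_cancel]
              _ ≤ _ := enorm_add_le _ _
        _ = (∫⁻ y in cball x (11 * r), ‖G y‖ₑ) +
              ∫⁻ y in cball x (11 * r), ‖mollify ρ G y - G y‖ₑ :=
            lintegral_add_left' hG.1.enorm.restrict _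
        _ ≤ _ := by gcongr; exact (setLIntegral_le_lintegral _ _).trans i2
    calc _ ≤ A * ((∫⁻ y in cball x (11 * r), ‖G y‖ₑ) + δ) + 2 * V * δ :=
          e1.trans (add_le_add (h0.trans (mul_le_mul' le_rfl e2)) le_rfl)
      _ = _ := by ring
  rw [← mul_assoc, ← hA]
  refine ENNReal.le_of_forall_pos_le_add fun ε hε _ => ?_
  have hB : 2 * V + A ≠ ∞ := ENNReal.add_ne_top.2 ⟨ENNReal.mul_ne_top (by norm_num) hVt, hAt⟩
  refine (key (ε / (2 * V + A + 1)) (ENNReal.div_pos (by positivity)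
    (ENNReal.add_ne_top.2 ⟨hB, ENNReal.one_ne_top⟩)).ne').trans (add_le_add le_rfl ?_)
  calc (2 * V + A) * (ε / (2 * V + A + 1)) ≤ (2 * V + A + 1) * (ε / (2 * V + A + 1)) :=
        mul_le_mul' le_self_add le_rfl
    _ = ε := ENNReal.mul_div_cancel (by simp) (ENNReal.add_ne_top.2 ⟨hB, ENNReal.one_ne_top⟩)

/-- The constant in the `L¹` Poincaré inequality. -/
def poincareConst (n : ℕ) : ℝ := 10 * 22 ^ homDim n

/-- The `L¹` Poincaré inequality on the Heisenberg group. -/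
theorem poincareOn_of_isWeakHGrad (hn : 1 ≤ n) {f : Heis n → ℝ}
    {G : Heis n → Hor n} (hf : Integrable f) (hG : Integrable G) (hfG : IsWeakHGrad univ f G) :
    PoincareOn (volume : Measure (BoxHeis n)) univ (poincareConst n) 11 f (fun y => ‖G y‖ₑ) := by
  intro x r hr _
  have hμ := isHomogeneousMeasure_boxHeis n
  have hr11 : (0 : ℝ) < 11 * r := by positivity
  have hκ := unitVol_pos n
  have h0 := hμ.closedBall_ne_zero x hr
  have ht := hμ.closedBall_ne_top x hr
  have hmain := lintegral_lintegral_cball_sub_le_of_isWeakHGrad hn hf hG hfG x hr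
  rw [← closedBall_boxHeis, ← closedBall_boxHeis] at hmain
  set B : Set (BoxHeis n) := Metric.closedBall x r with hB
  set V := (volume : Measure (BoxHeis n)) B with hV
  have e1 : ∫⁻ y in B, ‖f y - ⨍ z in B, f z ∂(volume : Measure (BoxHeis n))‖ₑ
      ∂(volume : Measure (BoxHeis n)) ≤
      V⁻¹ * ∫⁻ y in B, ∫⁻ z in B, ‖f z - f y‖ₑ
        ∂(volume : Measure (BoxHeis n)) ∂(volume : Measure (BoxHeis n)) := by
    rw [← lintegral_const_mul' _ _ (ENNReal.inv_ne_top.2 h0)]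
    refine lintegral_mono fun y => ?_
    rw [enorm_sub_rev]
    refine (enorm_setAverage_sub_le (ν := (volume : Measure (BoxHeis n))) hf.integrableOn h0 ht
      (f y)).trans_eq ?_
    rw [setLAverage_eq, ENNReal.div_eq_inv_mul]
  rw [setLAverage_eq, setLAverage_eq, ENNReal.div_le_iff h0 ht]
  refine e1.trans ?_
  rw [← ENNReal.mul_le_mul_iff_right h0 ht, ← mul_assoc, ENNReal.mul_inv_cancel h0 ht, one_mul]
  refine hmain.trans_eq ?_
  set I := ∫⁻ y in Metric.closedBall x (11 * r), ‖G y‖ₑ ∂(volume : Measure (BoxHeis n)) with hI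
  have h11 := hμ.closedBall x (11 * r) hr11
  have hVr : V = ENNReal.ofReal (unitVol n * r ^ homDim n) := hμ.closedBall x r hr
  rw [h11, hVr, ENNReal.div_eq_inv_mul, ← ENNReal.ofReal_inv_of_pos (by positivity)]
  have hreal : unitVol n * (2 * r) ^ homDim n * (10 * r) =
      unitVol n * r ^ homDim n * (poincareConst n * r * (unitVol n * (11 * r) ^ homDim n)⁻¹ *
        (unitVol n * r ^ homDim n)) := by
    have p0 : (0 : ℝ) < r ^ homDim n := by positivity
    have p1 : (0 : ℝ) < 11 ^ homDim n := by positivity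
    have p2 : (22 : ℝ) ^ homDim n = 2 ^ homDim n * 11 ^ homDim n := by
      rw [← Real.mul_rpow (by norm_num) (by norm_num)]; norm_num
    rw [poincareConst, p2, Real.mul_rpow two_pos.le hr.le, Real.mul_rpow (by norm_num) hr.le]
    field_simp
  rw [← mul_assoc, ← ENNReal.ofReal_mul (by positivity), hreal]
  have hp : 0 < poincareConst n := by unfold poincareConst; positivity
  rw [ENNReal.ofReal_mul (p := unitVol n * r ^ homDim n) (by positivity),
    ENNReal.ofReal_mul (p := poincareConst n * r * (unitVol n * (11 * r) ^ homDim n)⁻¹)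
      (by positivity), ENNReal.ofReal_mul (p := poincareConst n * r) (by positivity)]
  change _ * I = _
  ring

end

/-! ### Cutoff functions and localization -/

section

variable {n : ℕ}

theorem hgrad_mul {f g : Heis n → ℝ} {x : Heis n} (hf : DifferentiableAt ℝ f x)
    (hg : DifferentiableAt ℝ g x) :
    hgrad (fun y => f y * g y) x = f x • hgrad g x + g x • hgrad f x := by
  ext j
  simp only [hgrad_apply, PiLp.add_apply, PiLp.smul_apply, smul_eq_mul]
  rw [fderiv_fun_mul hf hg]
  simp

theorem integral_hgrad_eq_zero {ψ : Heis n → ℝ} (hψ : ContDiff ℝ 1 ψ) (hc : HasCompactSupport ψ)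
    (j : Fin n ⊕ Fin n) : ∫ x, hgrad ψ x j = 0 := by
  have hd := hψ.differentiable one_ne_zero
  have hline : ∀ v x, HasLineDerivAt ℝ ψ (fderiv ℝ ψ x v) x v := fun v x =>
    (hd x).hasFDerivAt.hasLineDerivAt v
  have hcf : HasCompactSupport (fderiv ℝ ψ) := hc.fderiv ℝ
  have hfc : Continuous (fderiv ℝ ψ) := hψ.continuous_fderiv one_ne_zero
  have hint : ∀ (a : Heis n → ℝ), Continuous a → ∀ v : Heis n,
      Integrable fun x => a x * fderiv ℝ ψ x v := fun a ha v => by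
    refine (ha.mul (hfc.clm_apply continuous_const)).integrable_of_hasCompactSupport ?_
    refine hcf.mono fun x hx => ?_
    simp only [Function.mem_support, ne_eq] at hx ⊢
    intro h; exact hx (by simp [h])
  set v : Hor n := EuclideanSpace.single j 1
  have h1 : ∫ x, (1 : ℝ) * fderiv ℝ ψ x (v, 0) = -∫ x, (0 : ℝ) * ψ x :=
    integral_bilinear_hasLineDerivAt_right_eq_neg_left_of_integrable
      (B := ContinuousLinearMap.mul ℝ ℝ) (f := fun _ => (1 : ℝ)) (f' := fun _ => 0) (g := ψ)
      (by simp) (by simpa using hint (fun _ => 1) continuous_const (v, 0))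
      (by simpa using hψ.continuous.integrable_of_hasCompactSupport hc)
      (fun x _ => (hasFDerivAt_const (1 : ℝ) x).hasLineDerivAt (v, 0)) (fun x _ => hline _ x)
  have hsc : Continuous fun x : Heis n => sympl x.1 v :=
    (contDiff_sympl (n := n) (k := 0) contDiff_fst contDiff_const).continuous
  have h2 : ∫ x, sympl x.1 v * fderiv ℝ ψ x (0, 1) = -∫ x, (0 : ℝ) * ψ x := by
    refine integral_bilinear_hasLineDerivAt_right_eq_neg_left_of_integrable
      (B := ContinuousLinearMap.mul ℝ ℝ) (f := fun x : Heis n => sympl x.1 v) (f' := fun _ => 0)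
      (g := ψ) (by simp) (by simpa using hint _ hsc (0, 1)) ?_ (fun x _ => ?_) (fun x _ => hline _ x)
    · exact (hsc.mul hψ.continuous).integrable_of_hasCompactSupport hc.mul_left
    · unfold HasLineDerivAt
      simp only [Prod.fst_add, Prod.smul_fst, smul_zero, add_zero]
      exact hasDerivAt_const _ _
  have hsplit : ∀ x, hgrad ψ x j =
      1 * fderiv ℝ ψ x (v, 0) + (1 / 2) * (sympl x.1 v * fderiv ℝ ψ x (0, 1)) := fun x => by
    have : X j x = (v, 0) + ((1 / 2) * sympl x.1 v) • ((0 : Hor n), (1 : ℝ)) := by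
      rw [X, lift_eq]; ext <;> simp [v]
    rw [hgrad_apply, this, map_add, map_smul, smul_eq_mul]; ring
  simp_rw [hsplit]
  rw [integral_add (by simpa using hint (fun _ => 1) continuous_const (v, 0))
    ((hint _ hsc (0, 1)).const_mul _), integral_const_mul (1 / 2 : ℝ), h1, h2]
  simp

/-- Localization of a weakly differentiable function by a test function. -/
theorem IsWeakHGrad.mul_test {U : Set (Heis n)} {u : Heis n → ℝ} {G : Heis n → Hor n}
    (h : IsWeakHGrad U u G) (hu : IntegrableOn u U) (hG : IntegrableOn G U) {η : Heis n → ℝ}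
    (hη : IsTest U η) (c : ℝ) :
    IsWeakHGrad univ (fun x => η x * (u x - c)) (fun x => η x • G x + (u x - c) • hgrad η x) := by
  intro ψ hψ j
  have hη1 : ContDiff ℝ 1 η := hη.1.of_le (by exact_mod_cast le_top)
  have hψ1 : ContDiff ℝ 1 ψ := hψ.1.of_le (by exact_mod_cast le_top)
  have hηd := hη1.differentiable one_ne_zero
  have hψd := hψ1.differentiable one_ne_zero
  have ht : IsTest U (fun x => η x * ψ x) :=
    ⟨hη.1.mul hψ.1, hη.2.1.mul_right, (tsupport_mul_subset_left).trans hη.2.2⟩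
  have h1 := h _ ht j
  have h0 := integral_hgrad_eq_zero (hη1.mul hψ1) ht.2.1 j
  have hgr : ∀ x, hgrad (fun y => η y * ψ y) x j = η x * hgrad ψ x j + ψ x * hgrad η x j :=
    fun x => by rw [hgrad_mul (hηd x) (hψd x)]; simp
  have hηU : ∀ x ∉ U, η x = 0 := fun x hx =>
    image_eq_zero_of_notMem_tsupport fun h => hx (hη.2.2 h)
  have hηU' : ∀ x ∉ U, hgrad η x = 0 := fun x hx =>
    hgrad_eq_zero_of_notMem_tsupport fun h => hx (hη.2.2 h)
  rw [setIntegral_univ, setIntegral_univ]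
  have hcψ : Continuous fun x => hgrad ψ x j :=
    (EuclideanSpace.proj j : Hor n →L[ℝ] ℝ).continuous.comp (continuous_hgrad hψ1)
  have hcη : Continuous fun x => hgrad η x j :=
    (EuclideanSpace.proj j : Hor n →L[ℝ] ℝ).continuous.comp (continuous_hgrad hη1)
  have hsη : HasCompactSupport η := hη.2.1
  have hsη' : HasCompactSupport fun x => hgrad η x j :=
    hsη.mono' fun x hx => by
      by_contra hx'
      exact hx (by simp [hgrad_eq_zero_of_notMem_tsupport hx'])
  -- products of `u` or `G` with bounded continuous functions
  have hub : ∀ a : Heis n → ℝ, Continuous a → HasCompactSupport a →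
      IntegrableOn (fun x => u x * a x) U := fun a ha hac => by
    obtain ⟨M, hM⟩ := ha.bounded_above_of_compact_support hac
    exact hu.mul_bdd ha.aestronglyMeasurable (Eventually.of_forall hM)
  have hGb : ∀ a : Heis n → ℝ, Continuous a → HasCompactSupport a →
      IntegrableOn (fun x => G x j * a x) U := fun a ha hac => by
    obtain ⟨M, hM⟩ := ha.bounded_above_of_compact_support hac
    exact Integrable.mul_bdd ((EuclideanSpace.proj j : Hor n →L[ℝ] ℝ).integrable_comp hG) ha.aestronglyMeasurable (Eventually.of_forall hM)
  have i1 := hub (fun x => η x * hgrad ψ x j) (hη1.continuous.mul hcψ) hsη.mul_right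
  have i2 := hub (fun x => ψ x * hgrad η x j) (hψ1.continuous.mul hcη) hsη'.mul_left
  have i3 := hGb (fun x => η x * ψ x) (hη1.continuous.mul hψ1.continuous) hsη.mul_right
  have j1 : Integrable fun x => η x * hgrad ψ x j :=
    (hη1.continuous.mul hcψ).integrable_of_hasCompactSupport hsη.mul_right
  have j2 : Integrable fun x => ψ x * hgrad η x j :=
    (hψ1.continuous.mul hcη).integrable_of_hasCompactSupport hsη'.mul_left
  simp_rw [hgr] at h0 h1
  rw [integral_add j1 j2] at h0
  simp_rw [mul_add] at h1
  rw [integral_add i1 i2] at h1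
  have i4 : IntegrableOn (fun x => u x * (ψ x * hgrad η x j) - c * (ψ x * hgrad η x j)) U :=
    i2.sub (j2.const_mul c).integrableOn
  have l1 : ∫ x, η x * (u x - c) * hgrad ψ x j =
      (∫ x in U, u x * (η x * hgrad ψ x j)) - c * ∫ x, η x * hgrad ψ x j := by
    rw [← integral_const_mul, ← setIntegral_eq_integral_of_forall_compl_eq_zero (s := U)
      (fun x hx => by rw [hηU x hx]; ring), ← setIntegral_eq_integral_of_forall_compl_eq_zero
      (s := U) (f := fun x => c * (η x * hgrad ψ x j)) (fun x hx => by rw [hηU x hx]; ring),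
      ← integral_sub i1 (j1.const_mul c).integrableOn]
    exact integral_congr_ae (Eventually.of_forall fun x => by ring)
  have l2 : ∫ x, (η x • G x + (u x - c) • hgrad η x) j * ψ x =
      (∫ x in U, G x j * (η x * ψ x)) + ((∫ x in U, u x * (ψ x * hgrad η x j)) -
        c * ∫ x, ψ x * hgrad η x j) := by
    rw [← integral_const_mul, ← setIntegral_eq_integral_of_forall_compl_eq_zero (s := U)
      (fun x hx => by rw [hηU x hx, hηU' x hx]; simp),
      ← setIntegral_eq_integral_of_forall_compl_eq_zero
      (s := U) (f := fun x => c * (ψ x * hgrad η x j)) (fun x hx => by rw [hηU' x hx]; simp),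
      ← integral_sub i2 (j2.const_mul c).integrableOn,
      ← integral_add i3 i4]
    refine integral_congr_ae (Eventually.of_forall fun x => ?_)
    simp only [PiLp.add_apply, PiLp.smul_apply, smul_eq_mul]
    ring
  rw [l1, l2]
  linear_combination h1 - c * h0

/-- The dilation `(z, t) ↦ (s z, s² t)`. -/
def dil (s : ℝ) (x : Heis n) : Heis n := (s • x.1, s ^ 2 * x.2)

theorem boxNorm_dil {s : ℝ} (hs : 0 ≤ s) (x : Heis n) : boxNorm (dil s x) = s * boxNorm x := by
  unfold boxNorm dil
  rw [norm_smul, Real.norm_of_nonneg hs, abs_mul, abs_of_nonneg (sq_nonneg s),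
    Real.sqrt_mul (sq_nonneg s), Real.sqrt_sq hs, mul_max_of_nonneg _ _ hs]

theorem dil_op (s : ℝ) (x y : Heis n) : dil s (op x y) = op (dil s x) (dil s y) := by
  unfold dil op
  ext
  · simp
  · simp; ring

/-- Cutoff functions between concentric balls. -/
theorem exists_cutoff (n : ℕ) : ∃ C : ℝ, 1 ≤ C ∧ ∀ (x₀ : Heis n) (r : ℝ), 0 < r →
    ∃ η : Heis n → ℝ, IsTest univ η ∧ (∀ x, 0 ≤ η x) ∧ (∀ x, η x ≤ 1) ∧
      (∀ x ∈ cball x₀ r, η x = 1) ∧ tsupport η ⊆ cball x₀ (2 * r) ∧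
      ∀ x, ‖hgrad η x‖ ≤ C / r := by
  let b : ContDiffBump (0 : Heis n) := ⟨1, 2, one_pos, one_lt_two⟩
  have hb : ContDiff ℝ ((⊤ : ℕ∞) : WithTop ℕ∞) b := b.contDiff
  have hb1 : ContDiff ℝ 1 b := hb.of_le (by exact_mod_cast le_top)
  have hbc : HasCompactSupport b := b.hasCompactSupport
  obtain ⟨C, hC⟩ := (continuous_hgrad hb1).bounded_above_of_compact_support (hbc.mono' fun x hx => by
    by_contra hx'; exact hx (hgrad_eq_zero_of_notMem_tsupport hx'))
  refine ⟨max C 1, le_max_right _ _, fun x₀ r hr => ?_⟩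
  have hr' : 0 ≤ r⁻¹ := by positivity
  set T : Heis n → Heis n := fun x => dil r⁻¹ (op (-x₀) x) with hT
  have hTs : ContDiff ℝ ((⊤ : ℕ∞) : WithTop ℕ∞) T := by
    have h1 : ContDiff ℝ ((⊤ : ℕ∞) : WithTop ℕ∞) fun x : Heis n => op (-x₀) x :=
      contDiff_op contDiff_const contDiff_id
    exact ((contDiff_const (c := r⁻¹)).smul h1.fst).prodMk (contDiff_const.mul h1.snd)
  have hTn : ∀ x, boxNorm (T x) = r⁻¹ * boxDist x₀ x := fun x => boxNorm_dil hr' _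
  have hsupp : tsupport (fun x => b (T x)) ⊆ cball x₀ (2 * r) := by
    refine closure_minimal (fun x hx => ?_) (isClosed_cball _ _)
    have h1 : T x ∈ Function.support b := hx
    rw [b.support_eq, mem_ball_zero_iff] at h1
    have h1' : ‖T x‖ < 2 := h1
    have h2 : boxNorm (T x) ≤ 2 := by
      rw [boxNorm_le_iff two_pos.le]
      refine ⟨(norm_fst_le _).trans h1'.le, ?_⟩
      have := (norm_snd_le (T x)).trans h1'.le
      rw [Real.norm_eq_abs] at this
      linarith
    rw [hTn, inv_mul_le_iff₀ hr] at h2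
    rw [mem_cball_iff]; linarith
  refine ⟨fun x => b (T x), ⟨hb.comp hTs, (isCompact_cball x₀ (2 * r)).of_isClosed_subset
    (isClosed_tsupport _) hsupp, subset_univ _⟩, fun x => b.nonneg, fun x => b.le_one,
    fun x hx => ?_, hsupp, fun x => ?_⟩
  · refine b.one_of_mem_closedBall ?_
    rw [mem_closedBall_zero_iff]
    refine norm_le_of_boxNorm_le zero_le_one le_rfl ?_
    rw [hTn, inv_mul_le_iff₀ hr, mul_one]
    exact hx
  · have hd : Differentiable ℝ fun x => b (T x) := (hb.comp hTs).differentiable (by simp)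
    have hinner : ∀ v, ⟪hgrad (fun x => b (T x)) x, v⟫ = r⁻¹ * ⟪hgrad b (T x), v⟫ := fun v => by
      have h1 := hasDerivAt_comp_op_horizontal hd x v 0
      have h2 := hasDerivAt_comp_op_horizontal (hb1.differentiable one_ne_zero) (T x) (r⁻¹ • v) 0
      have e1 : (fun s : ℝ => b (T (op x (s • v, 0)))) =
          fun s : ℝ => b (op (T x) (s • r⁻¹ • v, 0)) := by
        funext s
        simp only [hT]
        rw [← op_assoc, dil_op]
        congr 2
        exact Prod.ext (smul_comm _ _ _) (mul_zero _)
      rw [e1] at h1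
      have h3 := h1.unique h2
      have e0 : ∀ (x : Heis n) (v : Hor n), op x ((0 : ℝ) • v, 0) = x := fun x v => by
        rw [zero_smul]; exact op_zero x
      rw [e0, e0, fderiv_lift, fderiv_lift, inner_smul_right] at h3
      exact h3
    have e2 : hgrad (fun x => b (T x)) x = r⁻¹ • hgrad b (T x) := by
      refine ext_inner_right ℝ fun v => ?_
      rw [hinner, real_inner_smul_left]
    rw [e2, norm_smul, Real.norm_of_nonneg hr', div_eq_inv_mul]
    gcongr
    exact (hC _).trans (le_max_left _ _)

theorem hgrad_eq_zero_of_eq_one {η : Heis n → ℝ} (h1 : ∀ x, η x ≤ 1) {x : Heis n} (hx : η x = 1) :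
    hgrad η x = 0 := by
  have hmax : IsLocalMax η x := Eventually.of_forall fun y => by rw [hx]; exact h1 y
  ext j
  rw [hgrad_apply, hmax.fderiv_eq_zero]; simp

theorem integrable_mul_test {U : Set (Heis n)} {E : Type*}
    [NormedAddCommGroup E] [NormedSpace ℝ E] {f : Heis n → E} (hf : IntegrableOn f U)
    {η : Heis n → ℝ} (hη : Continuous η) (hc : HasCompactSupport η)
    (hs : ∀ x ∉ U, η x = 0) : Integrable fun x => η x • f x := by
  obtain ⟨M, hM⟩ := hη.bounded_above_of_compact_support hc
  have h1 : IntegrableOn (fun x => η x • f x) U :=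
    hf.bdd_smul M hη.aestronglyMeasurable (Eventually.of_forall hM)
  refine (integrableOn_iff_integrable_of_support_subset fun x hx => ?_).1 h1
  by_contra hxU
  exact hx (by simp [hs x hxU])

/-- The Sobolev-Poincaré inequality for weakly differentiable functions. -/
theorem exists_weak_sobolevPoincare_const (hn : 1 ≤ n) {θ γ : ℝ} (hθ : 1 ≤ θ)
    (hθQ : homDim n * (θ - 1) ≤ 1 / 2) :
    ∃ C : ℝ, 0 < C ∧ ∀ (U : Set (Heis n)) (u : Heis n → ℝ) (G : Heis n → Hor n),
      IntegrableOn u U → IntegrableOn G U → IsWeakHGrad U u G →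
      ∀ x r, 0 < r → cball x (92 * r) ⊆ U → ∃ c : ℝ, ∀ P, θ ≤ P → P ≤ γ →
      ∫⁻ y in cball x (2 * r), ‖u y - c‖ₑ ^ P ≤
        ENNReal.ofReal (C * r ^ P * r ^ (-(homDim n * (θ - 1)))) *
          (∫⁻ y in cball x (46 * r), ‖G y‖ₑ ^ (P / θ)) ^ θ := by
  have hμ := isHomogeneousMeasure_boxHeis n
  obtain ⟨C, hC, H⟩ := exists_sobolevPoincare_const hμ (C := poincareConst n) (lam := 11)
    (γ := γ) (by norm_num) hθ hθQ
  obtain ⟨Cη, -, hcut⟩ := exists_cutoff n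
  refine ⟨C, hC, fun U u G hu hG hw x r hr hxU => ?_⟩
  obtain ⟨η, hη, -, hη1, hηone, hηs, -⟩ := hcut x (46 * r) (by positivity)
  have hηU : IsTest U η := ⟨hη.1, hη.2.1, hηs.trans ((cball_mono (by linarith)).trans hxU)⟩
  have hηC : ContDiff ℝ 1 η := hη.1.of_le (by exact_mod_cast le_top)
  have hηz : ∀ y ∉ U, η y = 0 := fun y hy =>
    image_eq_zero_of_notMem_tsupport fun h => hy (hηU.2.2 h)
  set f : Heis n → ℝ := fun y => η y * (u y - 0) with hf
  set F : Heis n → Hor n := fun y => η y • G y + (u y - 0) • hgrad η y with hF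
  have hfF : IsWeakHGrad univ f F := hw.mul_test hu hG hηU 0
  have hfi : Integrable f := by
    simp only [hf, sub_zero]
    exact integrable_mul_test hu hηC.continuous hη.2.1 hηz
  have hgi : Integrable fun y => u y • hgrad η y := by
    obtain ⟨M, hM⟩ := (continuous_hgrad hηC).bounded_above_of_compact_support
      (hη.2.1.mono' fun x hx => by
        by_contra hx'; exact hx (hgrad_eq_zero_of_notMem_tsupport hx'))
    have h1 : IntegrableOn (fun y => u y • hgrad η y) U :=
      hu.smul_bdd M (continuous_hgrad hηC).aestronglyMeasurable (Eventually.of_forall hM)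
    refine (integrableOn_iff_integrable_of_support_subset fun y hy => ?_).1 h1
    by_contra hyU
    exact hy (by simp [hgrad_eq_zero_of_notMem_tsupport fun h => hyU (hηU.2.2 h)])
  have hFi : Integrable F := by
    simp only [hF, sub_zero]
    exact (integrable_mul_test hG hηC.continuous hη.2.1 hηz).add hgi
  set F' := hFi.1.mk F with hF'
  have hFF' : F =ᵐ[volume] F' := hFi.1.ae_eq_mk
  have hF'm : StronglyMeasurable F' := hFi.1.stronglyMeasurable_mk
  have hfF' : IsWeakHGrad univ f F' := fun ψ hψ j => by
    rw [hfF ψ hψ j, setIntegral_univ, setIntegral_univ]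
    congr 1
    refine integral_congr_ae ?_
    filter_upwards [hFF'] with y hy
    rw [hy]
  have hP := poincareOn_of_isWeakHGrad hn hfi (hFi.congr hFF') hfF'
  have hmain := H f hfi (fun y => ‖F' y‖ₑ) hF'm.enorm univ hP x r hr (subset_univ _)
  obtain ⟨c, hc⟩ : ∃ c : ℝ, c = ⨍ z in Metric.closedBall (x : BoxHeis n) (2 * r), f z ∂(volume : Measure (BoxHeis n)) := ⟨_, rfl⟩
  refine ⟨c, fun P hP1 hP2 => ?_⟩
  have hm := hmain P hP1 hP2
  rw [show (4 * 11 + 2 : ℝ) * r = 46 * r by ring, ← hc] at hm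
  have e1 : ∫⁻ y in cball x (2 * r), ‖u y - c‖ₑ ^ P = ∫⁻ y in cball x (2 * r), ‖f y - c‖ₑ ^ P := by
    refine setLIntegral_congr_fun (measurableSet_cball _ _) fun y hy => ?_
    have : f y = u y := by
      simp only [hf]
      rw [hηone y (cball_mono (by linarith) hy), one_mul, sub_zero]
    rw [this]
  have e2 : ∫⁻ y in cball x (46 * r), ‖G y‖ₑ ^ (P / θ) =
      ∫⁻ y in cball x (46 * r), ‖F' y‖ₑ ^ (P / θ) := by
    refine lintegral_congr_ae ?_
    filter_upwards [ae_restrict_of_ae hFF', ae_restrict_mem (measurableSet_cball x (46 * r))]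
      with y hy hyx
    rw [← hy]
    simp only [hF]
    rw [hηone y hyx, hgrad_eq_zero_of_eq_one hη1 (hηone y hyx), one_smul, smul_zero, add_zero]
  rw [e1, e2]
  have c1 : (Metric.closedBall (x : BoxHeis n) (2 * r) : Set (BoxHeis n)) = cball (n := n) x (2 * r) :=
    closedBall_boxHeis x (2 * r)
  have c2 : (Metric.closedBall (x : BoxHeis n) (46 * r) : Set (BoxHeis n)) =
      cball (n := n) x (46 * r) := closedBall_boxHeis x (46 * r)
  refine (congrArg (fun s : Set (BoxHeis n) =>
    ∫⁻ y in s, ‖f y - c‖ₑ ^ P ∂(volume : Measure (BoxHeis n))) c1.symm).trans_le (hm.trans_eq ?_)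
  exact congrArg (fun s : Set (BoxHeis n) =>
    ENNReal.ofReal (C * r ^ P * r ^ (-(homDim n * (θ - 1)))) *
      (∫⁻ y in s, ‖F' y‖ₑ ^ (P / θ) ∂(volume : Measure (BoxHeis n))) ^ θ) c2

end

/-! ### Log-Hölder continuous exponents -/

/-- An exponent with values in `[γ₁, γ₂]` whose modulus of continuity is at most `ω`, where
`ω r * log (1 / r)` stays below `M` for `r ≤ r₀`. -/
structure LogHolderOn {n : ℕ} (Ω : Set (Heis n)) (p : Heis n → ℝ) (γ₁ γ₂ M r₀ : ℝ) (ω : ℝ → ℝ) :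
    Prop where
  mem : ∀ x ∈ Ω, p x ∈ Icc γ₁ γ₂
  modulus_le : ∀ r, 0 < r → modulus p Ω r ≤ ω r
  pos : 0 < r₀
  lt_one : r₀ < 1
  log_le : ∀ r, 0 < r → r ≤ r₀ → ω r * Real.log (1 / r) ≤ M

namespace LogHolderOn

variable {n : ℕ} {Ω : Set (Heis n)} {p : Heis n → ℝ} {γ₁ γ₂ M r₀ : ℝ} {ω : ℝ → ℝ}

theorem abs_sub_le (h : LogHolderOn Ω p γ₁ γ₂ M r₀ ω) {x y : Heis n} (hx : x ∈ Ω) (hy : y ∈ Ω)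
    {r : ℝ} (hr : 0 < r) (hxy : dCC x y ≤ ENNReal.ofReal r) : |p x - p y| ≤ ω r := by
  have hb : BddAbove {s | ∃ x ∈ Ω, ∃ y ∈ Ω, dCC x y ≤ ENNReal.ofReal r ∧ s = |p x - p y|} := by
    refine ⟨γ₂ - γ₁, ?_⟩
    rintro _ ⟨a, ha, b, hb, -, rfl⟩
    have h1 := h.mem a ha
    have h2 := h.mem b hb
    rw [abs_le]
    constructor <;> linarith [h1.1, h1.2, h2.1, h2.2]
  exact le_trans (le_csSup hb ⟨x, hx, y, hy, hxy, rfl⟩) (h.modulus_le r hr)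

theorem nonneg (h : LogHolderOn Ω p γ₁ γ₂ M r₀ ω) {r : ℝ} (hr : 0 < r) : 0 ≤ ω r := by
  refine le_trans (Real.sSup_nonneg ?_) (h.modulus_le r hr)
  rintro _ ⟨a, -, b, -, -, rfl⟩
  exact abs_nonneg _

theorem le_div_log (h : LogHolderOn Ω p γ₁ γ₂ M r₀ ω) {r : ℝ} (hr : 0 < r) (hr₀ : r ≤ r₀) :
    ω r ≤ M / Real.log (1 / r) := by
  have h1 : 0 < Real.log (1 / r) := Real.log_pos (by
    rw [lt_div_iff₀ hr, one_mul]; exact hr₀.trans_lt h.lt_one)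
  rw [le_div_iff₀ h1]
  exact h.log_le r hr hr₀

theorem const_nonneg (h : LogHolderOn Ω p γ₁ γ₂ M r₀ ω) : 0 ≤ M := by
  refine le_trans (mul_nonneg (h.nonneg h.pos) (Real.log_nonneg ?_)) (h.log_le r₀ h.pos le_rfl)
  rw [le_div_iff₀ h.pos, one_mul]; exact h.lt_one.le

theorem tendsto_zero (h : LogHolderOn Ω p γ₁ γ₂ M r₀ ω) : Tendsto ω (𝓝[>] 0) (𝓝 0) := by
  have h1 : Tendsto (fun r : ℝ => M / Real.log (1 / r)) (𝓝[>] 0) (𝓝 0) := by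
    refine Tendsto.div_atTop tendsto_const_nhds ?_
    have h2 : Tendsto (fun r : ℝ => 1 / r) (𝓝[>] 0) atTop := by
      simpa only [one_div] using tendsto_inv_nhdsGT_zero (𝕜 := ℝ)
    exact Real.tendsto_log_atTop.comp h2
  refine tendsto_of_tendsto_of_tendsto_of_le_of_le' tendsto_const_nhds h1 ?_ ?_
  · filter_upwards [self_mem_nhdsWithin] with r hr using h.nonneg hr
  · filter_upwards [Ioc_mem_nhdsGT h.pos] with r hr using h.le_div_log hr.1 hr.2

theorem continuousOn (hn : 1 ≤ n) (h : LogHolderOn Ω p γ₁ γ₂ M r₀ ω) : ContinuousOn p Ω := by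
  intro x hx
  rw [ContinuousWithinAt, Metric.tendsto_nhds]
  intro ε hε
  obtain ⟨s, hs, hs0⟩ : ∃ s, ω s < ε ∧ 0 < s :=
    ((h.tendsto_zero.eventually_lt_const hε).and self_mem_nhdsWithin).exists
  have hc : Continuous (boxDist x) := continuous_boxNorm.comp (continuous_op_left _)
  have h1 : ∀ᶠ y in 𝓝[Ω] x, boxDist x y < s / 5 := nhdsWithin_le_nhds
    ((isOpen_lt hc continuous_const).mem_nhds (by simpa using hs0))
  filter_upwards [h1, self_mem_nhdsWithin] with y hy hyΩ
  rw [Real.dist_eq, abs_sub_comm]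
  refine lt_of_le_of_lt (h.abs_sub_le hx hyΩ hs0 ((dCC_le_boxDist hn x y).trans ?_)) hs
  exact ENNReal.ofReal_le_ofReal (by linarith)

end LogHolderOn

section

variable {n : ℕ}

theorem boxDist_op_left_le {w y : Heis n} {ε m : ℝ} (hw : ‖w‖ ≤ ε) (hε1 : ε ≤ 1) (hm : 0 ≤ m)
    (hy : ‖y.1‖ ≤ m) : boxDist (op w y) y ≤ Real.sqrt ((1 + m) * ε) := by
  have hε : 0 ≤ ε := (norm_nonneg w).trans hw
  have h1 : ‖w.1‖ ≤ ε := (norm_fst_le w).trans hw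
  have h2 : |w.2| ≤ ε := (norm_snd_le w).trans hw
  have e : op (-op w y) y = (-w.1, -w.2 + sympl y.1 w.1) := by
    simp only [op]
    ext
    · simp
    · simp [sympl_swap y.1 w.1]; ring
  rw [boxDist, e, boxNorm_le_iff (Real.sqrt_nonneg _), Real.sq_sqrt (by positivity)]
  constructor
  · rw [norm_neg]
    refine Real.le_sqrt_of_sq_le ?_
    nlinarith [norm_nonneg w.1]
  · have h3 := abs_sympl_le y.1 w.1
    have h4 : ‖y.1‖ * ‖w.1‖ ≤ m * ε := by gcongr
    calc |-w.2 + sympl y.1 w.1| ≤ |-w.2| + |sympl y.1 w.1| := abs_add_le _ _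
      _ ≤ (1 + m) * ε := by rw [abs_neg]; linarith

/-- Small translations change a log-Hölder exponent by an amount `δ` for which `ε ^ (-k δ)` stays
bounded. -/
theorem LogHolderOn.exists_forall_translation (hn : 1 ≤ n) {Ω : Set (Heis n)} {p : Heis n → ℝ}
    {γ₁ γ₂ M r₀ : ℝ} {ω : ℝ → ℝ} (h : LogHolderOn Ω p γ₁ γ₂ M r₀ ω) {K : Set (Heis n)}
    (hK : IsCompact K) (hKΩ : K ⊆ Ω) {τ : ℝ} (hτ : 0 < τ) (k : ℕ) :
    ∃ C ε₀ : ℝ, 0 < C ∧ 0 < ε₀ ∧ ε₀ ≤ 1 ∧ ∀ ε, 0 < ε → ε ≤ ε₀ → ∃ δ, 0 ≤ δ ∧ δ ≤ τ ∧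
      (ε⁻¹ ^ k) ^ δ ≤ C ∧ ∀ w : Heis n, ‖w‖ ≤ ε → ∀ y ∈ K, op w y ∈ Ω →
        |p (op w y) - p y| ≤ δ := by
  obtain ⟨m, hm0, hm⟩ : ∃ m : ℝ, 0 ≤ m ∧ ∀ y ∈ K, ‖y.1‖ ≤ m := by
    obtain ⟨m, hm⟩ := hK.isBounded.exists_norm_le
    exact ⟨max m 0, le_max_right _ _, fun y hy =>
      ((norm_fst_le y).trans (hm y hy)).trans (le_max_left _ _)⟩
  set b : ℝ := 25 * (1 + m) with hb
  have hb0 : 0 < b := by positivity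
  have hM := h.const_nonneg
  -- the displacement produced by a translation of size `ε` is at most `√(b ε)`
  set ρ : ℝ → ℝ := fun ε => Real.sqrt (b * ε) with hρ
  have hρt : Tendsto ρ (𝓝[>] 0) (𝓝[>] 0) := by
    refine tendsto_nhdsWithin_iff.2 ⟨?_, ?_⟩
    · have : Continuous ρ := Real.continuous_sqrt.comp (continuous_const.mul continuous_id)
      have h0 := this.tendsto 0
      simp only [hρ, mul_zero, Real.sqrt_zero] at h0
      exact h0.mono_left nhdsWithin_le_nhds
    · filter_upwards [self_mem_nhdsWithin] with ε hε
      exact Real.sqrt_pos.2 (mul_pos hb0 hε)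
  have ev1 : ∀ᶠ ε in 𝓝[>] 0, ω (ρ ε) < τ := (h.tendsto_zero.comp hρt).eventually_lt_const hτ
  have ev2 : ∀ᶠ ε in 𝓝[>] 0, ρ ε ∈ Ioc 0 r₀ := hρt (Ioc_mem_nhdsGT h.pos)
  have hb2 : 0 < min 1 (b ^ 2)⁻¹ := by positivity
  have ev3 : ∀ᶠ ε : ℝ in 𝓝[>] 0, ε ∈ Ioc 0 (min 1 (b ^ 2)⁻¹) := Ioc_mem_nhdsGT hb2
  obtain ⟨ε₀, hε₀, hε₀'⟩ := mem_nhdsGT_iff_exists_Ioc_subset.1 (ev1.and (ev2.and ev3))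
  have hε₀0 : 0 < ε₀ := hε₀
  have hε₀1 : ε₀ ≤ 1 := by
    have := (hε₀' ⟨hε₀0, le_rfl⟩).2.2.2
    exact this.trans (min_le_left _ _)
  refine ⟨Real.exp (k * (4 * M)), ε₀, Real.exp_pos _, hε₀0, hε₀1, fun ε hε hεε => ?_⟩
  obtain ⟨h1, h2, h3⟩ := hε₀' ⟨hε, hεε⟩
  have hδ0 : 0 ≤ ω (ρ ε) := h.nonneg h2.1
  refine ⟨ω (ρ ε), hδ0, h1.le, ?_, fun w hw y hy hwy => ?_⟩
  · have hlog : 0 ≤ Real.log (1 / ε) := Real.log_nonneg (by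
      rw [le_div_iff₀ hε, one_mul]; exact hεε.trans hε₀1)
    have hbε : b ^ 2 * ε ≤ 1 := by
      have := h3.2.trans (min_le_right _ _)
      calc b ^ 2 * ε ≤ b ^ 2 * (b ^ 2)⁻¹ := by gcongr
        _ = 1 := mul_inv_cancel₀ (by positivity)
    have hkey : ω (ρ ε) * Real.log (1 / ε) ≤ 4 * M := by
      have hl := h.log_le _ h2.1 h2.2
      have h4 : Real.log (1 / ε) ≤ 4 * Real.log (1 / ρ ε) := by
        have hρ0 : 0 < ρ ε := h2.1
        have e1 : 4 * Real.log (1 / ρ ε) = Real.log ((1 / ρ ε) ^ 4) := by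
          rw [Real.log_pow]; norm_num
        rw [e1]
        refine Real.log_le_log (by positivity) ?_
        rw [div_pow, one_pow, one_div_le_one_div hε (by positivity)]
        have : ρ ε ^ 4 = (b * ε) ^ 2 := by
          rw [show (4 : ℕ) = 2 * 2 by norm_num, pow_mul, Real.sq_sqrt (by positivity)]
        rw [this]
        nlinarith
      calc ω (ρ ε) * Real.log (1 / ε) ≤ ω (ρ ε) * (4 * Real.log (1 / ρ ε)) := by gcongr
        _ ≤ _ := by linarith
    have e2 : (ε⁻¹ ^ k) ^ ω (ρ ε) = Real.exp (k * (ω (ρ ε) * Real.log (1 / ε))) := by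
      rw [Real.rpow_def_of_pos (by positivity), Real.log_pow, one_div]
      congr 1; ring
    rw [e2]
    gcongr
  · refine h.abs_sub_le hwy (hKΩ hy) h2.1 ((dCC_le_boxDist hn _ _).trans
      (ENNReal.ofReal_le_ofReal ?_))
    have h5 := boxDist_op_left_le hw (hεε.trans hε₀1) hm0 (hm y hy)
    calc 5 * boxDist (op w y) y ≤ 5 * Real.sqrt ((1 + m) * ε) := by gcongr
      _ = ρ ε := by
        simp only [hρ, hb]
        rw [show (25 : ℝ) * (1 + m) * ε = 5 ^ 2 * ((1 + m) * ε) by ring,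
          Real.sqrt_mul (x := 5 ^ 2) (by positivity), Real.sqrt_sq (by norm_num)]

/-! ### Density of test functions in variable exponent spaces -/

/-- For bounded exponents, convergence of the modular to zero implies convergence of the norm. -/
theorem tendsto_luxNorm {E : Type*} [NormedAddCommGroup E] {U : Set (Heis n)} {p : Heis n → ℝ}
    {γ : ℝ} (hU : MeasurableSet U) (hp0 : ∀ x ∈ U, 0 ≤ p x) (hp : ∀ x ∈ U, p x ≤ γ)
    {f : ℕ → Heis n → E}
    (h : Tendsto (fun k => ∫⁻ x in U, ‖f k x‖ₑ ^ p x) atTop (𝓝 0)) :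
    Tendsto (fun k => luxNorm U p (f k)) atTop (𝓝 0) := by
  rw [ENNReal.tendsto_nhds_zero]
  intro ε hε
  obtain ⟨l, hl0, hl⟩ : ∃ l : ℝ≥0∞, 0 < l ∧ l < min ε 1 := exists_between (by simpa using hε)
  have hlε : l < ε := hl.trans_le (min_le_left _ _)
  have hl1 : l < 1 := hl.trans_le (min_le_right _ _)
  have hlt : l ≠ ∞ := (hl1.trans ENNReal.one_lt_top).ne
  have hlγ : 0 < l ^ γ := ENNReal.rpow_pos hl0 hlt
  have hinv : l⁻¹ ^ γ ≠ ∞ := by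
    rw [ENNReal.inv_rpow]; exact ENNReal.inv_ne_top.2 hlγ.ne'
  filter_upwards [(ENNReal.tendsto_nhds_zero.1 h) (l⁻¹ ^ γ)⁻¹ (ENNReal.inv_pos.2 hinv)] with k hk
  refine le_trans (sInf_le ⟨hl0, hl1.trans ENNReal.one_lt_top, ?_⟩) hlε.le
  calc ∫⁻ x in U, (‖f k x‖ₑ / l) ^ p x ≤ ∫⁻ x in U, l⁻¹ ^ γ * ‖f k x‖ₑ ^ p x := by
        refine setLIntegral_mono' hU fun x hx => ?_
        rw [div_eq_mul_inv, ENNReal.mul_rpow_of_nonneg _ _ (hp0 x hx), mul_comm]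
        gcongr
        · rw [ENNReal.one_le_inv]; exact hl1.le
        · exact hp x hx
    _ = l⁻¹ ^ γ * ∫⁻ x in U, ‖f k x‖ₑ ^ p x := lintegral_const_mul' _ _ hinv
    _ ≤ l⁻¹ ^ γ * (l⁻¹ ^ γ)⁻¹ := by gcongr
    _ ≤ 1 := ENNReal.mul_inv_le_one _

theorem rpow_le_rpow_add_one {a : ℝ≥0∞} {s t : ℝ} (hs : 0 ≤ s) (hst : s ≤ t) :
    a ^ s ≤ a ^ t + 1 := by
  rcases le_total a 1 with h | h
  · exact (ENNReal.rpow_le_one h hs).trans le_add_self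
  · exact (ENNReal.rpow_le_rpow_of_exponent_le h hst).trans le_self_add

/-- Modular bound for mollifications with a log-Hölder exponent. -/
theorem exists_forall_mollify_rpow_le (hn : 1 ≤ n) {Ω : Set (Heis n)} {p : Heis n → ℝ}
    {γ₁ γ₂ M r₀ : ℝ} {ω : ℝ → ℝ} (h : LogHolderOn Ω p γ₁ γ₂ M r₀ ω) (hγ₁ : 1 < γ₁)
    {K : Set (Heis n)} (hK : IsCompact K) (hKΩ : K ⊆ Ω) {C₀ : ℝ} (hC₀ : 0 < C₀) {I : ℝ}
    (hI : 0 ≤ I) :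
    ∃ C ε₀ : ℝ, 0 < C ∧ 0 < ε₀ ∧ ∀ ε, 0 < ε → ε ≤ ε₀ → ∀ ρ : Heis n → ℝ, IsMollifier ρ ε →
      (∀ x, ρ x ≤ C₀ * ε⁻¹ ^ Module.finrank ℝ (Heis n)) →
      ∀ (E : Type) [NormedAddCommGroup E] [NormedSpace ℝ E], ∀ f : Heis n → E,
      AEStronglyMeasurable f → (∀ y ∉ K, f y = 0) →
      ∫⁻ y in K, ‖f y‖ₑ ^ p y ≤ ENNReal.ofReal I → ∀ x ∈ Ω,
      ‖mollify ρ f x‖ₑ ^ p x ≤ ENNReal.ofReal C *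
        ((∫⁻ y in K, ‖ρ (op x (-y))‖ₑ * ‖f y‖ₑ ^ p y) + 1) := by
  set k := Module.finrank ℝ (Heis n) with hk
  obtain ⟨C, ε₀, hC, hε₀, hε₀1, H⟩ := h.exists_forall_translation hn hK hKΩ
    (τ := min 1 (γ₁ - 1)) (lt_min one_pos (by linarith)) k
  refine ⟨(C₀ * I + 1) * C, ε₀, by positivity, hε₀, fun ε hε hεε ρ hρ hρC E _ _ f hf hfK hfI x hx => ?_⟩
  obtain ⟨δ, hδ0, hδτ, hδC, hδ⟩ := H ε hε hεε
  have hδ1 : δ ≤ 1 := hδτ.trans (min_le_left _ _)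
  have hδ2 : δ ≤ γ₁ - 1 := hδτ.trans (min_le_right _ _)
  have hpx := h.mem x hx
  set q := p x - δ with hq
  have hq1 : 1 ≤ q := by rw [hq]; linarith [hpx.1]
  have hq0 : 0 < q := by linarith
  have hKm : MeasurableSet K := hK.isClosed.measurableSet
  set B := ∫⁻ y in K, ‖ρ (op x (-y))‖ₑ * ‖f y‖ₑ ^ p y with hB
  have hcont : Measurable fun y => ‖ρ (op x (-y))‖ₑ :=
    (hρ.contDiff.continuous.comp (continuous_op_neg.comp
      (continuous_const.prodMk continuous_id))).enorm.measurable
  set ν := (volume : Measure (Heis n)).withDensity fun y => ‖ρ (op x (-y))‖ₑ with hν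
  have hνac : ν ≪ volume := withDensity_absolutelyContinuous _ _
  have hA : ‖mollify ρ f x‖ₑ ≤ ∫⁻ y, ‖f y‖ₑ ∂ν := by
    refine (enorm_mollify_le f x).trans_eq ?_
    rw [hν, lintegral_withDensity_eq_lintegral_mul₀ hcont.aemeasurable hf.enorm]
    rfl
  have hAq : (∫⁻ y, ‖f y‖ₑ ∂ν) ^ q ≤ B + 1 := by
    have hν1 : ν univ ≤ 1 := by
      rw [hν, withDensity_apply _ MeasurableSet.univ, Measure.restrict_univ,
        lintegral_enorm_kernel hρ]
    refine (rpow_lintegral_le (hf.enorm.mono_ac hνac) hν1 hq1).trans ?_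
    rw [hν, lintegral_withDensity_eq_lintegral_mul₀ hcont.aemeasurable (hf.enorm.pow_const q)]
    calc ∫⁻ y, ((fun y => ‖ρ (op x (-y))‖ₑ) * fun y => ‖f y‖ₑ ^ q) y
        ≤ ∫⁻ y, (K.indicator (fun y => ‖ρ (op x (-y))‖ₑ * ‖f y‖ₑ ^ p y) y + ‖ρ (op x (-y))‖ₑ) := by
          refine lintegral_mono fun y => ?_
          simp only [Pi.mul_apply]
          by_cases hy : y ∈ K
          · rw [indicator_of_mem hy]
            by_cases hz : ρ (op x (-y)) = 0
            · simp [hz]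
            · have h1 := hδ _ (hρ.norm_le_of_ne_zero hz) y hy (by
                rwa [← eq_op_of_kernel x y])
              rw [← eq_op_of_kernel x y] at h1
              have h2 : q ≤ p y := by rw [hq]; linarith [(abs_le.1 h1).2]
              calc ‖ρ (op x (-y))‖ₑ * ‖f y‖ₑ ^ q
                  ≤ ‖ρ (op x (-y))‖ₑ * (‖f y‖ₑ ^ p y + 1) := by
                    gcongr; exact rpow_le_rpow_add_one hq0.le h2
                _ = _ := by rw [mul_add, mul_one]
          · rw [indicator_of_notMem hy, hfK y hy, enorm_zero, ENNReal.zero_rpow_of_pos hq0]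
            simp
      _ = B + 1 := by
          rw [lintegral_add_right _ hcont, lintegral_indicator hKm, lintegral_enorm_kernel hρ]
  have hBle : B + 1 ≤ ENNReal.ofReal ((C₀ * I + 1) * ε⁻¹ ^ k) := by
    have hε1 : 1 ≤ ε⁻¹ ^ k := one_le_pow₀ ((one_le_inv₀ hε).2 (hεε.trans hε₀1))
    have h1 : B ≤ ENNReal.ofReal (C₀ * ε⁻¹ ^ k) * ENNReal.ofReal I := by
      calc B ≤ ∫⁻ y in K, ENNReal.ofReal (C₀ * ε⁻¹ ^ k) * ‖f y‖ₑ ^ p y := by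
            refine lintegral_mono fun y => ?_
            gcongr
            rw [Real.enorm_eq_ofReal (hρ.nonneg _)]
            exact ENNReal.ofReal_le_ofReal (hρC _)
        _ = ENNReal.ofReal (C₀ * ε⁻¹ ^ k) * ∫⁻ y in K, ‖f y‖ₑ ^ p y :=
            lintegral_const_mul' _ _ ENNReal.ofReal_ne_top
        _ ≤ _ := by gcongr
    calc B + 1 ≤ ENNReal.ofReal (C₀ * ε⁻¹ ^ k) * ENNReal.ofReal I + ENNReal.ofReal 1 := by
          rw [ENNReal.ofReal_one]; gcongr
      _ = ENNReal.ofReal (C₀ * ε⁻¹ ^ k * I + 1) := by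
          rw [← ENNReal.ofReal_mul (by positivity), ← ENNReal.ofReal_add (by positivity) zero_le_one]
      _ ≤ _ := by
          refine ENNReal.ofReal_le_ofReal ?_
          calc C₀ * ε⁻¹ ^ k * I + 1 ≤ C₀ * ε⁻¹ ^ k * I + ε⁻¹ ^ k := by gcongr
            _ = _ := by ring
  have hpow : (B + 1) ^ (δ / q) ≤ ENNReal.ofReal ((C₀ * I + 1) * C) := by
    have hB1 : 1 ≤ B + 1 := le_add_self
    have hδq : δ / q ≤ δ := div_le_self hδ0 hq1
    calc (B + 1) ^ (δ / q) ≤ (B + 1) ^ δ := ENNReal.rpow_le_rpow_of_exponent_le hB1 hδq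
      _ ≤ ENNReal.ofReal ((C₀ * I + 1) * ε⁻¹ ^ k) ^ δ := by gcongr
      _ = ENNReal.ofReal ((C₀ * I + 1) ^ δ * (ε⁻¹ ^ k) ^ δ) := by
          rw [ENNReal.ofReal_rpow_of_nonneg (by positivity) hδ0,
            Real.mul_rpow (by positivity) (by positivity)]
      _ ≤ _ := by
          refine ENNReal.ofReal_le_ofReal ?_
          have h1 : (C₀ * I + 1) ^ δ ≤ C₀ * I + 1 := by
            have h2 : 1 ≤ C₀ * I + 1 := by
              have : 0 ≤ C₀ * I := by positivity
              linarith
            calc (C₀ * I + 1) ^ δ ≤ (C₀ * I + 1) ^ (1 : ℝ) :=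
                  Real.rpow_le_rpow_of_exponent_le h2 hδ1
              _ = _ := Real.rpow_one _
          gcongr
  have hexp : p x = q * (1 + δ / q) := by
    rw [mul_add, mul_one, mul_div_cancel₀ _ hq0.ne', hq]; ring
  calc ‖mollify ρ f x‖ₑ ^ p x ≤ (∫⁻ y, ‖f y‖ₑ ∂ν) ^ p x :=
        ENNReal.rpow_le_rpow hA (by linarith [hpx.1])
    _ = ((∫⁻ y, ‖f y‖ₑ ∂ν) ^ q) ^ (1 + δ / q) := by rw [← ENNReal.rpow_mul, ← hexp]
    _ ≤ (B + 1) ^ (1 + δ / q) := ENNReal.rpow_le_rpow hAq (by positivity)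
    _ = (B + 1) * (B + 1) ^ (δ / q) := by
        rw [ENNReal.rpow_add_of_nonneg _ _ zero_le_one (by positivity), ENNReal.rpow_one]
    _ ≤ (B + 1) * ENNReal.ofReal ((C₀ * I + 1) * C) := by gcongr
    _ = _ := mul_comm _ _

/-- Modular convergence from `L¹` convergence at a geometric rate and modular domination. -/
theorem tendsto_modular {E : Type*} [NormedAddCommGroup E] {U : Set (Heis n)} {p : Heis n → ℝ}
    {γ : ℝ} (hU : MeasurableSet U) (hUfin : volume U ≠ ∞) (hpm : AEMeasurable p (volume.restrict U))
    (hp0 : ∀ x ∈ U, 0 < p x) (hp : ∀ x ∈ U, p x ≤ γ) {f : Heis n → E} {F : ℕ → Heis n → E}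
    (hf : AEStronglyMeasurable f) (hF : ∀ j, AEStronglyMeasurable (F j))
    (hFf : ∀ j, ∫⁻ x, ‖F j x - f x‖ₑ ≤ ENNReal.ofReal ((1 / 2) ^ j))
    {g : Heis n → ℝ} {B : ℕ → Heis n → ℝ} (hg : AEStronglyMeasurable g)
    (hgfin : ∫⁻ x, ‖g x‖ₑ ≠ ∞)
    (hB : ∀ j, AEStronglyMeasurable (B j))
    (hBg : ∀ j, ∫⁻ x, ‖B j x - g x‖ₑ ≤ ENNReal.ofReal ((1 / 2) ^ j)) {C : ℝ≥0∞} (hC : C ≠ ∞)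
    (hFB : ∀ j, ∀ x ∈ U, ‖F j x‖ₑ ^ p x ≤ C * (‖B j x‖ₑ + 1))
    (hfg : ∀ x ∈ U, ‖f x‖ₑ ^ p x ≤ ‖g x‖ₑ) :
    Tendsto (fun j => ∫⁻ x in U, ‖F j x - f x‖ₑ ^ p x) atTop (𝓝 0) := by
  have hgeo : ∑' j : ℕ, ENNReal.ofReal ((1 / 2) ^ j) ≠ ∞ :=
    (summable_geometric_two).tsum_ofReal_ne_top
  set S : Heis n → ℝ≥0∞ := fun x => ∑' j, ‖B j x - g x‖ₑ with hS
  have hSm : AEMeasurable S volume := AEMeasurable.tsum fun j => ((hB j).sub hg).enorm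
  have hSfin : ∫⁻ x, S x ≠ ∞ := by
    have e := lintegral_tsum (μ := volume) (f := fun j x => ‖B j x - g x‖ₑ)
      fun j => ((hB j).sub hg).enorm
    simp only [hS]
    rw [e]
    exact ne_top_of_le_ne_top hgeo (ENNReal.tsum_le_tsum hBg)
  have hae : ∀ᵐ x, Tendsto (fun j => ‖F j x - f x‖ₑ) atTop (𝓝 0) := by
    have h1 : ∫⁻ x, ∑' j, ‖F j x - f x‖ₑ ≠ ∞ := by
      have e := lintegral_tsum (μ := volume) (f := fun j x => ‖F j x - f x‖ₑ)
        fun j => ((hF j).sub hf).enorm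
      rw [e]
      exact ne_top_of_le_ne_top hgeo (ENNReal.tsum_le_tsum hFf)
    filter_upwards [ae_lt_top' (AEMeasurable.tsum fun j => ((hF j).sub hf).enorm) h1] with x hx
    exact ENNReal.tendsto_atTop_zero_of_tsum_ne_top hx.ne
  set bound : Heis n → ℝ≥0∞ := fun x =>
    ENNReal.ofReal (2 ^ γ) * (C * (‖g x‖ₑ + S x + 1) + ‖g x‖ₑ) with hbound
  have hlim : ∫⁻ x in U, (0 : ℝ≥0∞) = 0 := lintegral_zero
  rw [← hlim]
  refine tendsto_lintegral_of_dominated_convergence' bound (fun j => ?_) (fun j => ?_) ?_ ?_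
  · exact ((hF j).sub hf).enorm.restrict.pow hpm
  · filter_upwards [ae_restrict_mem hU] with x hx
    have hpx := hp0 x hx
    have h1 : ‖F j x - f x‖ₑ ^ p x ≤ ENNReal.ofReal (2 ^ γ) * (‖F j x‖ₑ ^ p x + ‖f x‖ₑ ^ p x) := by
      have hmax : ‖F j x - f x‖ₑ ≤ 2 * max ‖F j x‖ₑ ‖f x‖ₑ := by
        refine enorm_sub_le.trans ?_
        rw [two_mul]
        exact add_le_add (le_max_left _ _) (le_max_right _ _)
      calc ‖F j x - f x‖ₑ ^ p x ≤ (2 * max ‖F j x‖ₑ ‖f x‖ₑ) ^ p x :=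
            ENNReal.rpow_le_rpow hmax hpx.le
        _ = 2 ^ p x * max ‖F j x‖ₑ ‖f x‖ₑ ^ p x := ENNReal.mul_rpow_of_nonneg _ _ hpx.le
        _ ≤ ENNReal.ofReal (2 ^ γ) * (‖F j x‖ₑ ^ p x + ‖f x‖ₑ ^ p x) := by
            refine mul_le_mul' ?_ ?_
            · rw [← ENNReal.ofReal_rpow_of_pos two_pos, ENNReal.ofReal_ofNat]
              exact ENNReal.rpow_le_rpow_of_exponent_le one_le_two (hp x hx)
            · rcases le_total ‖F j x‖ₑ ‖f x‖ₑ with h | h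
              · rw [max_eq_right h]; exact le_add_self
              · rw [max_eq_left h]; exact le_self_add
    refine h1.trans ?_
    have h2 : ‖B j x‖ₑ ≤ ‖g x‖ₑ + S x := by
      calc ‖B j x‖ₑ = ‖g x + (B j x - g x)‖ₑ := by rw [add_sub_cancel]
        _ ≤ ‖g x‖ₑ + ‖B j x - g x‖ₑ := enorm_add_le _ _
        _ ≤ _ := by gcongr; exact ENNReal.le_tsum (f := fun j => ‖B j x - g x‖ₑ) j
    simp only [hbound]
    gcongr
    · exact (hFB j x hx).trans (by gcongr)
    · exact hfg x hx
  · have hm : AEMeasurable (fun x => ‖g x‖ₑ + S x + 1) (volume.restrict U) :=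
      ((hg.enorm.add hSm).add_const 1).restrict
    rw [hbound, lintegral_const_mul' _ _ ENNReal.ofReal_ne_top]
    refine ENNReal.mul_ne_top ENNReal.ofReal_ne_top ?_
    rw [lintegral_add_right' _ hg.enorm.restrict, lintegral_const_mul' _ _ hC,
      lintegral_add_right _ measurable_const, lintegral_add_right' _ hSm.restrict]
    have hg' : ∫⁻ x in U, ‖g x‖ₑ ≠ ∞ := ne_top_of_le_ne_top hgfin (setLIntegral_le_lintegral _ _)
    have hS' : ∫⁻ x in U, S x ≠ ∞ := ne_top_of_le_ne_top hSfin (setLIntegral_le_lintegral _ _)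
    refine ENNReal.add_ne_top.2 ⟨ENNReal.mul_ne_top hC ?_, hg'⟩
    refine ENNReal.add_ne_top.2 ⟨ENNReal.add_ne_top.2 ⟨hg', hS'⟩, ?_⟩
    simpa using hUfin
  · filter_upwards [ae_restrict_of_ae hae, ae_restrict_mem hU] with x hx hxU
    have := (ENNReal.continuous_rpow_const (y := p x)).tendsto 0 |>.comp hx
    rwa [ENNReal.zero_rpow_of_pos (hp0 x hxU)] at this

end

section

variable {n : ℕ}

theorem enorm_norm_rpow {E : Type*} [NormedAddCommGroup E] (a : E) {s : ℝ} (hs : 0 ≤ s) :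
    ‖‖a‖ ^ s‖ₑ = ‖a‖ₑ ^ s := by
  rw [Real.enorm_eq_ofReal (by positivity), ← ENNReal.ofReal_rpow_of_nonneg (norm_nonneg _) hs,
    ofReal_norm]

/-- The density `‖f‖ ^ p` on `K`, extended by zero. -/
def powInd {E : Type*} [NormedAddCommGroup E] (K : Set (Heis n)) (p : Heis n → ℝ) (f : Heis n → E) :
    Heis n → ℝ :=
  K.indicator fun x => ‖f x‖ ^ p x

theorem powInd_nonneg {E : Type*} [NormedAddCommGroup E] (K : Set (Heis n)) (p : Heis n → ℝ)
    (f : Heis n → E) (x : Heis n) : 0 ≤ powInd K p f x :=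
  indicator_nonneg (fun x _ => by positivity) x

theorem enorm_powInd {E : Type*} [NormedAddCommGroup E] {K : Set (Heis n)} {p : Heis n → ℝ}
    (f : Heis n → E) (hp : ∀ x ∈ K, 0 ≤ p x) (x : Heis n) :
    ‖powInd K p f x‖ₑ = K.indicator (fun x => ‖f x‖ₑ ^ p x) x := by
  unfold powInd
  by_cases hx : x ∈ K
  · rw [indicator_of_mem hx, indicator_of_mem hx, enorm_norm_rpow _ (hp x hx)]
  · rw [indicator_of_notMem hx, indicator_of_notMem hx, enorm_zero]

theorem integrable_powInd {E : Type*} [NormedAddCommGroup E] {K : Set (Heis n)} {p : Heis n → ℝ}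
    {f : Heis n → E} (hK : MeasurableSet K) (hp : ∀ x ∈ K, 0 ≤ p x)
    (hpm : AEMeasurable p (volume.restrict K)) (hf : AEStronglyMeasurable f (volume.restrict K))
    (hfin : ∫⁻ x in K, ‖f x‖ₑ ^ p x < ∞) : Integrable (powInd K p f) := by
  refine ⟨?_, ?_⟩
  · unfold powInd
    exact ((aemeasurable_indicator_iff hK).2 (hf.norm.aemeasurable.pow hpm)).aestronglyMeasurable
  · unfold HasFiniteIntegral
    simp_rw [enorm_powInd f hp]
    rwa [lintegral_indicator hK]

theorem integrable_of_modular {E : Type*} [NormedAddCommGroup E] {K : Set (Heis n)}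
    {p : Heis n → ℝ} {f : Heis n → E} (hK : MeasurableSet K) (hvol : volume K ≠ ∞)
    (hp : ∀ x ∈ K, 1 ≤ p x) (hf : AEStronglyMeasurable f (volume.restrict K))
    (hfin : ∫⁻ x in K, ‖f x‖ₑ ^ p x < ∞) : IntegrableOn f K := by
  refine ⟨hf, ?_⟩
  calc ∫⁻ x in K, ‖f x‖ₑ ≤ ∫⁻ x in K, (‖f x‖ₑ ^ p x + 1) := by
        refine setLIntegral_mono' hK fun x hx => ?_
        simpa using rpow_le_rpow_add_one (a := ‖f x‖ₑ) zero_le_one (hp x hx)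
    _ = (∫⁻ x in K, ‖f x‖ₑ ^ p x) + volume K := by
        rw [lintegral_add_right _ measurable_const]; simp
    _ < ∞ := ENNReal.add_lt_top.2 ⟨hfin, hvol.lt_top⟩

theorem exists_forall_mollify_rpow_le' (hn : 1 ≤ n) {Ω : Set (Heis n)} {p : Heis n → ℝ}
    {γ₁ γ₂ M r₀ : ℝ} {ω : ℝ → ℝ} (h : LogHolderOn Ω p γ₁ γ₂ M r₀ ω) (hγ₁ : 1 < γ₁)
    {K : Set (Heis n)} (hK : IsCompact K) (hKΩ : K ⊆ Ω) {C₀ : ℝ} (hC₀ : 0 < C₀)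
    {E : Type} [NormedAddCommGroup E] [NormedSpace ℝ E] {f : Heis n → E}
    (hf : AEStronglyMeasurable f) (hfK : ∀ y ∉ K, f y = 0)
    (hfin : ∫⁻ y in K, ‖f y‖ₑ ^ p y < ∞) (hpm : AEMeasurable p (volume.restrict K)) :
    ∃ C ε₀ : ℝ, 0 < C ∧ 0 < ε₀ ∧ ∀ ε, 0 < ε → ε ≤ ε₀ → ∀ ρ : Heis n → ℝ, IsMollifier ρ ε →
      (∀ x, ρ x ≤ C₀ * ε⁻¹ ^ Module.finrank ℝ (Heis n)) → ∀ x ∈ Ω,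
      ‖mollify ρ f x‖ₑ ^ p x ≤ ENNReal.ofReal C * (‖mollify ρ (powInd K p f) x‖ₑ + 1) := by
  have hp0 : ∀ x ∈ K, 0 ≤ p x := fun x hx => by
    have := (h.mem x (hKΩ hx)).1; linarith
  obtain ⟨C, ε₀, hC, hε₀, H⟩ := exists_forall_mollify_rpow_le hn h hγ₁ hK hKΩ hC₀
    (I := (∫⁻ y in K, ‖f y‖ₑ ^ p y).toReal) ENNReal.toReal_nonneg
  refine ⟨C, ε₀, hC, hε₀, fun ε hε hεε ρ hρ hρC x hx => ?_⟩
  have h1 := H ε hε hεε ρ hρ hρC E f hf hfK (ENNReal.ofReal_toReal hfin.ne).ge x hx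
  have hKm := hK.isClosed.measurableSet
  have hg := integrable_powInd hKm hp0 hpm hf.restrict hfin
  have e : ‖mollify ρ (powInd K p f) x‖ₑ = ∫⁻ y in K, ‖ρ (op x (-y))‖ₑ * ‖f y‖ₑ ^ p y := by
    have hnn : ∀ y, 0 ≤ ρ (op x (-y)) • powInd K p f y := fun y =>
      mul_nonneg (hρ.nonneg _) (powInd_nonneg K p f y)
    have h2 := ofReal_integral_eq_lintegral_ofReal
      (integrable_kernel_smul hρ hg.locallyIntegrable x) (Eventually.of_forall hnn)
    rw [mollify, Real.enorm_eq_ofReal (integral_nonneg hnn), h2, ← lintegral_indicator hKm]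
    refine lintegral_congr fun y => ?_
    rw [← Real.enorm_eq_ofReal (hnn y), enorm_smul, enorm_powInd f hp0]
    by_cases hy : y ∈ K
    · simp [hy]
    · simp [hy]
  rw [e]; exact h1

/-- Compactly supported weakly differentiable functions of finite modular are limits of test
functions when the exponent is log-Hölder continuous. -/
theorem memHW0_of_isWeakHGrad (hn : 1 ≤ n) {Ω : Set (Heis n)} {p : Heis n → ℝ}
    {γ₁ γ₂ M r₀ : ℝ} {ω : ℝ → ℝ} (h : LogHolderOn Ω p γ₁ γ₂ M r₀ ω) (hγ₁ : 1 < γ₁)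
    {U K : Set (Heis n)} (hU : IsOpen U) (hUΩ : U ⊆ Ω) (hUfin : volume U ≠ ∞)
    (hK : IsCompact K) (hKU : K ⊆ U) {f : Heis n → ℝ} {G : Heis n → Hor n}
    (hf : AEStronglyMeasurable f) (hG : AEStronglyMeasurable G)
    (hfK : ∀ y ∉ K, f y = 0) (hGK : ∀ y ∉ K, G y = 0) (hfG : IsWeakHGrad univ f G)
    (hffin : ∫⁻ x in K, ‖f x‖ₑ ^ p x < ∞) (hGfin : ∫⁻ x in K, ‖G x‖ₑ ^ p x < ∞) :
    MemHW0 U p f G := by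
  have hKΩ : K ⊆ Ω := hKU.trans hUΩ
  have hKm := hK.isClosed.measurableSet
  have hpU : ∀ x ∈ U, 0 < p x := fun x hx => by
    have := (h.mem x (hUΩ hx)).1; linarith
  have hpK1 : ∀ x ∈ K, 1 ≤ p x := fun x hx => by
    have := (h.mem x (hKΩ hx)).1; linarith
  have hpK0 : ∀ x ∈ K, 0 ≤ p x := fun x hx => by linarith [hpK1 x hx]
  have hpUγ : ∀ x ∈ U, p x ≤ γ₂ := fun x hx => (h.mem x (hUΩ hx)).2
  have hpm : AEMeasurable p (volume.restrict U) :=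
    ((h.continuousOn hn).mono hUΩ).aemeasurable hU.measurableSet
  have hpmK : AEMeasurable p (volume.restrict K) := hpm.mono_measure (Measure.restrict_mono hKU le_rfl)
  have hKfin : volume K ≠ ∞ := hK.measure_lt_top.ne
  have hfi : Integrable f := (integrableOn_iff_integrable_of_support_subset fun x hx => by
    by_contra hxK; exact hx (hfK x hxK)).1
      (integrable_of_modular hKm hKfin hpK1 hf.restrict hffin)
  have hGi : Integrable G := (integrableOn_iff_integrable_of_support_subset fun x hx => by
    by_contra hxK; exact hx (hGK x hxK)).1
      (integrable_of_modular hKm hKfin hpK1 hG.restrict hGfin)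
  have hgf := integrable_powInd hKm hpK0 hpmK hf.restrict hffin
  have hgG := integrable_powInd hKm hpK0 hpmK hG.restrict hGfin
  obtain ⟨C₀, hC₀, hmoll⟩ := exists_isMollifier n
  obtain ⟨Cf, εf, hCf, hεf, Hf⟩ := exists_forall_mollify_rpow_le' hn h hγ₁ hK hKΩ hC₀ hf hfK hffin hpmK
  obtain ⟨CG, εG, hCG, hεG, HG⟩ := exists_forall_mollify_rpow_le' hn h hγ₁ hK hKΩ hC₀ hG hGK hGfin hpmK
  obtain ⟨εU, hεU, HU⟩ := exists_forall_op_mem hK hU hKU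
  -- mollifiers for which the functions, their gradients and the modular densities all converge in
  -- `L¹` at a summable rate; along such a sequence generalized dominated convergence applies
  have hseq : ∀ j : ℕ, ∃ (ρ : Heis n → ℝ) (ε : ℝ), IsMollifier ρ ε ∧ ε ≤ εU ∧
      (∀ x ∈ Ω, ‖mollify ρ f x‖ₑ ^ p x ≤ ENNReal.ofReal Cf * (‖mollify ρ (powInd K p f) x‖ₑ + 1)) ∧
      (∀ x ∈ Ω, ‖mollify ρ G x‖ₑ ^ p x ≤ ENNReal.ofReal CG * (‖mollify ρ (powInd K p G) x‖ₑ + 1)) ∧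
      ∫⁻ x, ‖mollify ρ f x - f x‖ₑ ≤ ENNReal.ofReal ((1 / 2) ^ j) ∧
      ∫⁻ x, ‖mollify ρ G x - G x‖ₑ ≤ ENNReal.ofReal ((1 / 2) ^ j) ∧
      ∫⁻ x, ‖mollify ρ (powInd K p f) x - powInd K p f x‖ₑ ≤ ENNReal.ofReal ((1 / 2) ^ j) ∧
      ∫⁻ x, ‖mollify ρ (powInd K p G) x - powInd K p G x‖ₑ ≤ ENNReal.ofReal ((1 / 2) ^ j) := by
    intro j
    have hδ : ENNReal.ofReal ((1 / 2) ^ j) ≠ 0 := by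
      rw [ne_eq, ENNReal.ofReal_eq_zero, not_le]; positivity
    obtain ⟨η₁, hη₁, h₁⟩ := exists_forall_lintegral_mollify_sub_le hfi hδ
    obtain ⟨η₂, hη₂, h₂⟩ := exists_forall_lintegral_mollify_sub_le hGi hδ
    obtain ⟨η₃, hη₃, h₃⟩ := exists_forall_lintegral_mollify_sub_le hgf hδ
    obtain ⟨η₄, hη₄, h₄⟩ := exists_forall_lintegral_mollify_sub_le hgG hδ
    obtain ⟨ε, hε, e1, e2, e3, e4, e5, e6, e7⟩ : ∃ ε > 0, ε ≤ εU ∧ ε ≤ εf ∧ ε ≤ εG ∧ ε ≤ η₁ ∧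
        ε ≤ η₂ ∧ ε ≤ η₃ ∧ ε ≤ η₄ := by
      refine ⟨min εU (min εf (min εG (min η₁ (min η₂ (min η₃ η₄))))), by positivity, ?_⟩
      simp only [min_le_iff, le_refl, true_or, or_true, and_self]
    obtain ⟨ρ, hρ, hρC⟩ := hmoll ε hε
    exact ⟨ρ, ε, hρ, e1, Hf ε hε e2 ρ hρ hρC, HG ε hε e3 ρ hρ hρC, h₁ ε e4 ρ hρ, h₂ ε e5 ρ hρ,
      h₃ ε e6 ρ hρ, h₄ ε e7 ρ hρ⟩
  choose ρ ε hρ hεU' hb1 hb2 l1 l2 l3 l4 using hseq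
  have hsm : ∀ j, ContDiff ℝ ((⊤ : ℕ∞) : WithTop ℕ∞) (mollify (ρ j) f) := fun j =>
    contDiff_mollify hfi.locallyIntegrable (hρ j).contDiff (hρ j).hasCompactSupport
  have hgr : ∀ j, hgrad (mollify (ρ j) f) = mollify (ρ j) G := fun j => funext fun x =>
    hgrad_mollify hfi.locallyIntegrable hGi.locallyIntegrable hfG (hρ j).contDiff
      (hρ j).hasCompactSupport x
  have hcG : ∀ j, AEStronglyMeasurable (mollify (ρ j) G) := fun j => by
    rw [← hgr]
    exact (continuous_hgrad ((hsm j).of_le (by exact_mod_cast le_top))).aestronglyMeasurable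
  have hcg : ∀ (g : Heis n → ℝ), Integrable g → ∀ j, AEStronglyMeasurable (mollify (ρ j) g) :=
    fun g hg j => (contDiff_mollify hg.locallyIntegrable (hρ j).contDiff
      (hρ j).hasCompactSupport).continuous.aestronglyMeasurable
  have hmodle : ∀ (E : Type) [NormedAddCommGroup E] (F : Heis n → E), (∀ y ∉ K, F y = 0) →
      ∀ x ∈ U, ‖F x‖ₑ ^ p x ≤ ‖powInd K p F x‖ₑ := fun E _ F hF x hx => by
    rw [enorm_powInd F hpK0]
    by_cases hxK : x ∈ K
    · rw [indicator_of_mem hxK]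
    · rw [hF x hxK, enorm_zero, ENNReal.zero_rpow_of_pos (hpU x hx)]; exact zero_le
  have hmodfin : ∀ (E : Type) [NormedAddCommGroup E] (F : Heis n → E), (∀ y ∉ K, F y = 0) →
      Integrable (powInd K p F) → ∫⁻ x in U, ‖F x‖ₑ ^ p x < ∞ := fun E _ F hF hi =>
    ((setLIntegral_mono' hU.measurableSet (hmodle E F hF)).trans
      (setLIntegral_le_lintegral _ _)).trans_lt hi.2
  have t1 := tendsto_modular (U := U) (p := p) hU.measurableSet hUfin hpm hpU hpUγ hf
    (fun j => (hsm j).continuous.aestronglyMeasurable) l1 hgf.1 hgf.2.ne (hcg _ hgf) l3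
    ENNReal.ofReal_ne_top (fun j x hx => hb1 j x (hUΩ hx)) (hmodle ℝ f hfK)
  have t2 := tendsto_modular (U := U) (p := p) hU.measurableSet hUfin hpm hpU hpUγ hG
    hcG l2 hgG.1 hgG.2.ne (hcg _ hgG) l4
    ENNReal.ofReal_ne_top (fun j x hx => hb2 j x (hUΩ hx)) (hmodle (Hor n) G hGK)
  refine ⟨⟨⟨hf.restrict, hmodfin ℝ f hfK hgf⟩, ⟨hG.restrict, hmodfin (Hor n) G hGK hgG⟩, ?_⟩,
    fun j => mollify (ρ j) f, fun j => ⟨hsm j, hasCompactSupport_mollify (hρ j) hK hfK, ?_⟩, ?_⟩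
  · intro ψ hψ j
    have h1 := hfG ψ ⟨hψ.1, hψ.2.1, subset_univ _⟩ j
    rw [setIntegral_univ, setIntegral_univ] at h1
    rw [setIntegral_eq_integral_of_forall_compl_eq_zero (fun x hx => by
        rw [hfK x fun hxK => hx (hKU hxK), zero_mul]),
      setIntegral_eq_integral_of_forall_compl_eq_zero (fun x hx => by
        rw [hGK x fun hxK => hx (hKU hxK)]; simp)]
    exact h1
  · refine (tsupport_mollify_subset (hρ j) hK hfK).trans ?_
    rintro _ ⟨⟨w, y⟩, ⟨hw, hy⟩, rfl⟩
    exact HU w ((by simpa using hw : ‖w‖ ≤ ε j).trans (hεU' j)) y hy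
  · have := (tendsto_luxNorm hU.measurableSet (fun x hx => (hpU x hx).le) hpUγ t1).add
      (tendsto_luxNorm hU.measurableSet (fun x hx => (hpU x hx).le) hpUγ t2)
    rw [add_zero] at this
    simp_rw [hgr]
    exact this

/-- Testing the definition with a cutoff that equals one on the support. -/
theorem integral_eq_zero_of_isWeakHGrad {K : Set (Heis n)} (hK : IsCompact K) {f : Heis n → ℝ}
    {G : Heis n → Hor n} (hG : Integrable G) (hfK : ∀ y ∉ K, f y = 0) (hGK : ∀ y ∉ K, G y = 0)
    (hfG : IsWeakHGrad univ f G) : ∫ x, G x = 0 := by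
  obtain ⟨m, hm⟩ := (hK.image continuous_boxNorm).isBounded.exists_norm_le
  obtain ⟨_, -, hcut⟩ := exists_cutoff n
  obtain ⟨η, hη, -, hη1, hη2, -, -⟩ := hcut 0 (max m 1) (by positivity)
  have hK1 : ∀ x ∈ K, η x = 1 := fun x hx => hη2 x (by
    rw [mem_cball_iff, boxDist, neg_zero, zero_op]
    have := hm _ ⟨x, hx, rfl⟩
    rw [Real.norm_of_nonneg (boxNorm_nonneg x)] at this
    exact this.trans (le_max_left _ _))
  ext j
  have h1 := hfG η hη j
  rw [setIntegral_univ, setIntegral_univ] at h1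
  have e1 : ∀ x, f x * hgrad η x j = 0 := fun x => by
    by_cases hx : x ∈ K
    · rw [hgrad_eq_zero_of_eq_one hη1 (hK1 x hx)]; simp
    · rw [hfK x hx, zero_mul]
  have e2 : ∀ x, G x j * η x = G x j := fun x => by
    by_cases hx : x ∈ K
    · rw [hK1 x hx, mul_one]
    · rw [hGK x hx]; simp
  simp_rw [e1, e2] at h1
  rw [integral_zero] at h1
  have h2 := (EuclideanSpace.proj j : Hor n →L[ℝ] ℝ).integral_comp_comm hG
  simp only [PiLp.proj_apply] at h2
  rw [← h2, PiLp.zero_apply]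
  linarith

end

/-! ### The Caccioppoli inequality -/

section

/-- Young's inequality with a constant uniform in the exponent. -/
theorem rpow_sub_one_mul_le {x y p γ₂ δ : ℝ} (hx : 0 ≤ x) (hy : 0 ≤ y) (hp : 1 < p) (hpγ : p ≤ γ₂)
    (hδ : 0 < δ) (hδ1 : δ ≤ 1) :
    x ^ (p - 1) * y ≤ δ * x ^ p + (1 / δ) ^ γ₂ * y ^ p := by
  have e : ∀ z : ℝ, 0 ≤ z → z ^ (p - 1) * z = z ^ p := fun z hz => by
    rw [← Real.rpow_add_one' hz (by linarith), sub_add_cancel]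
  rcases le_or_gt y (δ * x) with h | h
  · calc x ^ (p - 1) * y ≤ x ^ (p - 1) * (δ * x) := by gcongr
      _ = δ * (x ^ (p - 1) * x) := by ring
      _ = δ * x ^ p := by rw [e x hx]
      _ ≤ _ := le_add_of_nonneg_right (by positivity)
  · have hxy : x ≤ 1 / δ * y := by
      rw [one_div, ← div_eq_inv_mul, le_div_iff₀ hδ]; linarith
    have h1 : (1 / δ) ^ (p - 1) ≤ (1 / δ) ^ γ₂ :=
      Real.rpow_le_rpow_of_exponent_le (by rw [le_div_iff₀ hδ]; linarith) (by linarith)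
    calc x ^ (p - 1) * y ≤ (1 / δ * y) ^ (p - 1) * y := by
          gcongr
      _ = (1 / δ) ^ (p - 1) * (y ^ (p - 1) * y) := by
          rw [Real.mul_rpow (by positivity) hy]; ring
      _ ≤ (1 / δ) ^ γ₂ * y ^ p := by rw [e y hy]; gcongr
      _ ≤ _ := le_add_of_nonneg_left (by positivity)

/-- Young's inequality with the conjugate exponent of `p` raised to that of the lower bound `γ₁`. -/
theorem mul_le_rpow_add_conj {f y p γ₁ δ : ℝ} (hf : 0 ≤ f) (hy : 0 ≤ y) (hγ₁ : 1 < γ₁)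
    (hp : γ₁ ≤ p) (hδ : 0 < δ) (hδ1 : δ ≤ 1) :
    f * y ≤ δ * y ^ p + (1 / δ) ^ (1 / (γ₁ - 1)) * (f ^ (γ₁ / (γ₁ - 1)) + 1) := by
  have hp1 : 0 < p - 1 := by linarith
  have hγ1 : 0 < γ₁ - 1 := by linarith
  have e : y ^ (p - 1) * y = y ^ p := by
    rw [← Real.rpow_add_one' hy (by linarith), sub_add_cancel]
  rcases le_or_gt f (δ * y ^ (p - 1)) with h | h
  · calc f * y ≤ δ * y ^ (p - 1) * y := by gcongr
      _ = δ * y ^ p := by rw [mul_assoc, e]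
      _ ≤ _ := le_add_of_nonneg_right (by positivity)
  · have h1 : y ≤ (1 / δ * f) ^ (1 / (p - 1)) := by
      rw [one_div (p - 1), Real.le_rpow_inv_iff_of_pos hy (by positivity) hp1, one_div,
        ← div_eq_inv_mul, le_div_iff₀ hδ]
      linarith
    have h2 : 1 / (p - 1) ≤ 1 / (γ₁ - 1) := one_div_le_one_div_of_le hγ1 (by linarith)
    have h3 : f * f ^ (1 / (p - 1)) ≤ f ^ (γ₁ / (γ₁ - 1)) + 1 := by
      have e2 : f * f ^ (1 / (p - 1)) = f ^ (1 + 1 / (p - 1)) := by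
        rw [Real.rpow_add' hf (by positivity), Real.rpow_one]
      have e3 : γ₁ / (γ₁ - 1) = 1 + 1 / (γ₁ - 1) := by field_simp; ring
      rw [e2, e3]
      rcases le_or_gt f 1 with h4 | h4
      · exact (Real.rpow_le_one hf h4 (by positivity)).trans (le_add_of_nonneg_left (by positivity))
      · exact le_add_of_le_of_nonneg
          (Real.rpow_le_rpow_of_exponent_le h4.le (add_le_add_right h2 1)) zero_le_one
    calc f * y ≤ f * (1 / δ * f) ^ (1 / (p - 1)) := by gcongr
      _ = (1 / δ) ^ (1 / (p - 1)) * (f * f ^ (1 / (p - 1))) := by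
          rw [Real.mul_rpow (by positivity) hf]; ring
      _ ≤ (1 / δ) ^ (1 / (γ₁ - 1)) * (f ^ (γ₁ / (γ₁ - 1)) + 1) := by
          have : (1 / δ) ^ (1 / (p - 1)) ≤ (1 / δ) ^ (1 / (γ₁ - 1)) :=
            Real.rpow_le_rpow_of_exponent_le (by rw [le_div_iff₀ hδ]; linarith) h2
          gcongr
      _ ≤ _ := le_add_of_nonneg_left (by positivity)

theorem norm_rpow_sub_two_smul {E : Type*} [NormedAddCommGroup E] [NormedSpace ℝ E] (V : E) {p a : ℝ}
    (hp : 1 < p) (ha : 0 ≤ a) : ‖(a * ‖V‖ ^ (p - 2)) • V‖ = a * ‖V‖ ^ (p - 1) := by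
  rw [norm_smul, Real.norm_of_nonneg (by positivity), mul_assoc,
    ← Real.rpow_add_one' (norm_nonneg V) (by linarith)]
  ring_nf

/-- The power `η ^ m` of the cutoff with `m ≥ p` is what allows the gradient of the cutoff to be
absorbed: `η ^ (m - 1) ≤ (η ^ m) ^ ((p - 1) / p)`. -/
theorem exists_pointwise_caccioppoli_const {E : Type*} [NormedAddCommGroup E]
    [InnerProductSpace ℝ E] {γ₁ γ₂ ν Λ : ℝ} (hγ₁ : 1 < γ₁) (hν : 0 < ν) {m : ℕ} (hm : γ₂ ≤ m) :
    ∃ C : ℝ, 0 < C ∧ ∀ (p a η s : ℝ) (V f w : E), p ∈ Icc γ₁ γ₂ → a ∈ Icc ν Λ → 0 ≤ η → η ≤ 1 →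
      η ^ m * ‖V‖ ^ p ≤
        2 / ν * ⟪(a * ‖V‖ ^ (p - 2)) • V - f, η ^ m • V + s • ((m * η ^ (m - 1)) • w)⟫ +
        C * ((|s| * ‖w‖) ^ p + ‖f‖ ^ (γ₁ / (γ₁ - 1)) + 1) := by
  by_cases hγΛ : γ₁ ≤ γ₂ ∧ ν ≤ Λ
  swap
  · refine ⟨1, one_pos, fun p a η s V f w hp ha => ?_⟩
    exact absurd ⟨hp.1.trans hp.2, ha.1.trans ha.2⟩ hγΛ
  obtain ⟨hγ, hνΛ⟩ := hγΛ
  have hΛ : 0 < Λ := hν.trans_le hνΛ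
  have hmp : (0 : ℝ) < m := by linarith
  have hm0 : m ≠ 0 := by rintro rfl; simp at hmp
  obtain ⟨δ₁, hδ₁, hδ₁1, hδ₁ν⟩ : ∃ δ > 0, δ ≤ 1 ∧ Λ * m * δ ≤ ν / 4 := by
    refine ⟨min 1 (ν / (4 * Λ * m)), by positivity, min_le_left _ _, ?_⟩
    calc Λ * m * min 1 (ν / (4 * Λ * m)) ≤ Λ * m * (ν / (4 * Λ * m)) := by
          gcongr; exact min_le_right _ _
      _ = ν / 4 := by field_simp
  obtain ⟨δ₂, hδ₂, hδ₂1, hδ₂ν⟩ : ∃ δ > 0, δ ≤ 1 ∧ δ ≤ ν / 4 :=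
    ⟨min 1 (ν / 4), by positivity, min_le_left _ _, min_le_right _ _⟩
  set A₁ : ℝ := (1 / δ₁) ^ γ₂ with hA₁
  set A₂ : ℝ := (1 / δ₂) ^ (1 / (γ₁ - 1)) with hA₂
  have hA₁0 : 0 < A₁ := by positivity
  have hA₂0 : 0 < A₂ := by positivity
  set C₀ : ℝ := Λ * m * A₁ + A₂ + 2 * m + 1 with hC₀
  have hC₀0 : 0 < C₀ := by positivity
  refine ⟨2 / ν * C₀, by positivity, fun p a η s V f w hp ha hη hη1 => ?_⟩
  have hp1 : 1 < p := hγ₁.trans_le hp.1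
  have hp0 : 0 < p := by linarith
  have ha0 : 0 < a := hν.trans_le ha.1
  set x := ‖V‖ with hx
  set T := |s| * ‖w‖ with hT
  set φ := ‖f‖ ^ (γ₁ / (γ₁ - 1)) + 1 with hφ
  have hφ0 : 0 ≤ φ := by positivity
  have hT0 : 0 ≤ T := by positivity
  have hx0 : 0 ≤ x := norm_nonneg _
  set y := (η ^ m) ^ (1 / p) * x with hy
  have hy0 : 0 ≤ y := by positivity
  have hyp : y ^ p = η ^ m * x ^ p := by
    rw [hy, Real.mul_rpow (by positivity) hx0, ← Real.rpow_mul (by positivity), one_div,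
      inv_mul_cancel₀ hp0.ne', Real.rpow_one]
  have hpow : η ^ (m - 1) ≤ ((η ^ m) ^ (1 / p)) ^ (p - 1) := by
    rw [← Real.rpow_mul (by positivity), ← Real.rpow_natCast η m, ← Real.rpow_mul hη,
      ← Real.rpow_natCast η (m - 1)]
    rcases hη.eq_or_lt with h0 | h0
    · rw [← h0]
      have h2 : (1 : ℕ) < m := by
        have : (1 : ℝ) < m := by linarith [hp.1, hp.2]
        exact_mod_cast this
      have : ((m - 1 : ℕ) : ℝ) ≠ 0 := by
        rw [Nat.cast_ne_zero]; omega
      rw [Real.zero_rpow this]; positivity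
    · refine Real.rpow_le_rpow_of_exponent_ge h0 hη1 ?_
      rw [Nat.cast_sub (by omega), Nat.cast_one]
      have : (m : ℝ) * (1 / p * (p - 1)) = m - m / p := by field_simp
      rw [this]
      have : 1 ≤ (m : ℝ) / p := by rw [le_div_iff₀ hp0]; linarith [hp.2]
      linarith
  have hpow1 : η ^ (m - 1) ≤ 1 := pow_le_one₀ hη hη1
  have hθy : η ^ m * x ≤ y := by
    have h1 : η ^ m ≤ (η ^ m) ^ (1 / p) := by
      have := Real.rpow_le_rpow_of_exponent_ge' (x := η ^ m) (by positivity) (pow_le_one₀ hη hη1)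
        (by positivity : (0 : ℝ) ≤ 1 / p) (by rw [div_le_one hp0]; exact hp1.le)
      rwa [Real.rpow_one] at this
    exact mul_le_mul_of_nonneg_right h1 hx0
  -- the three error terms
  have t1 : a * x ^ (p - 1) * (m * η ^ (m - 1) * T) ≤ ν / 4 * y ^ p + Λ * m * A₁ * T ^ p := by
    have h1 : x ^ (p - 1) * η ^ (m - 1) ≤ y ^ (p - 1) := by
      rw [hy, Real.mul_rpow (by positivity) hx0, mul_comm]
      gcongr
    calc a * x ^ (p - 1) * (m * η ^ (m - 1) * T) = a * m * ((x ^ (p - 1) * η ^ (m - 1)) * T) := by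
          ring
      _ ≤ Λ * m * (y ^ (p - 1) * T) := by gcongr; exact ha.2
      _ ≤ Λ * m * (δ₁ * y ^ p + A₁ * T ^ p) := by
          gcongr; exact rpow_sub_one_mul_le hy0 hT0 hp1 hp.2 hδ₁ hδ₁1
      _ = (Λ * m * δ₁) * y ^ p + Λ * m * A₁ * T ^ p := by ring
      _ ≤ _ := by gcongr
  have t2 : ‖f‖ * (η ^ m * x) ≤ ν / 4 * y ^ p + A₂ * φ := by
    calc ‖f‖ * (η ^ m * x) ≤ ‖f‖ * y := by gcongr
      _ ≤ δ₂ * y ^ p + A₂ * φ := mul_le_rpow_add_conj (norm_nonneg f) hy0 hγ₁ hp.1 hδ₂ hδ₂1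
      _ ≤ _ := by gcongr
  have t3 : ‖f‖ * (m * η ^ (m - 1) * T) ≤ m * (T ^ p + φ) := by
    have h1 := mul_le_rpow_add_conj (norm_nonneg f) hT0 hγ₁ hp.1 one_pos le_rfl
    rw [div_one, Real.one_rpow, one_mul, one_mul] at h1
    calc ‖f‖ * (m * η ^ (m - 1) * T) = m * (η ^ (m - 1) * (‖f‖ * T)) := by ring
      _ ≤ m * (1 * (T ^ p + φ)) := by gcongr
      _ = _ := by ring
  have hxx : x ^ (p - 2) * (x * x) = x ^ p := by
    rw [← mul_assoc, ← Real.rpow_add_one' hx0 (by linarith), ← Real.rpow_add_one' hx0 (by linarith)]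
    ring_nf
  have hI : ⟪(a * x ^ (p - 2)) • V - f, η ^ m • V + s • ((m * η ^ (m - 1)) • w)⟫ =
      a * (η ^ m * x ^ p) + ⟪(a * x ^ (p - 2)) • V, s • ((m * η ^ (m - 1)) • w)⟫ -
        ⟪f, η ^ m • V⟫ - ⟪f, s • ((m * η ^ (m - 1)) • w)⟫ := by
    rw [inner_sub_left, inner_add_right, inner_add_right]
    have : ⟪(a * x ^ (p - 2)) • V, η ^ m • V⟫ = a * (η ^ m * x ^ p) := by
      rw [real_inner_smul_left, real_inner_smul_right, real_inner_self_eq_norm_mul_norm, ← hxx]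
      ring
    rw [this]; ring
  have hw : ‖s • ((m * η ^ (m - 1)) • w)‖ = m * η ^ (m - 1) * T := by
    rw [norm_smul, norm_smul, Real.norm_eq_abs, Real.norm_of_nonneg (by positivity), hT]; ring
  have i1 := neg_le_of_abs_le (abs_real_inner_le_norm ((a * x ^ (p - 2)) • V)
    (s • ((m * η ^ (m - 1)) • w)))
  rw [hw, norm_rpow_sub_two_smul V hp1 ha0.le] at i1
  have i2 := le_of_abs_le (abs_real_inner_le_norm f (η ^ m • V))
  rw [norm_smul, Real.norm_of_nonneg (by positivity : 0 ≤ η ^ m)] at i2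
  have i3 := le_of_abs_le (abs_real_inner_le_norm f (s • ((m * η ^ (m - 1)) • w)))
  rw [hw] at i3
  set I := ⟪(a * x ^ (p - 2)) • V - f, η ^ m • V + s • ((m * η ^ (m - 1)) • w)⟫ with hIdef
  have hTp : 0 ≤ T ^ p := by positivity
  have key : ν / 2 * y ^ p ≤ I + C₀ * (T ^ p + φ) := by
    have h1 : ν * y ^ p ≤ a * (η ^ m * x ^ p) := by
      rw [← hyp]; exact mul_le_mul_of_nonneg_right ha.1 (by positivity)
    have h2 : Λ * m * A₁ * T ^ p + A₂ * φ + m * (T ^ p + φ) ≤ C₀ * (T ^ p + φ) := by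
      rw [hC₀]
      have : 0 ≤ Λ * m * A₁ * φ + A₂ * T ^ p + m * (T ^ p + φ) + (T ^ p + φ) := by positivity
      linarith
    linarith
  rw [← hyp, add_assoc _ _ (1 : ℝ), ← hφ]
  calc y ^ p = 2 / ν * (ν / 2 * y ^ p) := by field_simp
    _ ≤ 2 / ν * (I + C₀ * (T ^ p + φ)) := by gcongr
    _ = _ := by ring

/-- Integrating a pointwise inequality whose middle term has integral zero. The function `f` on the
left need not be known to be integrable or measurable. -/
theorem lintegral_le_of_integral_eq_zero {Y : Type*} [MeasurableSpace Y] {μ : Measure Y} {I : Y → ℝ}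
    (hI : Integrable I μ) (h0 : ∫ x, I x ∂μ = 0) {f g : Y → ℝ} {K : Set Y}
    (hgm : AEMeasurable g (μ.restrict K)) (hK : MeasurableSet K)
    (hIK : ∀ x ∉ K, I x = 0) (hf0 : ∀ x ∈ K, 0 ≤ f x)
    (hg0 : ∀ x ∈ K, 0 ≤ g x) (h : ∀ x ∈ K, f x ≤ I x + g x) :
    ∫⁻ x in K, ENNReal.ofReal (f x) ∂μ ≤ ∫⁻ x in K, ENNReal.ofReal (g x) ∂μ := by
  rcases eq_or_ne (∫⁻ x in K, ENNReal.ofReal (g x) ∂μ) ∞ with hg | hg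
  · rw [hg]; exact le_top
  have hgi : IntegrableOn g K μ := by
    refine ⟨hgm.aestronglyMeasurable, ?_⟩
    rw [hasFiniteIntegral_iff_ofReal]
    · exact hg.lt_top
    · exact (ae_restrict_iff' hK).2 (Eventually.of_forall hg0)
  have h1 : ∫ x in K, I x ∂μ = 0 := by
    rw [setIntegral_eq_integral_of_forall_compl_eq_zero hIK, h0]
  calc ∫⁻ x in K, ENNReal.ofReal (f x) ∂μ ≤ ∫⁻ x in K, ENNReal.ofReal (I x + g x) ∂μ :=
        setLIntegral_mono' hK fun x hx => ENNReal.ofReal_le_ofReal (h x hx)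
    _ = ENNReal.ofReal (∫ x in K, (I x + g x) ∂μ) := by
        refine (ofReal_integral_eq_lintegral_ofReal (hI.integrableOn.add hgi) ?_).symm
        exact (ae_restrict_iff' hK).2 (Eventually.of_forall fun x hx => (hf0 x hx).trans (h x hx))
    _ = ENNReal.ofReal (∫ x in K, g x ∂μ) := by
        rw [integral_add hI.integrableOn hgi, h1, zero_add]
    _ = _ := ofReal_integral_eq_lintegral_ofReal hgi
        ((ae_restrict_iff' hK).2 (Eventually.of_forall hg0))

end

section

variable {n : ℕ}

theorem IsTest.pow {U : Set (Heis n)} {η : Heis n → ℝ} (hη : IsTest U η) {m : ℕ} (hm : m ≠ 0) :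
    IsTest U fun x => η x ^ m := by
  have hs : Function.support (fun x => η x ^ m) ⊆ Function.support η := fun x hx => by
    rw [Function.mem_support] at hx ⊢
    exact fun h => hx (by rw [h, zero_pow hm])
  exact ⟨hη.1.pow m, hη.2.1.mono hs, (closure_mono hs).trans hη.2.2⟩

theorem hgrad_pow {η : Heis n → ℝ} {x : Heis n} (hη : DifferentiableAt ℝ η x) (m : ℕ) :
    hgrad (fun x => η x ^ m) x = (m * η x ^ (m - 1)) • hgrad η x := by
  ext j
  rw [hgrad_apply, PiLp.smul_apply, hgrad_apply, (hη.hasFDerivAt.pow m).fderiv]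
  simp

theorem add_rpow_le_two_rpow_mul {x y : ℝ≥0∞} {p γ₂ : ℝ} (hp0 : 0 ≤ p) (hp : p ≤ γ₂) :
    (x + y) ^ p ≤ ENNReal.ofReal (2 ^ γ₂) * (x ^ p + y ^ p) := by
  have h1 : x + y ≤ 2 * max x y := by
    rw [two_mul]; exact add_le_add (le_max_left _ _) (le_max_right _ _)
  have h2 : max x y ^ p ≤ x ^ p + y ^ p := by
    rcases max_cases x y with h | h <;> rw [h.1]
    exacts [le_self_add, le_add_self]
  have h3 : (2 : ℝ≥0∞) ^ p ≤ ENNReal.ofReal (2 ^ γ₂) := by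
    rw [← ENNReal.ofReal_rpow_of_pos two_pos, ENNReal.ofReal_ofNat]
    exact ENNReal.rpow_le_rpow_of_exponent_le (by norm_num) hp
  calc (x + y) ^ p ≤ (2 * max x y) ^ p := ENNReal.rpow_le_rpow h1 hp0
    _ = 2 ^ p * max x y ^ p := ENNReal.mul_rpow_of_nonneg _ _ hp0
    _ ≤ _ := mul_le_mul' h3 h2

theorem isOpen_boxDist_lt (x₀ : Heis n) (r : ℝ) : IsOpen {y | boxDist x₀ y < r} :=
  isOpen_lt (continuous_boxNorm.comp (continuous_op_left _)) continuous_const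

theorem compactlyIn_boxDist_lt {x₀ : Heis n} {r : ℝ} {Ω : Set (Heis n)} (h : cball x₀ r ⊆ Ω) :
    CompactlyIn {y | boxDist x₀ y < r} Ω := by
  have h1 : closure {y | boxDist x₀ y < r} ⊆ cball x₀ r :=
    closure_minimal (fun y hy => (show boxDist x₀ y < r from hy).le) (isClosed_cball x₀ r)
  exact ⟨(isCompact_cball x₀ r).of_isClosed_subset isClosed_closure h1, h1.trans h⟩

/-- The datum `F` may be replaced by `F - ξ`, because the horizontal gradient of a compactly
supported function has integral zero. -/
theorem exists_caccioppoli_const (hn : 1 ≤ n) {γ₁ γ₂ ν Λ : ℝ} (hγ₁ : 1 < γ₁) (hγ : γ₁ ≤ γ₂)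
    (hν : 0 < ν) :
    ∃ C : ℝ, 0 < C ∧ ∀ (Ω : Set (Heis n)) (p a u : Heis n → ℝ) (F Xu : Heis n → Hor n)
      (M r₀ : ℝ) (ω : ℝ → ℝ), IsOpen Ω → LogHolderOn Ω p γ₁ γ₂ M r₀ ω →
      AEMeasurable a (volume.restrict Ω) → (∀ x ∈ Ω, a x ∈ Icc ν Λ) →
      AEStronglyMeasurable F (volume.restrict Ω) →
      (∫⁻ x in Ω, ‖F x‖ₑ ^ (γ₁ / (γ₁ - 1)) < ∞) →
      IsLocalWeakSolution Ω p a F u Xu →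
      ∀ (x₀ : Heis n) (r : ℝ), 0 < r → cball x₀ (3 * r) ⊆ Ω → ∀ (c : ℝ) (ξ : Hor n),
      ∫⁻ x in cball x₀ r, ‖Xu x‖ₑ ^ p x ≤ ENNReal.ofReal C * ∫⁻ x in cball x₀ (2 * r),
        ((‖u x - c‖ₑ / ENNReal.ofReal r) ^ p x + ‖F x - ξ‖ₑ ^ (γ₁ / (γ₁ - 1)) + 1) := by
  obtain ⟨m, hm⟩ := exists_nat_ge γ₂
  have hm0 : m ≠ 0 := by rintro rfl; norm_num at hm; linarith
  obtain ⟨C, hC, hpw⟩ := exists_pointwise_caccioppoli_const (E := Hor n) (γ₁ := γ₁) (Λ := Λ) hγ₁ hν hm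
  obtain ⟨Cη, hCη, hcut⟩ := exists_cutoff n
  refine ⟨C * Cη ^ γ₂, by positivity,
    fun Ω p a u F Xu M r₀ ω hΩ hp ham ha hFm hFfin hsol x₀ r hr hΩr c ξ => ?_⟩
  obtain ⟨η, hη, hη0, hη1, hηone, hηs, hηg⟩ := hcut x₀ r hr
  set U : Set (Heis n) := {y | boxDist x₀ y < 3 * r} with hU
  set K : Set (Heis n) := cball x₀ (2 * r) with hK
  have hUo : IsOpen U := isOpen_boxDist_lt x₀ _
  have hUm := hUo.measurableSet
  have hUc : CompactlyIn U Ω := compactlyIn_boxDist_lt hΩr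
  have hUΩ : U ⊆ Ω := subset_closure.trans hUc.2
  have hUfin : volume U ≠ ∞ :=
    ((measure_mono subset_closure).trans_lt hUc.1.measure_lt_top).ne
  have hKc : IsCompact K := isCompact_cball _ _
  have hKm : MeasurableSet K := measurableSet_cball _ _
  have hKU : K ⊆ U := fun y hy => lt_of_le_of_lt (mem_cball_iff.1 hy) (by linarith)
  have hKfin : volume K ≠ ∞ := hKc.measure_lt_top.ne
  have hpU : ∀ x ∈ U, p x ∈ Icc γ₁ γ₂ := fun x hx => hp.mem x (hUΩ hx)
  have hpm : AEMeasurable p (volume.restrict U) :=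
    ((hp.continuousOn hn).mono hUΩ).aemeasurable hUm
  obtain ⟨hu, hXu, hweak⟩ := hsol.1 U hUo hUc
  have hui : IntegrableOn u U := integrable_of_modular hUm hUfin
    (fun x hx => hγ₁.le.trans (hpU x hx).1) hu.1 hu.2
  have hXui : IntegrableOn Xu U := integrable_of_modular hUm hUfin
    (fun x hx => hγ₁.le.trans (hpU x hx).1) hXu.1 hXu.2
  have hηU : IsTest U η := ⟨hη.1, hη.2.1, hηs.trans hKU⟩
  have hηC : ContDiff ℝ 1 η := hη.1.of_le (by exact_mod_cast le_top)
  have hηd := hηC.differentiable one_ne_zero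
  have hηK : ∀ y ∉ K, η y = 0 := fun y hy =>
    image_eq_zero_of_notMem_tsupport fun h => hy (hηs h)
  have hgK : ∀ y ∉ K, hgrad η y = 0 := fun y hy =>
    hgrad_eq_zero_of_notMem_tsupport fun h => hy (hηs h)
  have hθ := hηU.pow hm0
  set φ : Heis n → ℝ := fun x => η x ^ m * (u x - c) with hφ
  set G : Heis n → Hor n := fun x => η x ^ m • Xu x + (u x - c) • ((m * η x ^ (m - 1)) • hgrad η x)
    with hG
  have hφG : IsWeakHGrad univ φ G := by
    have := IsWeakHGrad.mul_test hweak hui hXui hθ c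
    simp_rw [fun x => hgrad_pow (hηd x) m] at this
    exact this
  have hφK : ∀ y ∉ K, φ y = 0 := fun y hy => by simp [hφ, hηK y hy, hm0]
  have hGK : ∀ y ∉ K, G y = 0 := fun y hy => by simp [hG, hηK y hy, hgK y hy, hm0]
  have hη_m : AEStronglyMeasurable η (volume.restrict U) := hηC.continuous.aestronglyMeasurable
  have hgm : AEStronglyMeasurable (hgrad η) (volume.restrict U) :=
    (continuous_hgrad hηC).aestronglyMeasurable
  have hucm : AEStronglyMeasurable (fun x => u x - c) (volume.restrict U) :=
    hu.1.sub aestronglyMeasurable_const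
  have hGmU : AEStronglyMeasurable G (volume.restrict U) :=
    ((hη_m.pow m).smul hXu.1).add (hucm.smul (((hη_m.pow (m - 1)).const_mul _).smul hgm))
  have hφmU : AEStronglyMeasurable φ (volume.restrict U) := (hη_m.pow m).mul hucm
  have glob : ∀ (E : Type) [NormedAddCommGroup E] (f : Heis n → E), (∀ y ∉ K, f y = 0) →
      AEStronglyMeasurable f (volume.restrict U) → AEStronglyMeasurable f := fun E _ f hf hfm => by
    have e : U.indicator f = f := indicator_eq_self.2 fun x hx => by
      by_contra h; exact hx (hf x fun h' => h (hKU h'))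
    rw [← e]
    exact (aestronglyMeasurable_indicator_iff hUm).2 hfm
  have hφm := glob ℝ φ hφK hφmU
  have hGm := glob (Hor n) G hGK hGmU
  have hηpow : ∀ x k, ‖η x ^ k‖ₑ ≤ 1 := fun x k => by
    rw [Real.enorm_eq_ofReal (pow_nonneg (hη0 x) k), ENNReal.ofReal_le_one]
    exact pow_le_one₀ (hη0 x) (hη1 x)
  have hucfin : ∫⁻ x in U, ‖u x - c‖ₑ ^ p x < ∞ := by
    calc ∫⁻ x in U, ‖u x - c‖ₑ ^ p x
        ≤ ∫⁻ x in U, ENNReal.ofReal (2 ^ γ₂) * (‖u x‖ₑ ^ p x + (‖c‖ₑ ^ γ₂ + 1)) := by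
          refine setLIntegral_mono' hUm fun x hx => ?_
          have hpx := hpU x hx
          have h0 : 0 ≤ p x := by linarith [hpx.1]
          refine (ENNReal.rpow_le_rpow (enorm_sub_le) h0).trans
            ((add_rpow_le_two_rpow_mul h0 hpx.2).trans ?_)
          exact mul_le_mul' le_rfl (add_le_add le_rfl (rpow_le_rpow_add_one h0 hpx.2))
      _ = ENNReal.ofReal (2 ^ γ₂) * ((∫⁻ x in U, ‖u x‖ₑ ^ p x) + (‖c‖ₑ ^ γ₂ + 1) * volume U) := by
          rw [lintegral_const_mul' _ _ ENNReal.ofReal_ne_top,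
            lintegral_add_right _ measurable_const]; simp
      _ < ∞ := ENNReal.mul_lt_top ENNReal.ofReal_lt_top (ENNReal.add_lt_top.2 ⟨hu.2,
          ENNReal.mul_lt_top (ENNReal.add_lt_top.2 ⟨ENNReal.rpow_lt_top_of_nonneg (by linarith)
            enorm_ne_top, ENNReal.one_lt_top⟩) hUfin.lt_top⟩)
  have hφfin : ∫⁻ x in K, ‖φ x‖ₑ ^ p x < ∞ := by
    refine lt_of_le_of_lt ?_ hucfin
    refine (setLIntegral_mono' hKm fun x hx => ?_).trans (lintegral_mono_set hKU)
    refine ENNReal.rpow_le_rpow ?_ (by linarith [(hpU x (hKU hx)).1])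
    rw [hφ, enorm_mul]
    exact mul_le_of_le_one_left' (hηpow x m)
  obtain ⟨B, hB⟩ : ∃ B : ℝ, ∀ x, ‖(m * η x ^ (m - 1)) • hgrad η x‖ ≤ B := by
    refine ⟨m * (Cη / r), fun x => ?_⟩
    rw [norm_smul, Real.norm_of_nonneg (mul_nonneg (Nat.cast_nonneg _) (pow_nonneg (hη0 x) _))]
    have h1 : (m : ℝ) * η x ^ (m - 1) ≤ m * 1 := by
      gcongr; exact pow_le_one₀ (hη0 x) (hη1 x)
    rw [mul_one] at h1
    exact mul_le_mul h1 (hηg x) (norm_nonneg _) (Nat.cast_nonneg _)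
  have hGfin : ∫⁻ x in K, ‖G x‖ₑ ^ p x < ∞ := by
    calc ∫⁻ x in K, ‖G x‖ₑ ^ p x
        ≤ ∫⁻ x in U, ENNReal.ofReal (2 ^ γ₂) * (‖Xu x‖ₑ ^ p x +
            (ENNReal.ofReal B ^ γ₂ + 1) * ‖u x - c‖ₑ ^ p x) := by
          refine (setLIntegral_mono' hKm fun x hx => ?_).trans (lintegral_mono_set hKU)
          have hpx := hpU x (hKU hx)
          have h0 : 0 ≤ p x := by linarith [hpx.1]
          have h1 : ‖G x‖ₑ ≤ ‖Xu x‖ₑ + ENNReal.ofReal B * ‖u x - c‖ₑ := by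
            refine (enorm_add_le _ _).trans (add_le_add ?_ ?_)
            · rw [enorm_smul]; exact mul_le_of_le_one_left' (hηpow x m)
            · rw [enorm_smul, mul_comm]
              refine mul_le_mul' ?_ le_rfl
              rw [← ofReal_norm]; exact ENNReal.ofReal_le_ofReal (hB x)
          refine (ENNReal.rpow_le_rpow h1 h0).trans ((add_rpow_le_two_rpow_mul h0 hpx.2).trans ?_)
          refine mul_le_mul' le_rfl (add_le_add le_rfl ?_)
          rw [ENNReal.mul_rpow_of_nonneg _ _ h0]
          exact mul_le_mul' (rpow_le_rpow_add_one h0 hpx.2) le_rfl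
      _ = ENNReal.ofReal (2 ^ γ₂) * ((∫⁻ x in U, ‖Xu x‖ₑ ^ p x) +
            (ENNReal.ofReal B ^ γ₂ + 1) * ∫⁻ x in U, ‖u x - c‖ₑ ^ p x) := by
          have hfin : ENNReal.ofReal B ^ γ₂ + 1 ≠ ∞ := ENNReal.add_ne_top.2
            ⟨ENNReal.rpow_ne_top_of_nonneg (by linarith) ENNReal.ofReal_ne_top, ENNReal.one_ne_top⟩
          rw [lintegral_const_mul' _ _ ENNReal.ofReal_ne_top,
            lintegral_add_left' (hXu.1.enorm.pow hpm), lintegral_const_mul' _ _ hfin]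
      _ < ∞ := ENNReal.mul_lt_top ENNReal.ofReal_lt_top (ENNReal.add_lt_top.2 ⟨hXu.2,
          ENNReal.mul_lt_top (ENNReal.add_lt_top.2 ⟨ENNReal.rpow_lt_top_of_nonneg (by linarith)
            ENNReal.ofReal_ne_top, ENNReal.one_lt_top⟩) hucfin⟩)
  have hmem : MemHW0 U p φ G := memHW0_of_isWeakHGrad hn hp hγ₁ hUo hUΩ hUfin hKc hKU hφm hGm
    hφK hGK hφG hφfin hGfin
  have hGi : Integrable G := (integrableOn_iff_integrable_of_support_subset fun x hx => by
    by_contra hxK; exact hx (hGK x hxK)).1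
      (integrable_of_modular hKm hKfin (fun x hx => hγ₁.le.trans (hpU x (hKU hx)).1)
        hGm.restrict hGfin)
  have hG0 : ∫ x, G x = 0 := integral_eq_zero_of_isWeakHGrad hKc hGi hφK hGK hφG
  have hsolG := hsol.2 U hUo hUc φ G hmem
  set A : Heis n → Hor n := fun x => (a x * ‖Xu x‖ ^ (p x - 2)) • Xu x with hA
  have hpK : ∀ x ∈ K, p x ∈ Icc γ₁ γ₂ := fun x hx => hpU x (hKU hx)
  have hpK0 : ∀ x ∈ K, 0 ≤ p x := fun x hx => by linarith [(hpK x hx).1]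
  have hres : volume.restrict K ≤ volume.restrict U := Measure.restrict_mono hKU le_rfl
  have hresΩ : volume.restrict U ≤ volume.restrict Ω := Measure.restrict_mono hUΩ le_rfl
  have hXp : Integrable (powInd K p Xu) := integrable_powInd hKm hpK0 (hpm.mono_measure hres)
    (hXu.1.mono_measure hres) ((lintegral_mono_set hKU).trans_lt hXu.2)
  have hGp : Integrable (powInd K p G) := integrable_powInd hKm hpK0 (hpm.mono_measure hres)
    hGm.restrict hGfin
  have hq0 : 0 < γ₁ / (γ₁ - 1) := div_pos (by linarith) (by linarith)
  have hFmU : AEStronglyMeasurable F (volume.restrict U) := hFm.mono_measure hresΩ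
  have hFp : Integrable (powInd K (fun _ => γ₁ / (γ₁ - 1)) F) := integrable_powInd hKm
    (fun _ _ => hq0.le) aemeasurable_const (hFmU.mono_measure hres)
    ((lintegral_mono_set (hKU.trans hUΩ)).trans_lt hFfin)
  have hAm : AEStronglyMeasurable A (volume.restrict U) :=
    ((ham.mono_measure hresΩ).mul
      (hXu.1.norm.aemeasurable.pow (hpm.sub_const 2))).aestronglyMeasurable.smul hXu.1
  have hAG : Integrable fun x => ⟪A x, G x⟫ := by
    refine ((hXp.add hGp).const_mul Λ).mono' (glob ℝ _ (fun y hy => by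
      rw [hGK y hy, inner_zero_right]) (hAm.inner hGmU)) (Eventually.of_forall fun x => ?_)
    by_cases hx : x ∈ K
    · have hpx := hpK x hx
      have hax := ha x (hUΩ (hKU hx))
      have h1 := rpow_sub_one_mul_le (norm_nonneg (Xu x)) (norm_nonneg (G x))
        (hγ₁.trans_le hpx.1) hpx.2 one_pos le_rfl
      rw [div_one, Real.one_rpow, one_mul, one_mul] at h1
      have h2 : ‖A x‖ = a x * ‖Xu x‖ ^ (p x - 1) :=
        norm_rpow_sub_two_smul _ (hγ₁.trans_le hpx.1) (hν.le.trans hax.1)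
      have h3 : ‖⟪A x, G x⟫‖ ≤ ‖A x‖ * ‖G x‖ := norm_inner_le_norm _ _
      rw [h2, mul_assoc] at h3
      simp only [powInd, Pi.add_apply, indicator_of_mem hx]
      exact h3.trans (mul_le_mul hax.2 h1 (by positivity) (hν.le.trans (hax.1.trans hax.2)))
    · rw [hGK x hx, inner_zero_right, norm_zero]
      simp [powInd, hx]
  have hFG : Integrable fun x => ⟪F x, G x⟫ := by
    refine ((hGp.add hFp).add ((integrable_indicator_iff hKm).2
      (integrableOn_const (C := (1 : ℝ)) hKfin))).mono' (glob ℝ _ (fun y hy => by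
      rw [hGK y hy, inner_zero_right]) (hFmU.inner hGmU)) (Eventually.of_forall fun x => ?_)
    by_cases hx : x ∈ K
    · have h1 := mul_le_rpow_add_conj (norm_nonneg (F x)) (norm_nonneg (G x)) hγ₁ (hpK x hx).1
        one_pos le_rfl
      rw [div_one, Real.one_rpow, one_mul, one_mul] at h1
      simp only [powInd, Pi.add_apply, indicator_of_mem hx]
      exact (norm_inner_le_norm _ _).trans (h1.trans_eq (add_assoc _ _ _).symm)
    · rw [hGK x hx, inner_zero_right, norm_zero]
      simp [powInd, hx]
  have hξG : Integrable fun x => ⟪ξ, G x⟫ := hGi.const_inner ξ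
  set I : Heis n → ℝ := fun x => ⟪A x - (F x - ξ), G x⟫ with hI
  have hIeq : I = fun x => ⟪A x, G x⟫ - ⟪F x, G x⟫ + ⟪ξ, G x⟫ := by
    funext x
    rw [hI]
    simp only [inner_sub_left]
    ring
  have hIi : Integrable I := by rw [hIeq]; exact (hAG.sub hFG).add hξG
  have hI0 : ∫ x, I x = 0 := by
    have e1 : ∫ x, I x = (∫ x, (⟪A x, G x⟫ - ⟪F x, G x⟫)) + ∫ x, ⟪ξ, G x⟫ := by
      rw [hIeq]; exact integral_add (hAG.sub hFG) hξG
    rw [e1, integral_sub hAG hFG, integral_inner hGi, hG0, inner_zero_right, add_zero,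
      sub_eq_zero]
    rwa [setIntegral_eq_integral_of_forall_compl_eq_zero (fun x hx => by
        rw [hGK x fun h => hx (hKU h), inner_zero_right]),
      setIntegral_eq_integral_of_forall_compl_eq_zero (fun x hx => by
        rw [hGK x fun h => hx (hKU h), inner_zero_right])] at hsolG
  have hFξm : AEStronglyMeasurable (fun x => F x - ξ) (volume.restrict U) :=
    hFmU.sub aestronglyMeasurable_const
  have main := lintegral_le_of_integral_eq_zero (hIi.const_mul (2 / ν))
    (by rw [integral_const_mul, hI0, mul_zero])
    (f := fun x => η x ^ m * ‖Xu x‖ ^ p x)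
    (g := fun x => C * ((|u x - c| * ‖hgrad η x‖) ^ p x + ‖F x - ξ‖ ^ (γ₁ / (γ₁ - 1)) + 1))
    (K := K)
    ((((((hucm.norm.aemeasurable.mul hgm.norm.aemeasurable).pow hpm).add
      (hFξm.norm.aemeasurable.pow_const _)).add_const 1).const_mul C).mono_measure hres)
    hKm
    (fun x hx => by rw [hI]; simp [hGK x hx])
    (fun x hx => mul_nonneg (pow_nonneg (hη0 x) _) (by positivity))
    (fun x hx => by positivity)
    (fun x hx => hpw (p x) (a x) (η x) (u x - c) (Xu x) (F x - ξ) (hgrad η x) (hpK x hx)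
      (ha x (hUΩ (hKU hx))) (hη0 x) (hη1 x))
  calc ∫⁻ x in cball x₀ r, ‖Xu x‖ₑ ^ p x
      ≤ ∫⁻ x in K, ENNReal.ofReal (η x ^ m * ‖Xu x‖ ^ p x) := by
        have hsub : cball x₀ r ⊆ K := cball_mono (by linarith)
        refine (setLIntegral_mono' (measurableSet_cball _ _) fun x hx => ?_).trans
          (lintegral_mono_set hsub)
        rw [hηone x hx, one_pow, one_mul, ← enorm_norm_rpow _ (hpK0 x (hsub hx)),
          Real.enorm_eq_ofReal (by positivity)]
    _ ≤ _ := main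
    _ ≤ ∫⁻ x in K, ENNReal.ofReal (C * Cη ^ γ₂) *
        ((‖u x - c‖ₑ / ENNReal.ofReal r) ^ p x + ‖F x - ξ‖ₑ ^ (γ₁ / (γ₁ - 1)) + 1) := by
        refine setLIntegral_mono' hKm fun x hx => ?_
        have h0 := hpK0 x hx
        have hC1 : 1 ≤ Cη ^ γ₂ := Real.one_le_rpow hCη (by linarith)
        have e1 : (‖u x - c‖ₑ / ENNReal.ofReal r) ^ p x =
            ENNReal.ofReal ((|u x - c| / r) ^ p x) := by
          rw [← ENNReal.ofReal_rpow_of_nonneg (by positivity) h0, ENNReal.ofReal_div_of_pos hr,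
            ← Real.norm_eq_abs, ofReal_norm]
        have e2 : ‖F x - ξ‖ₑ ^ (γ₁ / (γ₁ - 1)) = ENNReal.ofReal (‖F x - ξ‖ ^ (γ₁ / (γ₁ - 1))) := by
          rw [← ENNReal.ofReal_rpow_of_nonneg (norm_nonneg _) hq0.le, ofReal_norm]
        rw [e1, e2, ← ENNReal.ofReal_one, ← ENNReal.ofReal_add (by positivity) (by positivity),
          ← ENNReal.ofReal_add (by positivity) (by positivity),
          ← ENNReal.ofReal_mul (by positivity)]
        refine ENNReal.ofReal_le_ofReal ?_
        rw [mul_assoc]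
        refine mul_le_mul_of_nonneg_left ?_ hC.le
        have h1 : (|u x - c| * ‖hgrad η x‖) ^ p x ≤ Cη ^ γ₂ * (|u x - c| / r) ^ p x := by
          calc (|u x - c| * ‖hgrad η x‖) ^ p x ≤ (Cη * (|u x - c| / r)) ^ p x := by
                refine Real.rpow_le_rpow (by positivity) ?_ h0
                calc |u x - c| * ‖hgrad η x‖ ≤ |u x - c| * (Cη / r) := by
                      gcongr; exact hηg x
                  _ = _ := by ring
            _ = Cη ^ p x * (|u x - c| / r) ^ p x :=
                Real.mul_rpow (by positivity) (by positivity)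
            _ ≤ _ := by
                gcongr
                exact (hpK x hx).2
        have h2 : ‖F x - ξ‖ ^ (γ₁ / (γ₁ - 1)) + 1 ≤
            Cη ^ γ₂ * (‖F x - ξ‖ ^ (γ₁ / (γ₁ - 1)) + 1) :=
          le_mul_of_one_le_left (by positivity) hC1
        linarith
    _ = _ := lintegral_const_mul' _ _ ENNReal.ofReal_ne_top

end

/-! ### The reverse Hölder inequality -/

section

variable {n : ℕ}

/-- The oscillation `δ` of a log-Hölder exponent over a ball of radius `r` is so small that
`r ^ (-δ)` stays bounded. -/
theorem LogHolderOn.inv_rpow_le {Ω : Set (Heis n)} {p : Heis n → ℝ} {γ₁ γ₂ M r₀ : ℝ} {ω : ℝ → ℝ}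
    (h : LogHolderOn Ω p γ₁ γ₂ M r₀ ω) {r b δ : ℝ} (hr : 0 < r) (hb : 1 ≤ b) (hbr : b * r ≤ r₀)
    (hδ : δ ≤ ω (b * r)) (hδγ : δ ≤ γ₂) : r⁻¹ ^ δ ≤ b ^ γ₂ * Real.exp M := by
  have hbr0 : 0 < b * r := by positivity
  have e : r⁻¹ = b * (1 / (b * r)) := by field_simp
  have hlog : 0 ≤ Real.log (1 / (b * r)) := Real.log_nonneg (by
    rw [le_div_iff₀ hbr0, one_mul]; exact hbr.trans h.lt_one.le)
  rw [e, Real.mul_rpow (by positivity) (by positivity)]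
  refine mul_le_mul (Real.rpow_le_rpow_of_exponent_le hb hδγ) ?_ (by positivity) (by positivity)
  rw [Real.rpow_def_of_pos (by positivity)]
  refine Real.exp_le_exp.2 ?_
  calc Real.log (1 / (b * r)) * δ ≤ Real.log (1 / (b * r)) * ω (b * r) := by gcongr
    _ = ω (b * r) * Real.log (1 / (b * r)) := mul_comm _ _
    _ ≤ M := h.log_le _ hbr0 hbr

theorem lintegral_rpow_le_rpow_lintegral {Y : Type*} [MeasurableSpace Y] {ν : Measure Y}
    {f : Y → ℝ≥0∞} (hf : AEMeasurable f ν) (hν : ν univ ≤ 1) {s : ℝ} (hs : 0 < s) (hs1 : s ≤ 1) :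
    ∫⁻ y, f y ^ s ∂ν ≤ (∫⁻ y, f y ∂ν) ^ s := by
  have h := rpow_lintegral_le (hf.pow_const s) hν (P := 1 / s) (by rwa [le_div_iff₀ hs, one_mul])
  simp_rw [← ENNReal.rpow_mul, mul_one_div_cancel hs.ne', ENNReal.rpow_one] at h
  have h2 := ENNReal.rpow_le_rpow h hs.le
  rwa [← ENNReal.rpow_mul, one_div_mul_cancel hs.ne', ENNReal.rpow_one] at h2

/-- The constant exponent `P = sup p` in a Sobolev-Poincaré inequality may be replaced by the
variable exponent, at the cost of the factor `N ^ (sup p - inf p)`, where `N` bounds the modular. -/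
theorem rpow_lintegral_rpow_le_of_oscillation {Y : Type*} [MeasurableSpace Y] {ν : Measure Y}
    (hν : ν univ ≤ 1) {g : Y → ℝ≥0∞} (hg : AEMeasurable g ν) {p : Y → ℝ} (hpm : AEMeasurable p ν)
    {p₀ P θ : ℝ} (hp₀ : 1 ≤ p₀) (hP : p₀ ≤ P) (hPθ : P ≤ θ * p₀) (hθ : 1 ≤ θ)
    (hp : ∀ᵐ y ∂ν, p₀ ≤ p y) {N N' : ℝ≥0∞} (hN : 1 ≤ N) (hgN : ∫⁻ y, g y ^ p y ∂ν ≤ N)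
    (hNN : N ^ (P - p₀) ≤ N') :
    (∫⁻ y, g y ^ (P / (θ * θ)) ∂ν) ^ (θ * θ) ≤
      ENNReal.ofReal (2 ^ (θ * θ)) * (N' * (∫⁻ y, (g y ^ p y) ^ (1 / θ) ∂ν) ^ θ + 1) := by
  have hθ0 : 0 < θ := by linarith
  have hp₀0 : 0 < p₀ := by linarith
  have hP0 : 0 < P := by linarith
  set s := P / (p₀ * θ) with hs
  have hs0 : 0 < s := by positivity
  have hs1 : s ≤ 1 := by rw [hs, div_le_one (by positivity)]; linarith
  have hf : AEMeasurable (fun y => (g y ^ p y) ^ (1 / θ)) ν := (hg.pow hpm).pow_const _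
  set Z := ∫⁻ y, (g y ^ p y) ^ (1 / θ) ∂ν with hZ
  have h1 : ∫⁻ y, g y ^ (P / (θ * θ)) ∂ν ≤ Z ^ s + 1 := by
    calc ∫⁻ y, g y ^ (P / (θ * θ)) ∂ν ≤ ∫⁻ y, (((g y ^ p y) ^ (1 / θ)) ^ s + 1) ∂ν := by
          refine lintegral_mono_ae ?_
          filter_upwards [hp] with y hy
          rw [← ENNReal.rpow_mul, ← ENNReal.rpow_mul]
          refine rpow_le_rpow_add_one (by positivity) ?_
          calc P / (θ * θ) = p₀ * (1 / θ) * s := by rw [hs]; field_simp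
            _ ≤ p y * (1 / θ) * s := by gcongr
            _ = p y * (1 / θ * s) := mul_assoc _ _ _
      _ = (∫⁻ y, ((g y ^ p y) ^ (1 / θ)) ^ s ∂ν) + ν univ := by
          rw [lintegral_add_right _ measurable_const, lintegral_one]
      _ ≤ _ := add_le_add (lintegral_rpow_le_rpow_lintegral hf hν hs0 hs1) hν
  have hZN : Z ^ θ ≤ N := by
    refine le_trans ?_ hgN
    refine (rpow_lintegral_le hf hν hθ).trans_eq (lintegral_congr fun y => ?_)
    rw [← ENNReal.rpow_mul, one_div_mul_cancel hθ0.ne', ENNReal.rpow_one]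
  have h2 : Z ^ (s * (θ * θ)) ≤ N' * Z ^ θ := by
    have e : s * (θ * θ) = θ + θ * ((P - p₀) / p₀) := by rw [hs]; field_simp; ring
    have h0 : 0 ≤ (P - p₀) / p₀ := div_nonneg (by linarith) hp₀0.le
    rw [e, ENNReal.rpow_add_of_nonneg _ _ hθ0.le (by positivity), mul_comm, ENNReal.rpow_mul]
    refine mul_le_mul' ((ENNReal.rpow_le_rpow hZN h0).trans (le_trans ?_ hNN)) le_rfl
    exact ENNReal.rpow_le_rpow_of_exponent_le hN (div_le_self (by linarith) hp₀)
  calc (∫⁻ y, g y ^ (P / (θ * θ)) ∂ν) ^ (θ * θ) ≤ (Z ^ s + 1) ^ (θ * θ) :=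
        ENNReal.rpow_le_rpow h1 (by positivity)
    _ ≤ ENNReal.ofReal (2 ^ (θ * θ)) * ((Z ^ s) ^ (θ * θ) + 1 ^ (θ * θ)) :=
        add_rpow_le_two_rpow_mul (by positivity) le_rfl
    _ ≤ _ := by
        rw [← ENNReal.rpow_mul, ENNReal.one_rpow]
        exact mul_le_mul' le_rfl (add_le_add h2 le_rfl)

theorem volume_cball_ne_zero (x : Heis n) {r : ℝ} (hr : 0 < r) : volume (cball x r) ≠ 0 := by
  have := unitVol_pos n
  rw [volume_cball x hr, ne_eq, ENNReal.ofReal_eq_zero, not_le]; positivity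

theorem volume_cball_ne_top (x : Heis n) (r : ℝ) : volume (cball x r) ≠ ∞ :=
  (isCompact_cball x r).measure_lt_top.ne

theorem lintegral_cball_eq (x : Heis n) {r : ℝ} (hr : 0 < r) (f : Heis n → ℝ≥0∞) :
    ∫⁻ y in cball x r, f y = ENNReal.ofReal (unitVol n * r ^ homDim n) * ⨍⁻ y in cball x r, f y ∂volume := by
  rw [setLAverage_eq, ← volume_cball x hr, ENNReal.mul_div_cancel (volume_cball_ne_zero x hr)
    (volume_cball_ne_top x r)]

theorem laverage_cball_le_mul (x : Heis n) {s t : ℝ} (hs : 0 < s) (hst : s ≤ t)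
    (f : Heis n → ℝ≥0∞) :
    ⨍⁻ y in cball x s, f y ∂volume ≤ ENNReal.ofReal ((t / s) ^ homDim n) * ⨍⁻ y in cball x t, f y ∂volume := by
  have ht : 0 < t := hs.trans_le hst
  have hκ := unitVol_pos n
  have h1 : ∫⁻ y in cball x s, f y ≤ ∫⁻ y in cball x t, f y := lintegral_mono_set (cball_mono hst)
  rw [lintegral_cball_eq x ht] at h1
  rw [setLAverage_eq, volume_cball x hs]
  refine ENNReal.div_le_of_le_mul (h1.trans_eq ?_)
  rw [mul_right_comm, ← ENNReal.ofReal_mul (by positivity)]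
  congr 2
  rw [Real.div_rpow ht.le hs.le]; field_simp

theorem laverage_cball_add_one_ge (x : Heis n) {r : ℝ} (hr : 0 < r) (f : Heis n → ℝ≥0∞) :
    1 ≤ ⨍⁻ y in cball x r, (f y + 1) ∂volume := by
  refine (setLAverage_const (volume_cball_ne_zero x hr) (volume_cball_ne_top x r) 1).symm.trans_le ?_
  rw [setLAverage_eq, setLAverage_eq]
  refine ENNReal.div_le_div_right (lintegral_mono fun y => ?_) _
  exact le_add_self

end

section

variable {n : ℕ}

theorem enorm_div_rpow_lintegral {Y : Type*} [MeasurableSpace Y] {ν : Measure Y} (v : Y → ℝ)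
    {r P : ℝ} (hr : 0 < r) (hP : 0 < P) :
    ∫⁻ y, (‖v y‖ₑ / ENNReal.ofReal r) ^ P ∂ν = ENNReal.ofReal (r ^ (-P)) * ∫⁻ y, ‖v y‖ₑ ^ P ∂ν := by
  rw [← lintegral_const_mul' _ _ ENNReal.ofReal_ne_top]
  refine lintegral_congr fun y => ?_
  rw [ENNReal.div_rpow_of_nonneg _ _ hP.le, ENNReal.div_eq_inv_mul,
    ENNReal.ofReal_rpow_of_pos hr, Real.rpow_neg hr.le, ENNReal.ofReal_inv_of_pos (by positivity)]

/-- A weakly differentiable function satisfies a Sobolev-Poincaré inequality with the variable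
exponent `p` on small balls. The smallness of the ball relative to the modular, `∫ ‖G‖ ^ p ≤ 1 / R`,
turns the oscillation of `p` into a bounded factor. -/
theorem exists_variable_sobolevPoincare_const (hn : 1 ≤ n) {γ₁ γ₂ θ M : ℝ} (hγ₁ : 1 < γ₁)
    (hθ : 1 ≤ θ) (hθγ : θ * θ ≤ γ₁) (hθQ : homDim n * (θ * θ - 1) ≤ 1 / 2) :
    ∃ C : ℝ, 0 < C ∧ ∀ (Ω U : Set (Heis n)) (p u : Heis n → ℝ) (G : Heis n → Hor n)
      (r₀ : ℝ) (ω : ℝ → ℝ), LogHolderOn Ω p γ₁ γ₂ M r₀ ω →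
      (∀ r, 0 < r → r ≤ r₀ → ω r ≤ (θ - 1) * γ₁) → U ⊆ Ω → IntegrableOn u U → IntegrableOn G U →
      IsWeakHGrad U u G → ∀ x r R, 0 < r → r ≤ R → 460 * r ≤ r₀ → cball x (92 * r) ⊆ U →
      ∫⁻ y in cball x (92 * r), ‖G y‖ₑ ^ p y ≤ ENNReal.ofReal (1 / R) →
      ∃ c P : ℝ, (∀ y ∈ cball x (46 * r), p y ≤ P) ∧ 0 < P ∧
        ⨍⁻ y in cball x (2 * r), (‖u y - c‖ₑ / ENNReal.ofReal r) ^ P ∂volume ≤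
          ENNReal.ofReal C *
            ((⨍⁻ y in cball x (46 * r), (‖G y‖ₑ ^ p y) ^ (1 / θ) ∂volume) ^ θ + 1) := by
  obtain ⟨C₁, hC₁, hSP⟩ := exists_weak_sobolevPoincare_const hn (γ := γ₂)
    (one_le_mul_of_one_le_of_one_le hθ hθ) hθQ
  have hκ := unitVol_pos n
  have hQ := homDim_pos n
  set κ := unitVol n with hκdef
  set Q := homDim n with hQdef
  set T : ℝ := max 1 κ⁻¹ with hT
  have hT1 : 1 ≤ T := le_max_left _ _
  set N₃ : ℝ := T ^ γ₂ * (460 ^ γ₂ * Real.exp M) ^ (Q + 1) with hN₃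
  have hN₃0 : 0 < N₃ := by positivity
  set C₂ : ℝ := (κ * 2 ^ Q)⁻¹ * (C₁ * (κ * 46 ^ Q) ^ (θ * θ)) with hC₂
  have hC₂0 : 0 < C₂ := by positivity
  refine ⟨C₂ * 2 ^ (θ * θ) * (N₃ + 1), by positivity,
    fun Ω U p u G r₀ ω hp hosc hUΩ hu hG hw x r R hr hrR hr₀ hxU hGR => ?_⟩
  have hR : 0 < R := hr.trans_le hrR
  obtain ⟨c, hc⟩ := hSP U u G hu hG hw x r hr hxU
  have hsub : cball x (46 * r) ⊆ cball x (92 * r) := cball_mono (by linarith)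
  have hBΩ : cball x (46 * r) ⊆ Ω := hsub.trans (hxU.trans hUΩ)
  have hcont : ContinuousOn p (cball x (46 * r)) := (hp.continuousOn hn).mono hBΩ
  have hne : (cball x (46 * r)).Nonempty := ⟨x, mem_cball_self (by positivity)⟩
  obtain ⟨y₁, hy₁, hmax⟩ := (isCompact_cball x (46 * r)).exists_isMaxOn hne hcont
  obtain ⟨y₀, hy₀, hmin⟩ := (isCompact_cball x (46 * r)).exists_isMinOn hne hcont
  have hP1 := hp.mem y₁ (hBΩ hy₁)
  have hP0 := hp.mem y₀ (hBΩ hy₀)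
  set P := p y₁ with hP
  set p₀ := p y₀ with hp₀
  have hpP : p₀ ≤ P := hmax hy₀
  -- points of the ball of radius `46 r` have box distance at most `92 r`, hence CC distance at most
  -- `5 * 92 r`
  have hδ : P - p₀ ≤ ω (460 * r) := by
    refine (le_abs_self _).trans (hp.abs_sub_le (hBΩ hy₁) (hBΩ hy₀) (by positivity) ?_)
    refine (dCC_le_boxDist hn _ _).trans (ENNReal.ofReal_le_ofReal ?_)
    have h1 := boxDist_triangle y₁ x y₀
    rw [boxDist_comm y₁ x] at h1
    have h2 := mem_cball_iff.1 hy₁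
    have h3 := mem_cball_iff.1 hy₀
    linarith
  have hδγ : P - p₀ ≤ γ₂ := by linarith [hP1.2, hP0.1]
  have hδ0 : 0 ≤ P - p₀ := by linarith
  refine ⟨c, P, fun y hy => hmax hy, by linarith [hP1.1], ?_⟩
  -- the Sobolev-Poincaré inequality with constant exponent, in normalized form
  have h1 : ⨍⁻ y in cball x (2 * r), (‖u y - c‖ₑ / ENNReal.ofReal r) ^ P ∂volume ≤
      ENNReal.ofReal C₂ * (⨍⁻ y in cball x (46 * r), ‖G y‖ₑ ^ (P / (θ * θ)) ∂volume) ^ (θ * θ) := by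
    rw [setLAverage_eq, enorm_div_rpow_lintegral _ hr (by linarith [hP1.1]),
      volume_cball x (by positivity)]
    refine ENNReal.div_le_of_le_mul ?_
    calc ENNReal.ofReal (r ^ (-P)) * ∫⁻ y in cball x (2 * r), ‖u y - c‖ₑ ^ P
        ≤ ENNReal.ofReal (r ^ (-P)) * (ENNReal.ofReal (C₁ * r ^ P * r ^ (-(Q * (θ * θ - 1)))) *
          (∫⁻ y in cball x (46 * r), ‖G y‖ₑ ^ (P / (θ * θ))) ^ (θ * θ)) :=
          mul_le_mul' le_rfl (hc P (hθγ.trans hP1.1) hP1.2)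
      _ = _ := by
          rw [lintegral_cball_eq x (by positivity), ENNReal.mul_rpow_of_nonneg _ _ (by positivity),
            ENNReal.ofReal_rpow_of_nonneg (by positivity) (by positivity), ← mul_assoc, ← mul_assoc,
            ← ENNReal.ofReal_mul (by positivity), ← ENNReal.ofReal_mul (by positivity),
            mul_right_comm (ENNReal.ofReal C₂), ← ENNReal.ofReal_mul (by positivity)]
          congr 2
          have e1 : r ^ (-P) * r ^ P = 1 := by
            rw [← Real.rpow_add hr, neg_add_cancel, Real.rpow_zero]
          have e2 : (κ * (46 * r) ^ Q) ^ (θ * θ) = (κ * 46 ^ Q) ^ (θ * θ) * r ^ (Q * (θ * θ)) := by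
            rw [Real.mul_rpow (by norm_num) hr.le, ← mul_assoc,
              Real.mul_rpow (by positivity) (by positivity), ← Real.rpow_mul hr.le]
          have e3 : r ^ (-(Q * (θ * θ - 1))) * r ^ (Q * (θ * θ)) = r ^ Q := by
            rw [← Real.rpow_add hr]; congr 1; ring
          have e4 : (κ * 2 ^ Q)⁻¹ * (κ * (2 * r) ^ Q) = r ^ Q := by
            rw [Real.mul_rpow (by norm_num) hr.le]; field_simp
          rw [e2, hC₂]
          calc _ = (r ^ (-P) * r ^ P) * (r ^ (-(Q * (θ * θ - 1))) * r ^ (Q * (θ * θ))) *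
                (C₁ * (κ * 46 ^ Q) ^ (θ * θ)) := by ring
            _ = r ^ Q * (C₁ * (κ * 46 ^ Q) ^ (θ * θ)) := by rw [e1, e3, one_mul]
            _ = ((κ * 2 ^ Q)⁻¹ * (κ * (2 * r) ^ Q)) * (C₁ * (κ * 46 ^ Q) ^ (θ * θ)) := by rw [e4]
            _ = _ := by ring
  -- the modular is at most a negative power of `r`
  set N : ℝ := T * r⁻¹ ^ (Q + 1) with hN
  have hr1 : 1 ≤ r⁻¹ := by
    rw [one_le_inv₀ hr]; linarith [hp.lt_one]
  have hN1 : 1 ≤ N := one_le_mul_of_one_le_of_one_le hT1 (Real.one_le_rpow hr1 (by positivity))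
  have hmod : ⨍⁻ y in cball x (46 * r), ‖G y‖ₑ ^ p y ∂volume ≤ ENNReal.ofReal N := by
    rw [setLAverage_eq, volume_cball x (by positivity)]
    refine ENNReal.div_le_of_le_mul (((lintegral_mono_set hsub).trans hGR).trans ?_)
    rw [← ENNReal.ofReal_mul (by positivity)]
    refine ENNReal.ofReal_le_ofReal ?_
    have e1 : (1 : ℝ) ≤ 46 ^ Q := Real.one_le_rpow (by norm_num) hQ.le
    have e2 : 1 ≤ T * κ := by
      calc (1 : ℝ) = κ⁻¹ * κ := (inv_mul_cancel₀ hκ.ne').symm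
        _ ≤ T * κ := by gcongr; exact le_max_right _ _
    have e3 : r⁻¹ ^ (Q + 1) * r ^ Q = r⁻¹ := by
      rw [Real.rpow_add (by positivity), Real.rpow_one, Real.inv_rpow hr.le]; field_simp
    calc 1 / R ≤ r⁻¹ := by rw [one_div]; exact inv_anti₀ hr hrR
      _ = 1 * 1 * r⁻¹ := by ring
      _ ≤ (T * κ) * 46 ^ Q * r⁻¹ := by gcongr
      _ = (T * κ) * 46 ^ Q * (r⁻¹ ^ (Q + 1) * r ^ Q) := by rw [e3]
      _ = N * (κ * (46 * r) ^ Q) := by rw [Real.mul_rpow (by norm_num) hr.le, hN]; ring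
  -- log-Hölder continuity: `r ^ (-(P - p₀))` is bounded
  have hNN : ENNReal.ofReal N ^ (P - p₀) ≤ ENNReal.ofReal N₃ := by
    rw [ENNReal.ofReal_rpow_of_nonneg (by positivity) hδ0]
    refine ENNReal.ofReal_le_ofReal ?_
    rw [hN, Real.mul_rpow (by positivity) (by positivity), hN₃]
    have e1 : (r⁻¹ ^ (Q + 1)) ^ (P - p₀) = (r⁻¹ ^ (P - p₀)) ^ (Q + 1) := by
      rw [← Real.rpow_mul (by positivity), ← Real.rpow_mul (by positivity), mul_comm]
    rw [e1]
    refine mul_le_mul (Real.rpow_le_rpow_of_exponent_le hT1 hδγ) ?_ (by positivity) (by positivity)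
    exact Real.rpow_le_rpow (by positivity)
      (hp.inv_rpow_le hr (by norm_num) hr₀ hδ hδγ) (by positivity)
  have hsubU : cball x (46 * r) ⊆ U := hsub.trans hxU
  have hBm := measurableSet_cball x (46 * r)
  have hm1 : ((volume.restrict (cball x (46 * r))) univ)⁻¹ • volume.restrict (cball x (46 * r)) ≪
      volume.restrict (cball x (46 * r)) := Measure.smul_absolutelyContinuous
  have h2 := rpow_lintegral_rpow_le_of_oscillation
    (ν := ((volume.restrict (cball x (46 * r))) univ)⁻¹ • volume.restrict (cball x (46 * r)))
    (by simp [ENNReal.inv_mul_le_one])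
    (g := fun y => ‖G y‖ₑ) ((hG.mono_set hsubU).1.enorm.smul_measure _) (p := p)
    ((hcont.aemeasurable hBm).smul_measure _) (p₀ := p₀) (P := P) (θ := θ)
    (hγ₁.le.trans hP0.1) hpP (by
      have h3 := hosc _ (by positivity : 0 < 460 * r) hr₀
      have h4 : (θ - 1) * γ₁ ≤ (θ - 1) * p₀ := mul_le_mul_of_nonneg_left hP0.1 (by linarith)
      linarith) hθ
    (hm1.ae_le ((ae_restrict_iff' hBm).2 (Eventually.of_forall fun y hy => hmin hy)))
    (N := ENNReal.ofReal N) (by rwa [ENNReal.one_le_ofReal]) hmod hNN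
  refine h1.trans ((mul_le_mul' le_rfl h2).trans ?_)
  rw [ENNReal.ofReal_mul (p := C₂ * 2 ^ (θ * θ)) (by positivity), ENNReal.ofReal_mul (p := C₂) hC₂0.le,
    mul_assoc, mul_assoc]
  refine mul_le_mul' le_rfl (mul_le_mul' le_rfl ?_)
  rw [mul_add, mul_one, ENNReal.ofReal_add hN₃0.le zero_le_one, ENNReal.ofReal_one]
  exact add_le_add (mul_le_mul' le_self_add le_rfl) le_add_self

end

section

variable {n : ℕ}

theorem le_of_cball_subset_cball {x y : Heis n} {r s : ℝ} (hr : 0 < r) (hs : 0 < s)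
    (h : cball x r ⊆ cball y s) : r ≤ s := by
  have h1 := measure_mono (μ := volume) h
  have hκ := unitVol_pos n
  rw [volume_cball x hr, volume_cball y hs, ENNReal.ofReal_le_ofReal_iff (by positivity)] at h1
  have h2 := le_of_mul_le_mul_left h1 hκ
  exact (Real.rpow_le_rpow_iff hr.le hs.le (homDim_pos n)).1 h2

/-- The Caccioppoli inequality combined with the variable exponent Sobolev-Poincaré inequality. -/
theorem exists_reverseHolder_const (hn : 1 ≤ n) {γ₁ γ₂ ν Λ θ M : ℝ} (hγ₁ : 1 < γ₁)
    (hγ : γ₁ ≤ γ₂) (hν : 0 < ν) (hθ : 1 ≤ θ) (hθγ : θ * θ ≤ γ₁)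
    (hθQ : homDim n * (θ * θ - 1) ≤ 1 / 2) :
    ∃ A : ℝ, 1 ≤ A ∧ ∀ (Ω : Set (Heis n)) (p a u : Heis n → ℝ) (F Xu : Heis n → Hor n)
      (r₀ : ℝ) (ω : ℝ → ℝ), IsOpen Ω → LogHolderOn Ω p γ₁ γ₂ M r₀ ω →
      (∀ r, 0 < r → r ≤ r₀ → ω r ≤ (θ - 1) * γ₁) →
      AEMeasurable a (volume.restrict Ω) → (∀ x ∈ Ω, a x ∈ Icc ν Λ) →
      AEStronglyMeasurable F (volume.restrict Ω) →
      (∫⁻ x in Ω, ‖F x‖ₑ ^ (γ₁ / (γ₁ - 1)) < ∞) →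
      IsLocalWeakSolution Ω p a F u Xu →
      ∀ (D : Set (Heis n)) (x₀ : Heis n) (R : ℝ), D ⊆ Ω → D ⊆ cball x₀ R → 0 < R → 5 * R ≤ r₀ →
      ∫⁻ x in D, ‖Xu x‖ₑ ^ p x ≤ ENNReal.ofReal (1 / R) →
      ∀ (ξ : Hor n) (x : Heis n) (r : ℝ), 0 < r → cball x (92 * r) ⊆ D →
      ⨍⁻ y in cball x r, ‖Xu y‖ₑ ^ p y ∂volume ≤ ENNReal.ofReal A *
        ((⨍⁻ y in cball x (92 * r), (‖Xu y‖ₑ ^ p y) ^ (1 / θ) ∂volume) ^ θ +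
          ⨍⁻ y in cball x (92 * r), (‖F y - ξ‖ₑ ^ (γ₁ / (γ₁ - 1)) + 1) ∂volume) := by
  obtain ⟨C₁, hC₁, hcac⟩ := exists_caccioppoli_const hn (Λ := Λ) hγ₁ hγ hν
  obtain ⟨C₂, hC₂, hsob⟩ := exists_variable_sobolevPoincare_const hn (γ₂ := γ₂) (M := M) hγ₁ hθ hθγ hθQ
  have hQ := homDim_pos n
  set Q := homDim n with hQdef
  set B : ℝ := C₂ * (2 ^ Q) ^ θ + C₂ + 2 * 46 ^ Q with hB
  have hB0 : 0 < B := by positivity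
  refine ⟨C₁ * 2 ^ Q * B + 1, le_add_of_nonneg_left (by positivity),
    fun Ω p a u F Xu r₀ ω hΩ hp hosc ham ha hFm hFfin hsol D x₀ R hDΩ hDR hR hRr₀ hDK ξ x r hr hxD => ?_⟩
  have h92 : 92 * r ≤ R := le_of_cball_subset_cball (by positivity) hR (hxD.trans hDR)
  obtain ⟨U, hU, hxU, hUΩ, hUc⟩ := exists_open_between_and_isCompact_closure
    (isCompact_cball x (92 * r)) hΩ (hxD.trans hDΩ)
  have hUin : CompactlyIn U Ω := ⟨hUc, hUΩ⟩
  have hUΩ' : U ⊆ Ω := subset_closure.trans hUΩ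
  obtain ⟨hu, hXu, hweak⟩ := hsol.1 U hU hUin
  have hUfin : volume U ≠ ∞ := ((measure_mono subset_closure).trans_lt hUc.measure_lt_top).ne
  have hp1 : ∀ y ∈ U, 1 ≤ p y := fun y hy => hγ₁.le.trans (hp.mem y (hUΩ' hy)).1
  have hui : IntegrableOn u U := integrable_of_modular hU.measurableSet hUfin hp1 hu.1 hu.2
  have hXui : IntegrableOn Xu U := integrable_of_modular hU.measurableSet hUfin hp1 hXu.1 hXu.2
  obtain ⟨c, P, hpP, hP0, hTP⟩ := hsob Ω U p u Xu r₀ ω hp hosc hUΩ' hui hXui hweak x r R hr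
    (by linarith) (by linarith) hxU ((lintegral_mono_set hxD).trans hDK)
  have hc := hcac Ω p a u F Xu M r₀ ω hΩ hp ham ha hFm hFfin hsol x r hr
    ((cball_mono (by linarith)).trans (hxD.trans hDΩ)) c ξ
  set f : Heis n → ℝ≥0∞ := fun y => ‖F y - ξ‖ₑ ^ (γ₁ / (γ₁ - 1)) with hf
  set Z := ⨍⁻ y in cball x (92 * r), (‖Xu y‖ₑ ^ p y) ^ (1 / θ) ∂volume with hZ
  set Φ := ⨍⁻ y in cball x (92 * r), (f y + 1) ∂volume with hΦ
  have hΦ1 : 1 ≤ Φ := laverage_cball_add_one_ge x (by positivity) f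
  have s1 : ⨍⁻ y in cball x r, ‖Xu y‖ₑ ^ p y ∂volume ≤ ENNReal.ofReal (C₁ * 2 ^ Q) *
      ⨍⁻ y in cball x (2 * r), ((‖u y - c‖ₑ / ENNReal.ofReal r) ^ p y + f y + 1) ∂volume := by
    have hκ := unitVol_pos n
    rw [setLAverage_eq, volume_cball x hr]
    refine ENNReal.div_le_of_le_mul (hc.trans_eq ?_)
    rw [lintegral_cball_eq x (by positivity), ← mul_assoc, mul_right_comm (ENNReal.ofReal (C₁ * 2 ^ Q)),
      ← ENNReal.ofReal_mul hC₁.le, ← ENNReal.ofReal_mul (by positivity),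
      Real.mul_rpow (by norm_num) hr.le]
    congr 2
    ring
  have s2 : ⨍⁻ y in cball x (2 * r), ((‖u y - c‖ₑ / ENNReal.ofReal r) ^ p y + f y + 1) ∂volume ≤
      (⨍⁻ y in cball x (2 * r), (‖u y - c‖ₑ / ENNReal.ofReal r) ^ P ∂volume) +
        2 * ⨍⁻ y in cball x (2 * r), (f y + 1) ∂volume := by
    have hm : AEMeasurable (fun y => (‖u y - c‖ₑ / ENNReal.ofReal r) ^ P)
        (((volume.restrict (cball x (2 * r))) univ)⁻¹ • volume.restrict (cball x (2 * r))) := by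
      have h1 : AEStronglyMeasurable u (volume.restrict (cball x (2 * r))) :=
        (hui.mono_set ((cball_mono (by linarith)).trans hxU)).1
      have h2 := (h1.sub (aestronglyMeasurable_const (b := c))).enorm
      exact ((h2.div_const _).pow_const P).smul_measure _
    have h0 : ∀ᵐ y ∂(((volume.restrict (cball x (2 * r))) univ)⁻¹ • volume.restrict (cball x (2 * r))),
        (‖u y - c‖ₑ / ENNReal.ofReal r) ^ p y + f y + 1 ≤
          (‖u y - c‖ₑ / ENNReal.ofReal r) ^ P + 2 * (f y + 1) := by
      refine Measure.smul_absolutelyContinuous.ae_le ((ae_restrict_iff' (measurableSet_cball _ _)).2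
        (Eventually.of_forall fun y hy => ?_))
      have hy46 : y ∈ cball x (46 * r) := cball_mono (by linarith) hy
      have hyU : y ∈ U := hxU (cball_mono (by linarith) hy)
      have h1 := rpow_le_rpow_add_one (a := ‖u y - c‖ₑ / ENNReal.ofReal r)
        (by linarith [hp1 y hyU]) (hpP y hy46)
      calc (‖u y - c‖ₑ / ENNReal.ofReal r) ^ p y + f y + 1
          ≤ ((‖u y - c‖ₑ / ENNReal.ofReal r) ^ P + 1) + (f y + f y) + 1 :=
            add_le_add (add_le_add h1 le_self_add) le_rfl
        _ = _ := by ring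
    refine (lintegral_mono_ae h0).trans_eq ?_
    rw [lintegral_add_left' hm, lintegral_const_mul' _ _ (by norm_num)]
    rfl
  have s3 := laverage_cball_le_mul x (by positivity : 0 < 2 * r)
    (by linarith : 2 * r ≤ 92 * r) (fun y => f y + 1)
  have s4 := laverage_cball_le_mul x (by positivity : 0 < 46 * r)
    (by linarith : 46 * r ≤ 92 * r) (fun y => (‖Xu y‖ₑ ^ p y) ^ (1 / θ))
  rw [show 92 * r / (2 * r) = 46 by field_simp; norm_num] at s3
  rw [show 92 * r / (46 * r) = 2 by field_simp; norm_num] at s4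
  have s5 : (⨍⁻ y in cball x (46 * r), (‖Xu y‖ₑ ^ p y) ^ (1 / θ) ∂volume) ^ θ ≤
      ENNReal.ofReal ((2 ^ Q) ^ θ) * Z ^ θ := by
    refine (ENNReal.rpow_le_rpow s4 (by linarith)).trans_eq ?_
    rw [ENNReal.mul_rpow_of_nonneg _ _ (by linarith),
      ENNReal.ofReal_rpow_of_nonneg (by positivity) (by linarith)]
  calc ⨍⁻ y in cball x r, ‖Xu y‖ₑ ^ p y ∂volume
      ≤ ENNReal.ofReal (C₁ * 2 ^ Q) * (ENNReal.ofReal C₂ * (ENNReal.ofReal ((2 ^ Q) ^ θ) * Z ^ θ + Φ) +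
          2 * (ENNReal.ofReal (46 ^ Q) * Φ)) := by
        refine s1.trans (mul_le_mul' le_rfl (s2.trans (add_le_add (hTP.trans ?_) ?_)))
        · exact mul_le_mul' le_rfl (add_le_add s5 hΦ1)
        · exact mul_le_mul' le_rfl s3
    _ = ENNReal.ofReal (C₁ * 2 ^ Q) * (ENNReal.ofReal (C₂ * (2 ^ Q) ^ θ) * Z ^ θ +
          ENNReal.ofReal (C₂ + 2 * 46 ^ Q) * Φ) := by
        rw [ENNReal.ofReal_add hC₂.le (by positivity), ENNReal.ofReal_mul (p := C₂) hC₂.le,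
          ENNReal.ofReal_mul (p := 2) zero_le_two, ENNReal.ofReal_ofNat]
        ring
    _ ≤ ENNReal.ofReal (C₁ * 2 ^ Q) * (ENNReal.ofReal B * Z ^ θ + ENNReal.ofReal B * Φ) := by
        refine mul_le_mul' le_rfl (add_le_add (mul_le_mul' (ENNReal.ofReal_le_ofReal ?_) le_rfl)
          (mul_le_mul' (ENNReal.ofReal_le_ofReal ?_) le_rfl))
        · rw [hB, add_assoc]; exact le_add_of_nonneg_right (by positivity)
        · rw [hB, add_assoc]; exact le_add_of_nonneg_left (by positivity)
    _ = ENNReal.ofReal (C₁ * 2 ^ Q * B) * (Z ^ θ + Φ) := by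
        rw [← mul_add, ← mul_assoc, ← ENNReal.ofReal_mul (by positivity)]
    _ ≤ _ := mul_le_mul' (ENNReal.ofReal_le_ofReal (by linarith)) le_rfl

end

/-! ### Higher integrability on Carnot-Carathéodory balls -/

section

variable {n : ℕ}

theorem ball_subset_cball (x : Heis n) {r : ℝ} (hr : 0 < r) : ball x r ⊆ cball x r := fun y hy =>
  ((ENNReal.ofReal_lt_ofReal_iff hr).1 ((boxDist_le_dCC x y).trans_lt hy)).le

theorem cball_subset_ball (hn : 1 ≤ n) (x : Heis n) {r : ℝ} (hr : 0 < r) :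
    cball x (r / 6) ⊆ ball x r := fun y hy =>
  (dCC_le_boxDist hn x y).trans_lt ((ENNReal.ofReal_lt_ofReal_iff hr).2 (by
    have := mem_cball_iff.1 hy
    linarith))

theorem isOpen_ball (hn : 1 ≤ n) (x : Heis n) (r : ℝ) : IsOpen (ball x r) := by
  rw [isOpen_iff_mem_nhds]
  intro y hy
  have hy' : dCC x y < ENNReal.ofReal r := hy
  obtain ⟨ε, hε, hεr⟩ : ∃ ε : ℝ, 0 < ε ∧ dCC x y + ENNReal.ofReal ε < ENNReal.ofReal r := by
    obtain ⟨δ, hδ, h⟩ := ENNReal.lt_iff_exists_add_pos_lt.1 hy'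
    exact ⟨δ, hδ, by simpa using h⟩
  filter_upwards [(isOpen_boxDist_lt y (ε / 5)).mem_nhds
    (show boxDist y y < ε / 5 by rw [boxDist_self]; positivity)] with z hz
  have hz' : boxDist y z < ε / 5 := hz
  refine ((dCC_triangle x y z).trans (add_le_add le_rfl ((dCC_le_boxDist hn y z).trans
    (ENNReal.ofReal_le_ofReal ?_)))).trans_lt hεr
  linarith

theorem volume_ball_le (x : Heis n) {r : ℝ} (hr : 0 < r) :
    volume (ball x r) ≤ ENNReal.ofReal (unitVol n * r ^ homDim n) :=
  (measure_mono (ball_subset_cball x hr)).trans_eq (volume_cball x hr)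

theorem le_volume_ball (hn : 1 ≤ n) (x : Heis n) {r : ℝ} (hr : 0 < r) :
    ENNReal.ofReal (unitVol n * (r / 6) ^ homDim n) ≤ volume (ball x r) :=
  (volume_cball x (by positivity)).symm.trans_le (measure_mono (cball_subset_ball hn x hr))

theorem nonempty_compl_ball (x : Heis n) {r : ℝ} (hr : 0 < r) : (ball x r)ᶜ.Nonempty := by
  rw [nonempty_compl]
  intro h
  have h1 : cball x (2 * r) ⊆ cball x r :=
    (subset_univ _).trans (h.symm.subset.trans (ball_subset_cball x hr))
  linarith [le_of_cball_subset_cball (by positivity) hr h1]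

theorem infDist_compl_ball_le (x₀ : Heis n) {R : ℝ} (hR : 0 < R) (x : BoxHeis n) :
    Metric.infDist x ((ball (n := n) x₀ R : Set (BoxHeis n))ᶜ) ≤ R := by
  refine le_of_forall_lt fun r hr => ?_
  rcases le_or_gt r 0 with h | h
  · linarith
  obtain ⟨s, hs, hs'⟩ := exists_between hr
  have h1 := closedBall_subset_of_lt_infDist hs'
  rw [closedBall_boxHeis] at h1
  exact hs.trans_le (le_of_cball_subset_cball (n := n) (h.trans hs) hR
    (h1.trans (ball_subset_cball (n := n) x₀ hR)))

theorem le_infDist_of_forall_le_dCC (hn : 1 ≤ n) {x₀ : Heis n} {R : ℝ} (hR : 0 < R)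
    {S : Set (BoxHeis n)} (hne : S.Nonempty)
    (hS : ∀ y : BoxHeis n, y ∈ S → ENNReal.ofReal R ≤ dCC (n := n) x₀ y) {x : BoxHeis n}
    (hx : dCC (n := n) x₀ x < ENNReal.ofReal (R / 2)) : 1 / 10 * R ≤ Metric.infDist x S := by
  refine (Metric.le_infDist hne).2 fun y hy => ?_
  rw [dist_boxHeis]
  have h3 : dCC (n := n) x y ≤ ENNReal.ofReal (5 * boxDist (n := n) x y) := dCC_le_boxDist hn _ _
  have h0 : 0 ≤ boxDist (n := n) x y := boxDist_nonneg _ _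
  generalize boxDist (n := n) x y = b at h3 h0 ⊢
  have h1 : ENNReal.ofReal R < ENNReal.ofReal (R / 2 + 5 * b) := by
    rw [ENNReal.ofReal_add (by positivity) (by positivity)]
    exact ((hS y hy).trans (dCC_triangle (n := n) x₀ x y)).trans_lt
      (ENNReal.add_lt_add_of_lt_of_le (ne_top_of_le_ne_top ENNReal.ofReal_ne_top h3) hx h3)
  have h2 := (ENNReal.ofReal_lt_ofReal_iff_of_nonneg hR.le).1 h1
  linarith

/-- A reverse Hölder inequality on box balls, stated for the metric space `BoxHeis` and for
representatives. -/
theorem reverseHolderOn_of_ae_eq {D : Set (Heis n)} {θ A lam : ℝ} (hlam : 1 ≤ lam)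
    {h k h' k' : Heis n → ℝ≥0∞} (hh : h =ᵐ[volume.restrict D] h') (hk : k =ᵐ[volume.restrict D] k')
    (H : ∀ x r, 0 < r → cball x (lam * r) ⊆ D →
      ⨍⁻ y in cball x r, h y ∂volume ≤ ENNReal.ofReal A *
        ((⨍⁻ y in cball x (lam * r), h y ^ (1 / θ) ∂volume) ^ θ +
          ⨍⁻ y in cball x (lam * r), k y ∂volume)) :
    ReverseHolderOn (volume : Measure (BoxHeis n)) D θ A lam h' k' := by
  intro x r hr hD
  rw [closedBall_boxHeis] at hD
  have hsub : cball (n := n) x r ⊆ D := (cball_mono (le_mul_of_one_le_left hr.le hlam)).trans hD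
  have h1 := H x r hr hD
  have e1 : ⨍⁻ y in cball (n := n) x r, h y ∂volume = ⨍⁻ y in cball (n := n) x r, h' y ∂volume := by
    rw [setLAverage_eq, setLAverage_eq,
      lintegral_congr_ae (ae_restrict_of_ae_restrict_of_subset hsub hh)]
  have e2 : ⨍⁻ y in cball (n := n) x (lam * r), h y ^ (1 / θ) ∂volume =
      ⨍⁻ y in cball (n := n) x (lam * r), h' y ^ (1 / θ) ∂volume := by
    rw [setLAverage_eq, setLAverage_eq]
    congr 1
    refine lintegral_congr_ae ?_
    filter_upwards [ae_restrict_of_ae_restrict_of_subset hD hh] with y hy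
    rw [hy]
  have e3 : ⨍⁻ y in cball (n := n) x (lam * r), k y ∂volume =
      ⨍⁻ y in cball (n := n) x (lam * r), k' y ∂volume := by
    rw [setLAverage_eq, setLAverage_eq,
      lintegral_congr_ae (ae_restrict_of_ae_restrict_of_subset hD hk)]
  rw [e1, e2, e3] at h1
  rw [closedBall_boxHeis, closedBall_boxHeis]
  exact h1

theorem laverage_half_ball_le (hn : 1 ≤ n) (x₀ : Heis n) {R : ℝ} (hR : 0 < R) {f : Heis n → ℝ≥0∞}
    {S : ℝ≥0∞} (h : ∫⁻ y in ball x₀ (R / 2), f y ≤ ENNReal.ofReal (R ^ homDim n) * S) :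
    ⨍⁻ y in ball x₀ (R / 2), f y ∂volume ≤
      ENNReal.ofReal ((unitVol n)⁻¹ * 12 ^ homDim n) * S := by
  have hκ := unitVol_pos n
  rw [setLAverage_eq]
  refine ENNReal.div_le_of_le_mul (h.trans ?_)
  rw [mul_right_comm]
  refine mul_le_mul' (le_trans ?_ (mul_le_mul' le_rfl (le_volume_ball hn x₀ (half_pos hR)))) le_rfl
  rw [← ENNReal.ofReal_mul (by positivity)]
  refine ENNReal.ofReal_le_ofReal (le_of_eq ?_)
  rw [show R / 2 / 6 = R / 12 by ring, Real.div_rpow hR.le (by norm_num)]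
  field_simp

theorem lintegral_ball_le (x₀ : Heis n) {R : ℝ} (hR : 0 < R) (f : Heis n → ℝ≥0∞) :
    ∫⁻ y in ball x₀ R, f y ≤
      ENNReal.ofReal (unitVol n * R ^ homDim n) * ⨍⁻ y in ball x₀ R, f y ∂volume := by
  rcases eq_or_ne (volume (ball x₀ R)) 0 with h | h
  · rw [Measure.restrict_eq_zero.2 h]; simp
  · have hfin : volume (ball x₀ R) ≠ ∞ :=
      ne_top_of_le_ne_top ENNReal.ofReal_ne_top (volume_ball_le x₀ hR)
    calc ∫⁻ y in ball x₀ R, f y = volume (ball x₀ R) * ⨍⁻ y in ball x₀ R, f y ∂volume := by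
          rw [setLAverage_eq, ENNReal.mul_div_cancel h hfin]
      _ ≤ _ := mul_le_mul' (volume_ball_le x₀ hR) le_rfl

/-- Gehring's lemma on Carnot-Carathéodory balls, reverse Hölder inequalities being assumed on box
balls. -/
theorem exists_gehring_ball_const (hn : 1 ≤ n) {θ A : ℝ} (hθ : 1 < θ) (hA : 1 ≤ A) :
    ∃ σ₁ C : ℝ, 0 < σ₁ ∧ σ₁ ≤ 1 ∧ 0 < C ∧ ∀ (x₀ : Heis n) (R : ℝ), 0 < R →
      ∀ h k : Heis n → ℝ≥0∞, AEMeasurable h (volume.restrict (ball x₀ R)) →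
      AEMeasurable k (volume.restrict (ball x₀ R)) → ∫⁻ x in ball x₀ R, h x ≠ ∞ →
      (∀ x r, 0 < r → cball x (92 * r) ⊆ ball x₀ R →
        ⨍⁻ y in cball x r, h y ∂volume ≤ ENNReal.ofReal A *
          ((⨍⁻ y in cball x (92 * r), h y ^ (1 / θ) ∂volume) ^ θ +
            ⨍⁻ y in cball x (92 * r), k y ∂volume)) →
      ∀ σ, 0 < σ → σ ≤ σ₁ →
      ⨍⁻ x in ball x₀ (R / 2), h x ^ (1 + σ) ∂volume ≤ ENNReal.ofReal C *
        ((⨍⁻ x in ball x₀ R, h x ∂volume) ^ (1 + σ) +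
          ⨍⁻ x in ball x₀ R, k x ^ (1 + σ) ∂volume) := by
  obtain ⟨σ₁, C, hσ₁, hσ₁1, hC, H⟩ := gehring_interior (isHomogeneousMeasure_boxHeis n) hθ hA
    (lam := 92) (by norm_num) (c := 1 / 10) (by norm_num) (by norm_num)
  have hκ := unitVol_pos n
  set κ := unitVol n with hκdef
  set m : ℝ := max 1 κ with hm
  have hm1 : 1 ≤ m := le_max_left _ _
  refine ⟨σ₁, κ⁻¹ * 12 ^ homDim n * (C * m ^ (2 : ℝ)), hσ₁, hσ₁1, by positivity,
    fun x₀ R hR h k hh hk hfin hrev σ hσ hσσ => ?_⟩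
  have hbm : MeasurableSet (ball x₀ (R / 2)) := (isOpen_ball hn _ _).measurableSet
  have hsub : ball x₀ (R / 2) ⊆ ball x₀ R := fun y hy =>
    lt_of_lt_of_le hy (ENNReal.ofReal_le_ofReal (by linarith))
  obtain ⟨h', hm', hh'⟩ : ∃ h' : BoxHeis n → ℝ≥0∞, Measurable h' ∧
      h =ᵐ[volume.restrict (ball x₀ R)] h' := ⟨hh.mk h, hh.measurable_mk, hh.ae_eq_mk⟩
  obtain ⟨k', km', hk'⟩ : ∃ k' : BoxHeis n → ℝ≥0∞, Measurable k' ∧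
      k =ᵐ[volume.restrict (ball x₀ R)] k' := ⟨hk.mk k, hk.measurable_mk, hk.ae_eq_mk⟩
  have hrev' := reverseHolderOn_of_ae_eq (by norm_num) hh' hk' hrev
  obtain ⟨D, hD⟩ : ∃ D : Set (BoxHeis n), D = ball (n := n) x₀ R := ⟨_, rfl⟩
  obtain ⟨B, hB⟩ : ∃ B : Set (BoxHeis n), B = ball (n := n) x₀ (R / 2) := ⟨_, rfl⟩
  have d1 : ∫⁻ x in D, h' x ∂(volume : Measure (BoxHeis n)) = ∫⁻ x in ball x₀ R, h x := by
    rw [hD]; exact (lintegral_congr_ae hh').symm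
  have d2 : ∫⁻ x in D, k' x ^ (1 + σ) ∂(volume : Measure (BoxHeis n)) =
      ∫⁻ x in ball x₀ R, k x ^ (1 + σ) := by
    rw [hD]
    exact lintegral_congr_ae (by filter_upwards [hk'] with x hx; rw [hx])
  have d3 : ∫⁻ x in B, h' x ^ (1 + σ) ∂(volume : Measure (BoxHeis n)) =
      ∫⁻ x in ball x₀ (R / 2), h x ^ (1 + σ) := by
    rw [hB]
    exact lintegral_congr_ae (by
      filter_upwards [ae_restrict_of_ae_restrict_of_subset hsub hh'] with x hx; rw [hx])
  have key := H D R hR (by rw [hD]; exact infDist_compl_ball_le x₀ hR) h' k'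
    hm' km' (by rwa [d1]) (by rw [hD]; exact hrev') σ hσ hσσ
  have hne : Dᶜ.Nonempty := by rw [hD]; exact nonempty_compl_ball x₀ hR
  have hDd : ∀ y : BoxHeis n, y ∈ Dᶜ → ENNReal.ofReal R ≤ dCC (n := n) x₀ y := fun y hy => by
    rw [hD] at hy; exact not_lt.1 hy
  have hBd : ∀ y : BoxHeis n, y ∈ B → dCC (n := n) x₀ y < ENNReal.ofReal (R / 2) := fun y hy => by
    rw [hB] at hy; exact hy
  have key2 := (lintegral_mono_set
    (fun x hx => le_infDist_of_forall_le_dCC hn hR hne hDd (hBd x hx))).trans key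
  rw [d1, d2, d3] at key2
  set a := ⨍⁻ x in ball x₀ R, h x ∂volume with ha
  set b := ⨍⁻ x in ball x₀ R, k x ^ (1 + σ) ∂volume with hb
  have i1 : ∫⁻ x in ball x₀ R, h x ≤ ENNReal.ofReal (κ * R ^ homDim n) * a := lintegral_ball_le x₀ hR h
  have i2 := lintegral_ball_le x₀ hR (fun x => k x ^ (1 + σ))
  have i3 : ENNReal.ofReal (R ^ (-homDim n)) * ∫⁻ x in ball x₀ R, h x ≤ ENNReal.ofReal κ * a := by
    refine (mul_le_mul' le_rfl i1).trans_eq ?_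
    rw [← mul_assoc, ← ENNReal.ofReal_mul (by positivity)]
    congr 2
    rw [Real.rpow_neg hR.le]; field_simp
  have hRQ : 0 < R ^ homDim n := by positivity
  refine (laverage_half_ball_le hn x₀ hR (S := ENNReal.ofReal (C * m ^ (2 : ℝ)) * (a ^ (1 + σ) + b))
    (key2.trans ?_)).trans_eq ?_
  · calc ENNReal.ofReal C * ((ENNReal.ofReal (R ^ (-homDim n)) * ∫⁻ x in ball x₀ R, h x) ^ σ *
          (∫⁻ x in ball x₀ R, h x) + ∫⁻ x in ball x₀ R, k x ^ (1 + σ))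
        ≤ ENNReal.ofReal C * ((ENNReal.ofReal κ * a) ^ σ * (ENNReal.ofReal (κ * R ^ homDim n) * a) +
            ENNReal.ofReal (κ * R ^ homDim n) * b) :=
          mul_le_mul' le_rfl (add_le_add (mul_le_mul' (ENNReal.rpow_le_rpow i3 hσ.le) i1) i2)
      _ = ENNReal.ofReal (R ^ homDim n) * (ENNReal.ofReal C *
            (ENNReal.ofReal (κ ^ (1 + σ)) * a ^ (1 + σ) + ENNReal.ofReal κ * b)) := by
          rw [ENNReal.mul_rpow_of_nonneg _ _ hσ.le, ENNReal.ofReal_rpow_of_pos hκ,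
            add_comm 1 σ, ENNReal.rpow_add_of_nonneg σ 1 hσ.le zero_le_one, ENNReal.rpow_one,
            Real.rpow_add hκ, Real.rpow_one, ENNReal.ofReal_mul (p := κ) hκ.le,
            ENNReal.ofReal_mul (p := κ ^ σ) (by positivity)]
          ring
      _ ≤ _ := by
          have j1 : κ ^ (1 + σ) ≤ m ^ (2 : ℝ) :=
            (Real.rpow_le_rpow hκ.le (le_max_right _ _) (by linarith)).trans
              (Real.rpow_le_rpow_of_exponent_le hm1 (by linarith))
          have j2 : κ ≤ m ^ (2 : ℝ) := (le_max_right 1 κ).trans (by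
            have := Real.rpow_le_rpow_of_exponent_le hm1 (one_le_two (α := ℝ))
            rwa [Real.rpow_one] at this)
          rw [ENNReal.ofReal_mul hC.le, mul_assoc (ENNReal.ofReal C), mul_add (ENNReal.ofReal (m ^ (2 : ℝ)))]
          exact mul_le_mul' le_rfl (mul_le_mul' le_rfl (add_le_add
            (mul_le_mul' (ENNReal.ofReal_le_ofReal j1) le_rfl)
            (mul_le_mul' (ENNReal.ofReal_le_ofReal j2) le_rfl)))
  · rw [← mul_assoc, ← ENNReal.ofReal_mul (by positivity)]

/-- Gehring's lemma on Carnot-Carathéodory balls, with a low power of `h` on the right-hand side. -/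
theorem exists_gehring_ball_lower_const (hn : 1 ≤ n) {θ A s : ℝ} (hθ : 1 < θ) (hA : 1 ≤ A)
    (hs : 0 < s) (hsθ : s < 1 / θ) :
    ∃ σ₁ C : ℝ, 0 < σ₁ ∧ σ₁ ≤ 1 ∧ 1 ≤ C ∧ ∀ (x₀ : Heis n) (R : ℝ), 0 < R →
      ∀ h : Heis n → ℝ≥0∞, AEMeasurable h (volume.restrict (ball x₀ R)) →
      ∫⁻ x in ball x₀ R, h x ≠ ∞ →
      (∀ x r, 0 < r → cball x (92 * r) ⊆ ball x₀ R →
        ⨍⁻ y in cball x r, h y ∂volume ≤ ENNReal.ofReal A *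
          ((⨍⁻ y in cball x (92 * r), h y ^ (1 / θ) ∂volume) ^ θ +
            ⨍⁻ _ in cball x (92 * r), 1 ∂volume)) →
      ∀ σ, 0 < σ → σ ≤ σ₁ →
      ⨍⁻ x in ball x₀ (R / 2), h x ^ (1 + σ) ∂volume ≤ ENNReal.ofReal C *
        ((⨍⁻ x in ball x₀ R, h x ^ s ∂volume) ^ (1 / s) + 1) ^ (1 + σ) := by
  obtain ⟨σ₁, C, hσ₁, hσ₁1, hC, H⟩ := gehring_lower_exponent (isHomogeneousMeasure_boxHeis n) hθ hA
    (lam := 92) (by norm_num) (c := 1 / 10) (by norm_num) (by norm_num) hs hsθ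
  have hκ := unitVol_pos n
  set κ := unitVol n with hκdef
  set m : ℝ := max 1 (κ ^ (1 / s)) with hm
  have hm1 : 1 ≤ m := le_max_left _ _
  refine ⟨σ₁, κ⁻¹ * 12 ^ homDim n * (C * m ^ (2 : ℝ)) + 1, hσ₁, hσ₁1,
    le_add_of_nonneg_left (by positivity), fun x₀ R hR h hh hfin hrev σ hσ hσσ => ?_⟩
  have hbm : MeasurableSet (ball x₀ (R / 2)) := (isOpen_ball hn _ _).measurableSet
  have hsub : ball x₀ (R / 2) ⊆ ball x₀ R := fun y hy =>
    lt_of_lt_of_le hy (ENNReal.ofReal_le_ofReal (by linarith))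
  obtain ⟨h', hm', hh'⟩ : ∃ h' : BoxHeis n → ℝ≥0∞, Measurable h' ∧
      h =ᵐ[volume.restrict (ball x₀ R)] h' := ⟨hh.mk h, hh.measurable_mk, hh.ae_eq_mk⟩
  have hrev' := reverseHolderOn_of_ae_eq (by norm_num) hh'
    (ae_eq_refl (fun _ => (1 : ℝ≥0∞))) hrev
  obtain ⟨D, hD⟩ : ∃ D : Set (BoxHeis n), D = ball (n := n) x₀ R := ⟨_, rfl⟩
  obtain ⟨B, hB⟩ : ∃ B : Set (BoxHeis n), B = ball (n := n) x₀ (R / 2) := ⟨_, rfl⟩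
  have d1 : ∫⁻ x in D, h' x ∂(volume : Measure (BoxHeis n)) = ∫⁻ x in ball x₀ R, h x := by
    rw [hD]; exact (lintegral_congr_ae hh').symm
  have d2 : ∫⁻ x in D, h' x ^ s ∂(volume : Measure (BoxHeis n)) =
      ∫⁻ x in ball x₀ R, h x ^ s := by
    rw [hD]
    exact lintegral_congr_ae (by filter_upwards [hh'] with x hx; rw [hx])
  have d3 : ∫⁻ x in B, h' x ^ (1 + σ) ∂(volume : Measure (BoxHeis n)) =
      ∫⁻ x in ball x₀ (R / 2), h x ^ (1 + σ) := by
    rw [hB]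
    exact lintegral_congr_ae (by
      filter_upwards [ae_restrict_of_ae_restrict_of_subset hsub hh'] with x hx; rw [hx])
  have key := H D R hR (by rw [hD]; exact infDist_compl_ball_le x₀ hR)
    (by rw [hD]; exact volume_ball_le x₀ hR) h'
    hm' (by rwa [d1]) (by rw [hD]; exact hrev') σ hσ hσσ
  have hne : Dᶜ.Nonempty := by rw [hD]; exact nonempty_compl_ball x₀ hR
  have hDd : ∀ y : BoxHeis n, y ∈ Dᶜ → ENNReal.ofReal R ≤ dCC (n := n) x₀ y := fun y hy => by
    rw [hD] at hy; exact not_lt.1 hy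
  have hBd : ∀ y : BoxHeis n, y ∈ B → dCC (n := n) x₀ y < ENNReal.ofReal (R / 2) := fun y hy => by
    rw [hB] at hy; exact hy
  have key2 := (lintegral_mono_set
    (fun x hx => le_infDist_of_forall_le_dCC hn hR hne hDd (hBd x hx))).trans key
  rw [d2, d3] at key2
  set a := ⨍⁻ x in ball x₀ R, h x ^ s ∂volume with ha
  have i1 : ∫⁻ x in ball x₀ R, h x ^ s ≤ ENNReal.ofReal (κ * R ^ homDim n) * a :=
    lintegral_ball_le x₀ hR _
  have i3 : ENNReal.ofReal (R ^ (-homDim n)) * ∫⁻ x in ball x₀ R, h x ^ s ≤ ENNReal.ofReal κ * a := by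
    refine (mul_le_mul' le_rfl i1).trans_eq ?_
    rw [← mul_assoc, ← ENNReal.ofReal_mul (by positivity)]
    congr 2
    rw [Real.rpow_neg hR.le]; field_simp
  have i4 : (ENNReal.ofReal (R ^ (-homDim n)) * ∫⁻ x in ball x₀ R, h x ^ s) ^ (1 / s) + 1 ≤
      ENNReal.ofReal m * (a ^ (1 / s) + 1) := by
    rw [mul_add, mul_one]
    refine add_le_add ((ENNReal.rpow_le_rpow i3 (by positivity)).trans ?_)
      (by rwa [ENNReal.one_le_ofReal])
    rw [ENNReal.mul_rpow_of_nonneg _ _ (by positivity), ENNReal.ofReal_rpow_of_pos hκ]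
    exact mul_le_mul' (ENNReal.ofReal_le_ofReal (le_max_right _ _)) le_rfl
  have i5 : ((ENNReal.ofReal (R ^ (-homDim n)) * ∫⁻ x in ball x₀ R, h x ^ s) ^ (1 / s) + 1) ^ (1 + σ) ≤
      ENNReal.ofReal (m ^ (2 : ℝ)) * (a ^ (1 / s) + 1) ^ (1 + σ) := by
    refine (ENNReal.rpow_le_rpow i4 (by linarith)).trans ?_
    rw [ENNReal.mul_rpow_of_nonneg _ _ (by linarith), ENNReal.ofReal_rpow_of_pos (by positivity)]
    exact mul_le_mul' (ENNReal.ofReal_le_ofReal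
      (Real.rpow_le_rpow_of_exponent_le hm1 (by linarith))) le_rfl
  refine (laverage_half_ball_le hn x₀ hR (S := ENNReal.ofReal (C * m ^ (2 : ℝ)) *
    (a ^ (1 / s) + 1) ^ (1 + σ)) (key2.trans ?_)).trans ?_
  · refine (mul_le_mul' le_rfl i5).trans_eq ?_
    rw [ENNReal.ofReal_mul hC.le]; ring
  · rw [← mul_assoc, ← ENNReal.ofReal_mul (by positivity)]
    exact mul_le_mul' (ENNReal.ofReal_le_ofReal (by linarith)) le_rfl

end

/-! ### Higher integrability of the gradient of local weak solutions -/

section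

variable {n : ℕ}

theorem laverage_half_ball_le_laverage (hn : 1 ≤ n) (x₀ : Heis n) {R : ℝ} (hR : 0 < R)
    (f : Heis n → ℝ≥0∞) :
    ⨍⁻ y in ball x₀ (R / 2), f y ∂volume ≤
      ENNReal.ofReal (12 ^ homDim n) * ⨍⁻ y in ball x₀ R, f y ∂volume := by
  have hκ := unitVol_pos n
  have h1 : ∫⁻ y in ball x₀ (R / 2), f y ≤ ENNReal.ofReal (R ^ homDim n) *
      (ENNReal.ofReal (unitVol n) * ⨍⁻ y in ball x₀ R, f y ∂volume) := by
    refine (lintegral_mono_set fun y hy => ?_).trans ((lintegral_ball_le x₀ hR f).trans_eq ?_)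
    · exact lt_of_lt_of_le hy (ENNReal.ofReal_le_ofReal (by linarith))
    · rw [ENNReal.ofReal_mul hκ.le]; ring
  refine (laverage_half_ball_le hn x₀ hR h1).trans_eq ?_
  rw [← mul_assoc, ← ENNReal.ofReal_mul (by positivity)]
  congr 2
  field_simp

theorem laverage_one_le {Y : Type*} [MeasurableSpace Y] (ν : Measure Y) : ⨍⁻ _, (1 : ℝ≥0∞) ∂ν ≤ 1 := by
  rw [laverage_eq', lintegral_one]
  simp [ENNReal.inv_mul_le_one]

theorem laverage_add_const_le {Y : Type*} [MeasurableSpace Y] (ν : Measure Y) (f : Y → ℝ≥0∞) :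
    ⨍⁻ y, (f y + 1) ∂ν ≤ (⨍⁻ y, f y ∂ν) + 1 := by
  rw [laverage_eq', lintegral_add_right _ measurable_const, ← laverage_eq', ← laverage_eq']
  exact add_le_add le_rfl (laverage_one_le ν)

theorem laverage_mono_ae {Y : Type*} [MeasurableSpace Y] {ν : Measure Y} {f g : Y → ℝ≥0∞}
    (h : ∀ᵐ y ∂ν, f y ≤ g y) : ⨍⁻ y, f y ∂ν ≤ ⨍⁻ y, g y ∂ν := by
  rw [laverage_eq', laverage_eq']
  exact lintegral_mono_ae (Measure.smul_absolutelyContinuous.ae_le h)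

theorem laverage_const_mul {Y : Type*} [MeasurableSpace Y] (ν : Measure Y) {c : ℝ≥0∞} (hc : c ≠ ∞)
    (f : Y → ℝ≥0∞) : ⨍⁻ y, c * f y ∂ν = c * ⨍⁻ y, f y ∂ν := by
  rw [laverage_eq', laverage_eq', lintegral_const_mul' _ _ hc]

/-- The Sobolev-Poincaré inequality gains `θ * θ`: one factor `θ` pays for the oscillation of the
exponent, the other one is the gain in the reverse Hölder inequality. -/
theorem exists_exponent {γ₁ Q : ℝ} (hγ₁ : 1 < γ₁) (hQ : 0 < Q) :
    ∃ θ : ℝ, 1 < θ ∧ θ < 2 ∧ θ * θ ≤ γ₁ ∧ Q * (θ * θ - 1) ≤ 1 / 2 := by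
  obtain ⟨τ, hτ, h1, h2, h3⟩ : ∃ τ > 0, τ ≤ 1 / 2 ∧ 3 * τ ≤ γ₁ - 1 ∧ Q * (3 * τ) ≤ 1 / 2 := by
    have hγ : 0 < γ₁ - 1 := by linarith
    refine ⟨min (1 / 2) (min ((γ₁ - 1) / 3) (1 / (6 * Q))), by positivity, min_le_left _ _, ?_, ?_⟩
    · have := (min_le_right (1 / 2) (min ((γ₁ - 1) / 3) (1 / (6 * Q)))).trans (min_le_left _ _)
      linarith
    · calc Q * (3 * min (1 / 2) (min ((γ₁ - 1) / 3) (1 / (6 * Q))))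
          ≤ Q * (3 * (1 / (6 * Q))) := by
            gcongr; exact (min_le_right _ _).trans (min_le_right _ _)
        _ = 1 / 2 := by field_simp; norm_num
  have e : (1 + τ) * (1 + τ) - 1 ≤ 3 * τ := by nlinarith
  refine ⟨1 + τ, by linarith, by linarith, by linarith, ?_⟩
  exact (mul_le_mul_of_nonneg_left e hQ.le).trans h3

/-- Since `log (1 / r)` tends to infinity, the modulus itself tends to zero. -/
theorem exists_radius {ω : ℝ → ℝ} {L δ : ℝ} (hL : 0 ≤ L) (hδ : 0 < δ)
    (hω : Tendsto (fun r => ω r * Real.log (1 / r)) (𝓝[>] 0) (𝓝 L)) :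
    ∃ r₀ : ℝ, 0 < r₀ ∧ r₀ < 1 ∧ (∀ r, 0 < r → r ≤ r₀ → ω r * Real.log (1 / r) ≤ L + 1) ∧
      ∀ r, 0 < r → r ≤ r₀ → ω r ≤ δ := by
  have h1 : ∀ᶠ r in 𝓝[>] (0 : ℝ), ω r * Real.log (1 / r) ≤ L + 1 :=
    (hω.eventually_lt_const (by linarith)).mono fun r hr => hr.le
  have h2 : Tendsto (fun r : ℝ => Real.log (1 / r)) (𝓝[>] 0) atTop := by
    have h3 : Tendsto (fun r : ℝ => 1 / r) (𝓝[>] 0) atTop := by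
      simpa only [one_div] using tendsto_inv_nhdsGT_zero (𝕜 := ℝ)
    exact Real.tendsto_log_atTop.comp h3
  obtain ⟨r₁, hr₁, h⟩ := mem_nhdsGT_iff_exists_Ioc_subset.1
    (h1.and (h2.eventually_ge_atTop ((L + 1) / δ)))
  have hr₁0 : 0 < r₁ := hr₁
  refine ⟨min r₁ (1 / 2), by positivity, (min_le_right _ _).trans_lt (by norm_num),
    fun r hr hr' => (h ⟨hr, hr'.trans (min_le_left _ _)⟩).1, fun r hr hr' => ?_⟩
  obtain ⟨h4, h5⟩ := h ⟨hr, hr'.trans (min_le_left _ _)⟩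
  have h6 : 0 < Real.log (1 / r) := lt_of_lt_of_le (by positivity) h5
  by_contra! h7
  have h8 : δ * Real.log (1 / r) < ω r * Real.log (1 / r) := mul_lt_mul_of_pos_right h7 h6
  rw [div_le_iff₀ hδ] at h5
  linarith

theorem volume_ne_top_of_isCCBounded {Ω : Set (Heis n)} (h : IsCCBounded Ω) : volume Ω ≠ ∞ := by
  obtain ⟨M, hM⟩ := h
  rcases Ω.eq_empty_or_nonempty with rfl | ⟨x, hx⟩
  · simp
  · refine ne_top_of_le_ne_top (volume_cball_ne_top x (max M 1)) (measure_mono fun y hy => ?_)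
    refine (ENNReal.ofReal_le_ofReal_iff (by positivity)).1 ?_
    exact (boxDist_le_dCC x y).trans ((hM x hx y hy).trans
      (ENNReal.ofReal_le_ofReal (le_max_left _ _)))

theorem lintegral_rpow_lt_top_of_memLp {Y : Type*} [MeasurableSpace Y] {ν : Measure Y}
    {E : Type*} [NormedAddCommGroup E] {F : Y → E} (hν : ν univ ≠ ∞) {s t : ℝ} (hs : 0 < s)
    (hst : s ≤ t) (hF : MemLp F (ENNReal.ofReal t) ν) : ∫⁻ y, ‖F y‖ₑ ^ s ∂ν < ∞ := by
  have ht : 0 < t := hs.trans_le hst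
  have h1 := lintegral_rpow_enorm_lt_top_of_eLpNorm_lt_top
    (by rw [ne_eq, ENNReal.ofReal_eq_zero, not_le]; exact ht) ENNReal.ofReal_ne_top hF.2
  rw [ENNReal.toReal_ofReal ht.le] at h1
  calc ∫⁻ y, ‖F y‖ₑ ^ s ∂ν ≤ ∫⁻ y, (‖F y‖ₑ ^ t + 1) ∂ν :=
        lintegral_mono fun y => rpow_le_rpow_add_one hs.le hst
    _ = (∫⁻ y, ‖F y‖ₑ ^ t ∂ν) + ν univ := by
        rw [lintegral_add_right _ measurable_const, lintegral_one]
    _ < ∞ := ENNReal.add_lt_top.2 ⟨h1, hν.lt_top⟩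

theorem CompactlyIn.subset {U V : Set (Heis n)} (h : CompactlyIn U V) : U ⊆ V :=
  subset_closure.trans h.2

theorem lintegral_le_inv_radius {S T : Set (Heis n)} (hST : S ⊆ T) {f : Heis n → ℝ≥0∞} {K R : ℝ}
    (hK : ENNReal.ofReal K = (∫⁻ x in T, f x) + 1) (hK1 : 1 ≤ K) (hR : 0 < R) (hRK : R ≤ 1 / K) :
    ∫⁻ x in S, f x ≤ ENNReal.ofReal (1 / R) := by
  calc ∫⁻ x in S, f x ≤ ∫⁻ x in T, f x := lintegral_mono_set hST
    _ ≤ ENNReal.ofReal K := by rw [hK]; exact le_self_add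
    _ ≤ _ := ENNReal.ofReal_le_ofReal (by
        rw [le_div_iff₀ hR, mul_comm, ← le_div_iff₀ (by positivity)]; exact hRK)

/-- Taking the root of order `1 + σ` in the conclusion of the Gehring lemma, with a constant
independent of `σ`. -/
theorem rpow_laverage_le_of_gehring {Y : Type*} [MeasurableSpace Y] {ν : Measure Y}
    {f : Y → ℝ≥0∞} {a b : ℝ≥0∞} {σ C : ℝ} (hσ : 0 < σ) (hσ1 : σ ≤ 1)
    (h : b ≤ ENNReal.ofReal C * (a ^ (1 + σ) + ⨍⁻ y, (f y + 1) ^ (1 + σ) ∂ν)) :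
    b ^ (1 / (1 + σ)) ≤ ENNReal.ofReal (4 * max C 1) *
      (a + (1 + ⨍⁻ y, f y ^ (1 + σ) ∂ν) ^ (1 / (1 + σ))) := by
  have hσ0 : 0 < 1 + σ := by linarith
  have ht1 : 1 / (1 + σ) ≤ 1 := by rw [div_le_one hσ0]; linarith
  have ht0 : 0 ≤ 1 / (1 + σ) := by positivity
  have e4 : (4 : ℝ≥0∞) = ENNReal.ofReal (2 ^ (2 : ℝ)) := by norm_num
  set g := ⨍⁻ y, f y ^ (1 + σ) ∂ν with hg
  have h1 : ⨍⁻ y, (f y + 1) ^ (1 + σ) ∂ν ≤ 4 * (1 + g) := by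
    calc ⨍⁻ y, (f y + 1) ^ (1 + σ) ∂ν ≤ ⨍⁻ y, 4 * (f y ^ (1 + σ) + 1) ∂ν := by
          refine laverage_mono_ae (Eventually.of_forall fun y => ?_)
          have := add_rpow_le_two_rpow_mul (x := f y) (y := 1) hσ0.le (by linarith : 1 + σ ≤ 2)
          rwa [ENNReal.one_rpow, ← e4] at this
      _ = 4 * ⨍⁻ y, (f y ^ (1 + σ) + 1) ∂ν := laverage_const_mul _ (by norm_num) _
      _ ≤ _ := by
          rw [add_comm 1 g]
          exact mul_le_mul' le_rfl (laverage_add_const_le _ _)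
  have hm : ∀ t : ℝ, 1 ≤ t → ENNReal.ofReal t ^ (1 / (1 + σ)) ≤ ENNReal.ofReal t := fun t ht => by
    have := ENNReal.rpow_le_rpow_of_exponent_le (x := ENNReal.ofReal t)
      (by rwa [ENNReal.one_le_ofReal]) ht1
    rwa [ENNReal.rpow_one] at this
  have h2 : b ≤ ENNReal.ofReal (4 * max C 1) * (a ^ (1 + σ) + (1 + g)) := by
    calc b ≤ ENNReal.ofReal C * (a ^ (1 + σ) + 4 * (1 + g)) :=
          h.trans (mul_le_mul' le_rfl (add_le_add le_rfl h1))
      _ ≤ ENNReal.ofReal (max C 1) * (4 * a ^ (1 + σ) + 4 * (1 + g)) :=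
          mul_le_mul' (ENNReal.ofReal_le_ofReal (le_max_left _ _))
            (add_le_add (le_mul_of_one_le_left' (by norm_num)) le_rfl)
      _ = _ := by
          rw [ENNReal.ofReal_mul (p := 4) (by norm_num), ENNReal.ofReal_ofNat]; ring
  calc b ^ (1 / (1 + σ)) ≤ (ENNReal.ofReal (4 * max C 1) * (a ^ (1 + σ) + (1 + g))) ^ (1 / (1 + σ)) :=
        ENNReal.rpow_le_rpow h2 ht0
    _ = ENNReal.ofReal (4 * max C 1) ^ (1 / (1 + σ)) *
          (a ^ (1 + σ) + (1 + g)) ^ (1 / (1 + σ)) := ENNReal.mul_rpow_of_nonneg _ _ ht0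
    _ ≤ ENNReal.ofReal (4 * max C 1) *
          ((a ^ (1 + σ)) ^ (1 / (1 + σ)) + (1 + g) ^ (1 / (1 + σ))) :=
        mul_le_mul' (hm _ (by linarith [le_max_right C 1])) (ENNReal.rpow_add_le_add_rpow _ _ ht0 ht1)
    _ = _ := by
        rw [← ENNReal.rpow_mul, mul_one_div_cancel hσ0.ne', ENNReal.rpow_one]

/-- Higher integrability for the equation with bounded measurable coefficient. For `σ = 0` the estimate
only compares averages over concentric balls. -/
theorem gradient_higher_integrability (n : ℕ) (hn : 1 ≤ n) (γ₁ γ₂ L : ℝ) (hγ₁ : 1 < γ₁)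
    (hγ₂ : γ₁ ≤ γ₂) (hL : 0 ≤ L) (ν Λ : ℝ) (hν : 0 < ν) :
      ∃ c : ℝ, 0 < c ∧ ∃ σ₀ : ℝ → ℝ,
        (∀ q, 1 < q → 0 < σ₀ q ∧ σ₀ q < 1 ∧ 1 + σ₀ q < q) ∧
        ∀ ω : ℝ → ℝ, Tendsto (fun r => ω r * Real.log (1 / r)) (𝓝[>] 0) (𝓝 L) →
        ∀ K₀ : ℝ, 1 ≤ K₀ → ∃ R₀ : ℝ, 0 < R₀ ∧ R₀ < 1 / K₀ ∧
        ∀ q : ℝ, 1 < q →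
        ∀ Ω Ω' : Set (Heis n), IsOpen Ω → IsCCBounded Ω → CompactlyIn Ω' Ω →
        ∀ (p a u : Heis n → ℝ) (F Xu : Heis n → Hor n),
          (∀ x ∈ Ω, p x ∈ Icc γ₁ γ₂) →
          (∀ r, 0 < r → modulus p Ω r ≤ ω r) →
          AEMeasurable a (volume.restrict Ω) → (∀ x ∈ Ω, a x ∈ Icc ν Λ) →
          MemLp F (ENNReal.ofReal (q * γ₁ / (γ₁ - 1))) (volume.restrict Ω) →
          IsLocalWeakSolution Ω p a F u Xu →
          ENNReal.ofReal K₀ = (∫⁻ x in Ω', ‖Xu x‖ₑ ^ p x) + 1 →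
        ∀ (x₀ : Heis n) (R : ℝ), 0 < R → R ≤ R₀ → CompactlyIn (ball x₀ R) Ω' →
        ∀ (ξ : Hor n) (σ : ℝ), 0 ≤ σ → σ ≤ σ₀ q →
          (⨍⁻ x in ball x₀ (R / 2), ‖Xu x‖ₑ ^ (p x * (1 + σ)) ∂volume) ^ (1 / (1 + σ)) ≤
            ENNReal.ofReal c * ((⨍⁻ x in ball x₀ R, ‖Xu x‖ₑ ^ p x ∂volume) + 1) +
            ENNReal.ofReal c *
              (1 + ⨍⁻ x in ball x₀ R, ‖F x - ξ‖ₑ ^ (γ₁ * (1 + σ) / (γ₁ - 1)) ∂volume) ^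
                (1 / (1 + σ)) := by
  obtain ⟨θ, hθ, -, hθγ, hθQ⟩ := exists_exponent hγ₁ (homDim_pos n)
  obtain ⟨A, hA, hrev⟩ := exists_reverseHolder_const hn (Λ := Λ) (M := L + 1) hγ₁ hγ₂ hν hθ.le hθγ hθQ
  obtain ⟨σ₁, C, hσ₁, hσ₁1, hC, hgeh⟩ := exists_gehring_ball_const hn hθ hA
  refine ⟨4 * max C 1 + 12 ^ homDim n, by positivity, fun q => min σ₁ (min ((q - 1) / 2) (1 / 2)),
    fun q hq => ⟨?_, ?_, ?_⟩, fun ω hω K₀ hK₀ => ?_⟩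
  · have : 0 < q - 1 := by linarith
    positivity
  · exact ((min_le_right _ _).trans (min_le_right _ _)).trans_lt (by norm_num)
  · have := (min_le_right σ₁ (min ((q - 1) / 2) (1 / 2))).trans (min_le_left _ _)
    linarith
  obtain ⟨r₀, hr₀, hr₀1, hlog, hosc⟩ := exists_radius hL
    (δ := (θ - 1) * γ₁) (mul_pos (by linarith) (by linarith)) hω
  -- `1 / (2 K₀)` rather than `1 / K₀`, because the inequality `R₀ < 1 / K₀` is strict
  refine ⟨min (r₀ / 5) (1 / (2 * K₀)), by positivity, (min_le_right _ _).trans_lt ?_, ?_⟩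
  · exact one_div_lt_one_div_of_lt (by linarith) (by linarith)
  intro q hq Ω Ω' hΩ hΩb hΩ' p a u F Xu hp hmod ham ha hF hsol hK x₀ R hR hRR hball ξ σ hσ hσσ
  have hR1 : 5 * R ≤ r₀ := by linarith [hRR.trans (min_le_left _ _)]
  have hR2 : R ≤ 1 / K₀ := (hRR.trans (min_le_right _ _)).trans
    (one_div_le_one_div_of_le (by linarith) (by linarith))
  have hlH : LogHolderOn Ω p γ₁ γ₂ (L + 1) r₀ ω := ⟨hp, hmod, hr₀, hr₀1, hlog⟩
  have hBΩ : ball x₀ R ⊆ Ω := hball.subset.trans hΩ'.subset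
  have hBin : CompactlyIn (ball x₀ R) Ω := ⟨hball.1, hball.2.trans hΩ'.subset⟩
  obtain ⟨-, hXu, -⟩ := hsol.1 (ball x₀ R) (isOpen_ball hn _ _) hBin
  have hmod1 := lintegral_le_inv_radius hball.subset hK hK₀ hR hR2
  have hpm : AEMeasurable p (volume.restrict (ball x₀ R)) :=
    ((hlH.continuousOn hn).mono hBΩ).aemeasurable (isOpen_ball hn _ _).measurableSet
  have hγ1 : 0 < γ₁ - 1 := by linarith
  have hq0 : 0 < γ₁ / (γ₁ - 1) := by positivity
  set avg := ⨍⁻ x in ball x₀ R, ‖Xu x‖ₑ ^ p x ∂volume with havg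
  rcases hσ.eq_or_lt with h0 | h0
  · subst h0
    simp only [add_zero, mul_one, div_one, ENNReal.rpow_one]
    calc ⨍⁻ x in ball x₀ (R / 2), ‖Xu x‖ₑ ^ p x ∂volume ≤ ENNReal.ofReal (12 ^ homDim n) * avg :=
          laverage_half_ball_le_laverage hn x₀ hR _
      _ ≤ ENNReal.ofReal (4 * max C 1 + 12 ^ homDim n) * (avg + 1) :=
          mul_le_mul' (ENNReal.ofReal_le_ofReal (le_add_of_nonneg_left (by positivity))) le_self_add
      _ ≤ _ := le_self_add
  have hFfin := lintegral_rpow_lt_top_of_memLp (s := γ₁ / (γ₁ - 1))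
    (by rw [Measure.restrict_apply_univ]; exact volume_ne_top_of_isCCBounded hΩb) hq0
    (by rw [mul_div_assoc]; exact le_mul_of_one_le_left hq0.le hq.le) hF
  have hkey := hgeh x₀ R hR (fun x => ‖Xu x‖ₑ ^ p x) (fun x => ‖F x - ξ‖ₑ ^ (γ₁ / (γ₁ - 1)) + 1)
    (hXu.1.enorm.pow hpm)
    ((((hF.1.mono_measure (Measure.restrict_mono hBΩ le_rfl)).sub
      aestronglyMeasurable_const).enorm.pow_const _).add_const 1)
    (ne_top_of_le_ne_top ENNReal.ofReal_ne_top hmod1)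
    (hrev Ω p a u F Xu r₀ ω hΩ hlH hosc ham ha hF.1 hFfin hsol (ball x₀ R) x₀ R hBΩ
      (ball_subset_cball x₀ hR) hR hR1 hmod1 ξ) σ h0 (hσσ.trans (min_le_left _ _))
  have hres := rpow_laverage_le_of_gehring h0
    ((hσσ.trans (min_le_left _ _)).trans hσ₁1) hkey
  simp_rw [← ENNReal.rpow_mul] at hres
  rw [div_mul_eq_mul_div] at hres
  refine hres.trans ?_
  rw [← mul_add]
  refine mul_le_mul' (ENNReal.ofReal_le_ofReal (le_add_of_nonneg_right (by positivity)))
    (add_le_add le_self_add le_rfl)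

end

section

variable {n : ℕ}

theorem laverage_rpow_le_rpow_laverage {Y : Type*} [MeasurableSpace Y] {ν : Measure Y}
    {f : Y → ℝ≥0∞} (hf : AEMeasurable f ν) {s t : ℝ} (hs : 0 < s) (hst : s ≤ t) :
    ⨍⁻ y, f y ^ s ∂ν ≤ ((⨍⁻ y, f y ^ t ∂ν) ^ (1 / t)) ^ s := by
  have ht : 0 < t := hs.trans_le hst
  have h := lintegral_rpow_le_rpow_lintegral (ν := (ν univ)⁻¹ • ν)
    ((hf.pow_const t).smul_measure _) (by simp [ENNReal.inv_mul_le_one]) (s := s / t)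
    (by positivity) (by rwa [div_le_one ht])
  have e : ∀ y, (f y ^ t) ^ (s / t) = f y ^ s := fun y => by
    rw [← ENNReal.rpow_mul, mul_div_cancel₀ s ht.ne']
  simp_rw [e] at h
  rw [laverage_eq', laverage_eq', ← ENNReal.rpow_mul]
  rwa [one_div_mul_eq_div]

theorem rpow_le_self_of_le_one {x : ℝ≥0∞} (hx : 1 ≤ x) {t : ℝ} (ht : t ≤ 1) : x ^ t ≤ x := by
  have := ENNReal.rpow_le_rpow_of_exponent_le hx ht
  rwa [ENNReal.rpow_one] at this

/-- The average of a low power of `g ^ p` over a ball where `p` is close to `P`. -/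
theorem rpow_laverage_rpow_variable_le {Y : Type*} [MeasurableSpace Y] {ν : Measure Y}
    {g : Y → ℝ≥0∞} (hg : AEMeasurable g ν) {p : Y → ℝ} {P s γ : ℝ} (hs : 0 < s)
    (hP : 0 < P) (hPγ : P * s ≤ γ) (hp : ∀ᵐ y ∂ν, 0 ≤ p y ∧ p y ≤ P) :
    (⨍⁻ y, (g y ^ p y) ^ s ∂ν) ^ (1 / s) + 1 ≤
      ENNReal.ofReal (2 ^ (1 / s) + 1) * (1 + (⨍⁻ y, g y ^ γ ∂ν) ^ (1 / γ)) ^ P := by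
  set Z := (⨍⁻ y, g y ^ γ ∂ν) ^ (1 / γ) with hZ
  have hW : 1 ≤ 1 + Z := le_self_add
  have h1 : ⨍⁻ y, (g y ^ p y) ^ s ∂ν ≤ 2 * (1 + Z) ^ (P * s) := by
    calc ⨍⁻ y, (g y ^ p y) ^ s ∂ν ≤ ⨍⁻ y, (g y ^ (P * s) + 1) ∂ν := by
          refine laverage_mono_ae ?_
          filter_upwards [hp] with y hy
          rw [← ENNReal.rpow_mul]
          exact rpow_le_rpow_add_one (mul_nonneg hy.1 hs.le) (by gcongr; exact hy.2)
      _ ≤ (⨍⁻ y, g y ^ (P * s) ∂ν) + 1 := laverage_add_const_le _ _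
      _ ≤ Z ^ (P * s) + 1 :=
          add_le_add (laverage_rpow_le_rpow_laverage hg (by positivity) hPγ) le_rfl
      _ ≤ (1 + Z) ^ (P * s) + (1 + Z) ^ (P * s) :=
          add_le_add (ENNReal.rpow_le_rpow le_add_self (by positivity))
            (ENNReal.one_le_rpow hW (by positivity))
      _ = _ := (two_mul _).symm
  have h2 : (⨍⁻ y, (g y ^ p y) ^ s ∂ν) ^ (1 / s) ≤ ENNReal.ofReal (2 ^ (1 / s)) * (1 + Z) ^ P := by
    refine (ENNReal.rpow_le_rpow h1 (by positivity)).trans_eq ?_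
    rw [ENNReal.mul_rpow_of_nonneg _ _ (by positivity), ← ENNReal.rpow_mul,
      ← ENNReal.ofReal_rpow_of_pos two_pos, ENNReal.ofReal_ofNat]
    congr 2
    field_simp
  rw [ENNReal.ofReal_add (by positivity) zero_le_one, ENNReal.ofReal_one, add_mul, one_mul]
  exact add_le_add h2 (ENNReal.one_le_rpow hW hP)

/-- Powers with exponent close to `1 / P` of a quantity bounded by `W ^ (P + δ)`, when `W ^ δ` is
bounded. -/
theorem rpow_le_of_le_rpow_add {T W C N : ℝ≥0∞} {P δ ρ : ℝ} (hW : 1 ≤ W) (hC : 1 ≤ C)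
    (hT : T ≤ C * W ^ (P + δ)) (hN : W ^ δ ≤ N) (hP : 1 ≤ P) (hδ : 0 ≤ δ) (hδ1 : δ ≤ 1) (hρ : 0 ≤ ρ)
    (hρδ : ρ ≤ δ) : T ^ ((1 + ρ) / P) ≤ C ^ (2 : ℝ) * (N ^ (3 : ℝ) * W) := by
  have hP0 : 0 < P := by linarith
  have he0 : 0 ≤ (1 + ρ) / P := by positivity
  have he2 : (1 + ρ) / P ≤ 2 := by rw [div_le_iff₀ hP0]; linarith
  have he3 : (P + δ) * ((1 + ρ) / P) ≤ δ * 3 + 1 := by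
    have h1 : (P + δ) / P ≤ 1 + δ := by
      rw [add_div, div_self hP0.ne']
      have := div_le_self hδ hP
      linarith
    calc (P + δ) * ((1 + ρ) / P) = (P + δ) / P * (1 + ρ) := by ring
      _ ≤ (1 + δ) * (1 + δ) := by gcongr
      _ ≤ δ * 3 + 1 := by nlinarith
  calc T ^ ((1 + ρ) / P) ≤ (C * W ^ (P + δ)) ^ ((1 + ρ) / P) := ENNReal.rpow_le_rpow hT he0
    _ = C ^ ((1 + ρ) / P) * W ^ ((P + δ) * ((1 + ρ) / P)) := by
        rw [ENNReal.mul_rpow_of_nonneg _ _ he0, ← ENNReal.rpow_mul]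
    _ ≤ C ^ (2 : ℝ) * W ^ (δ * 3 + 1) :=
        mul_le_mul' (ENNReal.rpow_le_rpow_of_exponent_le hC he2)
          (ENNReal.rpow_le_rpow_of_exponent_le hW he3)
    _ = C ^ (2 : ℝ) * ((W ^ δ) ^ (3 : ℝ) * W) := by
        rw [ENNReal.rpow_add_of_nonneg _ _ (by positivity) zero_le_one, ENNReal.rpow_one,
          ENNReal.rpow_mul]
    _ ≤ _ := mul_le_mul' le_rfl (mul_le_mul' (ENNReal.rpow_le_rpow hN (by norm_num)) le_rfl)

theorem laverage_ball_le_of_lintegral_le (hn : 1 ≤ n) (x₀ : Heis n) {R : ℝ} (hR : 0 < R)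
    {f : Heis n → ℝ≥0∞} (h : ∫⁻ y in ball x₀ R, f y ≤ ENNReal.ofReal (1 / R)) :
    ⨍⁻ y in ball x₀ R, f y ∂volume ≤
      ENNReal.ofReal ((unitVol n)⁻¹ * 6 ^ homDim n * R⁻¹ ^ (homDim n + 1)) := by
  have hκ := unitVol_pos n
  rw [setLAverage_eq]
  refine ENNReal.div_le_of_le_mul (h.trans
    (le_trans ?_ (mul_le_mul' le_rfl (le_volume_ball hn x₀ hR))))
  rw [← ENNReal.ofReal_mul (by positivity)]
  refine ENNReal.ofReal_le_ofReal (le_of_eq ?_)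
  rw [Real.div_rpow hR.le (by norm_num), Real.rpow_add (by positivity), Real.rpow_one,
    Real.inv_rpow hR.le]
  field_simp

/-- Higher integrability for the homogeneous equation, with any exponent `γ ∈ [1, γ₁]` on the
right-hand side. The Gehring lemma with the lowered power `s = γ / (2 γ₂)` of `‖Xw‖ ^ p` is followed by
the replacement of the variable exponent by its value at `x₁`. -/
theorem gradient_higher_integrability_homogeneous (n : ℕ) (hn : 1 ≤ n) (γ₁ γ₂ L : ℝ) (hγ₁ : 1 < γ₁)
    (hγ₂ : γ₁ ≤ γ₂) (hL : 0 ≤ L) (γ : ℝ) (hγ1 : 1 ≤ γ) (hγγ : γ ≤ γ₁) :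
      ∃ c : ℝ, 0 < c ∧ ∃ σ₀ : ℝ, 0 < σ₀ ∧ σ₀ < 1 ∧
        ∀ ω : ℝ → ℝ, Tendsto (fun r => ω r * Real.log (1 / r)) (𝓝[>] 0) (𝓝 L) →
        ∀ K₀ : ℝ, 1 ≤ K₀ → ∃ R₀ : ℝ, 0 < R₀ ∧ R₀ < 1 / K₀ ∧
        ∀ Ω Ω' : Set (Heis n), IsOpen Ω → CompactlyIn Ω' Ω →
        ∀ (p w : Heis n → ℝ) (Xw : Heis n → Hor n),
          (∀ x ∈ Ω, p x ∈ Icc γ₁ γ₂) →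
          (∀ r, 0 < r → modulus p Ω r ≤ ω r) →
          IsLocalWeakSolution Ω p (fun _ => 1) (fun _ => 0) w Xw →
          ENNReal.ofReal K₀ = (∫⁻ x in Ω', ‖Xw x‖ₑ ^ p x) + 1 →
        ∀ (x₀ : Heis n) (R : ℝ), 0 < R → R ≤ R₀ → CompactlyIn (ball x₀ R) Ω' →
        ∀ x₁ ∈ ball x₀ R, ∀ σ : ℝ, 0 < σ → σ ≤ σ₀ →
          max
            ((⨍⁻ x in ball x₀ (R / 2), ‖Xw x‖ₑ ^ (p x * (1 + σ)) ∂volume) ^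
              (1 / (p x₁ * (1 + σ))))
            ((⨍⁻ x in ball x₀ (R / 2), ‖Xw x‖ₑ ^ (p x₁ * (1 + σ)) ∂volume) ^
              (1 / (p x₁ * (1 + σ)))) ≤
          ENNReal.ofReal c *
            (1 + (⨍⁻ x in ball x₀ R, ‖Xw x‖ₑ ^ γ ∂volume) ^ (1 / γ)) := by
  obtain ⟨θ, hθ, hθ2, hθγ, hθQ⟩ := exists_exponent hγ₁ (homDim_pos n)
  obtain ⟨A, hA, hrev⟩ := exists_reverseHolder_const hn (Λ := 1) (M := L + 1) hγ₁ hγ₂ one_pos hθ.le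
    hθγ hθQ
  have hγ₁0 : 0 < γ₁ := by linarith
  have hγ₂0 : 0 < γ₂ := by linarith
  have hγ0 : 0 < γ := by linarith
  have hQ := homDim_pos n
  have hκ := unitVol_pos n
  -- chosen so that `(p x₁ + δ) s ≤ γ`, while `s ≤ 1 / 2 < 1 / θ`
  set s : ℝ := γ / (2 * γ₂) with hs
  have hs0 : 0 < s := by positivity
  have hs1 : s ≤ 1 / 2 := by
    rw [hs, div_le_div_iff₀ (by positivity) two_pos]; linarith
  obtain ⟨σ₁, C, hσ₁, hσ₁1, hC, hgeh⟩ := exists_gehring_ball_lower_const hn hθ hA hs0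
    (hs1.trans_lt (one_div_lt_one_div_of_lt (by linarith) hθ2))
  set T₁ : ℝ := max 1 ((unitVol n)⁻¹ * 6 ^ homDim n) with hT₁
  have hT₁1 : 1 ≤ T₁ := le_max_left _ _
  set N : ℝ := (3 * T₁) ^ γ₂ * (10 ^ γ₂ * Real.exp (L + 1)) ^ (homDim n + 1) with hN
  set B : ℝ := 2 ^ (1 / s) + 1 with hB
  have hB1 : 1 ≤ B := le_add_of_nonneg_left (by positivity)
  refine ⟨(C + 1) * (B ^ (2 : ℝ) * N ^ (3 : ℝ)), by positivity, σ₁ / 2, by positivity, by linarith,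
    fun ω hω K₀ hK₀ => ?_⟩
  obtain ⟨r₀, hr₀, hr₀1, hlog, hosc⟩ := exists_radius hL
    (δ := min (min ((θ - 1) * γ₁) (γ₁ * σ₁ / 4)) 1)
    (by have : 0 < θ - 1 := by linarith
        positivity) hω
  -- points of the CC ball of radius `R` have box distance at most `2 R`, hence CC distance at most
  -- `10 R`
  refine ⟨min (r₀ / 10) (1 / (2 * K₀)), by positivity, (min_le_right _ _).trans_lt ?_, ?_⟩
  · exact one_div_lt_one_div_of_lt (by linarith) (by linarith)
  intro Ω Ω' hΩ hΩ' p w Xw hp hmod hsol hK x₀ R hR hRR hball x₁ hx₁ σ hσ hσσ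
  have hR1 : 10 * R ≤ r₀ := by linarith [hRR.trans (min_le_left _ _)]
  have hR2 : R ≤ 1 / K₀ := (hRR.trans (min_le_right _ _)).trans
    (one_div_le_one_div_of_le (by linarith) (by linarith))
  have hlH : LogHolderOn Ω p γ₁ γ₂ (L + 1) r₀ ω := ⟨hp, hmod, hr₀, hr₀1, hlog⟩
  have hBΩ : ball x₀ R ⊆ Ω := hball.subset.trans hΩ'.subset
  have hBin : CompactlyIn (ball x₀ R) Ω := ⟨hball.1, hball.2.trans hΩ'.subset⟩
  have hBm : MeasurableSet (ball x₀ R) := (isOpen_ball hn _ _).measurableSet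
  obtain ⟨-, hXw, -⟩ := hsol.1 (ball x₀ R) (isOpen_ball hn _ _) hBin
  have hmod1 := lintegral_le_inv_radius hball.subset hK hK₀ hR hR2
  have hpm : AEMeasurable p (volume.restrict (ball x₀ R)) :=
    ((hlH.continuousOn hn).mono hBΩ).aemeasurable hBm
  have hsub : ball x₀ (R / 2) ⊆ ball x₀ R := fun y hy =>
    lt_of_lt_of_le hy (ENNReal.ofReal_le_ofReal (by linarith))
  have hq0 : 0 < γ₁ / (γ₁ - 1) := div_pos hγ₁0 (by linarith)
  -- the oscillation of the exponent
  set δ := ω (10 * R) with hδ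
  have hδ0 : 0 ≤ δ := hlH.nonneg (by positivity)
  have hδδ : δ ≤ min (min ((θ - 1) * γ₁) (γ₁ * σ₁ / 4)) 1 := hosc _ (by positivity) hR1
  have hδ1 : δ ≤ 1 := hδδ.trans (min_le_right _ _)
  have hδγ : δ ≤ γ₂ := by linarith
  have hδσ : δ ≤ γ₁ * σ₁ / 4 := (hδδ.trans (min_le_left _ _)).trans (min_le_right _ _)
  set p₁ := p x₁ with hp₁
  have hp₁m := hp x₁ (hBΩ hx₁)
  have hpδ : ∀ x ∈ ball x₀ R, |p x - p₁| ≤ δ := fun x hx => by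
    refine hlH.abs_sub_le (hBΩ hx) (hBΩ hx₁) (by positivity) ?_
    refine (dCC_le_boxDist hn _ _).trans (ENNReal.ofReal_le_ofReal ?_)
    have h1 := boxDist_triangle x x₀ x₁
    rw [boxDist_comm x x₀] at h1
    have h2 := mem_cball_iff.1 (ball_subset_cball x₀ hR hx)
    have h3 := mem_cball_iff.1 (ball_subset_cball x₀ hR hx₁)
    linarith
  set Y := (⨍⁻ x in ball x₀ R, ‖Xw x‖ₑ ^ γ ∂volume) ^ (1 / γ) with hY
  have hW1 : 1 ≤ 1 + Y := le_self_add
  -- `1 + Y` is at most a negative power of `R`, and `R ^ (-δ)` is bounded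
  have hWδ : (1 + Y) ^ δ ≤ ENNReal.ofReal N := by
    have hRinv : 1 ≤ R⁻¹ := by rw [one_le_inv₀ hR]; linarith
    have hRp : 1 ≤ R⁻¹ ^ (homDim n + 1) := Real.one_le_rpow hRinv (by positivity)
    have h1 : ⨍⁻ x in ball x₀ R, ‖Xw x‖ₑ ^ γ ∂volume ≤
        (⨍⁻ x in ball x₀ R, ‖Xw x‖ₑ ^ p x ∂volume) + 1 := by
      refine (laverage_mono_ae ((ae_restrict_iff' hBm).2 (Eventually.of_forall fun x hx => ?_))).trans
        (laverage_add_const_le _ _)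
      exact rpow_le_rpow_add_one hγ0.le (hγγ.trans (hp x (hBΩ hx)).1)
    have h2 : Y ≤ (⨍⁻ x in ball x₀ R, ‖Xw x‖ₑ ^ p x ∂volume) + 1 :=
      (ENNReal.rpow_le_rpow h1 (by positivity)).trans
        (rpow_le_self_of_le_one le_add_self (by rwa [div_le_one hγ0]))
    have h3 : 1 + Y ≤ ENNReal.ofReal (3 * T₁ * R⁻¹ ^ (homDim n + 1)) := by
      refine (add_le_add le_rfl (h2.trans (add_le_add
        (laverage_ball_le_of_lintegral_le hn x₀ hR hmod1) le_rfl))).trans ?_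
      rw [← ENNReal.ofReal_one, ← ENNReal.ofReal_add (by positivity) zero_le_one,
        ← ENNReal.ofReal_add zero_le_one (by positivity)]
      refine ENNReal.ofReal_le_ofReal ?_
      have h4 : (unitVol n)⁻¹ * 6 ^ homDim n * R⁻¹ ^ (homDim n + 1) ≤
          T₁ * R⁻¹ ^ (homDim n + 1) := by
        gcongr; exact le_max_right _ _
      have h5 : 1 ≤ T₁ * R⁻¹ ^ (homDim n + 1) := one_le_mul_of_one_le_of_one_le hT₁1 hRp
      linarith
    refine (ENNReal.rpow_le_rpow h3 hδ0).trans ?_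
    rw [ENNReal.ofReal_rpow_of_nonneg (by positivity) hδ0]
    refine ENNReal.ofReal_le_ofReal ?_
    rw [Real.mul_rpow (by positivity) (by positivity), hN]
    have e1 : (R⁻¹ ^ (homDim n + 1)) ^ δ = (R⁻¹ ^ δ) ^ (homDim n + 1) := by
      rw [← Real.rpow_mul (by positivity), ← Real.rpow_mul (by positivity), mul_comm]
    rw [e1]
    refine mul_le_mul (Real.rpow_le_rpow_of_exponent_le (by linarith) hδγ) ?_ (by positivity)
      (by positivity)
    exact Real.rpow_le_rpow (by positivity)
      (hlH.inv_rpow_le hR (by norm_num) hR1 le_rfl hδγ) (by positivity)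
  set T := (⨍⁻ x in ball x₀ R, (‖Xw x‖ₑ ^ p x) ^ s ∂volume) ^ (1 / s) + 1 with hT
  have hT1 : 1 ≤ T := le_add_self
  have hTW : T ≤ ENNReal.ofReal B * (1 + Y) ^ (p₁ + δ) := by
    refine rpow_laverage_rpow_variable_le hXw.1.enorm hs0 (by linarith [hp₁m.1]) ?_
      ((ae_restrict_iff' hBm).2 (Eventually.of_forall fun x hx => ?_))
    · calc (p₁ + δ) * s ≤ (2 * γ₂) * s := by
            gcongr; linarith [hp₁m.2]
        _ = γ := by rw [hs]; field_simp
    · have := abs_le.1 (hpδ x hx)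
      exact ⟨by linarith [(hp x (hBΩ hx)).1], by linarith⟩
  have hgeh' : ∀ τ, 0 < τ → τ ≤ σ₁ →
      ⨍⁻ x in ball x₀ (R / 2), (‖Xw x‖ₑ ^ p x) ^ (1 + τ) ∂volume ≤
        ENNReal.ofReal C * T ^ (1 + τ) := by
    refine hgeh x₀ R hR (fun x => ‖Xw x‖ₑ ^ p x) (hXw.1.enorm.pow hpm)
      (ne_top_of_le_ne_top ENNReal.ofReal_ne_top hmod1) fun x r hr hx => ?_
    have h1 := hrev Ω p (fun _ => 1) w (fun _ => 0) Xw r₀ ω hΩ hlH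
      (fun r hr hr' => (hosc r hr hr').trans ((min_le_left _ _).trans (min_le_left _ _)))
      aemeasurable_const (fun _ _ => ⟨le_rfl, le_rfl⟩) aestronglyMeasurable_const
      (by simp [ENNReal.zero_rpow_of_pos hq0]) hsol (ball x₀ R) x₀ R hBΩ
      (ball_subset_cball x₀ hR) hR (by linarith) hmod1 0 x r hr hx
    simp only [sub_zero, enorm_zero, ENNReal.zero_rpow_of_pos hq0, zero_add] at h1
    exact h1
  have hp₁1 : 1 ≤ p₁ := hγ₁.le.trans hp₁m.1
  have hp₁0 : 0 < p₁ := by linarith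
  have hσ0 : 0 < 1 + σ := by linarith
  have he0 : 0 ≤ 1 / (p₁ * (1 + σ)) := by positivity
  have he1 : 1 / (p₁ * (1 + σ)) ≤ 1 := by
    rw [div_le_one (by positivity)]
    exact one_le_mul_of_one_le_of_one_le hp₁1 (by linarith)
  have hC1 : 1 ≤ ENNReal.ofReal (C + 1) := by rw [ENNReal.one_le_ofReal]; linarith
  -- `ρ = 0` and `ρ = δ / γ₁` give the two entries of the maximum
  have final : ∀ (ρ : ℝ) (I : ℝ≥0∞), 0 ≤ ρ → ρ ≤ δ →
      I ≤ ENNReal.ofReal (C + 1) * T ^ ((1 + σ) * (1 + ρ)) →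
      I ^ (1 / (p₁ * (1 + σ))) ≤
        ENNReal.ofReal ((C + 1) * (B ^ (2 : ℝ) * N ^ (3 : ℝ))) * (1 + Y) := by
    intro ρ I hρ hρδ hI
    have h1 := rpow_le_of_le_rpow_add hW1 (by rwa [ENNReal.one_le_ofReal]) hTW hWδ hp₁1 hδ0 hδ1 hρ hρδ
    rw [ENNReal.ofReal_rpow_of_pos (by positivity), ENNReal.ofReal_rpow_of_pos (by positivity)] at h1
    calc I ^ (1 / (p₁ * (1 + σ)))
        ≤ (ENNReal.ofReal (C + 1) * T ^ ((1 + σ) * (1 + ρ))) ^ (1 / (p₁ * (1 + σ))) :=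
          ENNReal.rpow_le_rpow hI he0
      _ = ENNReal.ofReal (C + 1) ^ (1 / (p₁ * (1 + σ))) * T ^ ((1 + ρ) / p₁) := by
          rw [ENNReal.mul_rpow_of_nonneg _ _ he0, ← ENNReal.rpow_mul]
          congr 2
          field_simp
      _ ≤ ENNReal.ofReal (C + 1) *
          (ENNReal.ofReal (B ^ (2 : ℝ)) * (ENNReal.ofReal (N ^ (3 : ℝ)) * (1 + Y))) :=
          mul_le_mul' (rpow_le_self_of_le_one hC1 he1) h1
      _ = _ := by
          rw [ENNReal.ofReal_mul (p := C + 1) (by linarith),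
            ENNReal.ofReal_mul (p := B ^ (2 : ℝ)) (by positivity)]
          ring
  refine max_le (final 0 _ le_rfl hδ0 ?_) (final (δ / γ₁) _ (by positivity)
    (div_le_self hδ0 hγ₁.le) ?_)
  · simp_rw [ENNReal.rpow_mul]
    rw [add_zero, ENNReal.rpow_one]
    refine (hgeh' σ hσ (by linarith)).trans
      (mul_le_mul' (ENNReal.ofReal_le_ofReal (by linarith)) le_rfl)
  · -- raising `σ` to `τ` compensates the difference between `p x₁` and `p x`
    obtain ⟨τ, hτ⟩ : ∃ τ, 1 + τ = (1 + σ) * (1 + δ / γ₁) := ⟨(1 + σ) * (1 + δ / γ₁) - 1, by ring⟩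
    have hδγ₁ : δ / γ₁ ≤ σ₁ / 4 := by rw [div_le_iff₀ hγ₁0]; linarith
    have hδγ₁0 : 0 ≤ δ / γ₁ := by positivity
    have hτ0 : 0 < τ := by nlinarith
    have hτ1 : τ ≤ σ₁ := by nlinarith
    rw [← hτ]
    calc ⨍⁻ x in ball x₀ (R / 2), ‖Xw x‖ₑ ^ (p₁ * (1 + σ)) ∂volume
        ≤ ⨍⁻ x in ball x₀ (R / 2), ((‖Xw x‖ₑ ^ p x) ^ (1 + τ) + 1) ∂volume := by
          refine laverage_mono_ae ((ae_restrict_iff' (isOpen_ball hn _ _).measurableSet).2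
            (Eventually.of_forall fun x hx => ?_))
          rw [← ENNReal.rpow_mul]
          refine rpow_le_rpow_add_one (by positivity) ?_
          have h1 := abs_le.1 (hpδ x (hsub hx))
          have h2 := (hp x (hBΩ (hsub hx))).1
          have h3 : δ ≤ p x * (δ / γ₁) := by
            calc δ = γ₁ * (δ / γ₁) := by field_simp
              _ ≤ p x * (δ / γ₁) := by gcongr
          rw [hτ]
          calc p₁ * (1 + σ) ≤ (p x * (1 + δ / γ₁)) * (1 + σ) := by
                gcongr; linarith
            _ = _ := by ring
      _ ≤ (⨍⁻ x in ball x₀ (R / 2), (‖Xw x‖ₑ ^ p x) ^ (1 + τ) ∂volume) + 1 :=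
          laverage_add_const_le _ _
      _ ≤ ENNReal.ofReal C * T ^ (1 + τ) + T ^ (1 + τ) :=
          add_le_add (hgeh' τ hτ0 hτ1) (ENNReal.one_le_rpow hT1 (by linarith))
      _ = _ := by
          rw [ENNReal.ofReal_add (by linarith) zero_le_one, ENNReal.ofReal_one, add_mul, one_mul]

end

end Heisenberg

end

theorem theorem4p1 (n : ℕ) (hn : 1 ≤ n) (γ₁ γ₂ L : ℝ) (hγ₁ : 1 < γ₁) (hγ₂ : γ₁ ≤ γ₂)
    (hL : 0 ≤ L) :
    (∀ ν Λ : ℝ, 0 < ν → ν ≤ Λ →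
      ∃ c : ℝ, 0 < c ∧ ∃ σ₀ : ℝ → ℝ,
        (∀ q, 1 < q → 0 < σ₀ q ∧ σ₀ q < 1 ∧ 1 + σ₀ q < q) ∧
        ∀ ω : ℝ → ℝ, Tendsto (fun r => ω r * Real.log (1 / r)) (𝓝[>] 0) (𝓝 L) →
        ∀ K₀ : ℝ, 1 ≤ K₀ → ∃ R₀ : ℝ, 0 < R₀ ∧ R₀ < 1 / K₀ ∧
        ∀ q : ℝ, 1 < q →
        ∀ Ω Ω' : Set (Heisenberg.Heis n), IsOpen Ω → Heisenberg.IsCCBounded Ω →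
          IsOpen Ω' → Heisenberg.CompactlyIn Ω' Ω →
        ∀ (p a u : Heisenberg.Heis n → ℝ) (F Xu : Heisenberg.Heis n → Heisenberg.Hor n),
          (∀ x ∈ Ω, p x ∈ Icc γ₁ γ₂) →
          (∀ r, 0 < r → Heisenberg.modulus p Ω r ≤ ω r) →
          AEMeasurable a (volume.restrict Ω) → (∀ x ∈ Ω, a x ∈ Icc ν Λ) →
          MemLp F (ENNReal.ofReal (q * γ₁ / (γ₁ - 1))) (volume.restrict Ω) →
          Heisenberg.IsLocalWeakSolution Ω p a F u Xu →
          ENNReal.ofReal K₀ = (∫⁻ x in Ω', ‖Xu x‖ₑ ^ p x) + 1 →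
        ∀ (x₀ : Heisenberg.Heis n) (R : ℝ), 0 < R → R ≤ R₀ →
          Heisenberg.CompactlyIn (Heisenberg.ball x₀ R) Ω' →
        ∀ (ξ : Heisenberg.Hor n) (σ : ℝ), 0 ≤ σ → σ ≤ σ₀ q →
          (⨍⁻ x in Heisenberg.ball x₀ (R / 2), ‖Xu x‖ₑ ^ (p x * (1 + σ)) ∂volume) ^ (1 / (1 + σ)) ≤
            ENNReal.ofReal c * ((⨍⁻ x in Heisenberg.ball x₀ R, ‖Xu x‖ₑ ^ p x ∂volume) + 1) +
            ENNReal.ofReal c *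
              (1 + ⨍⁻ x in Heisenberg.ball x₀ R, ‖F x - ξ‖ₑ ^ (γ₁ * (1 + σ) / (γ₁ - 1)) ∂volume) ^
                (1 / (1 + σ))) ∧
    (∀ γ : ℝ, γ = min γ₁ (min (γ₂ / (γ₂ - 1))
        (2 * (Heisenberg.homDim n / (Heisenberg.homDim n - 1)))) →
      ∃ c : ℝ, 0 < c ∧ ∃ σ₀ : ℝ, 0 < σ₀ ∧ σ₀ < 1 ∧
        ∀ ω : ℝ → ℝ, Tendsto (fun r => ω r * Real.log (1 / r)) (𝓝[>] 0) (𝓝 L) →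
        ∀ K₀ : ℝ, 1 ≤ K₀ → ∃ R₀ : ℝ, 0 < R₀ ∧ R₀ < 1 / K₀ ∧
        ∀ Ω Ω' : Set (Heisenberg.Heis n), IsOpen Ω → Heisenberg.IsCCBounded Ω →
          IsOpen Ω' → Heisenberg.CompactlyIn Ω' Ω →
        ∀ (p w : Heisenberg.Heis n → ℝ) (Xw : Heisenberg.Heis n → Heisenberg.Hor n),
          (∀ x ∈ Ω, p x ∈ Icc γ₁ γ₂) →
          (∀ r, 0 < r → Heisenberg.modulus p Ω r ≤ ω r) →
          Heisenberg.IsLocalWeakSolution Ω p (fun _ => 1) (fun _ => 0) w Xw →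
          ENNReal.ofReal K₀ = (∫⁻ x in Ω', ‖Xw x‖ₑ ^ p x) + 1 →
        ∀ (x₀ : Heisenberg.Heis n) (R : ℝ), 0 < R → R ≤ R₀ →
          Heisenberg.CompactlyIn (Heisenberg.ball x₀ R) Ω' →
        ∀ x₁ ∈ Heisenberg.ball x₀ R, ∀ σ : ℝ, 0 < σ → σ ≤ σ₀ →
          max
            ((⨍⁻ x in Heisenberg.ball x₀ (R / 2), ‖Xw x‖ₑ ^ (p x * (1 + σ)) ∂volume) ^
              (1 / (p x₁ * (1 + σ))))
            ((⨍⁻ x in Heisenberg.ball x₀ (R / 2), ‖Xw x‖ₑ ^ (p x₁ * (1 + σ)) ∂volume) ^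
              (1 / (p x₁ * (1 + σ)))) ≤
          ENNReal.ofReal c *
            (1 + (⨍⁻ x in Heisenberg.ball x₀ R, ‖Xw x‖ₑ ^ γ ∂volume) ^ (1 / γ))) := by
  refine ⟨fun ν Λ hν _ => ?_, fun γ hγ => ?_⟩
  · obtain ⟨c, hc, σ₀, hσ₀, H⟩ :=
      Heisenberg.gradient_higher_integrability n hn γ₁ γ₂ L hγ₁ hγ₂ hL ν Λ hν
    refine ⟨c, hc, σ₀, hσ₀, fun ω hω K₀ hK₀ => ?_⟩
    obtain ⟨R₀, hR₀, hR₀K, H'⟩ := H ω hω K₀ hK₀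
    exact ⟨R₀, hR₀, hR₀K, fun q hq Ω Ω' hΩ hΩb _ hΩ' => H' q hq Ω Ω' hΩ hΩb hΩ'⟩
  · have hQ : 1 < Heisenberg.homDim n := by
      rw [Heisenberg.homDim]
      have : (0 : ℝ) ≤ n := Nat.cast_nonneg n
      linarith
    have hγ1 : 1 ≤ γ := by
      rw [hγ]
      refine le_min hγ₁.le (le_min ?_ ?_)
      · rw [le_div_iff₀ (by linarith)]; linarith
      · have h1 : 1 ≤ Heisenberg.homDim n / (Heisenberg.homDim n - 1) := by
          rw [le_div_iff₀ (by linarith)]; linarith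
        linarith
    obtain ⟨c, hc, σ₀, hσ₀, hσ₀1, H⟩ := Heisenberg.gradient_higher_integrability_homogeneous n hn
      γ₁ γ₂ L hγ₁ hγ₂ hL γ hγ1 (hγ.trans_le (min_le_left _ _))
    refine ⟨c, hc, σ₀, hσ₀, hσ₀1, fun ω hω K₀ hK₀ => ?_⟩
    obtain ⟨R₀, hR₀, hR₀K, H'⟩ := H ω hω K₀ hK₀
    exact ⟨R₀, hR₀, hR₀K, fun Ω Ω' hΩ _ _ hΩ' => H' Ω Ω' hΩ hΩ'⟩
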